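/- Throughout, $L^2(\mathbb R^3)=L^2(\mathbb R^3;\mathbb C)$, and for a real potential $U$ the operator $-\Delta+U$ acts on $L^2(\mathbb R^3)$ with domain $\{\psi\in H^2(\mathbb R^3): U\psi\in L^2(\mathbb R^3)\}$ (which is $H^2(\mathbb R^3)$ when $U\in L^2$). Let $V:\mathbb R^3\to\mathbb R$ with $V\in L^1(\mathbb R^3,(1+|x|^4)\,dx)\cap L^3(\mathbb R^3)$. Assume that zero is not an eigenvalue of $-\Delta+V$, and that zero is not a resonance of $-\Delta+V$, i.e. there is no distributional solution $\psi\notin L^2(\mathbb R^3)$ of $(-\Delta+V)\psi=0$ such that $(1+|x|)^{-s}\psi\in L^2(\mathbb R^3)$ for every $s>1/2$. Let $W\ge 0$ be a probability density on $\mathbb R^3$ with $W\in L^1(\mathbb R^3)\cap L^p(\mathbb R^3)$ for some $p>3$. For $N\in\mathbb N$ and $Y_N=(y_1,\dots,y_N)\in(\mathbb R^3)^N$ put $$H_N=-\Delta+\sum_{i=1}^N N^2V(N(x-y_i)),$$ and let $P_N=(W(x)\,dx)^{\otimes N}$ be the law of $N$ independent points with density $W$. Then $V$ has a unique scattering length $a\in\mathbb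 R$, namely $a=\frac1{4\pi}\int V\phi_0\,dx$ where $\phi_0$ is a continuous real distributional solution of $(-\Delta+V)\phi_0=0$ with $\phi_0(x)\to1$ as $|x|\to\infty$. With $H=-\Delta+4\pi aW$, there is $\lambda_0>0$, depending only on $V$ and $W$, such that for every $\lambda>\lambda_0$: the operator $H+\lambda$ has a bounded inverse on $L^2(\mathbb R^3)$; the probability under $P_N$ that $H_N+\lambda$ has no bounded inverse tends to $0$ as $N\to\infty$; and for all $f\in L^2(\mathbb R^3)$, $\varepsilon>0$ and $\beta<1/2$, $$\lim_{N\to\infty}P_N\big(\{Y_N: N^{\beta}\,\|(H_N+\lambda)^{-1}f-(H+\lambda)^{-1}f\|_{2}>\varepsilon\}\big)=0 .$$ -/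

import Mathlib

open MeasureTheory Filter Topology
open scoped ENNReal ContDiff Laplacian SchwartzMap

namespace LorentzGas

/-- Euclidean three-space. -/
abbrev E3 : Type := EuclideanSpace ℝ (Fin 3)

/-- The Hilbert space `L²(ℝ³; ℂ)`. -/
abbrev L2 : Type := Lp ℂ 2 (volume : Measure E3)

/-! ### Schrödinger operators on `L²(ℝ³)` -/

/-- The distributional Laplacian of an `H²` function is an `L²` function. -/
theorem exists_laplacian_eq (ψ : L2) (h : TemperedDistribution.MemSobolev 2 2 (ψ : 𝓢'(E3, ℂ))) :
    ∃ g : L2, Δ (ψ : 𝓢'(E3, ℂ)) = (g : 𝓢'(E3, ℂ)) := by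
  have h' := h.laplacian
  rw [sub_self, TemperedDistribution.memSobolev_zero_iff] at h'
  exact h'

theorem toTemperedDistribution_injective {f g : L2} (h : (f : 𝓢'(E3, ℂ)) = (g : 𝓢'(E3, ℂ))) :
    f = g := by
  have hk := Lp.ker_toTemperedDistributionCLM_eq_bot (F := ℂ) (μ := (volume : Measure E3)) (p := 2)
  exact LinearMap.ker_eq_bot.mp hk h

/-- The Sobolev space `H²(ℝ³)` as a subspace of `L²(ℝ³)`. -/
def sobolevH2 : Submodule ℂ L2 where
  carrier := {ψ | TemperedDistribution.MemSobolev 2 2 (ψ : 𝓢'(E3, ℂ))}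
  add_mem' {f g} hf hg := by
    simp only [Set.mem_ofPred_eq, ← Lp.toTemperedDistributionCLM_apply, map_add] at hf hg ⊢
    exact hf.add hg
  zero_mem' := by
    simp only [Set.mem_ofPred_eq, ← Lp.toTemperedDistributionCLM_apply, map_zero]
    exact TemperedDistribution.memSobolev_fun_zero E3 ℂ 2 2
  smul_mem' c f hf := by
    simp only [Set.mem_ofPred_eq, ← Lp.toTemperedDistributionCLM_apply, map_smul] at hf ⊢
    exact hf.smul c

/-- The `L²` function representing the distributional Laplacian of an `H²` function. -/
noncomputable def laplacianFun (ψ : sobolevH2) : L2 :=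
  (exists_laplacian_eq ψ ψ.2).choose

theorem laplacianFun_spec (ψ : sobolevH2) :
    Δ ((ψ : L2) : 𝓢'(E3, ℂ)) = (laplacianFun ψ : 𝓢'(E3, ℂ)) :=
  (exists_laplacian_eq ψ ψ.2).choose_spec

/-- The Laplacian `Δ` as an unbounded operator on `L²(ℝ³)` with domain `H²(ℝ³)`. -/
noncomputable def laplacianOp : L2 →ₗ.[ℂ] L2 where
  domain := sobolevH2
  toFun :=
    { toFun := laplacianFun
      map_add' := fun f g => by
        apply toTemperedDistribution_injective
        rw [← laplacianFun_spec]
        simp only [← Lp.toTemperedDistributionCLM_apply, map_add, Submodule.coe_add]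
        simp only [Lp.toTemperedDistributionCLM_apply, ← laplacianFun_spec]
        simp only [TemperedDistribution.laplacian_eq_fourierMultiplierCLM, map_add, smul_add]
      map_smul' := fun c f => by
        apply toTemperedDistribution_injective
        rw [← laplacianFun_spec]
        simp only [← Lp.toTemperedDistributionCLM_apply, map_smul, Submodule.coe_smul,
          RingHom.id_apply]
        simp only [Lp.toTemperedDistributionCLM_apply, ← laplacianFun_spec]
        simp only [TemperedDistribution.laplacian_eq_fourierMultiplierCLM, map_smul]
        exact smul_comm _ _ _ }

/-- The maximal domain `{ψ ∈ L² : Uψ ∈ L²}` of multiplication by `U`. -/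
def mulDomain (U : E3 → ℝ) : Submodule ℂ L2 where
  carrier := {ψ | MemLp (fun x => (U x : ℂ) * ψ x) 2 volume}
  add_mem' {f g} hf hg := by
    simp only [Set.mem_ofPred_eq] at hf hg ⊢
    refine (hf.add hg).ae_eq ?_
    filter_upwards [Lp.coeFn_add f g] with x hx
    rw [hx, Pi.add_apply, Pi.add_apply, mul_add]
  zero_mem' := by
    simp only [Set.mem_ofPred_eq]
    refine (MemLp.zero (ε := ℂ)).ae_eq ?_
    filter_upwards [Lp.coeFn_zero ℂ 2 (volume : Measure E3)] with x hx
    rw [hx, Pi.zero_apply, mul_zero]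
  smul_mem' c f hf := by
    simp only [Set.mem_ofPred_eq] at hf ⊢
    refine (hf.const_smul c).ae_eq ?_
    filter_upwards [Lp.coeFn_smul c f] with x hx
    rw [hx, Pi.smul_apply, Pi.smul_apply, mul_smul_comm]

theorem memLp_of_mem_mulDomain {U : E3 → ℝ} (ψ : mulDomain U) :
    MemLp (fun x => (U x : ℂ) * (ψ : L2) x) 2 volume :=
  ψ.2

/-- Multiplication by `U` as an unbounded operator on `L²(ℝ³)` with its maximal domain. -/
noncomputable def mulOp (U : E3 → ℝ) : L2 →ₗ.[ℂ] L2 where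
  domain := mulDomain U
  toFun :=
    { toFun := fun ψ => (memLp_of_mem_mulDomain ψ).toLp
      map_add' := fun f g => by
        rw [← MemLp.toLp_add]
        apply MemLp.toLp_congr
        filter_upwards [Lp.coeFn_add (f : L2) (g : L2)] with x hx
        rw [Submodule.coe_add, hx, Pi.add_apply, Pi.add_apply, mul_add]
      map_smul' := fun c f => by
        rw [RingHom.id_apply, ← MemLp.toLp_const_smul]
        apply MemLp.toLp_congr
        filter_upwards [Lp.coeFn_smul c (f : L2)] with x hx
        rw [Submodule.coe_smul, hx, Pi.smul_apply, Pi.smul_apply, mul_smul_comm] }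

/-- The Schrödinger operator `-Δ + U`, with domain `{ψ ∈ H² : Uψ ∈ L²}`
(which is all of `H²(ℝ³)` whenever `U ∈ L²(ℝ³)`). -/
noncomputable def schrodinger (U : E3 → ℝ) : L2 →ₗ.[ℂ] L2 :=
  -laplacianOp + mulOp U

/-! ### Resolvents of unbounded operators -/

/-- `R` is a bounded two-sided inverse of `T - z`. -/
structure IsResolvent (T : L2 →ₗ.[ℂ] L2) (z : ℂ) (R : L2 →L[ℂ] L2) : Prop where
  right_inv : ∀ f : L2, ∃ h : R f ∈ T.domain, T ⟨R f, h⟩ - z • R f = f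
  left_inv : ∀ ψ : T.domain, R (T ψ - z • (ψ : L2)) = ψ

/-- The resolvent set of an unbounded operator. -/
def resolventSet (T : L2 →ₗ.[ℂ] L2) : Set ℂ :=
  {z | ∃ R : L2 →L[ℂ] L2, IsResolvent T z R}

open Classical in
/-- The resolvent `(T - z)⁻¹` for `z` in the resolvent set (and `0` for other `z`). -/
noncomputable def resolvent (T : L2 →ₗ.[ℂ] L2) (z : ℂ) : L2 →L[ℂ] L2 :=
  if h : ∃ R : L2 →L[ℂ] L2, IsResolvent T z R then h.choose else 0

theorem IsResolvent.unique {T : L2 →ₗ.[ℂ] L2} {z : ℂ} {R S : L2 →L[ℂ] L2}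
    (hR : IsResolvent T z R) (hS : IsResolvent T z S) : R = S := by
  ext1 f
  obtain ⟨h, hf⟩ := hS.right_inv f
  have := hR.left_inv ⟨S f, h⟩
  rwa [hf] at this

/-! ### Zero-energy solutions, resonances, scattering length -/

/-- `(-Δ + V)ψ = 0` on `ℝ³` in the sense of distributions. -/
structure IsZeroEnergySolution (V : E3 → ℝ) (ψ : E3 → ℂ) : Prop where
  locallyIntegrable : LocallyIntegrable ψ volume
  locallyIntegrable_mul : LocallyIntegrable (fun x => (V x : ℂ) * ψ x) volume
  weak : ∀ φ : E3 → ℝ, ContDiff ℝ ∞ φ → HasCompactSupport φ →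
    ∫ x, (-(((Δ φ) x : ℝ) : ℂ) * ψ x + (φ x : ℂ) * ((V x : ℂ) * ψ x)) = 0

/-- Zero is an eigenvalue of `-Δ + V`. -/
def ZeroIsEigenvalue (V : E3 → ℝ) : Prop :=
  ∃ ψ : (schrodinger V).domain, ψ ≠ 0 ∧ schrodinger V ψ = 0

/-- Zero is a resonance of `-Δ + V`: there is a zero-energy solution outside `L²(ℝ³)` that lies in
the weighted space `L²((1 + |x|)^{-2s} dx)` for every `s > 1/2`. -/
def ZeroIsResonance (V : E3 → ℝ) : Prop :=
  ∃ ψ : E3 → ℂ, IsZeroEnergySolution V ψ ∧ ¬ MemLp ψ 2 volume ∧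
    ∀ s : ℝ, 1 / 2 < s → MemLp (fun x => (((1 + ‖x‖) ^ (-s) : ℝ) : ℂ) * ψ x) 2 volume

/-- `φ₀` solves the zero-energy scattering problem
`(-Δ + V)φ₀ = 0`, `φ₀(x) → 1` as `|x| → ∞`. -/
structure IsScatteringSolution (V : E3 → ℝ) (φ₀ : E3 → ℝ) : Prop where
  continuous : Continuous φ₀
  solution : IsZeroEnergySolution V (fun x => (φ₀ x : ℂ))
  tendsto_one : Tendsto φ₀ (cocompact E3) (𝓝 1)

/-- `a` is the scattering length `(4π)⁻¹ ∫ V φ₀` of the potential `V`. -/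
def IsScatteringLength (V : E3 → ℝ) (a : ℝ) : Prop :=
  ∃ φ₀ : E3 → ℝ, IsScatteringSolution V φ₀ ∧ Integrable (fun x => V x * φ₀ x) volume ∧
    a = 1 / (4 * Real.pi) * ∫ x, V x * φ₀ x

/-! ### The Lorentz gas -/

/-- The total potential `x ↦ ∑ i, N² V(N(x - yᵢ))` of the `N` obstacles `Y = (y₁, …, y_N)`. -/
noncomputable def obstaclePotential (V : E3 → ℝ) (N : ℕ) (Y : Fin N → E3) (x : E3) : ℝ :=
  ∑ i, (N : ℝ) ^ 2 * V ((N : ℝ) • (x - Y i))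

/-- The Hamiltonian `H_N = -Δ + ∑ i, N² V(N(x - yᵢ))`. -/
noncomputable def hamiltonian (V : E3 → ℝ) (N : ℕ) (Y : Fin N → E3) : L2 →ₗ.[ℂ] L2 :=
  schrodinger (obstaclePotential V N Y)

/-- The limiting Hamiltonian `H = -Δ + 4πaW`. -/
noncomputable def limitHamiltonian (a : ℝ) (W : E3 → ℝ) : L2 →ₗ.[ℂ] L2 :=
  schrodinger (fun x => 4 * Real.pi * a * W x)

/-- The law `(W dx)^{⊗N}` of `N` independent obstacles with density `W`. -/
noncomputable def obstacleLaw (W : E3 → ℝ) (N : ℕ) : Measure (Fin N → E3) :=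
  Measure.pi fun _ => (volume : Measure E3).withDensity fun x => ENNReal.ofReal (W x)

end LorentzGas

namespace LorentzGas

/-! ### The Yukawa kernel -/

/-! Put `λ = κ²`, let `G_κ` be the Yukawa kernel and `R` the free resolvent, i.e. convolution with
`G_κ`. The resolvent of `-Δ + U` at `-κ²` is `R (1 + U R)⁻¹`, and `U R` is Hilbert–Schmidt for `U ∈
L²`. By the Fredholm alternative only the injectivity of `1 + U R` has to be shown
(`schrodinger_resolvent`).

Let `ψ = (H_N + κ²)⁻¹ f`. In the variable `ξ = N(x - y_j)` the obstacle `j` carries the charge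
density `V χ_j`, where `χ_j(ξ) = ψ(y_j + ξ/N)`, and its field is generated by `G_{κ/N}`, which is
close to the Newtonian kernel `G_0`. So `ψ` is `G_κ * f` minus the `N` obstacle fields
(`yukawaConv_eq_of_resolvent`). With the factorization `V = A B`, `B` bounded, this is an `N × N`
system of operators for the functions `A χ_j`. The diagonal blocks are close to `1 + A G_0 B`. That
operator is invertible since a kernel element would yield a zero-energy eigenfunction or a resonance
(`scatteringOp_injective`). The off-diagonal blocks have total squared Hilbert–Schmidt norm
`totalInteraction`. With probability tending to one it exceeds a constant times `‖W‖₂² ‖G_κ‖₂² =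
O(1/κ)` by at most a prescribed amount (`tendsto_measure_totalInteraction`). For large `λ` the
system is thus invertible uniformly in `N` (`apriori_bound`), which gives both injectivity for `H_N`
and stability.

Let `Ψ = (H + κ²)⁻¹ f`. The ansatz near `y_i` is `χ_i ≈ Ψ(y_i) φ₀`, with `φ₀` the scattering
solution. Seen from a distance such an obstacle is a point charge of size `Ψ(y_i)/N` times `∫ V φ₀ =
4πa`, and by the law of large numbers `N⁻¹ ∑ Ψ(y_j) G_κ(x - y_j)` approximates `G_κ * (W Ψ)`; this
is the effective potential `4πa W`. The residual of the ansatz has four parts (`residual_eq`), all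
of mean square `O(1/N)`: three come from the `1/2`-Hölder continuity of `G_κ` in `L²`, from `G_0 -
G_{κ/N} = O(κ/N)`, and from the variance of independent sums, the fourth from replacing extended
obstacles by points, again through Hölder continuity. So `‖ψ - Ψ‖²` is bounded, off the bad event,
by a variable of mean `O(1/N)`, and Markov's inequality gives every rate `N^{-β}` with `β < 1/2`.

For the scattering length, `φ₀` is built by inverting `1 + A G_0 B`. Liouville's theorem turns any
scattering solution into a solution of the Lippmann–Schwinger equation, which injectivity makes
unique. -/

/-- The kernel `exp (-κ|x|) / (4π|x|)` of `(-Δ + κ²)⁻¹` on `ℝ³`. -/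
noncomputable def yukawa (κ : ℝ) (x : E3) : ℝ := Real.exp (-κ * ‖x‖) / (4 * Real.pi * ‖x‖)

theorem yukawa_nonneg (κ : ℝ) (x : E3) : 0 ≤ yukawa κ x := by
  unfold yukawa; positivity

@[fun_prop]
theorem measurable_yukawa (κ : ℝ) : Measurable (yukawa κ) := by
  unfold yukawa; fun_prop

theorem yukawa_neg (κ : ℝ) (x : E3) : yukawa κ (-x) = yukawa κ x := by
  simp [yukawa]

theorem yukawa_sub_comm (κ : ℝ) (x y : E3) : yukawa κ (x - y) = yukawa κ (y - x) := by
  rw [← yukawa_neg, neg_sub]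

theorem yukawa_zero_apply (x : E3) : yukawa 0 x = 1 / (4 * Real.pi * ‖x‖) := by
  simp [yukawa]

theorem yukawa_le_yukawa_zero {κ : ℝ} (hκ : 0 ≤ κ) (x : E3) : yukawa κ x ≤ yukawa 0 x := by
  unfold yukawa
  gcongr

/-- The singularities cancel, because `1 - exp (-t) ≤ t`. This makes the replacement of `κ / N` by
`0` in the self-interaction of a rescaled obstacle an `O(1/N)` perturbation. -/
theorem abs_yukawa_zero_sub_le {κ : ℝ} (hκ : 0 ≤ κ) (x : E3) :
    |yukawa 0 x - yukawa κ x| ≤ κ / (4 * Real.pi) := by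
  have h0 := yukawa_le_yukawa_zero hκ x
  rw [abs_of_nonneg (by linarith)]
  rcases eq_or_ne x 0 with rfl | hx
  -- At the origin both kernels equal `0`, by the convention for division by zero.
  · simp [yukawa]; positivity
  · have hx' : 0 < ‖x‖ := norm_pos_iff.mpr hx
    unfold yukawa
    rw [← sub_div, div_le_div_iff₀ (by positivity) (by positivity)]
    have := Real.add_one_le_exp (-κ * ‖x‖)
    simp only [neg_zero, zero_mul, Real.exp_zero]
    nlinarith [Real.pi_pos]

/-- Passing to the microscopic variable of an obstacle of size `1/n` trades the mass `κ` for `κ /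
n`; this is why the zero-energy problem governs the limit. -/
theorem yukawa_scale (κ : ℝ) {n : ℝ} (hn : 0 < n) (x : E3) :
    n⁻¹ * yukawa κ (n⁻¹ • x) = yukawa (κ / n) x := by
  unfold yukawa
  rw [norm_smul, Real.norm_eq_abs, abs_of_pos (inv_pos.mpr hn)]
  have : -κ * (n⁻¹ * ‖x‖) = -(κ / n) * ‖x‖ := by field_simp
  rw [this]
  rcases eq_or_ne x 0 with rfl | hx
  · simp
  · have hx' : 0 < ‖x‖ := norm_pos_iff.mpr hx
    field_simp

/-! ### Radial integrals in three dimensions -/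

theorem enorm_sq_eq_ofReal (r : ℝ) : ‖r‖ₑ ^ 2 = ENNReal.ofReal (r ^ 2) := by
  rw [← ofReal_norm, ← ENNReal.ofReal_pow (norm_nonneg _), Real.norm_eq_abs, sq_abs]

theorem two_mul_ofReal (r : ℝ) : 2 * ENNReal.ofReal r = ENNReal.ofReal (2 * r) := by
  rw [ENNReal.ofReal_mul (by norm_num), ENNReal.ofReal_ofNat]

/-- The area of the unit sphere in `ℝ³`. -/
noncomputable def sphereArea : ℝ := 3 * (volume : Measure E3).real (Metric.ball 0 1)

theorem sphereArea_nonneg : 0 ≤ sphereArea := by unfold sphereArea; positivity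

theorem integrable_radial {f : ℝ → ℝ} (hf : IntegrableOn (fun r => r ^ 2 * f r) (Set.Ioi 0)) :
    Integrable (fun x : E3 => f ‖x‖) := by
  rw [integrable_fun_norm_addHaar]
  simpa using hf

theorem integral_radial (f : ℝ → ℝ) :
    ∫ x : E3, f ‖x‖ = sphereArea * ∫ r in Set.Ioi 0, r ^ 2 * f r := by
  rw [integral_fun_norm_addHaar]
  simp [sphereArea, mul_assoc]

theorem lintegral_radial {f : ℝ → ℝ} (hf : IntegrableOn (fun r => r ^ 2 * f r) (Set.Ioi 0))
    (h0 : ∀ r, 0 ≤ r → 0 ≤ f r) :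
    ∫⁻ x : E3, ENNReal.ofReal (f ‖x‖) =
      ENNReal.ofReal (sphereArea * ∫ r in Set.Ioi 0, r ^ 2 * f r) := by
  rw [← ofReal_integral_eq_lintegral_ofReal (integrable_radial hf)
    (.of_forall fun x => h0 _ (norm_nonneg _)), integral_radial]

theorem integrable_yukawa {κ : ℝ} (hκ : 0 < κ) : Integrable (yukawa κ) := by
  apply integrable_radial (f := fun r => Real.exp (-κ * r) / (4 * Real.pi * r))
  have h2 : IntegrableOn (fun r : ℝ => r * Real.exp (-κ * r)) (Set.Ioi 0) := by
    have := integrableOn_rpow_mul_exp_neg_mul_rpow (s := 1) (p := 1) (b := κ) (by norm_num)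
      (by norm_num) hκ
    simpa using this
  refine IntegrableOn.congr_fun (h2.const_mul (1 / (4 * Real.pi))) (fun r hr => ?_)
    measurableSet_Ioi
  have : r ≠ 0 := (Set.mem_Ioi.mp hr).ne'
  field_simp

/-- Since `sphereArea` is `4π`, the value is `1/(8πκ)`. Its decay in `κ` is the source of all
smallness at large `λ`. -/
theorem lintegral_yukawa_sq {κ : ℝ} (hκ : 0 < κ) :
    ∫⁻ x, ‖yukawa κ x‖ₑ ^ 2 = ENNReal.ofReal (sphereArea / (32 * Real.pi ^ 2 * κ)) := by
  have hfun : ∀ r ∈ Set.Ioi (0 : ℝ), (16 * Real.pi ^ 2)⁻¹ * Real.exp (-(2 * κ) * r) =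
      r ^ 2 * (Real.exp (-κ * r) / (4 * Real.pi * r)) ^ 2 := fun r hr => by
    have : r ≠ 0 := (Set.mem_Ioi.mp hr).ne'
    rw [show -(2 * κ) * r = -κ * r + -κ * r by ring, Real.exp_add]
    field_simp
    norm_num
  have hint : IntegrableOn (fun r => r ^ 2 * (Real.exp (-κ * r) / (4 * Real.pi * r)) ^ 2)
      (Set.Ioi 0) := by
    refine IntegrableOn.congr_fun ?_ hfun measurableSet_Ioi
    exact (integrableOn_exp_mul_Ioi (by linarith) 0).const_mul _
  simp_rw [enorm_sq_eq_ofReal]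
  have := lintegral_radial (f := fun r => (Real.exp (-κ * r) / (4 * Real.pi * r)) ^ 2) hint
    (fun r _ => by positivity)
  unfold yukawa
  rw [this, ← setIntegral_congr_fun measurableSet_Ioi hfun, integral_const_mul,
    integral_exp_mul_Ioi (by linarith) 0]
  congr 1
  field_simp
  norm_num
  ring

theorem lintegral_ball_yukawa_zero_sq (R : ℝ) (hR : 0 ≤ R) :
    ∫⁻ x in Metric.ball (0 : E3) R, ‖yukawa 0 x‖ₑ ^ 2 =
      ENNReal.ofReal (sphereArea / (16 * Real.pi ^ 2) * R) := by
  set g : ℝ → ℝ := fun r => (Set.Iio R).indicator (fun r => (1 / (4 * Real.pi * r)) ^ 2) r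
  have hfun : ∀ r ∈ Set.Ioi (0 : ℝ),
      (Set.Ioo 0 R).indicator (fun _ => (16 * Real.pi ^ 2)⁻¹) r = r ^ 2 * g r := fun r hr => by
    have : r ≠ 0 := (Set.mem_Ioi.mp hr).ne'
    have hr' : 0 < r := hr
    simp only [g, Set.indicator, Set.mem_Ioo, Set.mem_Iio, hr', true_and]
    split_ifs
    · field_simp
      norm_num
    · simp
  have hint : IntegrableOn (fun r => r ^ 2 * g r) (Set.Ioi 0) := by
    refine IntegrableOn.congr_fun ?_ hfun measurableSet_Ioi
    apply Integrable.integrableOn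
    rw [integrable_indicator_iff measurableSet_Ioo]
    exact integrableOn_const (by simp)
  rw [← lintegral_indicator measurableSet_ball]
  have h := lintegral_radial hint (fun r _ => by
    simp only [g]; exact Set.indicator_nonneg (fun _ _ => by positivity) _)
  have h1 : ∫⁻ x : E3, (Metric.ball (0 : E3) R).indicator (fun x => ‖yukawa 0 x‖ₑ ^ 2) x =
      ∫⁻ x : E3, ENNReal.ofReal (g ‖x‖) := by
    congr 1; ext x
    simp only [g, Set.indicator, Metric.mem_ball, dist_zero_right, Set.mem_Iio]
    split_ifs
    · rw [enorm_sq_eq_ofReal, yukawa_zero_apply]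
    · simp
  rw [h1, h, ← setIntegral_congr_fun measurableSet_Ioi hfun, setIntegral_indicator measurableSet_Ioo]
  rw [show Set.Ioi 0 ∩ Set.Ioo 0 R = Set.Ioo 0 R by ext; simp]
  simp [hR]
  congr 1
  field_simp

theorem lintegral_compl_ball_inv_norm_four {R : ℝ} (hR : 0 < R) :
    ∫⁻ x in (Metric.ball (0 : E3) R)ᶜ, ENNReal.ofReal (1 / ‖x‖ ^ 4) =
      ENNReal.ofReal (sphereArea / R) := by
  set g : ℝ → ℝ := fun r => (Set.Ici R).indicator (fun r => 1 / r ^ 4) r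
  have hfun : ∀ r ∈ Set.Ioi (0 : ℝ),
      (Set.Ici R).indicator (fun r => r ^ (-2 : ℝ)) r = r ^ 2 * g r := fun r hr => by
    have : r ≠ 0 := (Set.mem_Ioi.mp hr).ne'
    have hr' : 0 < r := hr
    simp only [g, Set.indicator, Set.mem_Ici]
    split_ifs
    · rw [Real.rpow_neg hr'.le, Real.rpow_two]
      field_simp
    · simp
  have hint : IntegrableOn (fun r => r ^ 2 * g r) (Set.Ioi 0) := by
    refine IntegrableOn.congr_fun ?_ hfun measurableSet_Ioi
    apply Integrable.integrableOn
    rw [integrable_indicator_iff measurableSet_Ici, integrableOn_Ici_iff_integrableOn_Ioi]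
    exact integrableOn_Ioi_rpow_of_lt (by norm_num) hR
  rw [← lintegral_indicator measurableSet_ball.compl]
  have h := lintegral_radial hint (fun r _ => by
    simp only [g]; exact Set.indicator_nonneg (fun _ _ => by positivity) _)
  have h1 : ∫⁻ x : E3, ((Metric.ball (0 : E3) R)ᶜ).indicator
      (fun x => ENNReal.ofReal (1 / ‖x‖ ^ 4)) x = ∫⁻ x : E3, ENNReal.ofReal (g ‖x‖) := by
    congr 1; ext x
    simp only [g, Set.indicator, Set.mem_compl_iff, Metric.mem_ball, dist_zero_right, Set.mem_Ici,
      not_lt]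
    split_ifs <;> simp
  rw [h1, h, ← setIntegral_congr_fun measurableSet_Ioi hfun, setIntegral_indicator measurableSet_Ici]
  rw [show Set.Ioi 0 ∩ Set.Ici R = Set.Ici R by
    ext; simp only [Set.mem_inter_iff, Set.mem_Ioi, Set.mem_Ici]; constructor
    · tauto
    · intro h; exact ⟨by linarith, h⟩]
  rw [integral_Ici_eq_integral_Ioi, integral_Ioi_rpow_of_lt (by norm_num) hR]
  congr 1
  norm_num
  rw [Real.rpow_neg_one]
  field_simp

/-! ### Modulus of continuity of the Yukawa kernel in `L²` -/

/-- For `r ≤ s` put `t = 1 - exp (-κ(s - r))`. The difference is `exp (-κ s) (1/r - 1/s) + t exp (-κ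
r) / r`, and `t² ≤ t ≤ κ (s - r)`. The first part is the Newtonian case. In the second, the factor
`κ` will be compensated by the squared norm `O(1/κ)` of the kernel, so the final modulus does not
depend on `κ`. -/
theorem sq_exp_div_sub_le {κ r s : ℝ} (hκ : 0 ≤ κ) (hr : 0 < r) (hs : 0 < s) :
    (Real.exp (-κ * r) / r - Real.exp (-κ * s) / s) ^ 2 ≤
      2 * (1 / r - 1 / s) ^ 2 + 2 * (κ * |r - s|) *
        ((Real.exp (-κ * r) / r) ^ 2 + (Real.exp (-κ * s) / s) ^ 2) := by
  wlog hrs : r ≤ s generalizing r s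
  · have := this hs hr (le_of_not_ge hrs)
    rw [abs_sub_comm] at this
    nlinarith [this]
  have hd : 0 ≤ s - r := by linarith
  rw [abs_sub_comm, abs_of_nonneg hd]
  set t := 1 - Real.exp (-κ * (s - r)) with ht
  have hkd : 0 ≤ κ * (s - r) := mul_nonneg hκ hd
  have ht0 : 0 ≤ t := by
    rw [ht, sub_nonneg, Real.exp_le_one_iff]; linarith
  have ht1 : t ≤ 1 := by rw [ht]; linarith [Real.exp_pos (-κ * (s - r))]
  have htk : t ≤ κ * (s - r) := by
    have := Real.add_one_le_exp (-κ * (s - r)); rw [ht]; linarith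
  have hexp : Real.exp (-κ * s) = Real.exp (-κ * r) * (1 - t) := by
    rw [ht, sub_sub_cancel, ← Real.exp_add]; ring_nf
  have key : Real.exp (-κ * r) / r - Real.exp (-κ * s) / s =
      Real.exp (-κ * s) * (1 / r - 1 / s) + t * (Real.exp (-κ * r) / r) := by
    rw [hexp]; field_simp; ring
  have hes : Real.exp (-κ * s) ≤ 1 := by
    rw [Real.exp_le_one_iff]; nlinarith
  have hes0 := Real.exp_pos (-κ * s)
  rw [key]
  have h1 : (Real.exp (-κ * s) * (1 / r - 1 / s)) ^ 2 ≤ (1 / r - 1 / s) ^ 2 := by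
    rw [mul_pow]
    apply mul_le_of_le_one_left (sq_nonneg _)
    nlinarith
  have h2 : (t * (Real.exp (-κ * r) / r)) ^ 2 ≤ κ * (s - r) * (Real.exp (-κ * r) / r) ^ 2 := by
    rw [mul_pow]
    apply mul_le_mul_of_nonneg_right _ (sq_nonneg _)
    nlinarith
  have h3 : 0 ≤ κ * (s - r) * (Real.exp (-κ * s) / s) ^ 2 := mul_nonneg hkd (sq_nonneg _)
  nlinarith [sq_nonneg (Real.exp (-κ * s) * (1 / r - 1 / s) - t * (Real.exp (-κ * r) / r))]

/-- Near the singularity, `‖x‖ < 2‖z‖`, cancellation is irrelevant and both squares are kept.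
Farther out `‖x + z‖ ≥ ‖x‖ / 2`, so the Newtonian difference is of order `‖z‖ / ‖x‖²`. Each piece
integrates to a multiple of `‖z‖`. -/
theorem sq_yukawa_sub_le {κ : ℝ} (hκ : 0 ≤ κ) {x z : E3} (hx : x ≠ 0) (hxz : x + z ≠ 0) :
    ‖yukawa κ (x + z) - yukawa κ x‖ₑ ^ 2 ≤
      2 * ((Metric.ball (0 : E3) (2 * ‖z‖)).indicator (fun x => ‖yukawa 0 x‖ₑ ^ 2) x +
        (Metric.ball (0 : E3) (3 * ‖z‖)).indicator (fun x => ‖yukawa 0 x‖ₑ ^ 2) (x + z) +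
        ENNReal.ofReal (4 * ‖z‖ ^ 2 / (16 * Real.pi ^ 2)) *
          ((Metric.ball (0 : E3) (2 * ‖z‖))ᶜ).indicator (fun x => ENNReal.ofReal (1 / ‖x‖ ^ 4)) x) +
      ENNReal.ofReal (2 * (κ * ‖z‖)) * (‖yukawa κ x‖ₑ ^ 2 + ‖yukawa κ (x + z)‖ₑ ^ 2) := by
  have hr : 0 < ‖x‖ := norm_pos_iff.mpr hx
  have hs : 0 < ‖x + z‖ := norm_pos_iff.mpr hxz
  have hpi := Real.pi_pos
  have habs : |‖x + z‖ - ‖x‖| ≤ ‖z‖ := by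
    have := abs_norm_sub_norm_le (x + z) x; simpa using this
  have habs' := abs_le.mp habs
  have hmain : (yukawa κ (x + z) - yukawa κ x) ^ 2 ≤
      2 * (1 / (4 * Real.pi * ‖x + z‖) - 1 / (4 * Real.pi * ‖x‖)) ^ 2 +
      2 * (κ * ‖z‖) * (yukawa κ x ^ 2 + yukawa κ (x + z) ^ 2) := by
    have h := sq_exp_div_sub_le hκ hs hr
    have h' : 2 * (κ * |‖x + z‖ - ‖x‖|) * ((Real.exp (-κ * ‖x + z‖) / ‖x + z‖) ^ 2 +
        (Real.exp (-κ * ‖x‖) / ‖x‖) ^ 2) ≤ 2 * (κ * ‖z‖) *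
        ((Real.exp (-κ * ‖x + z‖) / ‖x + z‖) ^ 2 + (Real.exp (-κ * ‖x‖) / ‖x‖) ^ 2) := by
      gcongr
    have e1 : ∀ a b : ℝ, a / (4 * Real.pi * b) = (4 * Real.pi)⁻¹ * (a / b) := by
      intro a b; rw [mul_comm (4 * Real.pi), ← div_div, div_eq_inv_mul _ (4 * Real.pi)]
    simp only [yukawa, e1]
    have h'' := mul_le_mul_of_nonneg_left (h.trans (add_le_add_right h' _))
      (sq_nonneg (4 * Real.pi)⁻¹)
    nlinarith [h'']
  rw [enorm_sq_eq_ofReal]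
  refine (ENNReal.ofReal_le_ofReal hmain).trans ?_
  rw [ENNReal.ofReal_add (by positivity) (by positivity), ENNReal.ofReal_mul (by positivity),
    ENNReal.ofReal_mul (by positivity), ENNReal.ofReal_add (by positivity) (by positivity),
    enorm_sq_eq_ofReal, enorm_sq_eq_ofReal, ENNReal.ofReal_ofNat]
  gcongr
  by_cases hcase : ‖x‖ < 2 * ‖z‖
  · have hs3 : ‖x + z‖ < 3 * ‖z‖ := by linarith
    have hm : (1 / (4 * Real.pi * ‖x + z‖) - 1 / (4 * Real.pi * ‖x‖)) ^ 2 ≤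
        (1 / (4 * Real.pi * ‖x‖)) ^ 2 + (1 / (4 * Real.pi * ‖x + z‖)) ^ 2 := by
      have : 0 ≤ 1 / (4 * Real.pi * ‖x + z‖) * (1 / (4 * Real.pi * ‖x‖)) := by positivity
      nlinarith
    rw [Set.indicator_of_mem (by simpa using hcase), Set.indicator_of_mem (by simpa using hs3),
      enorm_sq_eq_ofReal, enorm_sq_eq_ofReal, yukawa_zero_apply, yukawa_zero_apply]
    refine le_add_right ?_
    rw [← ENNReal.ofReal_add (by positivity) (by positivity)]
    exact ENNReal.ofReal_le_ofReal hm
  · push Not at hcase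
    rw [Set.indicator_of_mem (s := (Metric.ball (0 : E3) (2 * ‖z‖))ᶜ) (by simpa using hcase),
      ← ENNReal.ofReal_mul (by positivity)]
    refine le_add_left (ENNReal.ofReal_le_ofReal ?_)
    have hs2 : ‖x‖ / 2 ≤ ‖x + z‖ := by linarith
    have e : 1 / (4 * Real.pi * ‖x + z‖) - 1 / (4 * Real.pi * ‖x‖) =
        (‖x‖ - ‖x + z‖) / (4 * Real.pi * (‖x + z‖ * ‖x‖)) := by
      field_simp
    rw [e, div_pow]
    have hnum : (‖x‖ - ‖x + z‖) ^ 2 ≤ ‖z‖ ^ 2 := by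
      apply sq_le_sq' <;> linarith
    have hden : (4 * Real.pi * (‖x‖ / 2 * ‖x‖)) ^ 2 ≤ (4 * Real.pi * (‖x + z‖ * ‖x‖)) ^ 2 := by
      gcongr
    calc _ ≤ ‖z‖ ^ 2 / (4 * Real.pi * (‖x‖ / 2 * ‖x‖)) ^ 2 := by gcongr
      _ = _ := by field_simp; ring

/-- The Yukawa kernel is Hölder continuous of order `1/2` in `L²`. -/
theorem lintegral_yukawa_translate_sq_le {κ : ℝ} (hκ : 0 ≤ κ) (z : E3) :
    ∫⁻ x, ‖yukawa κ (x + z) - yukawa κ x‖ₑ ^ 2 ≤ ENNReal.ofReal (sphereArea * ‖z‖) := by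
  rcases eq_or_ne z 0 with rfl | hz
  · simp
  have hz' : 0 < ‖z‖ := norm_pos_iff.mpr hz
  have hae : ∀ᵐ x : E3, x ≠ 0 ∧ x + z ≠ 0 := by
    have h1 : ∀ᵐ x : E3, x ≠ 0 := by simp [ae_iff]
    have h2 : ∀ᵐ x : E3, x ≠ -z := by simp [ae_iff]
    filter_upwards [h1, h2] with x h1 h2 
    exact ⟨h1, fun h => h2 (eq_neg_of_add_eq_zero_left h)⟩
  refine (lintegral_mono_ae (hae.mono fun x hx => sq_yukawa_sub_le hκ hx.1 hx.2)).trans ?_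
  have m1 : Measurable fun x : E3 =>
      (Metric.ball (0 : E3) (2 * ‖z‖)).indicator (fun x => ‖yukawa 0 x‖ₑ ^ 2) x :=
    (by fun_prop : Measurable fun x : E3 => ‖yukawa 0 x‖ₑ ^ 2).indicator measurableSet_ball
  have m2 : Measurable fun x : E3 =>
      (Metric.ball (0 : E3) (3 * ‖z‖)).indicator (fun x => ‖yukawa 0 x‖ₑ ^ 2) x :=
    (by fun_prop : Measurable fun x : E3 => ‖yukawa 0 x‖ₑ ^ 2).indicator measurableSet_ball
  have m2' : Measurable fun x : E3 =>
      (Metric.ball (0 : E3) (3 * ‖z‖)).indicator (fun x => ‖yukawa 0 x‖ₑ ^ 2) (x + z) :=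
    m2.comp (measurable_add_const z)
  have m3 : Measurable fun x : E3 =>
      ((Metric.ball (0 : E3) (2 * ‖z‖))ᶜ).indicator (fun x => ENNReal.ofReal (1 / ‖x‖ ^ 4)) x :=
    (by fun_prop : Measurable fun x : E3 => ENNReal.ofReal (1 / ‖x‖ ^ 4)).indicator
      measurableSet_ball.compl
  have m4 : Measurable fun x : E3 => ‖yukawa κ x‖ₑ ^ 2 := by fun_prop
  rw [lintegral_add_right _ (by fun_prop), lintegral_const_mul _ (by fun_prop),
    lintegral_add_right _ (by fun_prop), lintegral_add_right _ (by fun_prop),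
    lintegral_const_mul _ (by fun_prop), lintegral_const_mul _ (by fun_prop),
    lintegral_add_right _ (by fun_prop),
    lintegral_add_right_eq_self (fun x => ‖yukawa κ x‖ₑ ^ 2) z,
    lintegral_add_right_eq_self (fun x => (Metric.ball (0 : E3) (3 * ‖z‖)).indicator
      (fun x => ‖yukawa 0 x‖ₑ ^ 2) x) z,
    lintegral_indicator measurableSet_ball, lintegral_indicator measurableSet_ball,
    lintegral_indicator measurableSet_ball.compl, lintegral_ball_yukawa_zero_sq _ (by positivity),
    lintegral_ball_yukawa_zero_sq _ (by positivity),
    lintegral_compl_ball_inv_norm_four (by positivity)]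
  have hA := sphereArea_nonneg
  have hpi : 9 < Real.pi ^ 2 := by nlinarith [Real.pi_gt_three]
  have hlast : ENNReal.ofReal (2 * (κ * ‖z‖)) *
      ((∫⁻ x, ‖yukawa κ x‖ₑ ^ 2) + ∫⁻ x, ‖yukawa κ x‖ₑ ^ 2) ≤
      ENNReal.ofReal (sphereArea / (8 * Real.pi ^ 2) * ‖z‖) := by
    -- For `κ = 0` the norm of the kernel is infinite but its coefficient vanishes; for `κ > 0` the
    -- factor `κ` cancels the `1/κ` in the squared norm.
    rcases hκ.eq_or_lt with rfl | hκ'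
    · simp
    · rw [lintegral_yukawa_sq hκ', ← ENNReal.ofReal_add (by positivity) (by positivity),
        ← ENNReal.ofReal_mul (by positivity)]
      apply ENNReal.ofReal_le_ofReal
      apply le_of_eq
      field_simp
      ring
  refine (add_le_add_right hlast _).trans ?_
  rw [← ENNReal.ofReal_mul (by positivity), ← ENNReal.ofReal_add (by positivity) (by positivity),
    ← ENNReal.ofReal_add (by positivity) (by positivity),
    two_mul_ofReal, ← ENNReal.ofReal_add (by positivity) (by positivity)]
  apply ENNReal.ofReal_le_ofReal
  have : 2 * (sphereArea / (16 * Real.pi ^ 2) * (2 * ‖z‖) + sphereArea / (16 * Real.pi ^ 2) *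
      (3 * ‖z‖) + 4 * ‖z‖ ^ 2 / (16 * Real.pi ^ 2) * (sphereArea / (2 * ‖z‖))) +
      sphereArea / (8 * Real.pi ^ 2) * ‖z‖ = sphereArea * ‖z‖ / Real.pi ^ 2 := by
    field_simp; ring
  rw [this]
  exact div_le_self (by positivity) (by linarith)

/-- The Cauchy-Schwarz inequality for the lower Lebesgue integral. -/
theorem lintegral_mul_sq_le {α : Type*} [MeasurableSpace α] {μ : Measure α} {f g : α → ℝ≥0∞}
    (hf : AEMeasurable f μ) (hg : AEMeasurable g μ) :
    (∫⁻ x, f x * g x ∂μ) ^ 2 ≤ (∫⁻ x, f x ^ 2 ∂μ) * ∫⁻ x, g x ^ 2 ∂μ := by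
  have h := ENNReal.lintegral_mul_le_Lp_mul_Lq μ Real.HolderConjugate.two_two hf hg
  have h2 := pow_le_pow_left' h 2
  simp only [ENNReal.rpow_two] at h2
  refine h2.trans (le_of_eq ?_)
  rw [mul_pow, ← ENNReal.rpow_natCast, ← ENNReal.rpow_mul, ← ENNReal.rpow_natCast,
    ← ENNReal.rpow_mul]
  norm_num

/-- Weighted Cauchy-Schwarz inequality. -/
theorem lintegral_mul_sq_le_weighted {α : Type*} [MeasurableSpace α] {μ : Measure α}
    {f g : α → ℝ≥0∞} (hf : AEMeasurable f μ) (hg : AEMeasurable g μ) :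
    (∫⁻ x, f x * g x ∂μ) ^ 2 ≤ (∫⁻ x, f x ∂μ) * ∫⁻ x, f x * g x ^ 2 ∂μ := by
  have hs : ∀ x, f x ^ (1 / 2 : ℝ) * f x ^ (1 / 2 : ℝ) = f x := fun x => by
    rw [← ENNReal.rpow_add_of_nonneg _ _ (by norm_num) (by norm_num)]; norm_num
  have h := lintegral_mul_sq_le (hf.pow_const (1 / 2 : ℝ))
    (AEMeasurable.mul (hf.pow_const (1 / 2 : ℝ)) hg)
  have e1 : ∀ x, f x ^ (1 / 2 : ℝ) * (f x ^ (1 / 2 : ℝ) * g x) = f x * g x := fun x => by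
    rw [← mul_assoc, hs]
  have e2 : ∀ x, (f x ^ (1 / 2 : ℝ)) ^ 2 = f x := fun x => by rw [sq, hs]
  simpa only [Pi.mul_apply, e1, mul_pow, e2] using h

theorem le_rpow_half_of_sq_le {a b : ℝ≥0∞} (h : a ^ 2 ≤ b) : a ≤ b ^ (1 / 2 : ℝ) := by
  have h2 := ENNReal.rpow_le_rpow h (z := 1 / 2) (by norm_num)
  rwa [← ENNReal.rpow_natCast, ← ENNReal.rpow_mul, show ((2 : ℕ) : ℝ) * (1 / 2) = 1 by norm_num,
    ENNReal.rpow_one] at h2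

/-- Convolution with the Yukawa kernel is bounded on `L¹ ∩ L²`. -/
theorem lintegral_yukawa_mul_le {κ : ℝ} (hκ : 0 ≤ κ) {h : E3 → ℝ≥0∞} (hm : AEMeasurable h volume)
    (x : E3) :
    ∫⁻ y, ‖yukawa κ (x - y)‖ₑ * h y ≤
      (ENNReal.ofReal sphereArea * ∫⁻ y, h y ^ 2) ^ (1 / 2 : ℝ) + ∫⁻ y, h y := by
  -- Inside the unit ball around `x` the kernel is square integrable and Cauchy–Schwarz applies;
  -- outside it is at most `1`.
  have hpt : ∀ y, ‖yukawa κ (x - y)‖ₑ * h y ≤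
      (Metric.ball x 1).indicator (fun y => ‖yukawa 0 (x - y)‖ₑ) y * h y + h y := by
    intro y
    have hle : ‖yukawa κ (x - y)‖ₑ ≤ ‖yukawa 0 (x - y)‖ₑ := by
      rw [Real.enorm_eq_ofReal (yukawa_nonneg _ _), Real.enorm_eq_ofReal (yukawa_nonneg _ _)]
      exact ENNReal.ofReal_le_ofReal (yukawa_le_yukawa_zero hκ _)
    by_cases hy : dist y x < 1
    · rw [Set.indicator_of_mem (by simpa using hy)]
      exact le_add_right (by gcongr)
    · rw [Set.indicator_of_notMem (by simpa using hy), zero_mul, zero_add]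
      refine mul_le_of_le_one_left zero_le (hle.trans ?_)
      rw [Real.enorm_eq_ofReal (yukawa_nonneg _ _), yukawa_zero_apply, ENNReal.ofReal_le_one]
      push Not at hy
      rw [dist_eq_norm, norm_sub_rev] at hy
      rw [div_le_one (by positivity)]
      nlinarith [Real.pi_gt_three]
  have m0 : Measurable fun y : E3 => ‖yukawa 0 (x - y)‖ₑ := by fun_prop
  have m1 := m0.indicator (measurableSet_ball (x := x) (ε := 1))
  refine (lintegral_mono hpt).trans ?_
  rw [lintegral_add_right' _ hm]
  gcongr
  refine le_rpow_half_of_sq_le ?_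
  refine (lintegral_mul_sq_le m1.aemeasurable hm).trans ?_
  gcongr
  have e : ∀ y, (Metric.ball x 1).indicator (fun y => ‖yukawa 0 (x - y)‖ₑ) y ^ 2 =
      (Metric.ball (0 : E3) 1).indicator (fun y => ‖yukawa 0 y‖ₑ ^ 2) (x - y) := by
    intro y
    by_cases hy : dist y x < 1
    · rw [Set.indicator_of_mem (by simpa using hy), Set.indicator_of_mem]
      simpa [dist_eq_norm, norm_sub_rev] using hy
    · rw [Set.indicator_of_notMem (by simpa using hy), Set.indicator_of_notMem]
      · simp
      simpa [dist_eq_norm, norm_sub_rev] using hy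
  simp_rw [e]
  rw [lintegral_sub_left_eq_self (fun y => (Metric.ball (0 : E3) 1).indicator
    (fun y => ‖yukawa 0 y‖ₑ ^ 2) y) x, lintegral_indicator measurableSet_ball,
    lintegral_ball_yukawa_zero_sq 1 zero_le_one]
  apply ENNReal.ofReal_le_ofReal
  rw [mul_one]
  exact div_le_self sphereArea_nonneg (by nlinarith [Real.pi_gt_three])

/-- Away from the singularity the integrand is at most `(1 + ρ)^(-(2s+2))`, with `ρ` the smaller of
`‖x‖` and `‖x - y‖`. Both choices of `ρ` give a function integrable uniformly in `y`, because `2s +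
2 > 3`; this is exactly the condition `s > 1/2`. -/
theorem lintegral_weight_mul_yukawa_zero_sq_le {s : ℝ} (hs : 1 / 2 < s) :
    ∃ C : ℝ≥0∞, C ≠ ⊤ ∧ ∀ y : E3,
      ∫⁻ x, ENNReal.ofReal ((1 + ‖x‖) ^ (-(2 * s))) * ‖yukawa 0 (x - y)‖ₑ ^ 2 ≤ C := by
  set w : E3 → ℝ≥0∞ := fun x => ENNReal.ofReal ((1 + ‖x‖) ^ (-(2 * s + 2)))
  have hw : ∫⁻ x, w x ≠ ⊤ := by
    have hfr : (Module.finrank ℝ E3 : ℝ) < 2 * s + 2 := by simp; linarith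
    have := (integrable_one_add_norm (μ := (volume : Measure E3)) hfr).lintegral_lt_top
    exact this.ne
  have hwm : Measurable w := by fun_prop
  have hball := lintegral_ball_yukawa_zero_sq 1 zero_le_one
  refine ⟨(∫⁻ x in Metric.ball (0 : E3) 1, ‖yukawa 0 x‖ₑ ^ 2) + ((∫⁻ x, w x) + ∫⁻ x, w x), ?_, ?_⟩
  · rw [hball]; finiteness
  intro y
  have hpt : ∀ x, ENNReal.ofReal ((1 + ‖x‖) ^ (-(2 * s))) * ‖yukawa 0 (x - y)‖ₑ ^ 2 ≤
      (Metric.ball (0 : E3) 1).indicator (fun x => ‖yukawa 0 x‖ₑ ^ 2) (x - y) +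
      (w x + w (x - y)) := by
    intro x
    by_cases hx : ‖x - y‖ < 1
    · rw [Set.indicator_of_mem (by simpa using hx)]
      refine le_add_right (mul_le_of_le_one_left zero_le ?_)
      rw [ENNReal.ofReal_le_one]
      exact Real.rpow_le_one_of_one_le_of_nonpos (by simp) (by linarith)
    · push Not at hx
      refine le_add_left ?_
      have hpos : 0 < ‖x - y‖ := by linarith
      -- Here `4π r ≥ 1 + r`, since `r = ‖x - y‖ ≥ 1`.
      have hy : yukawa 0 (x - y) ^ 2 ≤ (1 + ‖x - y‖) ^ (-2 : ℝ) := by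
        rw [yukawa_zero_apply, Real.rpow_neg (by positivity), Real.rpow_two, div_pow, one_pow,
          one_div]
        apply inv_anti₀ (by positivity)
        gcongr
        nlinarith [Real.pi_gt_three]
      have hb1 : 0 < 1 + ‖x‖ := by positivity
      have hb2 : 0 < 1 + ‖x - y‖ := by positivity
      rw [enorm_sq_eq_ofReal, ← ENNReal.ofReal_mul (by positivity)]
      rcases le_total ‖x‖ ‖x - y‖ with h | h
      · refine le_add_right (ENNReal.ofReal_le_ofReal ?_)
        rw [neg_add, Real.rpow_add hb1]
        gcongr
        exact hy.trans (Real.rpow_le_rpow_of_nonpos hb1 (by linarith) (by norm_num))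
      · refine le_add_left (ENNReal.ofReal_le_ofReal ?_)
        rw [neg_add, Real.rpow_add hb2]
        exact mul_le_mul (Real.rpow_le_rpow_of_nonpos hb2 (by linarith) (by linarith)) hy
          (sq_nonneg _) (by positivity)
  refine (lintegral_mono hpt).trans ?_
  have m1 : Measurable fun x : E3 =>
      (Metric.ball (0 : E3) 1).indicator (fun x => ‖yukawa 0 x‖ₑ ^ 2) x :=
    (by fun_prop : Measurable fun x : E3 => ‖yukawa 0 x‖ₑ ^ 2).indicator measurableSet_ball
  rw [lintegral_add_right _ (by fun_prop), lintegral_add_right _ (by fun_prop),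
    lintegral_sub_right_eq_self w y,
    lintegral_sub_right_eq_self (fun x => (Metric.ball (0 : E3) 1).indicator
      (fun x => ‖yukawa 0 x‖ₑ ^ 2) x) y, lintegral_indicator measurableSet_ball]

/-! ### The Yukawa kernel as a mixture of heat kernels -/

/-- The Cauchy–Schlömilch substitution: `u = s - b/s` maps the half-line onto the whole line with
Jacobian `1 + b/s²`, and the inversion `s ↦ b/s` shows that the two summands of the Jacobian
contribute equally. Each is thus half of the Gaussian integral. -/
theorem integral_exp_neg_sub_div_sq {b : ℝ} (hb : 0 < b) :
    ∫ s in Set.Ioi (0 : ℝ), Real.exp (-(s - b / s) ^ 2) = Real.sqrt Real.pi / 2 := by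
  set f : ℝ → ℝ := fun s => Real.exp (-(s - b / s) ^ 2) with hf
  have hd1 : ∀ s ∈ Set.Ioi (0 : ℝ),
      HasDerivWithinAt (fun s => s - b / s) (1 + b / s ^ 2) (Set.Ioi 0) s := fun s hs => by
    have hs0 : s ≠ 0 := (Set.mem_Ioi.mp hs).ne'
    have h := (hasDerivAt_id s).sub ((hasDerivAt_inv hs0).const_mul b)
    simp only [div_eq_mul_inv]
    convert! h.hasDerivWithinAt using 1
    field_simp
    ring
  have hmono : StrictMonoOn (fun s => s - b / s) (Set.Ioi (0 : ℝ)) := fun x hx y hy hxy => by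
    have hx' : 0 < x := hx
    have : b / y < b / x := by gcongr
    simp only; linarith
  have him1 : (fun s => s - b / s) '' Set.Ioi (0 : ℝ) = Set.univ := by
    ext u
    simp only [Set.mem_image, Set.mem_Ioi, Set.mem_univ, iff_true]
    have hsq := Real.sq_sqrt (by positivity : 0 ≤ u ^ 2 + 4 * b)
    have hgt : |u| < Real.sqrt (u ^ 2 + 4 * b) := by
      rw [Real.lt_sqrt (abs_nonneg _), sq_abs]; linarith
    have hpos : 0 < u + Real.sqrt (u ^ 2 + 4 * b) := by linarith [neg_abs_le u]
    refine ⟨(u + Real.sqrt (u ^ 2 + 4 * b)) / 2, by linarith, ?_⟩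
    field_simp
    nlinarith
  have hd2 : ∀ s ∈ Set.Ioi (0 : ℝ),
      HasDerivWithinAt (fun s => b / s) (-(b / s ^ 2)) (Set.Ioi 0) s := fun s hs => by
    have hs0 : s ≠ 0 := (Set.mem_Ioi.mp hs).ne'
    have h := (hasDerivAt_inv hs0).const_mul b
    simp only [div_eq_mul_inv]
    convert! h.hasDerivWithinAt using 1
    ring
  have hinj2 : Set.InjOn (fun s => b / s) (Set.Ioi (0 : ℝ)) := fun x hx y hy hxy => by
    have hx' : 0 < x := hx
    have hy' : 0 < y := hy
    simp only at hxy
    field_simp at hxy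
    exact hxy.symm
  have him2 : (fun s => b / s) '' Set.Ioi (0 : ℝ) = Set.Ioi 0 := by
    ext u
    simp only [Set.mem_image, Set.mem_Ioi]
    constructor
    · rintro ⟨s, hs, rfl⟩; positivity
    · intro hu; exact ⟨b / u, by positivity, by field_simp⟩
  have h1 := integral_image_eq_integral_abs_deriv_smul measurableSet_Ioi hd1 hmono.injOn
    (fun x => Real.exp (-x ^ 2))
  have i1 := (integrableOn_image_iff_integrableOn_abs_deriv_smul measurableSet_Ioi hd1 hmono.injOn
    (fun x => Real.exp (-x ^ 2))).mp (by
      rw [him1, integrableOn_univ]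
      simpa using integrable_exp_neg_mul_sq (b := 1) one_pos)
  have h2 := integral_image_eq_integral_abs_deriv_smul measurableSet_Ioi hd2 hinj2 f
  rw [him1, setIntegral_univ] at h1
  rw [him2] at h2
  have hg : ∫ x : ℝ, Real.exp (-x ^ 2) = Real.sqrt Real.pi := by
    simpa using integral_gaussian 1
  rw [hg] at h1
  have hfm : Measurable f := by fun_prop
  have hfi : IntegrableOn f (Set.Ioi 0) := by
    refine i1.mono' hfm.aestronglyMeasurable ?_
    filter_upwards [ae_restrict_mem measurableSet_Ioi] with s hs
    have hs' : 0 < s := hs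
    rw [Real.norm_of_nonneg (Real.exp_pos _).le, smul_eq_mul,
      abs_of_pos (by positivity)]
    refine le_mul_of_one_le_left (Real.exp_pos _).le ?_
    have : 0 ≤ b / s ^ 2 := by positivity
    linarith
  have e1 : ∀ s ∈ Set.Ioi (0 : ℝ), |1 + b / s ^ 2| • Real.exp (-(s - b / s) ^ 2) =
      f s + |-(b / s ^ 2)| • f (b / s) := fun s hs => by
    have hs' : 0 < s := hs
    have : f (b / s) = f s := by
      simp only [hf]; congr 2; field_simp; ring
    rw [this, abs_neg, abs_of_nonneg (by positivity), abs_of_nonneg (by positivity)]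
    simp only [hf, smul_eq_mul]; ring
  have i2 : IntegrableOn (fun s => |-(b / s ^ 2)| • f (b / s)) (Set.Ioi 0) :=
    (integrableOn_image_iff_integrableOn_abs_deriv_smul measurableSet_Ioi hd2 hinj2 f).mp
      (by rw [him2]; exact hfi)
  rw [setIntegral_congr_fun measurableSet_Ioi e1, integral_add hfi i2, ← h2] at h1
  linarith

theorem integral_exp_neg_sub_div_sq' {b : ℝ} (hb : 0 ≤ b) :
    ∫ s in Set.Ioi (0 : ℝ), Real.exp (-(s - b / s) ^ 2) = Real.sqrt Real.pi / 2 := by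
  rcases hb.eq_or_lt with rfl | hb
  · have := integral_gaussian_Ioi 1
    simpa using this
  · exact integral_exp_neg_sub_div_sq hb

/-- The heat kernel on `ℝ³` at time `t` and distance `r`, damped by `exp (-κ² t)`. -/
noncomputable def dampedHeat (κ t r : ℝ) : ℝ :=
  Real.exp (-κ ^ 2 * t) * ((1 / (4 * Real.pi * t)) ^ (3 / 2 : ℝ) * Real.exp (-r ^ 2 / (4 * t)))

/-- The substitution `t = r²/(4s²)` turns the exponent `κ² t + r²/(4t)` into `κ r + (s - (κ
r/2)/s)²`, and all powers of `s` cancel. -/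
theorem integral_dampedHeat {κ r : ℝ} (hκ : 0 ≤ κ) (hr : 0 < r) :
    ∫ t in Set.Ioi (0 : ℝ), dampedHeat κ t r = Real.exp (-κ * r) / (4 * Real.pi * r) := by
  have hd : ∀ s ∈ Set.Ioi (0 : ℝ),
      HasDerivWithinAt (fun s => r ^ 2 / (4 * s ^ 2)) (-(r ^ 2 / (2 * s ^ 3))) (Set.Ioi 0) s :=
    fun s hs => by
      have hs0 : s ≠ 0 := (Set.mem_Ioi.mp hs).ne'
      have h := ((hasDerivAt_pow 2 s).inv (pow_ne_zero 2 hs0)).const_mul (r ^ 2 / 4)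
      convert! h.hasDerivWithinAt using 1
      · ext s; simp only [Pi.inv_apply]; field_simp
      · field_simp
        norm_num
        ring
  have hinj : Set.InjOn (fun s => r ^ 2 / (4 * s ^ 2)) (Set.Ioi (0 : ℝ)) := fun x hx y hy hxy => by
    have hx' : 0 < x := hx
    have hy' : 0 < y := hy
    simp only at hxy
    field_simp at hxy
    nlinarith
  have him : (fun s => r ^ 2 / (4 * s ^ 2)) '' Set.Ioi (0 : ℝ) = Set.Ioi 0 := by
    ext u
    simp only [Set.mem_image, Set.mem_Ioi]
    constructor
    · rintro ⟨s, hs, rfl⟩; positivity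
    · intro hu
      refine ⟨r / (2 * Real.sqrt u), by positivity, ?_⟩
      have := Real.sq_sqrt hu.le
      have hsu : 0 < Real.sqrt u := Real.sqrt_pos.mpr hu
      rw [div_pow, mul_pow, this]
      field_simp
      norm_num
  have h := integral_image_eq_integral_abs_deriv_smul measurableSet_Ioi hd hinj
    (fun t => dampedHeat κ t r)
  rw [him] at h
  rw [h]
  have e : ∀ s ∈ Set.Ioi (0 : ℝ), |-(r ^ 2 / (2 * s ^ 3))| • dampedHeat κ (r ^ 2 / (4 * s ^ 2)) r =
      Real.exp (-κ * r) / (2 * Real.pi ^ (3 / 2 : ℝ) * r) *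
        Real.exp (-(s - (κ * r / 2) / s) ^ 2) := fun s hs => by
    have hs' : 0 < s := hs
    rw [abs_neg, abs_of_pos (by positivity), smul_eq_mul, dampedHeat]
    have e1 : 1 / (4 * Real.pi * (r ^ 2 / (4 * s ^ 2))) = (s / r) ^ 2 / Real.pi := by field_simp
    have e2 : ((s / r) ^ 2 / Real.pi) ^ (3 / 2 : ℝ) = (s / r) ^ 3 / Real.pi ^ (3 / 2 : ℝ) := by
      rw [Real.div_rpow (by positivity) Real.pi_pos.le, ← Real.rpow_natCast, ← Real.rpow_mul
        (by positivity), ← Real.rpow_natCast]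
      norm_num
    have e3 : Real.exp (-κ ^ 2 * (r ^ 2 / (4 * s ^ 2))) *
        Real.exp (-r ^ 2 / (4 * (r ^ 2 / (4 * s ^ 2)))) =
        Real.exp (-κ * r) * Real.exp (-(s - (κ * r / 2) / s) ^ 2) := by
      rw [← Real.exp_add, ← Real.exp_add]
      congr 1
      field_simp
      ring
    rw [e1, e2]
    calc _ = r ^ 2 / (2 * s ^ 3) * ((s / r) ^ 3 / Real.pi ^ (3 / 2 : ℝ)) *
        (Real.exp (-κ ^ 2 * (r ^ 2 / (4 * s ^ 2))) *
        Real.exp (-r ^ 2 / (4 * (r ^ 2 / (4 * s ^ 2))))) := by ring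
      _ = _ := by rw [e3]; field_simp
  rw [setIntegral_congr_fun measurableSet_Ioi e, integral_const_mul,
    integral_exp_neg_sub_div_sq' (by positivity)]
  have hp : Real.pi ^ (3 / 2 : ℝ) = Real.pi * Real.sqrt Real.pi := by
    rw [show (3 / 2 : ℝ) = 1 + 1 / 2 by norm_num, Real.rpow_add Real.pi_pos, Real.rpow_one,
      Real.sqrt_eq_rpow]
  have hsp : 0 < Real.sqrt Real.pi := Real.sqrt_pos.mpr Real.pi_pos
  rw [hp]
  field_simp
  norm_num

/-- A non-integrable function has integral `0` by convention, whereas the value just computed is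
positive. -/
theorem integrableOn_dampedHeat {κ r : ℝ} (hκ : 0 ≤ κ) (hr : 0 < r) :
    IntegrableOn (fun t => dampedHeat κ t r) (Set.Ioi 0) := by
  by_contra h
  have h1 := integral_undef h
  rw [integral_dampedHeat hκ hr] at h1
  have : 0 < Real.exp (-κ * r) / (4 * Real.pi * r) := by positivity
  linarith

theorem integral_dampedHeat_norm {κ : ℝ} (hκ : 0 ≤ κ) {x : E3} (hx : x ≠ 0) :
    ∫ t in Set.Ioi (0 : ℝ), dampedHeat κ t ‖x‖ = yukawa κ x :=
  integral_dampedHeat hκ (norm_pos_iff.mpr hx)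

/-! ### The Green function identity via the Fourier transform -/

open FourierTransform

theorem lintegral_enorm_sq_schwartz_lt_top (η : 𝓢(E3, ℂ)) : ∫⁻ y, ‖η y‖ₑ ^ 2 < ⊤ := by
  have h := (η.memLp 2 (volume : Measure E3)).2
  rw [eLpNorm_lt_top_iff_lintegral_rpow_enorm_lt_top (by norm_num) (by norm_num)] at h
  simpa using h

theorem integrable_yukawa_mul {κ : ℝ} (hκ : 0 ≤ κ) {h : E3 → ℂ} (h1 : Integrable h)
    (h2 : ∫⁻ y, ‖h y‖ₑ ^ 2 < ⊤) (x : E3) :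
    Integrable fun y => (yukawa κ (x - y) : ℂ) * h y := by
  refine ⟨(by fun_prop : Measurable fun y => (yukawa κ (x - y) : ℂ)).aestronglyMeasurable.mul
    h1.1, ?_⟩
  rw [hasFiniteIntegral_iff_enorm]
  have e : ∀ y, ‖(yukawa κ (x - y) : ℂ) * h y‖ₑ = ‖yukawa κ (x - y)‖ₑ * ‖h y‖ₑ := fun y => by
    rw [enorm_mul]; congr 1; simp [enorm]
  simp_rw [e]
  refine (lintegral_yukawa_mul_le hκ h1.1.enorm x).trans_lt ?_
  have := h1.2
  rw [hasFiniteIntegral_iff_enorm] at this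
  refine ENNReal.add_lt_top.mpr ⟨?_, this⟩
  apply ENNReal.rpow_lt_top_of_nonneg (by norm_num)
  finiteness

theorem fourier_laplacian_apply (η : 𝓢(E3, ℂ)) (k : E3) :
    𝓕 (Δ η) k = -((2 * Real.pi * ‖k‖) ^ 2 : ℝ) * 𝓕 η k := by
  rw [SchwartzMap.laplacian_eq_fourierMultiplierCLM, SchwartzMap.fourierMultiplierCLM_apply,
    FourierTransform.fourier_smul, FourierTransform.fourier_fourierInv_eq]
  rw [smul_apply, SchwartzMap.smulLeftCLM_apply_apply (by fun_prop)]
  simp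
  ring

/-- The Fourier symbol of `-Δ + κ²`. -/
noncomputable def symbol (κ : ℝ) (k : E3) : ℝ := κ ^ 2 + (2 * Real.pi * ‖k‖) ^ 2

theorem fourier_sub_laplacian_apply (κ : ℝ) (η : 𝓢(E3, ℂ)) (k : E3) :
    𝓕 (((κ ^ 2 : ℝ) : ℂ) • η - Δ η) k = symbol κ k * 𝓕 η k := by
  have : 𝓕 (((κ ^ 2 : ℝ) : ℂ) • η - Δ η) = ((κ ^ 2 : ℝ) : ℂ) • 𝓕 η - 𝓕 (Δ η) := by
    rw [sub_eq_add_neg, FourierTransform.fourier_add, FourierTransform.fourier_smul, ← neg_one_smul ℂ (Δ η),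
      FourierTransform.fourier_smul, neg_one_smul, ← sub_eq_add_neg]
  rw [this, sub_apply, smul_apply, fourier_laplacian_apply, symbol]
  push_cast
  simp
  ring

/-- The multiplication formula for the Fourier transform, applied to a modulated Gaussian whose
transform is the translated heat kernel. -/
theorem integral_heat_mul_schwartz (ζ : 𝓢(E3, ℂ)) {t : ℝ} (ht : 0 < t) (x : E3) :
    ∫ y, (((1 / (4 * Real.pi * t)) ^ (3 / 2 : ℝ) * Real.exp (-‖x - y‖ ^ 2 / (4 * t)) : ℝ) : ℂ) * ζ y =
      ∫ k, Complex.exp (-((4 * Real.pi ^ 2 * t : ℝ) : ℂ) * ‖k‖ ^ 2 +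
        2 * Real.pi * Complex.I * (inner ℝ x k : ℝ)) * 𝓕 ζ k := by
  have hb : 0 < ((4 * Real.pi ^ 2 * t : ℝ) : ℂ).re := by
    rw [Complex.ofReal_re]; positivity
  have J : Integrable (fun k : E3 => Complex.exp (-((4 * Real.pi ^ 2 * t : ℝ) : ℂ) * ‖k‖ ^ 2 +
        2 * Real.pi * Complex.I * (inner ℝ x k : ℝ))) :=
      GaussianFourier.integrable_cexp_neg_mul_sq_norm_add hb _ _
  have h := VectorFourier.integral_fourierIntegral_smul_eq_flip (L := innerₗ E3)
      Real.continuous_fourierChar continuous_inner J ζ.integrable (μ := volume) (ν := volume)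
  have hF : ∀ y, VectorFourier.fourierIntegral Real.fourierChar volume (innerₗ E3)
      (fun k : E3 => Complex.exp (-((4 * Real.pi ^ 2 * t : ℝ) : ℂ) * ‖k‖ ^ 2 +
        2 * Real.pi * Complex.I * (inner ℝ x k : ℝ))) y =
      (((1 / (4 * Real.pi * t)) ^ (3 / 2 : ℝ) * Real.exp (-‖x - y‖ ^ 2 / (4 * t)) : ℝ) : ℂ) := by
    intro y
    have h1 := fourier_gaussian_innerProductSpace' hb x y
    rw [show VectorFourier.fourierIntegral Real.fourierChar volume (innerₗ E3)
      (fun k : E3 => Complex.exp (-((4 * Real.pi ^ 2 * t : ℝ) : ℂ) * ‖k‖ ^ 2 +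
        2 * Real.pi * Complex.I * (inner ℝ x k : ℝ))) y = _ from h1]
    have e1 : (Real.pi : ℂ) / ((4 * Real.pi ^ 2 * t : ℝ) : ℂ) = ((1 / (4 * Real.pi * t) : ℝ) : ℂ) := by
      rw [← Complex.ofReal_div]; congr 1; field_simp
    have e2 : (Module.finrank ℝ E3 / 2 : ℂ) = ((3 / 2 : ℝ) : ℂ) := by simp
    have e3 : -(Real.pi : ℂ) ^ 2 * ‖x - y‖ ^ 2 / ((4 * Real.pi ^ 2 * t : ℝ) : ℂ) =
        ((-‖x - y‖ ^ 2 / (4 * t) : ℝ) : ℂ) := by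
      push_cast
      field_simp
    rw [e1, e2, e3, ← Complex.ofReal_cpow (by positivity), ← Complex.ofReal_exp,
      ← Complex.ofReal_mul]
  have hflip : (innerₗ E3).flip = innerₗ E3 := by
    ext a b; simp
  simp_rw [hF, hflip, smul_eq_mul] at h
  exact h

/-- The Yukawa kernel is the Green function of `-Δ + κ²`. -/
theorem integral_yukawa_mul_sub_laplacian {κ : ℝ} (hκ : 0 ≤ κ) (η : 𝓢(E3, ℂ)) (x : E3) :
    ∫ y, (yukawa κ (x - y) : ℂ) * (((κ ^ 2 : ℝ) : ℂ) * η y - Δ η y) = η x := by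
  set ζ : 𝓢(E3, ℂ) := ((κ ^ 2 : ℝ) : ℂ) • η - Δ η with hζ
  have hζy : ∀ y, ((κ ^ 2 : ℝ) : ℂ) * η y - Δ η y = ζ y := fun y => by simp [hζ]
  simp_rw [hζy]
  have hne : ∀ᵐ y : E3, x - y ≠ 0 := by
    have : ∀ᵐ y : E3, y ≠ x := by simp [ae_iff]
    filter_upwards [this] with y hy h
    exact hy (sub_eq_zero.mp h).symm
  have hmeas : Measurable fun q : E3 × ℝ => ((dampedHeat κ q.2 ‖x - q.1‖ : ℝ) : ℂ) := by
    unfold dampedHeat; fun_prop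
  have hdn : ∀ t ∈ Set.Ioi (0 : ℝ), ∀ r, 0 ≤ dampedHeat κ t r := fun t ht r => by
    have : 0 < t := ht
    unfold dampedHeat; positivity
  -- The heat kernel is nonnegative, so integrating out the time first reduces absolute
  -- integrability to that of the Yukawa kernel against `ζ`.
  have hint : Integrable (fun q : E3 × ℝ => ((dampedHeat κ q.2 ‖x - q.1‖ : ℝ) : ℂ) * ζ q.1)
      (volume.prod (volume.restrict (Set.Ioi 0))) := by
    have hm2 : Measurable fun q : E3 × ℝ => ζ q.1 := ζ.continuous.measurable.comp measurable_fst
    have hm3 : Measurable fun q : E3 × ℝ => ((dampedHeat κ q.2 ‖x - q.1‖ : ℝ) : ℂ) * ζ q.1 :=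
      hmeas.mul hm2
    rw [integrable_prod_iff hm3.aestronglyMeasurable]
    refine ⟨?_, ?_⟩
    · filter_upwards [hne] with y hy
      exact ((integrableOn_dampedHeat hκ (norm_pos_iff.mpr hy)).ofReal).mul_const _
    · have := (integrable_yukawa_mul hκ ζ.integrable (lintegral_enorm_sq_schwartz_lt_top ζ) x).norm
      refine this.congr ?_
      filter_upwards [hne] with y hy
      rw [norm_mul, Complex.norm_real, Real.norm_of_nonneg (yukawa_nonneg _ _),
        ← integral_dampedHeat_norm hκ hy, ← integral_mul_const]
      refine setIntegral_congr_fun measurableSet_Ioi fun t ht => ?_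
      rw [norm_mul, Complex.norm_real, Real.norm_of_nonneg (hdn t ht _)]
  have step1 : ∫ y, (yukawa κ (x - y) : ℂ) * ζ y =
      ∫ y, ∫ t in Set.Ioi (0 : ℝ), ((dampedHeat κ t ‖x - y‖ : ℝ) : ℂ) * ζ y := by
    refine integral_congr_ae ?_
    filter_upwards [hne] with y hy
    rw [integral_mul_const, integral_complex_ofReal, integral_dampedHeat_norm hκ hy]
  rw [step1, integral_integral_swap hint]
  have hsym : ∀ k, 0 ≤ symbol κ k := fun k => by unfold symbol; positivity
  -- On the Fourier side `ζ` contributes the symbol `σ` as a factor. Since `∫ σ exp (-σ t) dt = 1`,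
  -- the time integral removes every trace of the operator and leaves Fourier inversion for `η`.
  set F : ℝ → E3 → ℂ := fun t k => (Real.exp (-symbol κ k * t) * symbol κ k : ℝ) *
      (Complex.exp (2 * Real.pi * Complex.I * (inner ℝ x k : ℝ)) * 𝓕 η k) with hF
  have step2 : ∀ t ∈ Set.Ioi (0 : ℝ), ∫ y, ((dampedHeat κ t ‖x - y‖ : ℝ) : ℂ) * ζ y =
      ∫ k, F t k := by
    intro t ht
    have e : ∀ y, ((dampedHeat κ t ‖x - y‖ : ℝ) : ℂ) * ζ y = ((Real.exp (-κ ^ 2 * t) : ℝ) : ℂ) *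
      ((((1 / (4 * Real.pi * t)) ^ (3 / 2 : ℝ) * Real.exp (-‖x - y‖ ^ 2 / (4 * t)) : ℝ) : ℂ) *
        ζ y) := fun y => by
      rw [dampedHeat, Complex.ofReal_mul, mul_assoc]
    simp_rw [e]
    rw [integral_const_mul, integral_heat_mul_schwartz ζ ht, ← integral_const_mul]
    congr 1
    ext k
    rw [hζ, fourier_sub_laplacian_apply, hF]
    simp only [symbol]
    rw [Complex.exp_add]
    push_cast
    have : Complex.exp (-(↑κ ^ 2 + (2 * ↑Real.pi * ↑‖k‖) ^ 2) * ↑t) = Complex.exp (-↑κ ^ 2 * ↑t) *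
        Complex.exp (-(4 * ↑Real.pi ^ 2 * ↑t) * ↑‖k‖ ^ 2) := by
      rw [← Complex.exp_add]; ring_nf
    rw [this]
    ring
  rw [setIntegral_congr_fun measurableSet_Ioi step2]
  -- When `κ = 0` the symbol vanishes, but only at the origin.
  have hkne : ∀ᵐ k : E3, 0 < symbol κ k := by
    have : ∀ᵐ k : E3, k ≠ 0 := by simp [ae_iff]
    filter_upwards [this] with k hk
    have := norm_pos_iff.mpr hk
    unfold symbol; positivity
  have hexpI : ∀ k : E3, 0 < symbol κ k →
      ∫ t in Set.Ioi (0 : ℝ), Real.exp (-symbol κ k * t) * symbol κ k = 1 := fun k hk => by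
    rw [integral_mul_const, integral_exp_mul_Ioi (by linarith) 0]
    simp; field_simp
  have hexpi : ∀ k : E3, 0 < symbol κ k →
      IntegrableOn (fun t => Real.exp (-symbol κ k * t) * symbol κ k) (Set.Ioi 0) := fun k hk =>
    (integrableOn_exp_mul_Ioi (by linarith) 0).mul_const _
  have hnormF : ∀ t k, ‖F t k‖ = Real.exp (-symbol κ k * t) * symbol κ k * ‖𝓕 η k‖ := fun t k => by
    have he : ‖Complex.exp (2 * Real.pi * Complex.I * (inner ℝ x k : ℝ))‖ = 1 := by
      rw [show 2 * (Real.pi : ℂ) * Complex.I * (inner ℝ x k : ℝ) =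
        ((2 * Real.pi * (inner ℝ x k : ℝ) : ℝ) : ℂ) * Complex.I by push_cast; ring]
      exact Complex.norm_exp_ofReal_mul_I _
    rw [hF]
    simp only
    rw [norm_mul, norm_mul, he, one_mul, Complex.norm_real,
      Real.norm_of_nonneg (mul_nonneg (Real.exp_pos _).le (hsym k))]
  have hFm : Continuous fun q : E3 × ℝ => F q.2 q.1 := by
    have := (𝓕 η).continuous
    simp only [hF, symbol]
    fun_prop
  have hint2 : Integrable (fun q : E3 × ℝ => F q.2 q.1)
      (volume.prod (volume.restrict (Set.Ioi 0))) := by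
    rw [integrable_prod_iff hFm.aestronglyMeasurable]
    refine ⟨?_, ?_⟩
    · filter_upwards [hkne] with k hk
      exact (hexpi k hk).ofReal.mul_const _
    · refine (𝓕 η).integrable.norm.congr ?_
      filter_upwards [hkne] with k hk
      simp_rw [hnormF]
      rw [integral_mul_const, hexpI k hk, one_mul]
  rw [← integral_integral_swap hint2]
  have step3 : ∫ k, ∫ t in Set.Ioi (0 : ℝ), F t k =
      ∫ k, Complex.exp (2 * Real.pi * Complex.I * (inner ℝ x k : ℝ)) * 𝓕 η k := by
    refine integral_congr_ae ?_
    filter_upwards [hkne] with k hk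
    simp only [hF]
    rw [integral_mul_const, integral_complex_ofReal, hexpI k hk, Complex.ofReal_one, one_mul]
  rw [step3]
  have hinv : 𝓕⁻ (𝓕 η) = η := FourierTransform.fourierInv_fourier_eq η
  have hinv' : (𝓕⁻ (𝓕 η) : 𝓢(E3, ℂ)) x = ∫ k, Complex.exp (2 * Real.pi * Complex.I *
      (inner ℝ x k : ℝ)) * 𝓕 η k := by
    rw [SchwartzMap.fourierInv_coe, Real.fourierInv_eq']
    congr 1; ext k
    rw [real_inner_comm]
    simp only [smul_eq_mul]
    congr 2
    push_cast; ring
  rw [← hinv', hinv]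

/-- For `κ > 0` the reciprocal of the symbol is smooth with temperate growth, so division by it
preserves Schwartz functions. Consequently testing against all `κ² η - Δη` is as good as testing
against all Schwartz functions. -/
theorem exists_sub_laplacian_eq {κ : ℝ} (hκ : 0 < κ) (ζ : 𝓢(E3, ℂ)) :
    ∃ η : 𝓢(E3, ℂ), ∀ y, ((κ ^ 2 : ℝ) : ℂ) * η y - Δ η y = ζ y := by
  set g : E3 → ℂ := fun k => ((symbol κ k)⁻¹ : ℝ) with hg
  have hgt : g.HasTemperateGrowth := by
    have h1 : (fun k : E3 => (1 + ‖k‖ ^ 2) ^ (-1 : ℝ)).HasTemperateGrowth := by fun_prop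
    have h2 : (fun k : E3 => (2 * Real.pi / κ) • k).HasTemperateGrowth := by fun_prop
    have h3 := h1.comp h2
    have h4 : (fun k : E3 => (κ ^ 2)⁻¹ * (1 + ‖(2 * Real.pi / κ) • k‖ ^ 2) ^ (-1 : ℝ)).HasTemperateGrowth :=
      (Function.HasTemperateGrowth.const _).mul h3
    have h5 : g = fun k => (((κ ^ 2)⁻¹ * (1 + ‖(2 * Real.pi / κ) • k‖ ^ 2) ^ (-1 : ℝ) : ℝ) : ℂ) := by
      ext k
      simp only [hg, symbol]
      congr 1
      rw [Real.rpow_neg_one, norm_smul, Real.norm_of_nonneg (by positivity), ← mul_inv]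
      congr 1
      field_simp
    rw [h5]
    exact Function.HasTemperateGrowth.comp Function.Complex.hasTemperateGrowth_ofReal h4
  set η : 𝓢(E3, ℂ) := 𝓕⁻ (SchwartzMap.smulLeftCLM ℂ g (𝓕 ζ)) with hη
  refine ⟨η, fun y => ?_⟩
  have : ((κ ^ 2 : ℝ) : ℂ) • η - Δ η = ζ := by
    have h : 𝓕 (((κ ^ 2 : ℝ) : ℂ) • η - Δ η) = 𝓕 ζ := by
      ext k
      rw [fourier_sub_laplacian_apply, hη, FourierTransform.fourier_fourierInv_eq,
        SchwartzMap.smulLeftCLM_apply_apply hgt, smul_eq_mul, ← mul_assoc, hg]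
      have hs : symbol κ k ≠ 0 := by
        have : 0 < symbol κ k := by unfold symbol; positivity
        exact this.ne'
      rw [← Complex.ofReal_mul, mul_inv_cancel₀ hs, Complex.ofReal_one, one_mul]
    have h' := congrArg (fun u : 𝓢(E3, ℂ) => 𝓕⁻ u) h
    simpa using h'
  have h2 := congrArg (fun u : 𝓢(E3, ℂ) => u y) this
  simpa using h2

/-! ### Integral operators with square-integrable kernels -/

theorem memLp_two_of_lintegral {F : Type*} [NormedAddCommGroup F] {f : E3 → F}
    (hm : AEStronglyMeasurable f volume) (h : ∫⁻ x, ‖f x‖ₑ ^ 2 < ⊤) : MemLp f 2 volume := by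
  refine ⟨hm, ?_⟩
  rw [eLpNorm_lt_top_iff_lintegral_rpow_enorm_lt_top (by norm_num) (by norm_num)]
  simpa using h

theorem lintegral_enorm_sq_lt_top {F : Type*} [NormedAddCommGroup F] {f : E3 → F}
    (hf : MemLp f 2 volume) : ∫⁻ x, ‖f x‖ₑ ^ 2 < ⊤ := by
  have h := hf.2
  rw [eLpNorm_lt_top_iff_lintegral_rpow_enorm_lt_top (by norm_num) (by norm_num)] at h
  simpa using h

theorem enorm_sq_eq_lintegral (g : L2) : ‖g‖ₑ ^ 2 = ∫⁻ x, ‖g x‖ₑ ^ 2 := by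
  rw [Lp.enorm_def, eLpNorm_eq_lintegral_rpow_enorm_toReal (by norm_num) (by norm_num),
    ← ENNReal.rpow_natCast, ← ENNReal.rpow_mul]
  norm_num

theorem enorm_ofReal_complex (r : ℝ) : ‖(r : ℂ)‖ₑ = ‖r‖ₑ := by simp [enorm]

theorem enorm_integral_mul_sq_le {k : E3 → ℝ} {f : E3 → ℂ}
    (hk : AEMeasurable k volume) (hf : AEStronglyMeasurable f volume) :
    ‖∫ y, (k y : ℂ) * f y‖ₑ ^ 2 ≤ (∫⁻ y, ‖k y‖ₑ ^ 2) * ∫⁻ y, ‖f y‖ₑ ^ 2 := by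
  refine (pow_le_pow_left' (enorm_integral_le_lintegral_enorm _) 2).trans ?_
  simp_rw [enorm_mul, enorm_ofReal_complex]
  exact lintegral_mul_sq_le hk.enorm hf.enorm

theorem integrable_mul_of_lintegral_sq {k : E3 → ℝ} {f : E3 → ℂ}
    (hk : AEMeasurable k volume) (hf : AEStronglyMeasurable f volume)
    (hk2 : ∫⁻ y, ‖k y‖ₑ ^ 2 < ⊤) (hf2 : ∫⁻ y, ‖f y‖ₑ ^ 2 < ⊤) :
    Integrable fun y => (k y : ℂ) * f y := by
  have hk' : MemLp (fun y => (k y : ℂ)) 2 volume :=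
    (memLp_two_of_lintegral hk.aestronglyMeasurable hk2).ofReal
  exact MemLp.integrable_mul hk' (memLp_two_of_lintegral hf hf2)

/-- A Hilbert-Schmidt operator is compact. -/
theorem isCompactOperator_of_summable_norm_sq {H : Type*} [NormedAddCommGroup H]
    [InnerProductSpace ℂ H] [CompleteSpace H] {ι : Type*} (b : HilbertBasis ι ℂ H) {T : H →L[ℂ] H}
    (hsum : Summable fun i => ‖T (b i)‖ ^ 2) : IsCompactOperator T := by
  classical
  have hcl := isClosed_setOfPred_isCompactOperator (σ₁₂ := RingHom.id ℂ) (M₁ := H) (M₂ := H)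
  have hmem : T ∈ closure {f : H →L[ℂ] H | IsCompactOperator f} := by
    rw [Metric.mem_closure_iff]
    intro ε hε
    obtain ⟨s, hs⟩ := summable_iff_vanishing_norm.mp hsum ((ε / 2) ^ 2) (by positivity)
    -- The approximant is the operator cut to finitely many basis vectors. The remainder is
    -- controlled by Cauchy–Schwarz, with Bessel's inequality for the coefficients and a small tail
    -- for the images.
    refine ⟨∑ i ∈ s, (innerSL ℂ (b i)).smulRight (T (b i)), ?_, ?_⟩
    · have : ∀ s : Finset ι, IsCompactOperator
          (∑ i ∈ s, (innerSL ℂ (b i)).smulRight (T (b i)) : H →L[ℂ] H) := by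
        intro s
        induction s using Finset.induction_on with
        | empty => simpa using isCompactOperator_zero
        | insert i s hi ih =>
          rw [Finset.sum_insert hi]
          refine IsCompactOperator.add ?_ ih
          have h0 : IsCompactOperator (ContinuousLinearMap.toSpanSingleton ℂ (T (b i))) :=
            isCompactOperator_of_locallyCompactSpace_rng _
          exact h0.comp_clm (innerSL ℂ (b i))
      exact this s
    · rw [dist_eq_norm]
      refine lt_of_le_of_lt (ContinuousLinearMap.opNorm_le_bound _ (half_pos hε).le fun f => ?_)
        (half_lt_self hε)
      have hhs : HasSum (fun i => inner ℂ (b i) f • T (b i)) (T f) := by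
        have h := (b.hasSum_repr f).mapL T
        simpa [b.repr_apply_apply] using h
      have hlim : Tendsto (fun t : Finset ι => ‖(∑ i ∈ t, inner ℂ (b i) f • T (b i)) -
          ∑ i ∈ s, inner ℂ (b i) f • T (b i)‖) atTop
          (𝓝 ‖(T - ∑ i ∈ s, (innerSL ℂ (b i)).smulRight (T (b i))) f‖) := by
        have h := (Tendsto.sub_const hhs (∑ i ∈ s, inner ℂ (b i) f • T (b i))).norm
        simpa using h
      refine le_of_tendsto hlim ?_
      filter_upwards [eventually_ge_atTop s] with t ht
      rw [← Finset.sum_sdiff ht, add_sub_cancel_right]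
      refine (norm_sum_le _ _).trans ?_
      simp_rw [norm_smul]
      have hcs := Finset.sum_mul_sq_le_sq_mul_sq (t \ s) (fun i => ‖inner ℂ (b i) f‖)
        (fun i => ‖T (b i)‖)
      have hbes := b.orthonormal.sum_inner_products_le (s := t \ s) f
      have htail := hs (t \ s) Finset.sdiff_disjoint
      rw [Real.norm_of_nonneg (Finset.sum_nonneg fun _ _ => by positivity)] at htail
      refine abs_le_of_sq_le_sq' (hcs.trans ?_) (by positivity) |>.2
      rw [mul_comm (ε / 2), mul_pow]
      exact mul_le_mul hbes htail.le (Finset.sum_nonneg fun _ _ => by positivity) (sq_nonneg _)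
  rw [hcl.closure_eq] at hmem
  exact hmem

section kernel

variable {k : E3 → E3 → ℝ}

theorem stronglyMeasurable_kernel_integral (hk : Measurable (Function.uncurry k)) {f : E3 → ℂ}
    (hf : StronglyMeasurable f) : StronglyMeasurable fun x => ∫ y, (k x y : ℂ) * f y := by
  have h1 : Measurable fun q : E3 × E3 => (k q.1 q.2 : ℂ) :=
    Complex.measurable_ofReal.comp hk
  have h2 : Measurable fun q : E3 × E3 => f q.2 := hf.measurable.comp measurable_snd
  have h3 : StronglyMeasurable (Function.uncurry fun x y => (k x y : ℂ) * f y) :=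
    (h1.mul h2).stronglyMeasurable
  exact h3.integral_prod_right

theorem lintegral_kernel_integral_sq_le (hk : Measurable (Function.uncurry k)) {f : E3 → ℂ}
    (hf : StronglyMeasurable f) :
    ∫⁻ x, ‖∫ y, (k x y : ℂ) * f y‖ₑ ^ 2 ≤ (∫⁻ x, ∫⁻ y, ‖k x y‖ₑ ^ 2) * ∫⁻ y, ‖f y‖ₑ ^ 2 := by
  have hm : Measurable fun x => ∫⁻ y, ‖k x y‖ₑ ^ 2 :=
    Measurable.lintegral_prod_right' (f := fun q : E3 × E3 => ‖k q.1 q.2‖ₑ ^ 2) (by fun_prop)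
  rw [← lintegral_mul_const _ hm]
  exact lintegral_mono fun x => enorm_integral_mul_sq_le
    (hk.comp measurable_prodMk_left).aemeasurable hf.aestronglyMeasurable

theorem memLp_kernel_integral (hk : Measurable (Function.uncurry k))
    (hk2 : ∫⁻ x, ∫⁻ y, ‖k x y‖ₑ ^ 2 < ⊤) (f : L2) :
    MemLp (fun x => ∫ y, (k x y : ℂ) * f y) 2 volume := by
  refine memLp_two_of_lintegral
    (stronglyMeasurable_kernel_integral hk (Lp.stronglyMeasurable f)).aestronglyMeasurable ?_
  refine (lintegral_kernel_integral_sq_le hk (Lp.stronglyMeasurable f)).trans_lt ?_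
  exact ENNReal.mul_lt_top hk2 (lintegral_enorm_sq_lt_top (Lp.memLp f))

theorem ae_kernel_lt_top (hk : Measurable (Function.uncurry k))
    (hk2 : ∫⁻ x, ∫⁻ y, ‖k x y‖ₑ ^ 2 < ⊤) : ∀ᵐ x, ∫⁻ y, ‖k x y‖ₑ ^ 2 < ⊤ :=
  ae_lt_top (Measurable.lintegral_prod_right' (f := fun q : E3 × E3 => ‖k q.1 q.2‖ₑ ^ 2)
    (by fun_prop)) hk2.ne

/-- The integral operator on `L²(ℝ³)` with a square-integrable real kernel. -/
noncomputable def kernelOp (hk : Measurable (Function.uncurry k))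
    (hk2 : ∫⁻ x, ∫⁻ y, ‖k x y‖ₑ ^ 2 < ⊤) : L2 →L[ℂ] L2 :=
  LinearMap.mkContinuous
    { toFun := fun f => (memLp_kernel_integral hk hk2 f).toLp
      map_add' := fun f g => by
        rw [← MemLp.toLp_add]
        apply MemLp.toLp_congr
        filter_upwards [ae_kernel_lt_top hk hk2] with x hx
        have hi : ∀ f : L2, Integrable fun y => (k x y : ℂ) * f y := fun f =>
          integrable_mul_of_lintegral_sq (hk.comp measurable_prodMk_left).aemeasurable
            (Lp.aestronglyMeasurable f) hx (lintegral_enorm_sq_lt_top (Lp.memLp f))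
        rw [Pi.add_apply, ← integral_add (hi f) (hi g)]
        apply integral_congr_ae
        filter_upwards [Lp.coeFn_add f g] with y hy
        rw [hy, Pi.add_apply, mul_add]
      map_smul' := fun c f => by
        rw [RingHom.id_apply, ← MemLp.toLp_const_smul]
        apply MemLp.toLp_congr
        filter_upwards with x
        rw [Pi.smul_apply, smul_eq_mul, ← integral_const_mul]
        apply integral_congr_ae
        filter_upwards [Lp.coeFn_smul c f] with y hy
        rw [hy, Pi.smul_apply, smul_eq_mul]
        ring }
    ((∫⁻ x, ∫⁻ y, ‖k x y‖ₑ ^ 2).toReal ^ (1 / 2 : ℝ)) fun f => by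
      have h := lintegral_kernel_integral_sq_le hk (Lp.stronglyMeasurable f)
      rw [← enorm_sq_eq_lintegral] at h
      have h1 : ‖(memLp_kernel_integral hk hk2 f).toLp‖ₑ ^ 2 ≤
          (∫⁻ x, ∫⁻ y, ‖k x y‖ₑ ^ 2) * ‖f‖ₑ ^ 2 := by
        rw [enorm_sq_eq_lintegral]
        refine le_trans (le_of_eq ?_) h
        apply lintegral_congr_ae
        filter_upwards [(memLp_kernel_integral hk hk2 f).coeFn_toLp] with x hx
        rw [hx]
      have h2 := ENNReal.toReal_mono (by finiteness) h1
      simp only [ENNReal.toReal_mul, ENNReal.toReal_pow, toReal_enorm] at h2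
      refine abs_le_of_sq_le_sq' ?_ (by positivity) |>.2
      rw [mul_pow, ← Real.rpow_natCast (_ ^ _), ← Real.rpow_mul ENNReal.toReal_nonneg,
        show (1 / 2 : ℝ) * ((2 : ℕ) : ℝ) = 1 by norm_num, Real.rpow_one]
      exact h2

theorem coeFn_kernelOp (hk : Measurable (Function.uncurry k))
    (hk2 : ∫⁻ x, ∫⁻ y, ‖k x y‖ₑ ^ 2 < ⊤) (f : L2) :
    kernelOp hk hk2 f =ᵐ[volume] fun x => ∫ y, (k x y : ℂ) * f y :=
  (memLp_kernel_integral hk hk2 f).coeFn_toLp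

/-- For almost every `x` the value at `x` of the image of `b i` is the inner product of `b i` with
the real slice `k x`; Bessel's inequality on each slice is then integrated over `x`. -/
theorem sum_norm_kernelOp_sq_le (hk : Measurable (Function.uncurry k))
    (hk2 : ∫⁻ x, ∫⁻ y, ‖k x y‖ₑ ^ 2 < ⊤) {ι : Type*} {b : ι → L2} (hb : Orthonormal ℂ b)
    (s : Finset ι) :
    ∑ i ∈ s, ‖kernelOp hk hk2 (b i)‖ₑ ^ 2 ≤ ∫⁻ x, ∫⁻ y, ‖k x y‖ₑ ^ 2 := by
  simp_rw [enorm_sq_eq_lintegral]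
  rw [← lintegral_finsetSum' _ (fun i _ =>
    ((Lp.aestronglyMeasurable (kernelOp hk hk2 (b i))).enorm.pow_const 2))]
  apply lintegral_mono_ae
  have hall : ∀ᵐ x, ∀ i ∈ s, kernelOp hk hk2 (b i) x = ∫ y, (k x y : ℂ) * b i y := by
    rw [eventually_all_finset]
    exact fun i _ => coeFn_kernelOp hk hk2 (b i)
  filter_upwards [ae_kernel_lt_top hk hk2, hall] with x hx hx2
  have hkx : MemLp (fun y => (k x y : ℂ)) 2 volume :=
    (memLp_two_of_lintegral (hk.comp measurable_prodMk_left).aestronglyMeasurable hx).ofReal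
  have hin : ∀ i, ∫ y, (k x y : ℂ) * b i y = inner ℂ hkx.toLp (b i) := fun i => by
    rw [L2.inner_def]
    apply integral_congr_ae
    filter_upwards [hkx.coeFn_toLp] with y hy
    rw [hy]
    simp [mul_comm]
  have hbes := hb.sum_inner_products_le (s := s) hkx.toLp
  have e : ∑ i ∈ s, ‖kernelOp hk hk2 (b i) x‖ₑ ^ 2 =
      ENNReal.ofReal (∑ i ∈ s, ‖inner ℂ (b i) hkx.toLp‖ ^ 2) := by
    rw [ENNReal.ofReal_sum_of_nonneg (fun _ _ => by positivity)]
    refine Finset.sum_congr rfl fun i hi => ?_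
    rw [hx2 i hi, hin, ← norm_inner_symm, ENNReal.ofReal_pow (norm_nonneg _), ofReal_norm]
  rw [e]
  refine (ENNReal.ofReal_le_ofReal hbes).trans (le_of_eq ?_)
  rw [ENNReal.ofReal_pow (norm_nonneg _), ofReal_norm, enorm_sq_eq_lintegral]
  apply lintegral_congr_ae
  filter_upwards [hkx.coeFn_toLp] with y hy
  rw [hy, enorm_ofReal_complex]

theorem isCompactOperator_kernelOp (hk : Measurable (Function.uncurry k))
    (hk2 : ∫⁻ x, ∫⁻ y, ‖k x y‖ₑ ^ 2 < ⊤) : IsCompactOperator (kernelOp hk hk2) := by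
  obtain ⟨w, b, -⟩ := exists_hilbertBasis ℂ L2
  refine isCompactOperator_of_summable_norm_sq b ?_
  refine summable_of_sum_le (c := (∫⁻ x, ∫⁻ y, ‖k x y‖ₑ ^ 2).toReal)
    (fun _ => by positivity) fun s => ?_
  have h := ENNReal.toReal_mono hk2.ne (sum_norm_kernelOp_sq_le hk hk2 b.orthonormal s)
  rw [ENNReal.toReal_sum (fun _ _ => by finiteness)] at h
  simpa using h

end kernel

/-- Fredholm alternative for `1 + T` with `T` compact. -/
theorem exists_inverse_one_add {T : L2 →L[ℂ] L2} (hT : IsCompactOperator T)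
    (hinj : ∀ h : L2, h + T h = 0 → h = 0) :
    ∃ S : L2 →L[ℂ] L2, (∀ h, S (h + T h) = h) ∧ ∀ h, S h + T (S h) = h := by
  -- A nonzero point of the spectrum of a compact operator is an eigenvalue, and injectivity
  -- excludes `-1`.
  rcases hT.hasEigenvalue_or_mem_resolventSet (μ := -1) (by norm_num) with h | h
  · obtain ⟨v, hv⟩ := h.exists_hasEigenvector
    have h1 := hv.apply_eq_smul
    refine absurd (hinj v ?_) hv.2
    have : T v = -v := by simpa using h1
    rw [this, add_neg_cancel]
  · rw [spectrum.mem_resolventSet_iff] at h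
    have h' : IsUnit (1 + T) := by
      rw [← IsUnit.neg_iff]
      convert h using 1
      simp; abel
    obtain ⟨u, hu⟩ := h'
    refine ⟨↑u⁻¹, fun x => ?_, fun x => ?_⟩
    · have := congrArg (fun A : L2 →L[ℂ] L2 => A x) u.inv_mul
      simpa [hu] using this
    · have := congrArg (fun A : L2 →L[ℂ] L2 => A x) u.mul_inv
      simpa [hu] using this

/-! ### Convolution with the Yukawa kernel -/

/-- Convolution with the Yukawa kernel. -/
noncomputable def yukawaConv (κ : ℝ) (h : E3 → ℂ) (x : E3) : ℂ :=
  ∫ y, (yukawa κ (x - y) : ℂ) * h y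

theorem yukawaConv_congr {κ : ℝ} {h h' : E3 → ℂ} (e : h =ᵐ[volume] h') :
    yukawaConv κ h = yukawaConv κ h' := by
  ext x
  apply integral_congr_ae
  filter_upwards [e] with y hy
  rw [hy]

theorem measurable_uncurry_yukawa (κ : ℝ) :
    Measurable (Function.uncurry fun x y : E3 => yukawa κ (x - y)) := by
  unfold Function.uncurry; fun_prop

theorem stronglyMeasurable_yukawaConv (κ : ℝ) {h : E3 → ℂ}
    (hh : AEStronglyMeasurable h volume) : StronglyMeasurable (yukawaConv κ h) := by
  rw [yukawaConv_congr hh.ae_eq_mk]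
  exact stronglyMeasurable_kernel_integral (measurable_uncurry_yukawa κ) hh.stronglyMeasurable_mk

theorem lintegral_yukawa_sub_sq (κ : ℝ) (x : E3) :
    ∫⁻ y, ‖yukawa κ (x - y)‖ₑ ^ 2 = ∫⁻ y, ‖yukawa κ y‖ₑ ^ 2 :=
  lintegral_sub_left_eq_self (fun y => ‖yukawa κ y‖ₑ ^ 2) x

theorem lintegral_yukawa_sq_lt_top {κ : ℝ} (hκ : 0 < κ) : ∫⁻ y, ‖yukawa κ y‖ₑ ^ 2 < ⊤ := by
  rw [lintegral_yukawa_sq hκ]; exact ENNReal.ofReal_lt_top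

theorem lintegral_yukawa_lt_top {κ : ℝ} (hκ : 0 < κ) : ∫⁻ y, ‖yukawa κ y‖ₑ < ⊤ :=
  (integrable_yukawa hκ).2

theorem enorm_yukawaConv_sq_le (κ : ℝ) {h : E3 → ℂ} (hh : AEStronglyMeasurable h volume) (x : E3) :
    ‖yukawaConv κ h x‖ₑ ^ 2 ≤ (∫⁻ y, ‖yukawa κ y‖ₑ ^ 2) * ∫⁻ y, ‖h y‖ₑ ^ 2 := by
  rw [← lintegral_yukawa_sub_sq κ x]
  exact enorm_integral_mul_sq_le (by fun_prop) hh

theorem integrable_yukawa_mul_of_sq {κ : ℝ} (hκ : 0 < κ) {h : E3 → ℂ}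
    (hh : AEStronglyMeasurable h volume) (h2 : ∫⁻ y, ‖h y‖ₑ ^ 2 < ⊤) (x : E3) :
    Integrable fun y => (yukawa κ (x - y) : ℂ) * h y :=
  integrable_mul_of_lintegral_sq (by fun_prop) hh
    (by rw [lintegral_yukawa_sub_sq]; exact lintegral_yukawa_sq_lt_top hκ) h2

theorem enorm_yukawaConv_le (κ : ℝ) (h : E3 → ℂ) (x : E3) :
    ‖yukawaConv κ h x‖ₑ ≤ ∫⁻ y, ‖yukawa κ (x - y)‖ₑ * ‖h y‖ₑ := by
  refine (enorm_integral_le_lintegral_enorm _).trans (le_of_eq ?_)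
  simp_rw [enorm_mul, enorm_ofReal_complex]

/-- Schur's test for the Yukawa kernel. -/
theorem lintegral_lintegral_yukawa_sq_le (κ : ℝ) {h : E3 → ℝ≥0∞} (hh : AEMeasurable h volume) :
    ∫⁻ x, (∫⁻ y, ‖yukawa κ (x - y)‖ₑ * h y) ^ 2 ≤ (∫⁻ y, ‖yukawa κ y‖ₑ) ^ 2 * ∫⁻ y, h y ^ 2 := by
  have h1 : ∀ x, (∫⁻ y, ‖yukawa κ (x - y)‖ₑ * h y) ^ 2 ≤
      (∫⁻ y, ‖yukawa κ y‖ₑ) * ∫⁻ y, ‖yukawa κ (x - y)‖ₑ * h y ^ 2 := fun x => by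
    rw [← lintegral_sub_left_eq_self (fun y => ‖yukawa κ y‖ₑ) x]
    exact lintegral_mul_sq_le_weighted
      (by fun_prop : Measurable fun y => ‖yukawa κ (x - y)‖ₑ).aemeasurable hh
  have hm : AEMeasurable (fun q : E3 × E3 => ‖yukawa κ (q.1 - q.2)‖ₑ * h q.2 ^ 2)
      (volume.prod volume) :=
    (by fun_prop : Measurable fun q : E3 × E3 => ‖yukawa κ (q.1 - q.2)‖ₑ).aemeasurable.mul
      ((hh.comp_quasiMeasurePreserving Measure.quasiMeasurePreserving_snd).pow_const 2)
  refine (lintegral_mono h1).trans ?_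
  rw [lintegral_const_mul'' _ hm.lintegral_prod_right', lintegral_lintegral_swap hm]
  have h2 : ∀ y, ∫⁻ x, ‖yukawa κ (x - y)‖ₑ * h y ^ 2 = (∫⁻ y, ‖yukawa κ y‖ₑ) * h y ^ 2 := fun y => by
    rw [lintegral_mul_const _ (by fun_prop),
      lintegral_sub_right_eq_self (fun x => ‖yukawa κ x‖ₑ) y]
  simp_rw [h2]
  rw [lintegral_const_mul'' _ (hh.pow_const 2), sq, mul_assoc]

theorem lintegral_yukawaConv_sq_le (κ : ℝ) {h : E3 → ℂ} (hh : AEStronglyMeasurable h volume) :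
    ∫⁻ x, ‖yukawaConv κ h x‖ₑ ^ 2 ≤ (∫⁻ y, ‖yukawa κ y‖ₑ) ^ 2 * ∫⁻ y, ‖h y‖ₑ ^ 2 := by
  refine (lintegral_mono fun x => pow_le_pow_left' (enorm_yukawaConv_le κ h x) 2).trans ?_
  exact lintegral_lintegral_yukawa_sq_le κ hh.enorm

theorem lintegral_yukawa_translate_sub_sq_le {κ : ℝ} (hκ : 0 ≤ κ) (x z : E3) :
    ∫⁻ y, ‖yukawa κ (x + z - y) - yukawa κ (x - y)‖ₑ ^ 2 ≤ ENNReal.ofReal (sphereArea * ‖z‖) := by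
  have := lintegral_sub_left_eq_self (μ := volume) (fun y : E3 => ‖yukawa κ (y + z) - yukawa κ y‖ₑ ^ 2) x
  simp only [sub_add_eq_add_sub] at this
  rw [this]
  exact lintegral_yukawa_translate_sq_le hκ z

/-- Cauchy–Schwarz transfers the `L²` modulus of the kernel to the potential. The bound on the
square is linear in `‖z‖`, so displacements of size `1/N` cost `O(1/N)` in square. -/
theorem enorm_yukawaConv_translate_sq_le {κ : ℝ} (hκ : 0 ≤ κ) {h : E3 → ℂ}
    (hh : AEStronglyMeasurable h volume)
    (hi : ∀ x, Integrable fun y => (yukawa κ (x - y) : ℂ) * h y) (x z : E3) :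
    ‖yukawaConv κ h (x + z) - yukawaConv κ h x‖ₑ ^ 2 ≤
      ENNReal.ofReal (sphereArea * ‖z‖) * ∫⁻ y, ‖h y‖ₑ ^ 2 := by
  unfold yukawaConv
  rw [← integral_sub (hi _) (hi _)]
  have e : ∀ y, (yukawa κ (x + z - y) : ℂ) * h y - (yukawa κ (x - y) : ℂ) * h y =
      ((yukawa κ (x + z - y) - yukawa κ (x - y) : ℝ) : ℂ) * h y := fun y => by push_cast; ring
  simp_rw [e]
  refine (enorm_integral_mul_sq_le (by fun_prop) hh).trans ?_
  gcongr
  exact lintegral_yukawa_translate_sub_sq_le hκ x z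

theorem continuous_yukawaConv {κ : ℝ} (hκ : 0 ≤ κ) {h : E3 → ℂ}
    (hh : AEStronglyMeasurable h volume) (h2 : ∫⁻ y, ‖h y‖ₑ ^ 2 < ⊤)
    (hi : ∀ x, Integrable fun y => (yukawa κ (x - y) : ℂ) * h y) :
    Continuous (yukawaConv κ h) := by
  rw [continuous_iff_continuousAt]
  intro x
  rw [ContinuousAt, tendsto_iff_norm_sub_tendsto_zero]
  set A := (∫⁻ y, ‖h y‖ₑ ^ 2).toReal
  have hb : ∀ x', ‖yukawaConv κ h x' - yukawaConv κ h x‖ ^ 2 ≤ sphereArea * ‖x' - x‖ * A := by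
    intro x'
    have h1 := enorm_yukawaConv_translate_sq_le hκ hh hi x (x' - x)
    rw [add_sub_cancel] at h1
    have h3 := ENNReal.toReal_mono (by finiteness) h1
    simpa [ENNReal.toReal_ofReal (mul_nonneg sphereArea_nonneg (norm_nonneg _))] using h3
  have hlim : Tendsto (fun x' => sphereArea * ‖x' - x‖ * A) (𝓝 x) (𝓝 0) := by
    have : Continuous fun x' => sphereArea * ‖x' - x‖ * A := by fun_prop
    simpa using this.tendsto x
  have hsq := squeeze_zero (fun _ => sq_nonneg _) hb hlim
  have := hsq.sqrt
  simpa [Real.sqrt_sq (norm_nonneg _)] using this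

/-- The weak form of `(-Δ + κ²) (yukawaConv κ h) = h`. -/
theorem integral_yukawaConv_mul {κ : ℝ} (hκ : 0 ≤ κ) {h : E3 → ℂ}
    (hh : AEStronglyMeasurable h volume) (η : 𝓢(E3, ℂ))
    (hfin : ∫⁻ y, (∫⁻ x, ‖yukawa κ (y - x)‖ₑ * ‖((κ ^ 2 : ℝ) : ℂ) * η x - Δ η x‖ₑ) * ‖h y‖ₑ < ⊤) :
    ∫ x, yukawaConv κ h x * (((κ ^ 2 : ℝ) : ℂ) * η x - Δ η x) = ∫ y, h y * η y := by
  set ζ : E3 → ℂ := fun x => ((κ ^ 2 : ℝ) : ℂ) * η x - Δ η x with hζ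
  have hζc : Continuous ζ := by
    have h1 := η.continuous
    have h2 := (Δ η).continuous
    simp only [hζ]; fun_prop
  have hm1 : AEStronglyMeasurable (fun q : E3 × E3 => (yukawa κ (q.1 - q.2) : ℂ) * h q.2 * ζ q.1)
      (volume.prod volume) := by
    have a1 : Measurable fun q : E3 × E3 => (yukawa κ (q.1 - q.2) : ℂ) := by fun_prop
    have a2 : Measurable fun q : E3 × E3 => ζ q.1 := hζc.measurable.comp measurable_fst
    exact (a1.aestronglyMeasurable.mul (hh.comp_quasiMeasurePreserving
      Measure.quasiMeasurePreserving_snd)).mul a2.aestronglyMeasurable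
  have hint : Integrable (fun q : E3 × E3 => (yukawa κ (q.1 - q.2) : ℂ) * h q.2 * ζ q.1)
      (volume.prod volume) := by
    refine ⟨hm1, ?_⟩
    rw [hasFiniteIntegral_iff_enorm, lintegral_prod_symm _ hm1.enorm]
    refine lt_of_eq_of_lt ?_ hfin
    apply lintegral_congr
    intro y
    have : Measurable fun x => ‖yukawa κ (y - x)‖ₑ * ‖ζ x‖ₑ := by
      have := hζc.measurable; fun_prop
    rw [← lintegral_mul_const _ this]
    apply lintegral_congr
    intro x
    rw [enorm_mul, enorm_mul, enorm_ofReal_complex, yukawa_sub_comm]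
    ring
  have e1 : ∀ x, yukawaConv κ h x * ζ x = ∫ y, (yukawa κ (x - y) : ℂ) * h y * ζ x := fun x => by
    rw [integral_mul_const]; rfl
  change ∫ x, yukawaConv κ h x * ζ x = _
  rw [integral_congr_ae (Eventually.of_forall e1), integral_integral_swap hint]
  congr 1
  ext y
  -- After Fubini, and by symmetry of the kernel, the inner integral is the Green identity at `y`.
  rw [← integral_yukawa_mul_sub_laplacian hκ η y, ← integral_const_mul]
  congr 1
  ext x
  rw [yukawa_sub_comm]
  ring

/-! ### The free resolvent -/

theorem memLp_yukawaConv {κ : ℝ} (hκ : 0 < κ) (f : L2) : MemLp (yukawaConv κ f) 2 volume := by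
  refine memLp_two_of_lintegral
    (stronglyMeasurable_yukawaConv κ (Lp.aestronglyMeasurable f)).aestronglyMeasurable ?_
  refine (lintegral_yukawaConv_sq_le κ (Lp.aestronglyMeasurable f)).trans_lt ?_
  have h1 := lintegral_yukawa_lt_top hκ
  have h2 := lintegral_enorm_sq_lt_top (Lp.memLp f)
  finiteness

theorem integrable_yukawa_mul_coeFn {κ : ℝ} (hκ : 0 < κ) (f : L2) (x : E3) :
    Integrable fun y => (yukawa κ (x - y) : ℂ) * f y :=
  integrable_yukawa_mul_of_sq hκ (Lp.aestronglyMeasurable f)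
    (lintegral_enorm_sq_lt_top (Lp.memLp f)) x

theorem yukawaConv_add_coeFn {κ : ℝ} (hκ : 0 < κ) (f g : L2) (x : E3) :
    yukawaConv κ (f + g : L2) x = yukawaConv κ f x + yukawaConv κ g x := by
  rw [yukawaConv_congr (Lp.coeFn_add f g)]
  unfold yukawaConv
  rw [← integral_add (integrable_yukawa_mul_coeFn hκ f x) (integrable_yukawa_mul_coeFn hκ g x)]
  simp [mul_add]

/-- The free resolvent `(-Δ + κ²)⁻¹` on `L²(ℝ³)`. -/
noncomputable def freeResolvent {κ : ℝ} (hκ : 0 < κ) : L2 →L[ℂ] L2 :=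
  LinearMap.mkContinuous
    { toFun := fun f => (memLp_yukawaConv hκ f).toLp
      map_add' := fun f g => by
        rw [← MemLp.toLp_add]
        apply MemLp.toLp_congr
        filter_upwards with x
        rw [yukawaConv_add_coeFn hκ, Pi.add_apply]
      map_smul' := fun c f => by
        rw [RingHom.id_apply, ← MemLp.toLp_const_smul]
        apply MemLp.toLp_congr
        filter_upwards with x
        rw [yukawaConv_congr (Lp.coeFn_smul c f), Pi.smul_apply, smul_eq_mul, yukawaConv,
          yukawaConv, ← integral_const_mul]
        congr 1
        ext y
        rw [Pi.smul_apply, smul_eq_mul]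
        ring }
    (∫⁻ y, ‖yukawa κ y‖ₑ).toReal fun f => by
      have h := lintegral_yukawaConv_sq_le κ (Lp.aestronglyMeasurable f)
      rw [← enorm_sq_eq_lintegral] at h
      have h1 : ‖(memLp_yukawaConv hκ f).toLp‖ₑ ^ 2 ≤ (∫⁻ y, ‖yukawa κ y‖ₑ) ^ 2 * ‖f‖ₑ ^ 2 := by
        rw [enorm_sq_eq_lintegral]
        refine le_trans (le_of_eq ?_) h
        apply lintegral_congr_ae
        filter_upwards [(memLp_yukawaConv hκ f).coeFn_toLp] with x hx
        rw [hx]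
      have h3 := lintegral_yukawa_lt_top hκ
      have h2 := ENNReal.toReal_mono (by finiteness) h1
      simp only [ENNReal.toReal_mul, ENNReal.toReal_pow, toReal_enorm, ← mul_pow] at h2
      exact abs_le_of_sq_le_sq' h2 (by positivity) |>.2

theorem coeFn_freeResolvent {κ : ℝ} (hκ : 0 < κ) (f : L2) :
    freeResolvent hκ f =ᵐ[volume] yukawaConv κ f :=
  (memLp_yukawaConv hκ f).coeFn_toLp

theorem integrable_mul_schwartz (f : L2) (η : 𝓢(E3, ℂ)) : Integrable fun x => f x * η x :=
  MemLp.integrable_mul (Lp.memLp f) (η.memLp 2 volume)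

theorem integral_freeResolvent_mul {κ : ℝ} (hκ : 0 < κ) (f : L2) (η : 𝓢(E3, ℂ)) :
    ∫ x, freeResolvent hκ f x * (((κ ^ 2 : ℝ) : ℂ) * η x - Δ η x) = ∫ x, f x * η x := by
  rw [← integral_yukawaConv_mul hκ.le (Lp.aestronglyMeasurable f) η]
  · apply integral_congr_ae
    filter_upwards [coeFn_freeResolvent hκ f] with x hx
    rw [hx]
  · set ζ : 𝓢(E3, ℂ) := ((κ ^ 2 : ℝ) : ℂ) • η - Δ η with hζ
    have hζy : ∀ y, ((κ ^ 2 : ℝ) : ℂ) * η y - Δ η y = ζ y := fun y => by simp [hζ]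
    simp_rw [hζy]
    have hzm : Measurable fun y => ‖ζ y‖ₑ := ζ.continuous.measurable.enorm
    have m1 : Measurable fun y => ∫⁻ x, ‖yukawa κ (y - x)‖ₑ * ‖ζ x‖ₑ :=
      Measurable.lintegral_prod_right' (f := fun q : E3 × E3 => ‖yukawa κ (q.1 - q.2)‖ₑ * ‖ζ q.2‖ₑ)
        ((by fun_prop : Measurable fun q : E3 × E3 => ‖yukawa κ (q.1 - q.2)‖ₑ).mul
          (hzm.comp measurable_snd))
    have h1 := lintegral_mul_sq_le m1.aemeasurable (Lp.aestronglyMeasurable f).enorm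
    have h2 := lintegral_lintegral_yukawa_sq_le κ hzm.aemeasurable
    have h3 := lintegral_enorm_sq_schwartz_lt_top ζ
    have h4 := lintegral_enorm_sq_lt_top (Lp.memLp f)
    have h5 := lintegral_yukawa_lt_top hκ
    have h6 := h1.trans_lt (ENNReal.mul_lt_top (h2.trans_lt (by finiteness)) h4)
    -- The bound is on the square of the integral; a finite square forces a finite integral.
    by_contra hcon
    rw [not_lt, top_le_iff] at hcon
    rw [hcon] at h6
    simp at h6

theorem laplacian_freeResolvent {κ : ℝ} (hκ : 0 < κ) (f : L2) :
    Δ ((freeResolvent hκ f : L2) : 𝓢'(E3, ℂ)) =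
      ((((κ ^ 2 : ℝ) : ℂ) • freeResolvent hκ f - f : L2) : 𝓢'(E3, ℂ)) := by
  ext η
  rw [TemperedDistribution.laplacian_apply_apply, Lp.toTemperedDistribution_apply,
    Lp.toTemperedDistribution_apply]
  have h := integral_freeResolvent_mul hκ f η
  have e1 : ∫ x, η x • (((κ ^ 2 : ℝ) : ℂ) • freeResolvent hκ f - f : L2) x =
      (((κ ^ 2 : ℝ) : ℂ) * ∫ x, freeResolvent hκ f x * η x) - ∫ x, f x * η x := by
    rw [← integral_const_mul, ← integral_sub ((integrable_mul_schwartz _ η).const_mul _)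
      (integrable_mul_schwartz f η)]
    apply integral_congr_ae
    filter_upwards [Lp.coeFn_sub (((κ ^ 2 : ℝ) : ℂ) • freeResolvent hκ f) f,
      Lp.coeFn_smul ((κ ^ 2 : ℝ) : ℂ) (freeResolvent hκ f)] with x h1 h2
    rw [h1, Pi.sub_apply, h2, Pi.smul_apply]
    simp only [smul_eq_mul]
    ring
  have e2 : ∫ x, freeResolvent hκ f x * (((κ ^ 2 : ℝ) : ℂ) * η x - Δ η x) =
      (((κ ^ 2 : ℝ) : ℂ) * ∫ x, freeResolvent hκ f x * η x) - ∫ x, Δ η x • freeResolvent hκ f x := by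
    rw [← integral_const_mul, ← integral_sub ((integrable_mul_schwartz _ η).const_mul _)]
    · congr 1; ext x; simp only [smul_eq_mul]; ring
    · simpa [mul_comm] using integrable_mul_schwartz (freeResolvent hκ f) (Δ η)
  rw [e1, ← h, e2]
  ring

/-- The Bessel potential of order two has symbol `1 + ‖x‖²`, which in the convention with phase
`2π⟨x, ξ⟩` is the operator `1 - (2π)⁻² Δ`. This dictates the witness. -/
theorem memSobolev_of_laplacian_eq {ψ g : L2} (h : Δ (ψ : 𝓢'(E3, ℂ)) = (g : 𝓢'(E3, ℂ))) :
    TemperedDistribution.MemSobolev 2 2 (ψ : 𝓢'(E3, ℂ)) := by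
  refine ⟨ψ - (((2 * Real.pi) ^ 2 : ℝ) : ℂ)⁻¹ • g, ?_⟩
  have e0 : ((ψ - (((2 * Real.pi) ^ 2 : ℝ) : ℂ)⁻¹ • g : L2) : 𝓢'(E3, ℂ)) =
      (ψ : 𝓢'(E3, ℂ)) - (((2 * Real.pi) ^ 2 : ℝ) : ℂ)⁻¹ • (g : 𝓢'(E3, ℂ)) := by
    simp only [← Lp.toTemperedDistributionCLM_apply, map_sub, map_smul]
  rw [e0, ← h, TemperedDistribution.laplacian_eq_fourierMultiplierCLM,
    TemperedDistribution.besselPotential]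
  have e : (fun x : E3 => (((1 + ‖x‖ ^ 2) ^ ((2 : ℝ) / 2) : ℝ) : ℂ)) =
      (fun _ => (1 : ℂ)) + fun x : E3 => Complex.ofReal (‖x‖ ^ 2) := by
    ext x; simp
  rw [e, TemperedDistribution.fourierMultiplierCLM_apply,
    TemperedDistribution.smulLeftCLM_add (by fun_prop) (by fun_prop)]
  rw [_root_.add_apply, FourierTransform.fourierInv_add, TemperedDistribution.smulLeftCLM_const, one_smul,
    FourierTransform.fourierInv_fourier_eq, ← TemperedDistribution.fourierMultiplierCLM_apply,
    sub_eq_add_neg]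
  congr 1
  rw [← Complex.coe_smul, smul_smul, ← neg_smul]
  have hpi : (Real.pi : ℂ) ≠ 0 := by exact_mod_cast Real.pi_ne_zero
  have : -((((2 * Real.pi) ^ 2 : ℝ) : ℂ)⁻¹ * ((-(2 * Real.pi) ^ 2 : ℝ) : ℂ)) = 1 := by
    push_cast; field_simp
  rw [this, one_smul]

theorem freeResolvent_mem_sobolevH2 {κ : ℝ} (hκ : 0 < κ) (f : L2) :
    freeResolvent hκ f ∈ sobolevH2 :=
  memSobolev_of_laplacian_eq (laplacian_freeResolvent hκ f)

/-- By duality: an arbitrary test function is `κ² η - Δη` for some `η`, which moves the resolvent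
and then the Laplacian onto the test function. -/
theorem freeResolvent_sub_laplacianFun {κ : ℝ} (hκ : 0 < κ) (ψ : sobolevH2) :
    freeResolvent hκ (((κ ^ 2 : ℝ) : ℂ) • (ψ : L2) - laplacianFun ψ) = ψ := by
  apply toTemperedDistribution_injective
  ext ζ
  obtain ⟨η, hη⟩ := exists_sub_laplacian_eq hκ ζ
  rw [Lp.toTemperedDistribution_apply, Lp.toTemperedDistribution_apply]
  have h := integral_freeResolvent_mul hκ (((κ ^ 2 : ℝ) : ℂ) • (ψ : L2) - laplacianFun ψ) η
  have hl : ∫ x, Δ η x • (ψ : L2) x = ∫ x, η x • laplacianFun ψ x := by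
    rw [← Lp.toTemperedDistribution_apply, ← Lp.toTemperedDistribution_apply, ← laplacianFun_spec,
      TemperedDistribution.laplacian_apply_apply]
  simp_rw [hη] at h
  simp_rw [smul_eq_mul, mul_comm (ζ _)]
  rw [h]
  simp_rw [smul_eq_mul, mul_comm _ ((ψ : L2) _), mul_comm _ (laplacianFun ψ _)] at hl
  have e1 : ∫ x, (((κ ^ 2 : ℝ) : ℂ) • (ψ : L2) - laplacianFun ψ : L2) x * η x =
      (((κ ^ 2 : ℝ) : ℂ) * ∫ x, (ψ : L2) x * η x) - ∫ x, laplacianFun ψ x * η x := by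
    rw [← integral_const_mul, ← integral_sub ((integrable_mul_schwartz _ η).const_mul _)
      (integrable_mul_schwartz _ η)]
    apply integral_congr_ae
    filter_upwards [Lp.coeFn_sub (((κ ^ 2 : ℝ) : ℂ) • (ψ : L2)) (laplacianFun ψ),
      Lp.coeFn_smul ((κ ^ 2 : ℝ) : ℂ) (ψ : L2)] with x h1 h2
    rw [h1, Pi.sub_apply, h2, Pi.smul_apply]
    simp only [smul_eq_mul]
    ring
  rw [e1, ← hl, ← integral_const_mul, ← integral_sub ((integrable_mul_schwartz _ η).const_mul _)
      (integrable_mul_schwartz _ (Δ η))]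
  congr 1
  ext x
  rw [← hη]
  ring

/-! ### Resolvents of Schrödinger operators -/

section perturbed

variable {κ : ℝ} {U : E3 → ℝ}

theorem measurable_uncurry_mul_yukawa (κ : ℝ) (hU : Measurable U) :
    Measurable (Function.uncurry fun x y : E3 => U x * yukawa κ (x - y)) := by
  unfold Function.uncurry; fun_prop

theorem lintegral_mul_yukawa_lt_top (hκ : 0 < κ) (hU2 : MemLp U 2 volume) :
    ∫⁻ x, ∫⁻ y, ‖U x * yukawa κ (x - y)‖ₑ ^ 2 < ⊤ := by
  have e : ∀ x, ∫⁻ y, ‖U x * yukawa κ (x - y)‖ₑ ^ 2 = ‖U x‖ₑ ^ 2 * ∫⁻ y, ‖yukawa κ y‖ₑ ^ 2 := by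
    intro x
    simp_rw [enorm_mul, mul_pow]
    rw [lintegral_const_mul _ (by fun_prop), lintegral_yukawa_sub_sq]
  simp_rw [e]
  rw [lintegral_mul_const' _ _ (lintegral_yukawa_sq_lt_top hκ).ne]
  exact ENNReal.mul_lt_top (lintegral_enorm_sq_lt_top hU2) (lintegral_yukawa_sq_lt_top hκ)

/-- The operator `U (-Δ + κ²)⁻¹`. -/
noncomputable def mulResolvent (hκ : 0 < κ) (hU : Measurable U) (hU2 : MemLp U 2 volume) :
    L2 →L[ℂ] L2 :=
  kernelOp (measurable_uncurry_mul_yukawa κ hU) (lintegral_mul_yukawa_lt_top hκ hU2)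

theorem coeFn_mulResolvent (hκ : 0 < κ) (hU : Measurable U) (hU2 : MemLp U 2 volume) (f : L2) :
    mulResolvent hκ hU hU2 f =ᵐ[volume] fun x => (U x : ℂ) * yukawaConv κ f x := by
  filter_upwards [coeFn_kernelOp (measurable_uncurry_mul_yukawa κ hU)
    (lintegral_mul_yukawa_lt_top hκ hU2) f] with x hx
  rw [mulResolvent, hx, yukawaConv, ← integral_const_mul]
  congr 1
  ext y
  push_cast
  ring

theorem coeFn_mulResolvent' (hκ : 0 < κ) (hU : Measurable U) (hU2 : MemLp U 2 volume) (f : L2) :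
    mulResolvent hκ hU hU2 f =ᵐ[volume] fun x => (U x : ℂ) * freeResolvent hκ f x := by
  filter_upwards [coeFn_mulResolvent hκ hU hU2 f, coeFn_freeResolvent hκ f] with x h1 h2
  rw [h1, h2]

/-- This is the factorization `-Δ + U + κ² = (1 + U R)(-Δ + κ²)` with `R` the free resolvent, read
in both orders on the domain of the operator. -/
theorem isResolvent_schrodinger (hκ : 0 < κ) (hU : Measurable U) (hU2 : MemLp U 2 volume)
    {S : L2 →L[ℂ] L2} (hS1 : ∀ h, S (h + mulResolvent hκ hU hU2 h) = h)
    (hS2 : ∀ h, S h + mulResolvent hκ hU hU2 (S h) = h) :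
    IsResolvent (schrodinger U) (-((κ ^ 2 : ℝ) : ℂ)) (freeResolvent hκ ∘L S) := by
  constructor
  · intro f
    have h1 : freeResolvent hκ (S f) ∈ sobolevH2 := freeResolvent_mem_sobolevH2 hκ _
    -- The product lies in `L²` because it is the image of `S f` under the bounded operator `U R`.
    have h2 : freeResolvent hκ (S f) ∈ mulDomain U :=
      (memLp_congr_ae (coeFn_mulResolvent' hκ hU hU2 (S f))).mp (Lp.memLp _)
    have hdom : (freeResolvent hκ ∘L S) f ∈ (schrodinger U).domain := ⟨h1, h2⟩
    refine ⟨hdom, ?_⟩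
    have e : schrodinger U ⟨(freeResolvent hκ ∘L S) f, hdom⟩ =
        -laplacianFun ⟨freeResolvent hκ (S f), h1⟩ + (memLp_of_mem_mulDomain ⟨_, h2⟩).toLp := rfl
    have e1 : laplacianFun ⟨freeResolvent hκ (S f), h1⟩ =
        ((κ ^ 2 : ℝ) : ℂ) • freeResolvent hκ (S f) - S f := by
      apply toTemperedDistribution_injective
      rw [← laplacianFun_spec, laplacian_freeResolvent]
    have e2 : (memLp_of_mem_mulDomain ⟨freeResolvent hκ (S f), h2⟩).toLp =
        mulResolvent hκ hU hU2 (S f) := by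
      apply Lp.ext
      exact (MemLp.coeFn_toLp _).trans (coeFn_mulResolvent' hκ hU hU2 (S f)).symm
    rw [e, e1, e2]
    have h3 := hS2 f
    simp only [ContinuousLinearMap.comp_apply]
    refine Eq.trans ?_ h3
    rw [neg_smul]
    abel
  · rintro ⟨ψ, h1, h2⟩
    have h1' : ψ ∈ sobolevH2 := h1
    have h2' : ψ ∈ mulDomain U := h2
    have e : schrodinger U ⟨ψ, h1, h2⟩ =
        -laplacianFun ⟨ψ, h1'⟩ + (memLp_of_mem_mulDomain ⟨_, h2'⟩).toLp := rfl
    set g : L2 := ((κ ^ 2 : ℝ) : ℂ) • ψ - laplacianFun ⟨ψ, h1'⟩ with hg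
    have hRg : freeResolvent hκ g = ψ := freeResolvent_sub_laplacianFun hκ ⟨ψ, h1'⟩
    have e2 : (memLp_of_mem_mulDomain ⟨ψ, h2'⟩).toLp = mulResolvent hκ hU hU2 g := by
      apply Lp.ext
      refine (MemLp.coeFn_toLp _).trans ?_
      have := (coeFn_mulResolvent' hκ hU hU2 g).symm
      rwa [hRg] at this
    have e3 : schrodinger U ⟨ψ, h1, h2⟩ - (-((κ ^ 2 : ℝ) : ℂ)) • ψ = g + mulResolvent hκ hU hU2 g := by
      rw [e, e2, hg, neg_smul]
      abel
    rw [ContinuousLinearMap.comp_apply]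
    change freeResolvent hκ (S (schrodinger U ⟨ψ, h1, h2⟩ - (-((κ ^ 2 : ℝ) : ℂ)) • ψ)) = ψ
    rw [e3, hS1, hRg]

/-- If `1 + U (-Δ + κ²)⁻¹` is injective then `-κ²` is in the resolvent set of `-Δ + U`. -/
theorem schrodinger_resolvent (hκ : 0 < κ) (hU : Measurable U) (hU2 : MemLp U 2 volume)
    (hinj : ∀ h : L2, h + mulResolvent hκ hU hU2 h = 0 → h = 0) :
    -((κ ^ 2 : ℝ) : ℂ) ∈ resolventSet (schrodinger U) ∧
    ∀ f : L2, ∃ h : L2, resolvent (schrodinger U) (-((κ ^ 2 : ℝ) : ℂ)) f = freeResolvent hκ h ∧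
      h + mulResolvent hκ hU hU2 h = f := by
  obtain ⟨S, hS1, hS2⟩ := exists_inverse_one_add (T := mulResolvent hκ hU hU2)
    (isCompactOperator_kernelOp _ _) hinj
  have hR := isResolvent_schrodinger hκ hU hU2 hS1 hS2
  have hex : ∃ R, IsResolvent (schrodinger U) (-((κ ^ 2 : ℝ) : ℂ)) R := ⟨_, hR⟩
  refine ⟨hex, fun f => ⟨S f, ?_, hS2 f⟩⟩
  have : resolvent (schrodinger U) (-((κ ^ 2 : ℝ) : ℂ)) = freeResolvent hκ ∘L S := by
    rw [resolvent, dif_pos hex]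
    exact hex.choose_spec.unique hR
  rw [this]
  rfl

end perturbed

/-! ### Newtonian potentials of functions in `L¹ ∩ L²` -/

theorem tendsto_setLIntegral_compl_closedBall {g : E3 → ℝ≥0∞} (hg : AEMeasurable g volume)
    (hfin : ∫⁻ x, g x ≠ ⊤) :
    Tendsto (fun n : ℕ => ∫⁻ x in (Metric.closedBall (0 : E3) n)ᶜ, g x) atTop (𝓝 0) := by
  have hm : ∀ n : ℕ, MeasurableSet (Metric.closedBall (0 : E3) n)ᶜ := fun n =>
    Metric.isClosed_closedBall.measurableSet.compl
  simp_rw [← lintegral_indicator (hm _)]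
  rw [← lintegral_zero (α := E3) (μ := volume)]
  refine tendsto_lintegral_of_dominated_convergence' g (fun n => hg.indicator (hm n))
    (fun n => Eventually.of_forall fun x => Set.indicator_le_self _ _ _) hfin
    (Eventually.of_forall fun x => ?_)
  apply tendsto_const_nhds.congr'
  filter_upwards [eventually_ge_atTop ⌈‖x‖⌉₊] with n hn
  rw [Set.indicator_of_notMem]
  simpa using (Nat.ceil_le.mp hn)

theorem exists_norm_yukawaConv_le {h : E3 → ℂ} (h1 : Integrable h)
    (h2 : ∫⁻ y, ‖h y‖ₑ ^ 2 < ⊤) :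
    ∃ C : ℝ, 0 ≤ C ∧ ∀ κ : ℝ, 0 ≤ κ → ∀ x, ‖yukawaConv κ h x‖ ≤ C := by
  set D := (ENNReal.ofReal sphereArea * ∫⁻ y, ‖h y‖ₑ ^ 2) ^ (1 / 2 : ℝ) + ∫⁻ y, ‖h y‖ₑ with hD
  have hD' : D ≠ ⊤ := by
    have := h1.2.ne
    rw [hD]
    finiteness
  refine ⟨D.toReal, ENNReal.toReal_nonneg, fun κ hκ x => ?_⟩
  have h3 := ENNReal.toReal_mono hD' ((enorm_yukawaConv_le κ h x).trans
    (lintegral_yukawa_mul_le hκ h1.1.enorm x))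
  rwa [toReal_enorm] at h3

/-- The source is cut at a large ball. Its tail has a uniformly small potential by the `L¹ ∩ L²`
bound, and on the ball of radius `n` the kernel is at most `1/(4π(‖x‖ - n))`. -/
theorem tendsto_yukawaConv_zero_cocompact {h : E3 → ℂ} (h1 : Integrable h)
    (h2 : ∫⁻ y, ‖h y‖ₑ ^ 2 < ⊤) : Tendsto (yukawaConv 0 h) (cocompact E3) (𝓝 0) := by
  rw [tendsto_zero_iff_enorm_tendsto_zero, ENNReal.tendsto_nhds_zero]
  intro ε hε
  set B : ℕ → Set E3 := fun n => Metric.closedBall (0 : E3) n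
  have hB : ∀ n, MeasurableSet (B n) := fun n => Metric.isClosed_closedBall.measurableSet
  have hI : ∫⁻ y, ‖h y‖ₑ ≠ ⊤ := h1.2.ne
  have hT : Tendsto (fun n : ℕ => (ENNReal.ofReal sphereArea *
      ∫⁻ y in (B n)ᶜ, ‖h y‖ₑ ^ 2) ^ (1 / 2 : ℝ) + ∫⁻ y in (B n)ᶜ, ‖h y‖ₑ) atTop (𝓝 0) := by
    have t1 := tendsto_setLIntegral_compl_closedBall (h1.1.enorm.pow_const 2) h2.ne
    have t2 := tendsto_setLIntegral_compl_closedBall h1.1.enorm hI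
    have t3 := (ENNReal.Tendsto.const_mul t1
      (Or.inr (ENNReal.ofReal_ne_top (r := sphereArea)))).ennrpow_const (1 / 2 : ℝ)
    have t4 := t3.add t2
    simpa using t4
  obtain ⟨n, hn⟩ := ((ENNReal.tendsto_nhds_zero.mp hT) (ε / 2) (ENNReal.half_pos hε.ne')).exists
  have hin : Tendsto (fun x : E3 => ENNReal.ofReal (1 / (4 * Real.pi * (‖x‖ - n))) *
      ∫⁻ y, ‖h y‖ₑ) (cocompact E3) (𝓝 0) := by
    have t1 : Tendsto (fun x : E3 => 4 * Real.pi * (‖x‖ - n)) (cocompact E3) atTop :=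
      (tendsto_atTop_add_const_right _ (-(n : ℝ)) (tendsto_norm_cocompact_atTop)).const_mul_atTop
        (by positivity)
    have t2 := ENNReal.tendsto_ofReal (t1.inv_tendsto_atTop)
    have t3 := ENNReal.Tendsto.mul_const t2 (Or.inr hI)
    simpa using t3
  filter_upwards [(ENNReal.tendsto_nhds_zero.mp hin) (ε / 2) (ENNReal.half_pos hε.ne'),
    tendsto_norm_cocompact_atTop.eventually (eventually_gt_atTop (n : ℝ))] with x hx hxn
  have hsplit : ∫⁻ y, ‖yukawa 0 (x - y)‖ₑ * ‖h y‖ₑ =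
      (∫⁻ y in B n, ‖yukawa 0 (x - y)‖ₑ * ‖h y‖ₑ) +
        ∫⁻ y in (B n)ᶜ, ‖yukawa 0 (x - y)‖ₑ * ‖h y‖ₑ := (lintegral_add_compl _ (hB n)).symm
  have hin' : ∫⁻ y in B n, ‖yukawa 0 (x - y)‖ₑ * ‖h y‖ₑ ≤
      ENNReal.ofReal (1 / (4 * Real.pi * (‖x‖ - n))) * ∫⁻ y, ‖h y‖ₑ := by
    rw [← lintegral_const_mul' _ _ ENNReal.ofReal_ne_top]
    refine (setLIntegral_mono' (hB n) fun y hy => ?_).trans (setLIntegral_le_lintegral _ _)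
    gcongr
    rw [Real.enorm_eq_ofReal (yukawa_nonneg _ _), yukawa_zero_apply]
    apply ENNReal.ofReal_le_ofReal
    have hy' : ‖y‖ ≤ n := by simpa [B] using hy
    have := norm_sub_norm_le x y
    have hpos : 0 < ‖x‖ - n := by linarith
    gcongr
    linarith
  have hout : ∫⁻ y in (B n)ᶜ, ‖yukawa 0 (x - y)‖ₑ * ‖h y‖ₑ ≤ ε / 2 := by
    refine le_trans ?_ hn
    have := lintegral_yukawa_mul_le le_rfl (h1.1.enorm.indicator (hB n).compl) x
    rw [← lintegral_indicator (hB n).compl, ← lintegral_indicator (hB n).compl,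
      ← lintegral_indicator (hB n).compl]
    refine le_trans (le_of_eq ?_) (this.trans (le_of_eq ?_))
    · apply lintegral_congr
      intro y
      by_cases hy : y ∈ (B n)ᶜ <;> simp [hy]
    · congr 4
      ext y
      by_cases hy : y ∈ (B n)ᶜ <;> simp [hy]
  refine (enorm_yukawaConv_le 0 h x).trans ?_
  rw [hsplit, ← ENNReal.add_halves ε]
  exact add_le_add (hin'.trans hx) hout

/-- Weighted Cauchy–Schwarz and Fubini reduce this to a bound uniform in the position of a point
source. It supplies the growth condition in the definition of a resonance. -/
theorem memLp_weight_mul_yukawaConv_zero {h : E3 → ℂ} (h1 : Integrable h) {s : ℝ} (hs : 1 / 2 < s) :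
    MemLp (fun x => (((1 + ‖x‖) ^ (-s) : ℝ) : ℂ) * yukawaConv 0 h x) 2 volume := by
  obtain ⟨C, hC, hC2⟩ := lintegral_weight_mul_yukawa_zero_sq_le hs
  have hw : Measurable fun x : E3 => ENNReal.ofReal ((1 + ‖x‖) ^ (-(2 * s))) := by fun_prop
  refine memLp_two_of_lintegral ?_ ?_
  · exact (by fun_prop : Measurable fun x : E3 => (((1 + ‖x‖) ^ (-s) : ℝ) : ℂ)).aestronglyMeasurable.mul
      (stronglyMeasurable_yukawaConv 0 h1.1).aestronglyMeasurable
  have hpt : ∀ x, ‖(((1 + ‖x‖) ^ (-s) : ℝ) : ℂ) * yukawaConv 0 h x‖ₑ ^ 2 ≤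
      (∫⁻ y, ‖h y‖ₑ) * ∫⁻ y, ‖h y‖ₑ * (ENNReal.ofReal ((1 + ‖x‖) ^ (-(2 * s))) *
        ‖yukawa 0 (x - y)‖ₑ ^ 2) := fun x => by
    have e1 : ‖((1 + ‖x‖) ^ (-s) : ℝ)‖ₑ ^ 2 = ENNReal.ofReal ((1 + ‖x‖) ^ (-(2 * s))) := by
      rw [enorm_sq_eq_ofReal]
      congr 1
      rw [← Real.rpow_natCast, ← Real.rpow_mul (by positivity)]
      congr 1
      push_cast; ring
    have h3 : ‖yukawaConv 0 h x‖ₑ ^ 2 ≤ (∫⁻ y, ‖h y‖ₑ) * ∫⁻ y, ‖h y‖ₑ * ‖yukawa 0 (x - y)‖ₑ ^ 2 := by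
      refine (pow_le_pow_left' (enorm_yukawaConv_le 0 h x) 2).trans ?_
      simp_rw [mul_comm (‖yukawa 0 (x - _)‖ₑ)]
      exact lintegral_mul_sq_le_weighted h1.1.enorm (by fun_prop)
    rw [enorm_mul, enorm_ofReal_complex, mul_pow, e1]
    simp_rw [mul_left_comm (‖h _‖ₑ) (ENNReal.ofReal _)]
    rw [lintegral_const_mul' _ _ ENNReal.ofReal_ne_top, mul_left_comm]
    gcongr
  refine (lintegral_mono hpt).trans_lt ?_
  rw [lintegral_const_mul' _ _ h1.2.ne]
  refine ENNReal.mul_lt_top h1.2 ?_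
  rw [lintegral_lintegral_swap]
  · have : ∀ y, ∫⁻ x, ‖h y‖ₑ * (ENNReal.ofReal ((1 + ‖x‖) ^ (-(2 * s))) *
        ‖yukawa 0 (x - y)‖ₑ ^ 2) ≤ ‖h y‖ₑ * C := fun y => by
      rw [lintegral_const_mul' _ _ enorm_ne_top]
      gcongr
      exact hC2 y
    refine (lintegral_mono this).trans_lt ?_
    rw [lintegral_mul_const' _ _ hC]
    exact ENNReal.mul_lt_top h1.2 hC.lt_top
  · refine AEMeasurable.mul (h1.1.enorm.comp_quasiMeasurePreserving
      Measure.quasiMeasurePreserving_snd) (Measurable.aemeasurable ?_)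
    exact (hw.comp measurable_fst).mul (by fun_prop)

theorem integral_yukawaConv_zero_mul_laplacian {h : E3 → ℂ} (h1 : Integrable h) (η : 𝓢(E3, ℂ)) :
    ∫ x, yukawaConv 0 h x * Δ η x = -∫ y, h y * η y := by
  have hfin : ∫⁻ y, (∫⁻ x, ‖yukawa 0 (y - x)‖ₑ * ‖(((0 : ℝ) ^ 2 : ℝ) : ℂ) * η x - Δ η x‖ₑ) *
      ‖h y‖ₑ < ⊤ := by
    have e : ∀ x, ‖(((0 : ℝ) ^ 2 : ℝ) : ℂ) * η x - Δ η x‖ₑ = ‖Δ η x‖ₑ := fun x => by simp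
    simp_rw [e]
    set D := (ENNReal.ofReal sphereArea * ∫⁻ y, ‖Δ η y‖ₑ ^ 2) ^ (1 / 2 : ℝ) + ∫⁻ y, ‖Δ η y‖ₑ with hD
    have hD' : D ≠ ⊤ := by
      have := (Δ η).integrable (μ := volume) |>.2.ne
      have := (lintegral_enorm_sq_schwartz_lt_top (Δ η)).ne
      rw [hD]
      finiteness
    refine (lintegral_mono fun y => mul_le_mul_left (lintegral_yukawa_mul_le le_rfl
      (Δ η).continuous.measurable.enorm.aemeasurable y) _).trans_lt ?_
    rw [lintegral_const_mul' _ _ hD']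
    exact ENNReal.mul_lt_top hD'.lt_top h1.2
  have := integral_yukawaConv_mul le_rfl h1.1 η hfin
  rw [← this, ← integral_neg]
  congr 1
  ext x
  simp

theorem integral_laplacian_schwartz (η : 𝓢(E3, ℂ)) : ∫ x, Δ η x = 0 := by
  have h := fourier_laplacian_apply η 0
  rw [SchwartzMap.fourier_coe, Real.fourier_eq] at h
  simpa using h

/-- A real test function as a Schwartz function. -/
noncomputable def testSchwartz {φ : E3 → ℝ} (h1 : ContDiff ℝ (⊤ : ℕ∞) φ) (h2 : HasCompactSupport φ) :
    𝓢(E3, ℂ) :=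
  HasCompactSupport.toSchwartzMap (f := fun x => (φ x : ℂ))
    (h2.comp_left Complex.ofReal_zero) (Complex.ofRealCLM.contDiff.comp h1)

theorem testSchwartz_apply {φ : E3 → ℝ} (h1 : ContDiff ℝ (⊤ : ℕ∞) φ) (h2 : HasCompactSupport φ)
    (x : E3) : testSchwartz h1 h2 x = φ x := rfl

theorem two_le_smooth : (2 : WithTop ℕ∞) ≤ ((⊤ : ℕ∞) : WithTop ℕ∞) := by
  exact WithTop.coe_le_coe.mpr (le_top : (2 : ℕ∞) ≤ ⊤)

theorem laplacian_testSchwartz {φ : E3 → ℝ} (h1 : ContDiff ℝ (⊤ : ℕ∞) φ) (h2 : HasCompactSupport φ)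
    (x : E3) : Δ (testSchwartz h1 h2) x = ((Δ φ x : ℝ) : ℂ) := by
  rw [SchwartzMap.laplacian_apply]
  have : ContDiffAt ℝ 2 φ x := (h1.of_le two_le_smooth).contDiffAt
  exact this.laplacian_CLM_comp_left (l := Complex.ofRealCLM)

/-! ### Liouville's theorem for weakly harmonic functions vanishing at infinity -/

theorem norm_laplacian_le (f : E3 → ℝ) (x : E3) : ‖Δ f x‖ ≤ 3 * ‖iteratedFDeriv ℝ 2 f x‖ := by
  rw [InnerProductSpace.laplacian_eq_iteratedFDeriv_stdOrthonormalBasis]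
  refine (norm_sum_le _ _).trans ?_
  have h : ∀ i, ‖iteratedFDeriv ℝ 2 f x ![stdOrthonormalBasis ℝ E3 i, stdOrthonormalBasis ℝ E3 i]‖ ≤
      ‖iteratedFDeriv ℝ 2 f x‖ := fun i => by
    refine (ContinuousMultilinearMap.le_opNorm _ _).trans ?_
    simp
  refine (Finset.sum_le_sum fun i _ => h i).trans ?_
  simp

theorem exists_smooth_cutoff :
    ∃ (θ : ℕ → E3 → ℝ) (K : ℝ), (∀ n, ContDiff ℝ (⊤ : ℕ∞) (θ n)) ∧ (∀ n, HasCompactSupport (θ n)) ∧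
      (∀ (n : ℕ) x, ‖x‖ < n + 1 → θ n x = 1) ∧ ∀ n, ∀ k ≤ 2, ∀ x, ‖iteratedFDeriv ℝ k (θ n) x‖ ≤ K := by
  let b : ContDiffBump (0 : E3) := ⟨1, 2, one_pos, one_lt_two⟩
  have hb : ContDiff ℝ (⊤ : ℕ∞) (b : E3 → ℝ) := b.contDiff
  have hdec : ∀ k : ℕ, ∃ C, ∀ x, ‖iteratedFDeriv ℝ k (b : E3 → ℝ) x‖ ≤ C := fun k => by
    obtain ⟨C, hC⟩ := (b.hasCompactSupport.toSchwartzMap hb).decay' 0 k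
    refine ⟨C, fun x => ?_⟩
    have h := hC x
    rw [pow_zero, one_mul] at h
    exact h
  choose C hC using hdec
  have hscale : ∀ n : ℕ, (0 : ℝ) < ((n : ℝ) + 1)⁻¹ := fun n => by positivity
  refine ⟨fun n x => b (((n : ℝ) + 1)⁻¹ • x), max (C 0) (max (C 1) (C 2)), fun n => by fun_prop,
    fun n => b.hasCompactSupport.comp_smul (hscale n).ne', fun n x hx => ?_,
    fun n k hk x => ?_⟩
  · apply b.one_of_mem_closedBall
    rw [mem_closedBall_zero_iff, norm_smul, Real.norm_of_nonneg (hscale n).le, inv_mul_le_iff₀ (by positivity)]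
    simpa [b] using hx.le
  · rw [iteratedFDeriv_comp_const_smul _ (hb.of_le (by exact_mod_cast le_top)), norm_smul, norm_pow,
      Real.norm_of_nonneg (hscale n).le]
    have h1 : (((n : ℝ) + 1)⁻¹) ^ k ≤ 1 :=
      pow_le_one₀ (hscale n).le (inv_le_one_of_one_le₀ (by linarith [n.cast_nonneg (α := ℝ)]))
    have h2 := hC k (((n : ℝ) + 1)⁻¹ • x)
    have h3 : C k ≤ max (C 0) (max (C 1) (C 2)) := by
      interval_cases k <;> simp
    calc _ ≤ 1 * ‖iteratedFDeriv ℝ k (b : E3 → ℝ) (((n : ℝ) + 1)⁻¹ • x)‖ := by gcongr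
      _ ≤ _ := by linarith

/-- Weak harmonicity is extended from compactly supported to decaying test functions by cutoffs with
uniformly bounded derivatives. Decay of order four suffices for domination in dimension three. -/
theorem integral_laplacian_mul_eq_zero {χ : E3 → ℂ} (hχ : Continuous χ) {M : ℝ}
    (hM : ∀ x, ‖χ x‖ ≤ M)
    (hweak : ∀ φ : E3 → ℝ, ContDiff ℝ (⊤ : ℕ∞) φ → HasCompactSupport φ →
      ∫ x, ((Δ φ x : ℝ) : ℂ) * χ x = 0)
    {u : E3 → ℝ} (hu : ContDiff ℝ (⊤ : ℕ∞) u) {C : ℝ}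
    (hC : ∀ k ≤ 2, ∀ x, (1 + ‖x‖) ^ 4 * ‖iteratedFDeriv ℝ k u x‖ ≤ C) :
    ∫ x, ((Δ u x : ℝ) : ℂ) * χ x = 0 := by
  obtain ⟨θ, K, hθ, hθc, hθ1, hθK⟩ := exists_smooth_cutoff
  have hK0 : 0 ≤ K := (norm_nonneg _).trans (hθK 0 0 (by norm_num) 0)
  have hM0 : 0 ≤ M := (norm_nonneg _).trans (hM 0)
  have hfun : ∀ n, ContDiff ℝ (⊤ : ℕ∞) (fun x => θ n x * u x) := fun n => (hθ n).mul hu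
  have hzero : ∀ n, ∫ x, ((Δ (fun x => θ n x * u x) x : ℝ) : ℂ) * χ x = 0 := fun n =>
    hweak _ (hfun n) ((hθc n).mul_right)
  -- The factor `12` is `3` from bounding the Laplacian by the Hessian, times `4 = 1 + 2 + 1` from
  -- the Leibniz rule.
  have hdom : ∀ n x, ‖((Δ (fun x => θ n x * u x) x : ℝ) : ℂ) * χ x‖ ≤
      12 * K * C * M * (1 + ‖x‖) ^ (-(4 : ℝ)) := fun n x => by
    have hpos : 0 < (1 + ‖x‖) ^ 4 := by positivity
    have hD : ∀ k ≤ 2, ‖iteratedFDeriv ℝ k u x‖ ≤ C * ((1 + ‖x‖) ^ 4)⁻¹ := fun k hk => by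
      rw [← div_eq_mul_inv, le_div_iff₀ hpos, mul_comm]; exact hC k hk x
    have h2 := norm_iteratedFDeriv_mul_le ((hθ n).of_le two_le_smooth) (hu.of_le two_le_smooth) x
      (n := 2) (by norm_num)
    have h3 : ‖iteratedFDeriv ℝ 2 (fun x => θ n x * u x) x‖ ≤ 4 * K * (C * ((1 + ‖x‖) ^ 4)⁻¹) := by
      refine h2.trans ?_
      have hi : ∀ i ∈ Finset.range (2 + 1), ((2 : ℕ).choose i : ℝ) * ‖iteratedFDeriv ℝ i (θ n) x‖ *
          ‖iteratedFDeriv ℝ (2 - i) u x‖ ≤ ((2 : ℕ).choose i : ℝ) * K * (C * ((1 + ‖x‖) ^ 4)⁻¹) := by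
        intro i hi
        have hi' : i ≤ 2 := by simpa [Nat.lt_succ_iff] using hi
        have a1 := hθK n i hi' x
        have a2 := hD (2 - i) (by omega)
        gcongr
      refine (Finset.sum_le_sum hi).trans (le_of_eq ?_)
      simp [Finset.sum_range_succ, Nat.choose]
      ring
    rw [norm_mul, Complex.norm_real, Real.rpow_neg (by positivity)]
    have h4 := norm_laplacian_le (fun x => θ n x * u x) x
    have h5 : (1 + ‖x‖) ^ (4 : ℝ) = (1 + ‖x‖) ^ 4 := by exact_mod_cast Real.rpow_natCast (1 + ‖x‖) 4
    rw [h5]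
    calc _ ≤ (3 * (4 * K * (C * ((1 + ‖x‖) ^ 4)⁻¹))) * M := by
            have h6 := h4.trans (mul_le_mul_of_nonneg_left h3 zero_le_three)
            exact mul_le_mul h6 (hM x) (norm_nonneg _) ((norm_nonneg _).trans h6)
      _ = _ := by ring
  have hbint : Integrable fun x : E3 => 12 * K * C * M * (1 + ‖x‖) ^ (-(4 : ℝ)) :=
    (integrable_one_add_norm (by simp; norm_num)).const_mul _
  have hlc : ∀ {v : E3 → ℝ}, ContDiff ℝ (⊤ : ℕ∞) v → Continuous (Δ v) := fun {v} hv => by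
    rw [InnerProductSpace.laplacian_eq_iteratedFDeriv_stdOrthonormalBasis]
    have := hv.continuous_iteratedFDeriv (m := 2) (by exact_mod_cast two_le_smooth)
    fun_prop
  have hlim := tendsto_integral_of_dominated_convergence _
    (F := fun (n : ℕ) x => ((Δ (fun x => θ n x * u x) x : ℝ) : ℂ) * χ x)
    (f := fun x => ((Δ u x : ℝ) : ℂ) * χ x)
    (fun n => ((Complex.continuous_ofReal.comp (hlc (hfun n))).mul hχ).aestronglyMeasurable) hbint
    (fun n => Eventually.of_forall (hdom n)) (Eventually.of_forall fun x => by
      apply tendsto_const_nhds.congr'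
      filter_upwards [eventually_ge_atTop ⌈‖x‖⌉₊] with n hn
      have hx : ‖x‖ < n + 1 := lt_of_le_of_lt (Nat.ceil_le.mp hn) (lt_add_one _)
      have : (fun x => θ n x * u x) =ᶠ[𝓝 x] u := by
        filter_upwards [continuous_norm.continuousAt.eventually_lt continuousAt_const hx] with y hy
        rw [hθ1 n y hy, one_mul]
      rw [(InnerProductSpace.laplacian_congr_nhds this).eq_of_nhds])
  simp_rw [hzero] at hlim
  exact tendsto_nhds_unique hlim tendsto_const_nhds

theorem integral_laplacian_schwartz_mul_eq_zero {χ : E3 → ℂ} (hχ : Continuous χ) {M : ℝ}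
    (hM : ∀ x, ‖χ x‖ ≤ M)
    (hweak : ∀ φ : E3 → ℝ, ContDiff ℝ (⊤ : ℕ∞) φ → HasCompactSupport φ →
      ∫ x, ((Δ φ x : ℝ) : ℂ) * χ x = 0) (η : 𝓢(E3, ℂ)) :
    ∫ x, Δ η x * χ x = 0 := by
  have hη : ContDiff ℝ (⊤ : ℕ∞) η := η.smooth ⊤
  have hη2 : ∀ x, ContDiffAt ℝ 2 η x := fun x => (hη.of_le two_le_smooth).contDiffAt
  have hpart : ∀ l : ℂ →L[ℝ] ℝ, ∫ x, ((l (Δ η x) : ℝ) : ℂ) * χ x = 0 := fun l => by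
    have hl : ∀ x, l (Δ η x) = Δ (l ∘ η) x := fun x => by
      rw [SchwartzMap.laplacian_apply, (hη2 x).laplacian_CLM_comp_left]; rfl
    simp_rw [hl]
    refine integral_laplacian_mul_eq_zero hχ hM hweak (l.contDiff.comp hη)
      (C := ‖l‖ * (2 ^ 4 * ((Finset.Iic (4, 2)).sup
        (fun m : ℕ × ℕ => SchwartzMap.seminorm ℝ m.1 m.2)) η)) fun k hk x => ?_
    have h1 := SchwartzMap.one_add_le_sup_seminorm_apply (𝕜 := ℝ) (m := (4, 2)) (k := 4) (n := k)
      le_rfl hk η x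
    have h2 : ‖iteratedFDeriv ℝ k (l ∘ η) x‖ ≤ ‖l‖ * ‖iteratedFDeriv ℝ k η x‖ :=
      l.norm_iteratedFDeriv_comp_left (hη.of_le (by exact_mod_cast le_top)).contDiffAt le_rfl
    calc _ ≤ (1 + ‖x‖) ^ 4 * (‖l‖ * ‖iteratedFDeriv ℝ k η x‖) := by gcongr
      _ = ‖l‖ * ((1 + ‖x‖) ^ 4 * ‖iteratedFDeriv ℝ k η x‖) := by ring
      _ ≤ _ := by gcongr
  have hint : ∀ l : ℂ →L[ℝ] ℝ, Integrable fun x => ((l (Δ η x) : ℝ) : ℂ) * χ x := fun l => by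
    have hi : Integrable fun x => ((l (Δ η x) : ℝ) : ℂ) :=
      (l.integrable_comp (Δ η).integrable).ofReal
    exact hi.mul_bdd (c := M) hχ.aestronglyMeasurable (Eventually.of_forall hM)
  have e : ∀ x, Δ η x * χ x = ((Complex.reCLM (Δ η x) : ℝ) : ℂ) * χ x +
      Complex.I * (((Complex.imCLM (Δ η x) : ℝ) : ℂ) * χ x) := fun x => by
    nth_rewrite 1 [← Complex.re_add_im (Δ η x)]
    simp only [Complex.reCLM_apply, Complex.imCLM_apply]
    ring
  simp_rw [e]
  rw [integral_add (hint _) ((hint _).const_mul _), integral_const_mul, hpart, hpart]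
  simp

theorem integral_yukawa {κ : ℝ} (hκ : 0 < κ) : κ ^ 2 * ∫ x, yukawa κ x = ∫ x, yukawa 1 x := by
  have h : ∀ x, yukawa κ x = κ * yukawa 1 (κ • x) := fun x => by
    have := yukawa_scale 1 (inv_pos.mpr hκ) x
    rw [inv_inv, one_div, inv_inv] at this
    exact this.symm
  simp_rw [h]
  rw [integral_const_mul, Measure.integral_comp_smul]
  simp only [finrank_euclideanSpace, Fintype.card_fin, smul_eq_mul]
  rw [abs_of_pos (by positivity)]
  field_simp

theorem integrable_yukawa_sub {κ : ℝ} (hκ : 0 < κ) (x : E3) :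
    Integrable fun y => yukawa κ (x - y) :=
  (integrable_yukawa hκ).comp_sub_left x

theorem integral_yukawa_sub {κ : ℝ} (x : E3) : ∫ y, yukawa κ (x - y) = ∫ y, yukawa κ y :=
  integral_sub_left_eq_self (yukawa κ) volume x

theorem norm_yukawaConv_le_of_bounded {κ : ℝ} (hκ : 0 < κ) {χ : E3 → ℂ} {M : ℝ}
    (hM : ∀ x, ‖χ x‖ ≤ M) (x : E3) : ‖yukawaConv κ χ x‖ ≤ M * ∫ y, yukawa κ y := by
  rw [← integral_yukawa_sub x, ← integral_const_mul]
  refine norm_integral_le_of_norm_le ((integrable_yukawa_sub hκ x).const_mul M)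
    (Eventually.of_forall fun y => ?_)
  rw [norm_mul, Complex.norm_real, Real.norm_of_nonneg (yukawa_nonneg _ _), mul_comm]
  exact mul_le_mul_of_nonneg_right (hM y) (yukawa_nonneg _ _)

/-- Harmonicity gives `(κ² - Δ) χ = κ² χ`, and inverting the operator expresses `χ` through itself,
for every `κ > 0` at once. By scaling, the mass of the kernel `κ² G_κ` is independent of `κ`. -/
theorem ae_eq_yukawaConv_of_weakly_harmonic {χ : E3 → ℂ} (hχ : Continuous χ) {M : ℝ}
    (hM : ∀ x, ‖χ x‖ ≤ M)
    (hweak : ∀ φ : E3 → ℝ, ContDiff ℝ (⊤ : ℕ∞) φ → HasCompactSupport φ →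
      ∫ x, ((Δ φ x : ℝ) : ℂ) * χ x = 0) {κ : ℝ} (hκ : 0 < κ) :
    ∀ᵐ x, χ x = ((κ ^ 2 : ℝ) : ℂ) * yukawaConv κ χ x := by
  have hsm := (stronglyMeasurable_yukawaConv κ hχ.aestronglyMeasurable).aestronglyMeasurable
    (μ := volume)
  have hbd := norm_yukawaConv_le_of_bounded hκ hM
  have hM0 : 0 ≤ M := (norm_nonneg _).trans (hM 0)
  refine ae_eq_of_integral_contDiff_smul_eq hχ.locallyIntegrable ?_ fun g hg hgc => ?_
  · refine (locallyIntegrable_const (((κ ^ 2 : ℝ) : ℂ) * ((M * ∫ y, yukawa κ y : ℝ) : ℂ))).mono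
      (hsm.const_mul _) (Eventually.of_forall fun x => ?_)
    rw [norm_mul, norm_mul]
    gcongr
    refine (hbd x).trans ?_
    rw [Complex.norm_real]
    exact Real.le_norm_self _
  set ζ := testSchwartz hg hgc
  obtain ⟨η, hη⟩ := exists_sub_laplacian_eq hκ ζ
  have hfin : ∫⁻ y, (∫⁻ x, ‖yukawa κ (y - x)‖ₑ * ‖((κ ^ 2 : ℝ) : ℂ) * η x - Δ η x‖ₑ) * ‖χ y‖ₑ < ⊤ := by
    simp_rw [hη]
    have hz : Measurable fun x => ‖ζ x‖ₑ := ζ.continuous.measurable.enorm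
    have hm : Measurable fun q : E3 × E3 => ‖yukawa κ (q.1 - q.2)‖ₑ * ‖ζ q.2‖ₑ :=
      (by fun_prop : Measurable fun q : E3 × E3 => ‖yukawa κ (q.1 - q.2)‖ₑ).mul
        (hz.comp measurable_snd)
    have hb : ∀ y, (∫⁻ x, ‖yukawa κ (y - x)‖ₑ * ‖ζ x‖ₑ) * ‖χ y‖ₑ ≤
        (∫⁻ x, ‖yukawa κ (y - x)‖ₑ * ‖ζ x‖ₑ) * ENNReal.ofReal M := fun y => by
      gcongr
      rw [← ofReal_norm]
      exact ENNReal.ofReal_le_ofReal (hM y)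
    refine (lintegral_mono hb).trans_lt ?_
    rw [lintegral_mul_const' _ _ ENNReal.ofReal_ne_top, lintegral_lintegral_swap hm.aemeasurable]
    refine ENNReal.mul_lt_top ?_ ENNReal.ofReal_lt_top
    have : ∀ y, ∫⁻ x, ‖yukawa κ (x - y)‖ₑ * ‖ζ y‖ₑ = (∫⁻ x, ‖yukawa κ x‖ₑ) * ‖ζ y‖ₑ := fun y => by
      rw [lintegral_mul_const' _ _ enorm_ne_top,
        lintegral_sub_right_eq_self (fun x => ‖yukawa κ x‖ₑ) y]
    simp_rw [this]
    rw [lintegral_const_mul _ hz]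
    exact ENNReal.mul_lt_top (lintegral_yukawa_lt_top hκ) ζ.integrable.2
  have h1 := integral_yukawaConv_mul hκ.le hχ.aestronglyMeasurable η hfin
  simp_rw [hη] at h1
  have h2 := integral_laplacian_schwartz_mul_eq_zero hχ hM hweak η
  have i1 : Integrable fun x => χ x * η x := by
    simpa only [mul_comm] using
      η.integrable.mul_bdd (c := M) hχ.aestronglyMeasurable (Eventually.of_forall hM)
  have i2 : Integrable fun x => Δ η x * χ x :=
    (Δ η).integrable.mul_bdd (c := M) hχ.aestronglyMeasurable (Eventually.of_forall hM)
  have e1 : ∀ x, g x • χ x = ((κ ^ 2 : ℝ) : ℂ) * (χ x * η x) - Δ η x * χ x := fun x => by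
    have : ((g x : ℝ) : ℂ) = ζ x := rfl
    rw [Complex.real_smul, this, ← hη]
    ring
  have e2 : ∀ x, g x • (((κ ^ 2 : ℝ) : ℂ) * yukawaConv κ χ x) =
      ((κ ^ 2 : ℝ) : ℂ) * (yukawaConv κ χ x * ζ x) := fun x => by
    have : ((g x : ℝ) : ℂ) = ζ x := rfl
    rw [Complex.real_smul, this]
    ring
  simp_rw [e1, e2]
  rw [integral_sub (i1.const_mul _) i2, integral_const_mul, integral_const_mul, h1, h2, sub_zero]

/-- A weakly harmonic continuous function vanishing at infinity is zero. -/
theorem eq_zero_of_weakly_harmonic {χ : E3 → ℂ} (hχ : Continuous χ)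
    (hlim : Tendsto χ (cocompact E3) (𝓝 0))
    (hweak : ∀ φ : E3 → ℝ, ContDiff ℝ (⊤ : ℕ∞) φ → HasCompactSupport φ →
      ∫ x, ((Δ φ x : ℝ) : ℂ) * χ x = 0) : χ = 0 := by
  obtain ⟨M, hM⟩ : ∃ M, ∀ x, ‖χ x‖ ≤ M := by
    let f : ZeroAtInftyContinuousMap E3 ℂ := ⟨⟨χ, hχ⟩, hlim⟩
    exact ⟨‖f.toBCF‖, fun x => f.toBCF.norm_coe_le_norm x⟩
  have hM0 : 0 ≤ M := (norm_nonneg _).trans (hM 0)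
  have hae : ∀ᵐ x, ∀ n : ℕ, χ x = (((1 / ((n : ℝ) + 1)) ^ 2 : ℝ) : ℂ) *
      yukawaConv (1 / ((n : ℝ) + 1)) χ x :=
    ae_all_iff.mpr fun n => ae_eq_yukawaConv_of_weakly_harmonic hχ hM hweak (by positivity)
  have hzero : χ =ᵐ[volume] 0 := by
    filter_upwards [hae] with x hx
    set c := ∫ y, yukawa 1 y
    have hc : 0 ≤ c := integral_nonneg fun y => yukawa_nonneg _ _
    -- As `κ → 0` the mass of `κ² G_κ` escapes to infinity, where `χ` is small. The part outside a
    -- large ball contributes at most `ε c`, and the part inside is `O(κ²)` because `G_κ ≤ G_0` is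
    -- locally integrable.
    have key : ∀ ε : ℝ, 0 < ε → ‖χ x‖ ≤ ε * c := by
      intro ε hε
      obtain ⟨R, hR⟩ : ∃ R : ℝ, ∀ y : E3, R < ‖y‖ → ‖χ y‖ ≤ ε := by
        have h1 := (hlim.norm).eventually_le_const (show ‖(0 : ℂ)‖ < ε by simpa using hε)
        rw [← Metric.cobounded_eq_cocompact, ← comap_norm_atTop, eventually_comap] at h1
        obtain ⟨R, hR⟩ := eventually_atTop.mp h1
        exact ⟨R, fun y hy => hR ‖y‖ hy.le y rfl⟩
      set s : Set E3 := Metric.closedBall 0 R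
      have hs : MeasurableSet s := Metric.isClosed_closedBall.measurableSet
      set ind : E3 → ℂ := s.indicator fun _ => 1
      have hi1 : Integrable ind := (integrable_indicator_iff hs).mpr
        (integrableOn_const (isCompact_closedBall 0 R).measure_lt_top.ne)
      have hi2 : ∫⁻ y, ‖ind y‖ₑ ^ 2 < ⊤ := by
        refine lt_of_eq_of_lt (lintegral_congr fun y => ?_) hi1.2
        by_cases hy : y ∈ s <;> simp [ind, hy]
      have hiY : Integrable fun y => yukawa 0 (x - y) * ‖ind y‖ := by
        have := (integrable_yukawa_mul le_rfl hi1 hi2 x).norm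
        simpa [abs_of_nonneg (yukawa_nonneg _ _)] using this
      set D := ∫ y, yukawa 0 (x - y) * ‖ind y‖
      have hb : ∀ n : ℕ, ‖χ x‖ ≤ ε * c + (1 / ((n : ℝ) + 1)) ^ 2 * (M * D) := by
        intro n
        set κ := 1 / ((n : ℝ) + 1)
        have hκ : 0 < κ := by positivity
        rw [hx n, norm_mul, Complex.norm_real, Real.norm_of_nonneg (by positivity)]
        have h1 : ‖yukawaConv κ χ x‖ ≤ ε * (∫ y, yukawa κ y) + M * D := by
          rw [← integral_yukawa_sub x, ← integral_const_mul, ← integral_const_mul,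
            ← integral_add ((integrable_yukawa_sub hκ x).const_mul ε) (hiY.const_mul M)]
          refine norm_integral_le_of_norm_le
            (((integrable_yukawa_sub hκ x).const_mul ε).add (hiY.const_mul M))
            (Eventually.of_forall fun y => ?_)
          have hy0 := yukawa_nonneg κ (x - y)
          have hy1 := yukawa_nonneg 0 (x - y)
          rw [norm_mul, Complex.norm_real, Real.norm_of_nonneg hy0]
          by_cases hy : y ∈ s
          · have h3 := yukawa_le_yukawa_zero hκ.le (x - y)
            have h4 : yukawa κ (x - y) * ‖χ y‖ ≤ yukawa 0 (x - y) * M :=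
              mul_le_mul h3 (hM y) (norm_nonneg _) hy1
            simp only [ind, Set.indicator_of_mem hy, norm_one]
            nlinarith [mul_nonneg hε.le hy0]
          · have h3 := hR y (by simpa [s] using hy)
            simp only [ind, Set.indicator_of_notMem hy, norm_zero]
            nlinarith [mul_le_mul_of_nonneg_left h3 hy0]
        calc κ ^ 2 * ‖yukawaConv κ χ x‖ ≤ κ ^ 2 * (ε * (∫ y, yukawa κ y) + M * D) := by gcongr
          _ = ε * (κ ^ 2 * ∫ y, yukawa κ y) + κ ^ 2 * (M * D) := by ring
          _ = _ := by rw [integral_yukawa hκ]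
      have hl : Tendsto (fun n : ℕ => ε * c + (1 / ((n : ℝ) + 1)) ^ 2 * (M * D)) atTop
          (𝓝 (ε * c + 0 ^ 2 * (M * D))) :=
        ((tendsto_one_div_add_atTop_nhds_zero_nat.pow 2).mul_const _).const_add _
      have := ge_of_tendsto' hl hb
      simpa using this
    have h0 : ‖χ x‖ ≤ 0 := by
      refine le_of_forall_pos_le_add fun δ hδ => ?_
      refine (key (δ / (c + 1)) (by positivity)).trans ?_
      rw [zero_add, div_mul_eq_mul_div, div_le_iff₀ (by positivity)]
      nlinarith
    simpa using h0
  exact (Continuous.ae_eq_iff_eq volume hχ continuous_zero).mp hzero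

/-! ### Factorization of the potential -/

/-- The bounded factor `min(|V|, 1)^{1/2}` of a potential. -/
noncomputable def potB (V : E3 → ℝ) (x : E3) : ℝ := √(min |V x| 1)

/-- The complementary factor of a potential, with `potA V * potB V = V`. -/
noncomputable def potA (V : E3 → ℝ) (x : E3) : ℝ := V x / potB V x

section factors

variable (V : E3 → ℝ) (x : E3)

theorem sq_potB : potB V x ^ 2 = min |V x| 1 :=
  Real.sq_sqrt (le_min (abs_nonneg _) zero_le_one)

theorem potA_mul_potB : potA V x * potB V x = V x := by
  by_cases h : potB V x = 0
  · have h2 := sq_potB V x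
    rw [h] at h2
    have h3 : |V x| = 0 := by
      rcases min_choice |V x| 1 with h4 | h4 <;> rw [h4] at h2
      · simpa using h2.symm
      · norm_num at h2
    rw [h, mul_zero, abs_eq_zero.mp h3]
  · exact div_mul_cancel₀ _ h

theorem enorm_potB_le_one : ‖potB V x‖ₑ ≤ 1 := by
  rw [potB, Real.enorm_eq_ofReal (Real.sqrt_nonneg _), ENNReal.ofReal_le_one, Real.sqrt_le_one]
  exact min_le_right _ _

theorem enorm_potB_sq_le : ‖potB V x‖ₑ ^ 2 ≤ ‖V x‖ₑ := by
  rw [enorm_sq_eq_ofReal, sq_potB, ← ofReal_norm]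
  exact ENNReal.ofReal_le_ofReal (min_le_left _ _)

/-- Where `V` is nonzero the square is `|V|` if `|V| ≤ 1` and `V²` otherwise. The uneven
factorization keeps `potB` bounded, so that `potB V * g` stays in `L²` for `g ∈ L²` and has a
continuous Newtonian potential, at the cost of needing only `V ∈ L¹ ∩ L²` for `potA`. -/
theorem enorm_potA_sq_le : ‖potA V x‖ₑ ^ 2 ≤ ‖V x‖ₑ + ‖V x‖ₑ ^ 2 := by
  rw [enorm_sq_eq_ofReal, enorm_sq_eq_ofReal, ← ofReal_norm,
    ← ENNReal.ofReal_add (norm_nonneg _) (sq_nonneg _)]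
  apply ENNReal.ofReal_le_ofReal
  rw [potA, div_pow, sq_potB, Real.norm_eq_abs, ← sq_abs (V x)]
  rcases le_total |V x| 1 with h | h
  · rw [min_eq_left h]
    by_cases h0 : |V x| = 0
    · simp [h0]
    · rw [sq, mul_div_cancel_right₀ _ h0]
      nlinarith [sq_nonneg |V x|]
  · rw [min_eq_right h, div_one]
    linarith [abs_nonneg (V x)]

end factors

theorem measurable_potB {V : E3 → ℝ} (hV : Measurable V) : Measurable (potB V) := by
  unfold potB; fun_prop

theorem measurable_potA {V : E3 → ℝ} (hV : Measurable V) : Measurable (potA V) :=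
  hV.div (measurable_potB hV)

/-! ### Admissible potentials and the Birman–Schwinger operator -/

/-- The class of potentials considered: measurable, with a fourth moment, in `L³`. -/
structure IsAdmissible (V : E3 → ℝ) : Prop where
  measurable : Measurable V
  integrable_moment : Integrable (fun x => (1 + ‖x‖ ^ 4) * V x) volume
  memLp : MemLp V 3 volume

namespace IsAdmissible

variable {V : E3 → ℝ} (hV : IsAdmissible V)

include hV

theorem lintegral_moment_lt_top : ∫⁻ x, ENNReal.ofReal (1 + ‖x‖ ^ 4) * ‖V x‖ₑ < ⊤ := by
  refine lt_of_eq_of_lt (lintegral_congr fun x => ?_) hV.integrable_moment.2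
  rw [enorm_mul, Real.enorm_eq_ofReal (by positivity : 0 ≤ 1 + ‖x‖ ^ 4)]

theorem lintegral_cube_lt_top : ∫⁻ x, ‖V x‖ₑ ^ 3 < ⊤ := by
  have h := hV.memLp.2
  rw [eLpNorm_lt_top_iff_lintegral_rpow_enorm_lt_top (by norm_num) (by norm_num)] at h
  simpa using h

theorem lintegral_one_add_norm_lt_top :
    ∫⁻ x, ENNReal.ofReal (1 + ‖x‖) * ‖V x‖ₑ < ⊤ := by
  refine lt_of_le_of_lt ?_ (ENNReal.mul_lt_top ENNReal.ofReal_lt_top hV.lintegral_moment_lt_top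
    : ENNReal.ofReal 2 * _ < ⊤)
  rw [← lintegral_const_mul' _ _ ENNReal.ofReal_ne_top]
  refine lintegral_mono fun x => ?_
  rw [← mul_assoc, ← ENNReal.ofReal_mul zero_le_two]
  gcongr
  nlinarith [sq_nonneg (‖x‖ - 1), sq_nonneg (‖x‖ ^ 2 - 1), norm_nonneg x]

theorem lintegral_lt_top : ∫⁻ x, ‖V x‖ₑ < ⊤ := by
  refine lt_of_le_of_lt (lintegral_mono fun x => ?_) hV.lintegral_one_add_norm_lt_top
  exact le_mul_of_one_le_left' (ENNReal.one_le_ofReal.mpr (by linarith [norm_nonneg x]))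

theorem integrable : Integrable V :=
  ⟨hV.measurable.aestronglyMeasurable, hV.lintegral_lt_top⟩

/-- This is where cube integrability enters: Young's inequality `(1 + ‖x‖)|V| ≤ 2(1 + ‖x‖⁴) + |V|²`,
multiplied by `|V|`, interpolates between the fourth moment and `L³`. -/
theorem lintegral_one_add_norm_mul_sq_lt_top :
    ∫⁻ x, ENNReal.ofReal (1 + ‖x‖) * ‖V x‖ₑ ^ 2 < ⊤ := by
  have hb : ∀ x, ENNReal.ofReal (1 + ‖x‖) * ‖V x‖ₑ ^ 2 ≤
      ENNReal.ofReal 2 * (ENNReal.ofReal (1 + ‖x‖ ^ 4) * ‖V x‖ₑ) + ‖V x‖ₑ ^ 3 := fun x => by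
    rw [enorm_sq_eq_ofReal, ← ofReal_norm, ← ENNReal.ofReal_mul (by positivity),
      ← ENNReal.ofReal_mul (by positivity), ← ENNReal.ofReal_mul (by positivity),
      ← ENNReal.ofReal_pow (by positivity), ← ENNReal.ofReal_add (by positivity) (by positivity)]
    apply ENNReal.ofReal_le_ofReal
    rw [← sq_abs (V x), Real.norm_eq_abs]
    have hv := abs_nonneg (V x)
    have h1 : (1 + ‖x‖) * |V x| ≤ 2 * (1 + ‖x‖ ^ 4) + |V x| ^ 2 := by
      nlinarith [sq_nonneg (‖x‖ ^ 2 - 1), sq_nonneg (1 + ‖x‖ - |V x|), sq_nonneg (‖x‖ - 1),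
        norm_nonneg x]
    nlinarith [mul_le_mul_of_nonneg_left h1 hv]
  refine (lintegral_mono hb).trans_lt ?_
  rw [lintegral_add_right _ (by have := hV.measurable; fun_prop),
    lintegral_const_mul' _ _ ENNReal.ofReal_ne_top]
  exact ENNReal.add_lt_top.mpr ⟨ENNReal.mul_lt_top ENNReal.ofReal_lt_top
    hV.lintegral_moment_lt_top, hV.lintegral_cube_lt_top⟩

theorem lintegral_sq_lt_top : ∫⁻ x, ‖V x‖ₑ ^ 2 < ⊤ := by
  refine lt_of_le_of_lt (lintegral_mono fun x => ?_) hV.lintegral_one_add_norm_mul_sq_lt_top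
  exact le_mul_of_one_le_left' (ENNReal.one_le_ofReal.mpr (by linarith [norm_nonneg x]))

theorem lintegral_potA_lt_top :
    ∫⁻ x, ENNReal.ofReal (1 + ‖x‖) * ‖potA V x‖ₑ ^ 2 < ⊤ := by
  have h : ∀ x, ENNReal.ofReal (1 + ‖x‖) * ‖potA V x‖ₑ ^ 2 ≤
      ENNReal.ofReal (1 + ‖x‖) * ‖V x‖ₑ + ENNReal.ofReal (1 + ‖x‖) * ‖V x‖ₑ ^ 2 := fun x => by
    rw [← mul_add]
    gcongr
    exact enorm_potA_sq_le V x
  refine (lintegral_mono h).trans_lt ?_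
  rw [lintegral_add_right _ (by have := hV.measurable; fun_prop)]
  exact ENNReal.add_lt_top.mpr ⟨hV.lintegral_one_add_norm_lt_top,
    hV.lintegral_one_add_norm_mul_sq_lt_top⟩

theorem lintegral_potA_sq_lt_top : ∫⁻ x, ‖potA V x‖ₑ ^ 2 < ⊤ := by
  refine lt_of_le_of_lt (lintegral_mono fun x => ?_) hV.lintegral_potA_lt_top
  exact le_mul_of_one_le_left' (ENNReal.one_le_ofReal.mpr (by linarith [norm_nonneg x]))

theorem lintegral_potB_sq_lt_top : ∫⁻ x, ‖potB V x‖ₑ ^ 2 < ⊤ :=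
  (lintegral_mono fun x => enorm_potB_sq_le V x).trans_lt hV.lintegral_lt_top

theorem memLp_potA : MemLp (fun x => (potA V x : ℂ)) 2 volume :=
  (memLp_two_of_lintegral (measurable_potA hV.measurable).aestronglyMeasurable
    hV.lintegral_potA_sq_lt_top).ofReal

/-- If `g ∈ L²` then `potB V * g ∈ L¹`. -/
theorem integrable_potB_mul {g : E3 → ℂ} (hg : AEStronglyMeasurable g volume)
    (hg2 : ∫⁻ x, ‖g x‖ₑ ^ 2 < ⊤) : Integrable fun x => (potB V x : ℂ) * g x :=
  integrable_mul_of_lintegral_sq (measurable_potB hV.measurable).aemeasurable hg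
    hV.lintegral_potB_sq_lt_top hg2

omit hV in
theorem lintegral_potB_mul_sq_le (V : E3 → ℝ) (g : E3 → ℂ) :
    ∫⁻ x, ‖(potB V x : ℂ) * g x‖ₑ ^ 2 ≤ ∫⁻ x, ‖g x‖ₑ ^ 2 := by
  refine lintegral_mono fun x => ?_
  rw [enorm_mul, enorm_ofReal_complex]
  exact pow_le_pow_left' (mul_le_of_le_one_left' (enorm_potB_le_one V x)) 2

/-- Close to `x` the factor is at most `1` and the kernel is locally square integrable; farther away
the kernel is at most `1` and the factor is in `L²`. Uniformity in `x` makes the scattering kernel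
Hilbert–Schmidt. -/
theorem lintegral_yukawa_sq_mul_potB_le {κ : ℝ} (hκ : 0 ≤ κ) (x : E3) :
    ∫⁻ y, ‖yukawa κ (x - y)‖ₑ ^ 2 * ‖potB V y‖ₑ ^ 2 ≤
      ENNReal.ofReal (sphereArea / (16 * Real.pi ^ 2) * 1) + ∫⁻ y, ‖potB V y‖ₑ ^ 2 := by
  have hball : MeasurableSet (Metric.ball x 1) := Metric.isOpen_ball.measurableSet
  have hpt : ∀ y, ‖yukawa κ (x - y)‖ₑ ^ 2 * ‖potB V y‖ₑ ^ 2 ≤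
      (Metric.ball (0 : E3) 1).indicator (fun y => ‖yukawa 0 y‖ₑ ^ 2) (x - y) + ‖potB V y‖ₑ ^ 2 := by
    intro y
    have hle : ‖yukawa κ (x - y)‖ₑ ≤ ‖yukawa 0 (x - y)‖ₑ := by
      rw [Real.enorm_eq_ofReal (yukawa_nonneg _ _), Real.enorm_eq_ofReal (yukawa_nonneg _ _)]
      exact ENNReal.ofReal_le_ofReal (yukawa_le_yukawa_zero hκ _)
    by_cases hy : x - y ∈ Metric.ball (0 : E3) 1
    · rw [Set.indicator_of_mem hy]
      refine le_trans ?_ le_self_add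
      refine (mul_le_of_le_one_right' (pow_le_one' (enorm_potB_le_one V y) 2)).trans ?_
      exact pow_le_pow_left' hle 2
    · refine le_trans ?_ le_add_self
      refine mul_le_of_le_one_left' (pow_le_one' (hle.trans ?_) 2)
      have hy' : 1 ≤ ‖x - y‖ := by simpa using hy
      rw [Real.enorm_eq_ofReal (yukawa_nonneg _ _), yukawa_zero_apply, ENNReal.ofReal_le_one,
        div_le_one (by positivity)]
      nlinarith [Real.pi_gt_three]
  refine (lintegral_mono hpt).trans ?_
  have hm : Measurable fun y => ‖potB V y‖ₑ ^ 2 := by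
    have := measurable_potB hV.measurable; fun_prop
  rw [lintegral_add_right _ hm,
    lintegral_sub_left_eq_self ((Metric.ball (0 : E3) 1).indicator fun y => ‖yukawa 0 y‖ₑ ^ 2) x,
    lintegral_indicator Metric.isOpen_ball.measurableSet,
    lintegral_ball_yukawa_zero_sq 1 zero_le_one]

theorem measurable_scatteringKernel :
    Measurable (Function.uncurry fun x y : E3 => potA V x * yukawa 0 (x - y) * potB V y) := by
  have h1 := measurable_potA hV.measurable
  have h2 := measurable_potB hV.measurable
  unfold Function.uncurry; fun_prop

theorem lintegral_scatteringKernel_lt_top :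
    ∫⁻ x, ∫⁻ y, ‖potA V x * yukawa 0 (x - y) * potB V y‖ₑ ^ 2 < ⊤ := by
  have h : ∀ x, ∫⁻ y, ‖potA V x * yukawa 0 (x - y) * potB V y‖ₑ ^ 2 ≤ ‖potA V x‖ₑ ^ 2 *
      (ENNReal.ofReal (sphereArea / (16 * Real.pi ^ 2) * 1) + ∫⁻ y, ‖potB V y‖ₑ ^ 2) := fun x => by
    simp_rw [enorm_mul, mul_pow, mul_assoc]
    rw [lintegral_const_mul' _ _ (by finiteness)]
    gcongr
    exact hV.lintegral_yukawa_sq_mul_potB_le le_rfl x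
  have hB := hV.lintegral_potB_sq_lt_top
  refine (lintegral_mono h).trans_lt ?_
  rw [lintegral_mul_const' _ _ (by finiteness)]
  exact ENNReal.mul_lt_top hV.lintegral_potA_sq_lt_top (by finiteness)

/-- The Birman–Schwinger operator at zero energy. -/
noncomputable def scatteringOp : L2 →L[ℂ] L2 :=
  kernelOp hV.measurable_scatteringKernel hV.lintegral_scatteringKernel_lt_top

theorem coeFn_scatteringOp (g : L2) : hV.scatteringOp g =ᵐ[volume] fun x =>
    (potA V x : ℂ) * yukawaConv 0 (fun y => (potB V y : ℂ) * g y) x := by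
  filter_upwards [coeFn_kernelOp hV.measurable_scatteringKernel
    hV.lintegral_scatteringKernel_lt_top g] with x hx
  rw [scatteringOp, hx, yukawaConv, ← integral_const_mul]
  congr 1
  ext y
  push_cast
  ring

/-! ### Zero-energy solutions -/

theorem integrable_mul_of_bounded {φ : E3 → ℂ} (hφ : Continuous φ) {M : ℝ}
    (hM : ∀ x, ‖φ x‖ ≤ M) : Integrable fun x => (V x : ℂ) * φ x :=
  (hV.integrable.ofReal).mul_bdd (c := M) hφ.aestronglyMeasurable (Eventually.of_forall hM)

theorem lintegral_mul_sq_lt_top_of_bounded {φ : E3 → ℂ} {M : ℝ}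
    (hM : ∀ x, ‖φ x‖ ≤ M) : ∫⁻ x, ‖(V x : ℂ) * φ x‖ₑ ^ 2 < ⊤ := by
  have h : ∀ x, ‖(V x : ℂ) * φ x‖ₑ ^ 2 ≤ ‖V x‖ₑ ^ 2 * ENNReal.ofReal M ^ 2 := fun x => by
    rw [enorm_mul, enorm_ofReal_complex, mul_pow]
    gcongr
    rw [← ofReal_norm]
    exact ENNReal.ofReal_le_ofReal (hM x)
  refine (lintegral_mono h).trans_lt ?_
  rw [lintegral_mul_const' _ _ (by finiteness)]
  exact ENNReal.mul_lt_top hV.lintegral_sq_lt_top (by finiteness)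

omit hV in
/-- A function of the form `c - yukawaConv 0 h` with `h = V φ` is a zero-energy solution. -/
theorem isZeroEnergySolution {φ h : E3 → ℂ} {c : ℂ} (h1 : Integrable h)
    (h2 : ∫⁻ x, ‖h x‖ₑ ^ 2 < ⊤) (hφ : ∀ x, φ x = c - yukawaConv 0 h x)
    (hh : h =ᵐ[volume] fun x => (V x : ℂ) * φ x) : IsZeroEnergySolution V φ := by
  obtain ⟨C, hC0, hC⟩ := exists_norm_yukawaConv_le h1 h2
  have hcont : Continuous φ := by
    have := continuous_yukawaConv le_rfl h1.1 h2 (integrable_yukawa_mul le_rfl h1 h2)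
    have e : φ = fun x => c - yukawaConv 0 h x := funext hφ
    rw [e]; fun_prop
  refine ⟨hcont.locallyIntegrable, (h1.congr hh).locallyIntegrable, fun u hu huc => ?_⟩
  set η := testSchwartz hu huc
  have e : ∀ᵐ x, (-(((Δ u) x : ℝ) : ℂ) * φ x + (u x : ℂ) * ((V x : ℂ) * φ x)) =
      -(c * Δ η x) + yukawaConv 0 h x * Δ η x + h x * η x := by
    filter_upwards [hh] with x hx
    rw [← hx, hφ, laplacian_testSchwartz, testSchwartz_apply]
    ring
  have i1 : Integrable fun x => -(c * Δ η x) := ((Δ η).integrable.const_mul c).neg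
  have i2 : Integrable fun x => yukawaConv 0 h x * Δ η x := 
    (Δ η).integrable.bdd_mul (c := C)
      (stronglyMeasurable_yukawaConv 0 h1.1).aestronglyMeasurable
      (Eventually.of_forall (hC 0 le_rfl))
  have i3 : Integrable fun x => h x * η x := by
    have hm := memLp_two_of_lintegral h1.1 h2
    exact MemLp.integrable_mul hm (η.memLp 2 volume)
  have i12 : Integrable fun x => -(c * Δ η x) + yukawaConv 0 h x * Δ η x := i1.add i2
  rw [integral_congr_ae e, integral_add i12 i3, integral_add i1 i2, integral_neg,
    integral_const_mul, integral_laplacian_schwartz, integral_yukawaConv_zero_mul_laplacian h1]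
  simp

/-- A kernel element `g` produces `φ = -G_0 * (B g)` with `g = A φ`, so `B g = V φ` and `φ` solves
the zero-energy equation with the growth allowed to resonances. Hence `φ ∈ L²`; as its Laplacian `V
φ` is also in `L²`, it lies in `H²` and would be an eigenfunction unless it vanishes, and then so
does `g`. -/
theorem scatteringOp_injective (heig : ¬ ZeroIsEigenvalue V) (hres : ¬ ZeroIsResonance V) (g : L2)
    (hg : g + hV.scatteringOp g = 0) : g = 0 := by
  set h : E3 → ℂ := fun x => (potB V x : ℂ) * g x with hh
  have hgsq := lintegral_enorm_sq_lt_top (Lp.memLp g)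
  have h1 : Integrable h := hV.integrable_potB_mul (Lp.aestronglyMeasurable g) hgsq
  have h2 : ∫⁻ x, ‖h x‖ₑ ^ 2 < ⊤ := (lintegral_potB_mul_sq_le V g).trans_lt hgsq
  set φ : E3 → ℂ := fun x => 0 - yukawaConv 0 h x with hφ
  have hgA : g =ᵐ[volume] fun x => (potA V x : ℂ) * φ x := by
    have h0 : (g + hV.scatteringOp g : L2) =ᵐ[volume] 0 := by
      rw [hg]; exact Lp.coeFn_zero _ _ _
    filter_upwards [h0, Lp.coeFn_add g (hV.scatteringOp g), hV.coeFn_scatteringOp g] with x a1 a2 a3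
    rw [a2, Pi.add_apply, a3, Pi.zero_apply] at a1
    rw [eq_neg_of_add_eq_zero_left a1]
    simp [hφ, hh]
  have hhV : h =ᵐ[volume] fun x => (V x : ℂ) * φ x := by
    filter_upwards [hgA] with x hx
    rw [hh]
    simp only
    rw [hx, ← mul_assoc, ← Complex.ofReal_mul, mul_comm (potB V x), potA_mul_potB]
  have hsol := isZeroEnergySolution h1 h2 (fun x => rfl) hhV
  have hφ2 : MemLp φ 2 volume := by
    by_contra hcon
    refine hres ⟨φ, hsol, hcon, fun s hs => ?_⟩
    convert (memLp_weight_mul_yukawaConv_zero h1 hs).neg using 1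
    ext x
    simp [hφ]
  set ψ : L2 := hφ2.toLp
  set G : L2 := (memLp_two_of_lintegral h1.1 h2).toLp
  have hψ : ψ =ᵐ[volume] φ := hφ2.coeFn_toLp
  have hG : G =ᵐ[volume] h := (memLp_two_of_lintegral h1.1 h2).coeFn_toLp
  have hlap : Δ (ψ : 𝓢'(E3, ℂ)) = (G : 𝓢'(E3, ℂ)) := by
    ext η
    rw [TemperedDistribution.laplacian_apply_apply, Lp.toTemperedDistribution_apply,
      Lp.toTemperedDistribution_apply]
    have e1 : ∫ x, Δ η x • ψ x = -∫ x, yukawaConv 0 h x * Δ η x := by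
      rw [← integral_neg]
      apply integral_congr_ae
      filter_upwards [hψ] with x hx
      rw [hx, hφ, smul_eq_mul]
      ring
    have e2 : ∫ x, η x • G x = ∫ x, h x * η x := by
      apply integral_congr_ae
      filter_upwards [hG] with x hx
      rw [hx, smul_eq_mul, mul_comm]
    rw [e1, e2, integral_yukawaConv_zero_mul_laplacian h1, neg_neg]
  have hH2 : ψ ∈ sobolevH2 := memSobolev_of_laplacian_eq hlap
  have hVψ : (fun x => (V x : ℂ) * ψ x) =ᵐ[volume] G := by
    filter_upwards [hψ, hG, hhV] with x a1 a2 a3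
    rw [a1, a2, a3]
  have hmul : ψ ∈ mulDomain V := (memLp_congr_ae hVψ).mpr (Lp.memLp G)
  have hψ0 : ψ = 0 := by
    by_contra hne
    refine heig ⟨⟨ψ, hH2, hmul⟩, fun h0 => hne (congrArg Subtype.val h0), ?_⟩
    change -laplacianFun ⟨ψ, hH2⟩ + (memLp_of_mem_mulDomain ⟨ψ, hmul⟩).toLp = 0
    have e1 : laplacianFun ⟨ψ, hH2⟩ = G := by
      apply toTemperedDistribution_injective
      rw [← laplacianFun_spec, hlap]
    have e2 : (memLp_of_mem_mulDomain ⟨ψ, hmul⟩).toLp = G :=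
      Lp.ext ((MemLp.coeFn_toLp _).trans hVψ)
    rw [e1, e2, neg_add_cancel]
  apply Lp.ext
  have hz : ψ =ᵐ[volume] 0 := by rw [hψ0]; exact Lp.coeFn_zero _ _ _
  filter_upwards [hgA, hψ, hz, Lp.coeFn_zero ℂ 2 (volume : Measure E3)] with x a1 a2 a3 a4
  rw [a1, ← a2, a3, a4]
  simp

/-- Coercivity of the Birman–Schwinger operator. -/
theorem exists_lintegral_sq_le (heig : ¬ ZeroIsEigenvalue V) (hres : ¬ ZeroIsResonance V) :
    ∃ C : ℝ≥0∞, C ≠ ⊤ ∧ ∀ g : E3 → ℂ, AEStronglyMeasurable g volume → ∫⁻ x, ‖g x‖ₑ ^ 2 < ⊤ →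
      ∫⁻ x, ‖g x‖ₑ ^ 2 ≤ C * ∫⁻ x, ‖g x +
        (potA V x : ℂ) * yukawaConv 0 (fun y => (potB V y : ℂ) * g y) x‖ₑ ^ 2 := by
  obtain ⟨S, hS, -⟩ := exists_inverse_one_add (T := hV.scatteringOp)
    (isCompactOperator_kernelOp _ _) (hV.scatteringOp_injective heig hres)
  refine ⟨‖S‖ₑ ^ 2, by finiteness, fun g hg hg2 => ?_⟩
  set G : L2 := (memLp_two_of_lintegral hg hg2).toLp
  have hG : G =ᵐ[volume] g := MemLp.coeFn_toLp _
  have e1 : ∫⁻ x, ‖g x‖ₑ ^ 2 = ‖G‖ₑ ^ 2 := by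
    rw [enorm_sq_eq_lintegral]
    apply lintegral_congr_ae
    filter_upwards [hG] with x hx
    rw [hx]
  have e2 : ∫⁻ x, ‖g x + (potA V x : ℂ) * yukawaConv 0 (fun y => (potB V y : ℂ) * g y) x‖ₑ ^ 2 =
      ‖G + hV.scatteringOp G‖ₑ ^ 2 := by
    rw [enorm_sq_eq_lintegral]
    apply lintegral_congr_ae
    have hc : yukawaConv 0 (fun y => (potB V y : ℂ) * g y) =
        yukawaConv 0 (fun y => (potB V y : ℂ) * G y) := yukawaConv_congr (by
      filter_upwards [hG] with x hx
      rw [hx])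
    filter_upwards [hG, Lp.coeFn_add G (hV.scatteringOp G), hV.coeFn_scatteringOp G] with x a1 a2 a3
    rw [a2, Pi.add_apply, a3, a1, hc]
  rw [e1, e2, ← mul_pow]
  nth_rewrite 1 [← hS G]
  exact pow_le_pow_left' (S.le_opENorm _) 2

/-- The function `A φ₀` must solve `(1 + A G_0 B) g = A`, and conversely `φ₀` is recovered from `g`
as `1 - G_0 * (B g)`. -/
theorem exists_scatteringSolution (heig : ¬ ZeroIsEigenvalue V) (hres : ¬ ZeroIsResonance V) :
    ∃ φ₀ : E3 → ℝ, IsScatteringSolution V φ₀ := by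
  obtain ⟨S, -, hS⟩ := exists_inverse_one_add (T := hV.scatteringOp)
    (isCompactOperator_kernelOp _ _) (hV.scatteringOp_injective heig hres)
  set a : L2 := hV.memLp_potA.toLp
  set g : L2 := S a
  have hg : g + hV.scatteringOp g = a := hS a
  set h : E3 → ℂ := fun x => (potB V x : ℂ) * g x with hh
  have hgsq := lintegral_enorm_sq_lt_top (Lp.memLp g)
  have h1 : Integrable h := hV.integrable_potB_mul (Lp.aestronglyMeasurable g) hgsq
  have h2 : ∫⁻ x, ‖h x‖ₑ ^ 2 < ⊤ := (lintegral_potB_mul_sq_le V g).trans_lt hgsq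
  have hgA : g =ᵐ[volume] fun x => (potA V x : ℂ) * (1 - yukawaConv 0 h x) := by
    have h0 : (g + hV.scatteringOp g : L2) =ᵐ[volume] fun x => (potA V x : ℂ) := by
      rw [hg]; exact MemLp.coeFn_toLp _
    filter_upwards [h0, Lp.coeFn_add g (hV.scatteringOp g), hV.coeFn_scatteringOp g] with x a1 a2 a3
    rw [a2, Pi.add_apply, a3] at a1
    rw [mul_sub, mul_one]
    exact eq_sub_of_add_eq a1
  have hhV : h =ᵐ[volume] fun x => (V x : ℂ) * (1 - yukawaConv 0 h x) := by
    filter_upwards [hgA] with x hx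
    rw [hh]
    simp only
    rw [hx, ← mul_assoc, ← Complex.ofReal_mul, mul_comm (potB V x), potA_mul_potB]
  -- The solution produced by the inverse is complex-valued. Potential and kernel are real, so its
  -- real part solves the same equation.
  set φ₀ : E3 → ℝ := fun x => 1 - (yukawaConv 0 h x).re with hφ₀
  set h' : E3 → ℂ := fun x => ((h x).re : ℂ) with hh'
  have hre : ∀ x, yukawaConv 0 h' x = ((yukawaConv 0 h x).re : ℂ) := fun x => by
    have e1 := integral_re (integrable_yukawa_mul le_rfl h1 h2 x)
    have e2 : (yukawaConv 0 h x).re = ∫ y, yukawa 0 (x - y) * (h y).re := by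
      refine Eq.trans e1.symm ?_
      congr 1
      ext y
      simp
    rw [e2, ← integral_complex_ofReal]
    unfold yukawaConv
    congr 1
    ext y
    simp [hh']
  have h1' : Integrable h' := h1.re.ofReal
  have h2' : ∫⁻ x, ‖h' x‖ₑ ^ 2 < ⊤ := by
    refine lt_of_le_of_lt (lintegral_mono fun x => pow_le_pow_left' ?_ 2) h2
    rw [hh', ← ofReal_norm, ← ofReal_norm, Complex.norm_real]
    exact ENNReal.ofReal_le_ofReal (Complex.abs_re_le_norm _)
  have hconv0 := continuous_yukawaConv le_rfl h1.1 h2 (integrable_yukawa_mul le_rfl h1 h2)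
  refine ⟨φ₀, ?_, ?_, ?_⟩
  · exact continuous_const.sub (Complex.continuous_re.comp hconv0)
  · refine isZeroEnergySolution (c := 1) h1' h2' (fun x => ?_) ?_
    · rw [hre, hφ₀]; push_cast; ring
    · filter_upwards [hhV] with x hx
      have := congrArg Complex.re hx
      rw [hh']
      simp only
      rw [this, hφ₀]
      simp
  · have h0 := tendsto_yukawaConv_zero_cocompact h1 h2
    have h3 := (Complex.continuous_re.tendsto 0).comp h0
    simpa [hφ₀, Function.comp_def] using h3.const_sub 1

omit hV in
theorem _root_.LorentzGas.IsScatteringSolution.exists_bound {φ₀ : E3 → ℝ}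
    (hφ : IsScatteringSolution V φ₀) : ∃ M : ℝ, ∀ x, ‖(φ₀ x : ℂ)‖ ≤ M := by
  let f : ZeroAtInftyContinuousMap E3 ℝ := ⟨⟨fun x => φ₀ x - 1, hφ.continuous.sub continuous_const⟩, by
    simpa using hφ.tendsto_one.sub_const 1⟩
  refine ⟨‖f.toBCF‖ + 1, fun x => ?_⟩
  have h := f.toBCF.norm_coe_le_norm x
  have hle : ‖φ₀ x - 1‖ ≤ ‖f.toBCF‖ := h
  rw [Complex.norm_real]
  calc ‖φ₀ x‖ = ‖(φ₀ x - 1) + 1‖ := by rw [sub_add_cancel]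
    _ ≤ _ := (norm_add_le _ _).trans (by simpa using hle)

/-- The Lippmann–Schwinger equation for scattering solutions. -/
theorem scatteringSolution_eq {φ₀ : E3 → ℝ} (hφ : IsScatteringSolution V φ₀) (x : E3) :
    (φ₀ x : ℂ) = 1 - yukawaConv 0 (fun y => (V y : ℂ) * φ₀ y) x := by
  obtain ⟨M, hM⟩ := hφ.exists_bound
  have hc : Continuous fun x => (φ₀ x : ℂ) := Complex.continuous_ofReal.comp hφ.continuous
  set h : E3 → ℂ := fun y => (V y : ℂ) * φ₀ y with hh
  have h1 : Integrable h := hV.integrable_mul_of_bounded hc hM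
  have h2 : ∫⁻ x, ‖h x‖ₑ ^ 2 < ⊤ := hV.lintegral_mul_sq_lt_top_of_bounded hM
  have hconv0 := continuous_yukawaConv le_rfl h1.1 h2 (integrable_yukawa_mul le_rfl h1 h2)
  -- The two sides have the same distributional Laplacian and the same limit at infinity, so
  -- Liouville's theorem identifies them.
  have hzero : (fun x => (φ₀ x : ℂ) - 1 + yukawaConv 0 h x) = 0 := by
    apply eq_zero_of_weakly_harmonic
    · fun_prop
    · have t1 : Tendsto (fun x => (φ₀ x : ℂ)) (cocompact E3) (𝓝 ((1 : ℝ) : ℂ)) :=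
        (Complex.continuous_ofReal.tendsto _).comp hφ.tendsto_one
      simpa using (t1.sub_const 1).add (tendsto_yukawaConv_zero_cocompact h1 h2)
    · intro u hu huc
      set η := testSchwartz hu huc
      obtain ⟨C, hC0, hC⟩ := exists_norm_yukawaConv_le h1 h2
      have i1 : Integrable fun x => Δ η x := (Δ η).integrable
      have i2 : Integrable fun x => yukawaConv 0 h x * Δ η x :=
        (Δ η).integrable.bdd_mul (c := C)
          (stronglyMeasurable_yukawaConv 0 h1.1).aestronglyMeasurable
          (Eventually.of_forall (hC 0 le_rfl))
      have i3 : Integrable fun x => h x * η x :=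
        MemLp.integrable_mul (memLp_two_of_lintegral h1.1 h2) (η.memLp 2 volume)
      have i4 : Integrable fun x => Δ η x * (φ₀ x : ℂ) :=
        (Δ η).integrable.mul_bdd (c := M) hc.aestronglyMeasurable (Eventually.of_forall hM)
      have hw := hφ.solution.weak u hu huc
      have e : ∀ x, (-(((Δ u) x : ℝ) : ℂ) * (φ₀ x : ℂ) + (u x : ℂ) * ((V x : ℂ) * φ₀ x)) =
          h x * η x - Δ η x * (φ₀ x : ℂ) := fun x => by
        rw [laplacian_testSchwartz, testSchwartz_apply, hh]
        ring
      simp_rw [e] at hw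
      rw [integral_sub i3 i4] at hw
      have e' : ∀ x, (((Δ u) x : ℝ) : ℂ) * ((φ₀ x : ℂ) - 1 + yukawaConv 0 h x) =
          Δ η x * (φ₀ x : ℂ) - Δ η x + yukawaConv 0 h x * Δ η x := fun x => by
        rw [laplacian_testSchwartz]
        ring
      have i41 : Integrable fun x => Δ η x * (φ₀ x : ℂ) - Δ η x := i4.sub i1
      simp_rw [e']
      rw [integral_add i41 i2, integral_sub i4 i1, integral_laplacian_schwartz,
        integral_yukawaConv_zero_mul_laplacian h1, ← sub_eq_zero.mp hw]
      ring
  have := congrFun hzero x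
  simp only [Pi.zero_apply] at this
  linear_combination this

/-- The difference `d` of two solutions satisfies `d = -G_0 * (V d)`, whence `A d` lies in the
kernel of the Birman–Schwinger operator. -/
theorem scatteringSolution_unique (heig : ¬ ZeroIsEigenvalue V) (hres : ¬ ZeroIsResonance V)
    {φ φ' : E3 → ℝ} (hφ : IsScatteringSolution V φ) (hφ' : IsScatteringSolution V φ') :
    φ = φ' := by
  obtain ⟨C, hC, hCg⟩ := hV.exists_lintegral_sq_le heig hres
  obtain ⟨M, hM⟩ := hφ.exists_bound
  obtain ⟨M', hM'⟩ := hφ'.exists_bound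
  have hc : Continuous fun x => (φ x : ℂ) := Complex.continuous_ofReal.comp hφ.continuous
  have hc' : Continuous fun x => (φ' x : ℂ) := Complex.continuous_ofReal.comp hφ'.continuous
  set d : E3 → ℂ := fun x => (φ x : ℂ) - φ' x with hd
  have hdb : ∀ x, ‖d x‖ ≤ M + M' := fun x => (norm_sub_le _ _).trans (add_le_add (hM x) (hM' x))
  have i := integrable_yukawa_mul le_rfl (hV.integrable_mul_of_bounded hc hM)
    (hV.lintegral_mul_sq_lt_top_of_bounded hM)
  have i' := integrable_yukawa_mul le_rfl (hV.integrable_mul_of_bounded hc' hM')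
    (hV.lintegral_mul_sq_lt_top_of_bounded hM')
  have hdeq : ∀ x, d x = -yukawaConv 0 (fun y => (V y : ℂ) * d y) x := fun x => by
    rw [hd]
    simp only
    rw [hV.scatteringSolution_eq hφ x, hV.scatteringSolution_eq hφ' x]
    have : yukawaConv 0 (fun y => (V y : ℂ) * ((φ y : ℂ) - φ' y)) x =
        yukawaConv 0 (fun y => (V y : ℂ) * φ y) x - yukawaConv 0 (fun y => (V y : ℂ) * φ' y) x := by
      unfold yukawaConv
      rw [← integral_sub (i x) (i' x)]
      congr 1
      ext y
      ring
    rw [this]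
    ring
  set g : E3 → ℂ := fun x => (potA V x : ℂ) * d x with hg
  have hgm : AEStronglyMeasurable g volume :=
    hV.memLp_potA.1.mul (hc.sub hc').aestronglyMeasurable
  have hBg : (fun y => (potB V y : ℂ) * g y) = fun y => (V y : ℂ) * d y := by
    ext y
    rw [hg]
    simp only
    rw [← mul_assoc, ← Complex.ofReal_mul, mul_comm (potB V y), potA_mul_potB]
  have hg2 : ∫⁻ x, ‖g x‖ₑ ^ 2 < ⊤ := by
    have h : ∀ x, ‖g x‖ₑ ^ 2 ≤ ‖potA V x‖ₑ ^ 2 * ENNReal.ofReal (M + M') ^ 2 := fun x => by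
      rw [hg, enorm_mul, enorm_ofReal_complex, mul_pow]
      gcongr
      rw [← ofReal_norm]
      exact ENNReal.ofReal_le_ofReal (hdb x)
    refine (lintegral_mono h).trans_lt ?_
    rw [lintegral_mul_const' _ _ (by finiteness)]
    exact ENNReal.mul_lt_top hV.lintegral_potA_sq_lt_top (by finiteness)
  have hle := hCg g hgm hg2
  have hz : ∀ x, ‖g x + (potA V x : ℂ) * yukawaConv 0 (fun y => (potB V y : ℂ) * g y) x‖ₑ ^ 2 =
      0 := fun x => by
    rw [hBg, hg]
    simp only
    rw [hdeq x]
    simp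
  simp_rw [hz] at hle
  simp only [lintegral_zero, mul_zero, nonpos_iff_eq_zero] at hle
  rw [lintegral_eq_zero_iff' (hgm.enorm.pow_const 2)] at hle
  have hVd : (fun y => (V y : ℂ) * d y) =ᵐ[volume] 0 := by
    rw [← hBg]
    filter_upwards [hle] with x hx
    simp only [Pi.zero_apply, pow_eq_zero_iff two_ne_zero, enorm_eq_zero] at hx
    simp [hx]
  -- So far only `V d = 0` almost everywhere; the integral equation upgrades this to `d = 0`
  -- everywhere.
  ext x
  have h0 := hdeq x
  rw [yukawaConv_congr hVd] at h0
  simp only [yukawaConv, Pi.zero_apply, mul_zero, integral_zero, neg_zero] at h0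
  exact_mod_cast sub_eq_zero.mp h0

theorem integrable_mul_scatteringSolution {φ₀ : E3 → ℝ} (hφ : IsScatteringSolution V φ₀) :
    Integrable fun x => V x * φ₀ x := by
  obtain ⟨M, hM⟩ := hφ.exists_bound
  exact hV.integrable.mul_bdd (c := M) hφ.continuous.aestronglyMeasurable
    (Eventually.of_forall fun x => by simpa using hM x)

theorem existsUnique_scatteringLength (heig : ¬ ZeroIsEigenvalue V) (hres : ¬ ZeroIsResonance V) :
    ∃! a : ℝ, IsScatteringLength V a := by
  obtain ⟨φ₀, hφ⟩ := hV.exists_scatteringSolution heig hres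
  refine ⟨_, ⟨φ₀, hφ, hV.integrable_mul_scatteringSolution hφ, rfl⟩, ?_⟩
  rintro b ⟨φ, hφ', -, rfl⟩
  rw [hV.scatteringSolution_unique heig hres hφ hφ']

end IsAdmissible

/-! ### Finite Cauchy–Schwarz inequalities in `ℝ≥0∞` -/

section finiteSums

variable {ι : Type*} (s : Finset ι)

theorem sum_mul_sq_le (f g : ι → ℝ≥0∞) :
    (∑ i ∈ s, f i * g i) ^ 2 ≤ (∑ i ∈ s, f i ^ 2) * ∑ i ∈ s, g i ^ 2 := by
  have h := pow_le_pow_left' (ENNReal.inner_le_Lp_mul_Lq s f g Real.HolderConjugate.two_two) 2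
  simp only [ENNReal.rpow_two] at h
  refine h.trans (le_of_eq ?_)
  rw [mul_pow, ← ENNReal.rpow_natCast, ← ENNReal.rpow_natCast, ← ENNReal.rpow_mul,
    ← ENNReal.rpow_mul]
  norm_num

theorem sq_sum_le (f : ι → ℝ≥0∞) : (∑ i ∈ s, f i) ^ 2 ≤ s.card * ∑ i ∈ s, f i ^ 2 := by
  have h := sum_mul_sq_le s (fun _ => 1) f
  simpa using h

theorem sq_sum_le_of_sq_le {t a b : ι → ℝ≥0∞} (h : ∀ i ∈ s, t i ^ 2 ≤ a i * b i) :
    (∑ i ∈ s, t i) ^ 2 ≤ (∑ i ∈ s, a i) * ∑ i ∈ s, b i := by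
  have hs : ∀ c : ℝ≥0∞, (c ^ (1 / 2 : ℝ)) ^ 2 = c := fun c => by
    rw [← ENNReal.rpow_natCast, ← ENNReal.rpow_mul]; norm_num
  have h1 : ∀ i ∈ s, t i ≤ a i ^ (1 / 2 : ℝ) * b i ^ (1 / 2 : ℝ) := fun i hi => by
    rw [← ENNReal.mul_rpow_of_nonneg _ _ (by norm_num)]
    exact le_rpow_half_of_sq_le (h i hi)
  refine (pow_le_pow_left' (Finset.sum_le_sum h1) 2).trans ((sum_mul_sq_le s _ _).trans ?_)
  simp_rw [hs]
  exact le_rfl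

theorem add_sq_le_two (a b : ℝ≥0∞) : (a + b) ^ 2 ≤ 2 * (a ^ 2 + b ^ 2) := by
  simpa [Fin.sum_univ_two] using sq_sum_le Finset.univ ![a, b]

theorem add_sq_le_three (a b c : ℝ≥0∞) : (a + b + c) ^ 2 ≤ 3 * (a ^ 2 + b ^ 2 + c ^ 2) := by
  simpa [Fin.sum_univ_three] using sq_sum_le Finset.univ ![a, b, c]

theorem add_sq_le_four (a b c d : ℝ≥0∞) :
    (a + b + c + d) ^ 2 ≤ 4 * (a ^ 2 + b ^ 2 + c ^ 2 + d ^ 2) := by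
  simpa [Fin.sum_univ_four] using sq_sum_le Finset.univ ![a, b, c, d]

theorem enorm_add_three_sq_le (a b c : ℂ) :
    ‖a + b + c‖ₑ ^ 2 ≤ 3 * (‖a‖ₑ ^ 2 + ‖b‖ₑ ^ 2 + ‖c‖ₑ ^ 2) :=
  (pow_le_pow_left' ((enorm_add_le _ _).trans (add_le_add_left (enorm_add_le _ _) _)) 2).trans
    (add_sq_le_three _ _ _)

theorem enorm_add_four_sq_le (a b c d : ℂ) :
    ‖a + b + c + d‖ₑ ^ 2 ≤ 4 * (‖a‖ₑ ^ 2 + ‖b‖ₑ ^ 2 + ‖c‖ₑ ^ 2 + ‖d‖ₑ ^ 2) :=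
  (pow_le_pow_left' ((enorm_add_le _ _).trans (add_le_add_left ((enorm_add_le _ _).trans
    (add_le_add_left (enorm_add_le _ _) _)) _)) 2).trans (add_sq_le_four _ _ _ _)

end finiteSums

/-! ### The a-priori estimate for the system of scattering equations -/

theorem enorm_yukawaConv_zero_sub_le {κ : ℝ} (hκ : 0 ≤ κ) {u : E3 → ℂ} (h1 : Integrable u)
    (h2 : ∫⁻ y, ‖u y‖ₑ ^ 2 < ⊤) (x : E3) :
    ‖yukawaConv 0 u x - yukawaConv κ u x‖ₑ ≤ ENNReal.ofReal (κ / (4 * Real.pi)) * ∫⁻ y, ‖u y‖ₑ := by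
  unfold yukawaConv
  rw [← integral_sub (integrable_yukawa_mul le_rfl h1 h2 x) (integrable_yukawa_mul hκ h1 h2 x),
    ← lintegral_const_mul' _ _ ENNReal.ofReal_ne_top]
  refine (enorm_integral_le_lintegral_enorm _).trans (lintegral_mono fun y => ?_)
  rw [← sub_mul, ← Complex.ofReal_sub, enorm_mul, enorm_ofReal_complex, ← ofReal_norm]
  gcongr
  exact abs_yukawa_zero_sub_le hκ _

/-- A bound for the inverse of the Birman–Schwinger operator `1 + A (-Δ)⁻¹ B`. -/
def IsCoercive (V : E3 → ℝ) (C : ℝ≥0∞) : Prop :=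
  ∀ g : E3 → ℂ, AEStronglyMeasurable g volume → ∫⁻ x, ‖g x‖ₑ ^ 2 < ⊤ →
    ∫⁻ x, ‖g x‖ₑ ^ 2 ≤ C * ∫⁻ x, ‖g x +
      (potA V x : ℂ) * yukawaConv 0 (fun y => (potB V y : ℂ) * g y) x‖ₑ ^ 2

/-- The Hilbert–Schmidt size of the interaction between two obstacles at distance `c`. -/
noncomputable def pairInteraction (V : E3 → ℝ) (κ : ℝ) (c : E3) : ℝ≥0∞ :=
  ∫⁻ ξ, ∫⁻ ξ', ‖potA V ξ‖ₑ ^ 2 * (‖yukawa κ (c + ξ - ξ')‖ₑ ^ 2 * ‖potB V ξ'‖ₑ ^ 2)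

/-- The total Hilbert–Schmidt size of the interaction between distinct obstacles. -/
noncomputable def totalInteraction (V : E3 → ℝ) (κ : ℝ) {ι : Type*} [Fintype ι] [DecidableEq ι]
    (z : ι → E3) : ℝ≥0∞ :=
  ∑ i, ∑ j ∈ Finset.univ.erase i, pairInteraction V κ (z i - z j)

namespace IsAdmissible

variable {V : E3 → ℝ} (hV : IsAdmissible V)

include hV

theorem sq_lintegral_potB_mul_le {g : E3 → ℂ} (hg : AEStronglyMeasurable g volume) :
    (∫⁻ y, ‖(potB V y : ℂ) * g y‖ₑ) ^ 2 ≤ (∫⁻ y, ‖potB V y‖ₑ ^ 2) * ∫⁻ y, ‖g y‖ₑ ^ 2 := by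
  simp_rw [enorm_mul, enorm_ofReal_complex]
  exact lintegral_mul_sq_le (measurable_potB hV.measurable).enorm.aemeasurable hg.enorm

theorem enorm_yukawaConv_potB_sq_le {κ : ℝ} {g : E3 → ℂ} (hg : AEStronglyMeasurable g volume)
    (x : E3) : ‖yukawaConv κ (fun y => (potB V y : ℂ) * g y) x‖ₑ ^ 2 ≤
      (∫⁻ y, ‖yukawa κ (x - y)‖ₑ ^ 2 * ‖potB V y‖ₑ ^ 2) * ∫⁻ y, ‖g y‖ₑ ^ 2 := by
  have hB := measurable_potB hV.measurable
  have e : yukawaConv κ (fun y => (potB V y : ℂ) * g y) x =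
      ∫ y, ((yukawa κ (x - y) * potB V y : ℝ) : ℂ) * g y := by
    unfold yukawaConv
    congr 1
    ext y
    push_cast
    ring
  rw [e]
  refine (enorm_integral_mul_sq_le (by fun_prop) hg).trans (le_of_eq ?_)
  simp_rw [enorm_mul, mul_pow]

theorem measurable_pair (κ : ℝ) (c : E3) : Measurable fun ξ => ∫⁻ ξ', ‖yukawa κ (c + ξ - ξ')‖ₑ ^ 2 *
    ‖potB V ξ'‖ₑ ^ 2 := by
  have hB := measurable_potB hV.measurable
  exact Measurable.lintegral_prod_right' (f := fun q : E3 × E3 => ‖yukawa κ (c + q.1 - q.2)‖ₑ ^ 2 *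
    ‖potB V q.2‖ₑ ^ 2) (by fun_prop)

omit hV in
theorem pairInteraction_eq (V : E3 → ℝ) (κ : ℝ) (c : E3) : pairInteraction V κ c =
    ∫⁻ ξ, ‖potA V ξ‖ₑ ^ 2 * ∫⁻ ξ', ‖yukawa κ (c + ξ - ξ')‖ₑ ^ 2 * ‖potB V ξ'‖ₑ ^ 2 := by
  unfold pairInteraction
  congr 1
  ext ξ
  rw [lintegral_const_mul' _ _ (by finiteness)]

/-- In the unknowns `g i = A (e i)` this inverts a block operator. Each diagonal block is the
coercive operator at zero energy up to an error `O(κ)`, and the off-diagonal blocks are bounded in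
Hilbert–Schmidt norm. The constant is `3 C` from splitting three terms, doubled by absorbing half of
the unknown. -/
theorem apriori_bound {C : ℝ≥0∞} (hcoer : IsCoercive V C)
    {ι : Type*} [Fintype ι] [DecidableEq ι] {κ : ℝ} (hκ : 0 ≤ κ) (z : ι → E3) {e : ι → E3 → ℂ}
    (he : ∀ i, AEStronglyMeasurable (e i) volume)
    (hg : ∀ i, ∫⁻ ξ, ‖(potA V ξ : ℂ) * e i ξ‖ₑ ^ 2 < ⊤)
    (hsmall : 3 * C * (ENNReal.ofReal (κ / (4 * Real.pi)) ^ 2 * (∫⁻ ξ, ‖potA V ξ‖ₑ ^ 2) *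
      (∫⁻ ξ, ‖potB V ξ‖ₑ ^ 2) + totalInteraction V κ z) ≤ 2⁻¹) :
    ∑ i, ∫⁻ ξ, ‖(potA V ξ : ℂ) * e i ξ‖ₑ ^ 2 ≤ 6 * C * ∑ i, ∫⁻ ξ, ‖(potA V ξ : ℂ) *
      (e i ξ + ∑ j, yukawaConv κ (fun y => (V y : ℂ) * e j y) (z i - z j + ξ))‖ₑ ^ 2 := by
  have hAm := measurable_potA hV.measurable
  have hBm := measurable_potB hV.measurable
  set KA := ∫⁻ ξ, ‖potA V ξ‖ₑ ^ 2
  set KB := ∫⁻ ξ, ‖potB V ξ‖ₑ ^ 2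
  set b := ENNReal.ofReal (κ / (4 * Real.pi)) ^ 2 * KA * KB
  set g : ι → E3 → ℂ := fun i ξ => (potA V ξ : ℂ) * e i ξ with hgdef
  have hgm : ∀ i, AEStronglyMeasurable (g i) volume := fun i => hV.memLp_potA.1.mul (he i)
  have hBg : ∀ j, (fun y => (potB V y : ℂ) * g j y) = fun y => (V y : ℂ) * e j y := fun j => by
    ext y
    simp only [hgdef]
    rw [← mul_assoc, ← Complex.ofReal_mul, mul_comm (potB V y), potA_mul_potB]
  set r : ι → E3 → ℂ := fun i ξ =>
    e i ξ + ∑ j, yukawaConv κ (fun y => (V y : ℂ) * e j y) (z i - z j + ξ) with hr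
  set X := ∑ i, ∫⁻ ξ, ‖g i ξ‖ₑ ^ 2 with hX
  -- Finiteness is what later permits subtracting `X / 2` in `ℝ≥0∞`.
  have hXtop : X ≠ ⊤ := by
    rw [hX]
    exact (ENNReal.sum_lt_top.mpr fun i _ => hg i).ne
  have hint : ∀ j, Integrable fun y => (V y : ℂ) * e j y := fun j => by
    rw [← hBg]; exact hV.integrable_potB_mul (hgm j) (hg j)
  have hint2 : ∀ j, ∫⁻ y, ‖(V y : ℂ) * e j y‖ₑ ^ 2 < ⊤ := fun j => by
    refine lt_of_le_of_lt ?_ (hg j)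
    have := lintegral_potB_mul_sq_le V (g j)
    simp_rw [congrFun (hBg j)] at this
    exact this
  -- The three parts are the residual, the change from `0` to `κ` in the self-interaction, and the
  -- fields of the other obstacles. The self-term sits at displacement `z i - z i = 0`.
  have hsplit : ∀ i ξ, g i ξ + (potA V ξ : ℂ) * yukawaConv 0 (fun y => (potB V y : ℂ) * g i y) ξ =
      (potA V ξ : ℂ) * r i ξ + (potA V ξ : ℂ) *
        (yukawaConv 0 (fun y => (V y : ℂ) * e i y) ξ - yukawaConv κ (fun y => (V y : ℂ) * e i y) ξ) +
      -((potA V ξ : ℂ) * ∑ j ∈ Finset.univ.erase i,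
        yukawaConv κ (fun y => (V y : ℂ) * e j y) (z i - z j + ξ)) := fun i ξ => by
    have h1 : r i ξ = e i ξ + (yukawaConv κ (fun y => (V y : ℂ) * e i y) ξ +
        ∑ j ∈ Finset.univ.erase i, yukawaConv κ (fun y => (V y : ℂ) * e j y) (z i - z j + ξ)) := by
      simp only [hr]
      rw [← Finset.add_sum_erase Finset.univ _ (Finset.mem_univ i), sub_self, zero_add]
    rw [h1, hBg]
    simp only [hgdef]
    ring
  have hbI : ∀ i, ∫⁻ ξ, ‖(potA V ξ : ℂ) * (yukawaConv 0 (fun y => (V y : ℂ) * e i y) ξ -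
      yukawaConv κ (fun y => (V y : ℂ) * e i y) ξ)‖ₑ ^ 2 ≤ b * ∫⁻ ξ, ‖g i ξ‖ₑ ^ 2 := fun i => by
    have hpt : ∀ ξ, ‖(potA V ξ : ℂ) * (yukawaConv 0 (fun y => (V y : ℂ) * e i y) ξ -
        yukawaConv κ (fun y => (V y : ℂ) * e i y) ξ)‖ₑ ^ 2 ≤
        ‖potA V ξ‖ₑ ^ 2 * (ENNReal.ofReal (κ / (4 * Real.pi)) ^ 2 * (KB * ∫⁻ ξ, ‖g i ξ‖ₑ ^ 2)) :=
      fun ξ => by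
      rw [enorm_mul, enorm_ofReal_complex, mul_pow]
      gcongr
      refine (pow_le_pow_left' (enorm_yukawaConv_zero_sub_le hκ (hint i) (hint2 i) ξ) 2).trans ?_
      rw [mul_pow]
      gcongr
      have := hV.sq_lintegral_potB_mul_le (hgm i)
      simp_rw [congrFun (hBg i)] at this
      exact this
    refine (lintegral_mono hpt).trans (le_of_eq ?_)
    rw [lintegral_mul_const _ (by fun_prop)]
    ring
  have hcI : ∀ i, ∫⁻ ξ, ‖-((potA V ξ : ℂ) * ∑ j ∈ Finset.univ.erase i,
      yukawaConv κ (fun y => (V y : ℂ) * e j y) (z i - z j + ξ))‖ₑ ^ 2 ≤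
      (∑ j ∈ Finset.univ.erase i, pairInteraction V κ (z i - z j)) * X := fun i => by
    have hpt : ∀ ξ, ‖-((potA V ξ : ℂ) * ∑ j ∈ Finset.univ.erase i,
        yukawaConv κ (fun y => (V y : ℂ) * e j y) (z i - z j + ξ))‖ₑ ^ 2 ≤
        (∑ j ∈ Finset.univ.erase i, ‖potA V ξ‖ₑ ^ 2 *
          ∫⁻ ξ', ‖yukawa κ (z i - z j + ξ - ξ')‖ₑ ^ 2 * ‖potB V ξ'‖ₑ ^ 2) * X := fun ξ => by
      rw [enorm_neg, enorm_mul, enorm_ofReal_complex, mul_pow, ← Finset.mul_sum, mul_assoc]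
      gcongr
      refine (pow_le_pow_left' (enorm_sum_le _ _) 2).trans ?_
      refine (sq_sum_le_of_sq_le _
        (a := fun j => ∫⁻ ξ', ‖yukawa κ (z i - z j + ξ - ξ')‖ₑ ^ 2 * ‖potB V ξ'‖ₑ ^ 2)
        (b := fun j => ∫⁻ ξ, ‖g j ξ‖ₑ ^ 2) fun j _ => ?_).trans ?_
      · rw [← hBg]
        exact hV.enorm_yukawaConv_potB_sq_le (hgm j) _
      · gcongr
        exact Finset.sum_le_sum_of_subset (Finset.erase_subset _ _)
    refine (lintegral_mono hpt).trans (le_of_eq ?_)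
    have hm : ∀ j ∈ Finset.univ.erase i, Measurable fun ξ => ‖potA V ξ‖ₑ ^ 2 *
        ∫⁻ ξ', ‖yukawa κ (z i - z j + ξ - ξ')‖ₑ ^ 2 * ‖potB V ξ'‖ₑ ^ 2 := fun j _ => by
      have := hV.measurable_pair κ (z i - z j)
      fun_prop
    rw [lintegral_mul_const _ (Finset.measurable_fun_sum _ hm), lintegral_finsetSum _ hm]
    simp_rw [pairInteraction_eq]
  have hone : ∀ i, ∫⁻ ξ, ‖g i ξ‖ₑ ^ 2 ≤ C * (3 * ((∫⁻ ξ, ‖(potA V ξ : ℂ) * r i ξ‖ₑ ^ 2) +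
      b * (∫⁻ ξ, ‖g i ξ‖ₑ ^ 2) +
      (∑ j ∈ Finset.univ.erase i, pairInteraction V κ (z i - z j)) * X)) := fun i => by
    refine (hcoer (g i) (hgm i) (hg i)).trans ?_
    gcongr
    simp_rw [hsplit]
    have hconvm : ∀ (κ' : ℝ) (j : ι), StronglyMeasurable
        (yukawaConv κ' (fun y => (V y : ℂ) * e j y)) := fun κ' j =>
      stronglyMeasurable_yukawaConv κ' (hint j).1
    have m1 : AEMeasurable (fun ξ => ‖(potA V ξ : ℂ) * r i ξ‖ₑ ^ 2) volume := by
      refine (AEStronglyMeasurable.enorm (hV.memLp_potA.1.mul ?_)).pow_const 2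
      refine (he i).add (Measurable.aestronglyMeasurable ?_)
      exact Finset.measurable_fun_sum _ fun j _ => (hconvm κ j).measurable.comp (by fun_prop)
    have m2 : AEMeasurable (fun ξ => ‖(potA V ξ : ℂ) * (yukawaConv 0 (fun y => (V y : ℂ) * e i y) ξ -
        yukawaConv κ (fun y => (V y : ℂ) * e i y) ξ)‖ₑ ^ 2) volume :=
      (AEStronglyMeasurable.enorm (hV.memLp_potA.1.mul
        ((hconvm 0 i).sub (hconvm κ i)).aestronglyMeasurable)).pow_const 2
    refine (lintegral_mono fun ξ => enorm_add_three_sq_le _ _ _).trans ?_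
    have m12 : AEMeasurable (fun ξ => ‖(potA V ξ : ℂ) * r i ξ‖ₑ ^ 2 +
        ‖(potA V ξ : ℂ) * (yukawaConv 0 (fun y => (V y : ℂ) * e i y) ξ -
          yukawaConv κ (fun y => (V y : ℂ) * e i y) ξ)‖ₑ ^ 2) volume := m1.add m2
    rw [lintegral_const_mul' _ _ (by finiteness), lintegral_add_left' m12,
      lintegral_add_left' m1]
    gcongr
    · exact hbI i
    · exact hcI i
  have hsum : X ≤ 3 * C * (∑ i, ∫⁻ ξ, ‖(potA V ξ : ℂ) * r i ξ‖ₑ ^ 2) + X / 2 := by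
    calc X ≤ ∑ i, C * (3 * ((∫⁻ ξ, ‖(potA V ξ : ℂ) * r i ξ‖ₑ ^ 2) + b * (∫⁻ ξ, ‖g i ξ‖ₑ ^ 2) +
          (∑ j ∈ Finset.univ.erase i, pairInteraction V κ (z i - z j)) * X)) :=
        Finset.sum_le_sum fun i _ => hone i
      _ = 3 * C * (∑ i, ∫⁻ ξ, ‖(potA V ξ : ℂ) * r i ξ‖ₑ ^ 2) +
          (3 * C * (b + totalInteraction V κ z)) * X := by
        rw [← Finset.mul_sum, ← Finset.mul_sum, Finset.sum_add_distrib, Finset.sum_add_distrib,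
          ← Finset.mul_sum, ← Finset.sum_mul, ← hX]
        unfold totalInteraction
        ring
      _ ≤ _ := by
        gcongr
        rw [div_eq_mul_inv, mul_comm X]
        gcongr
  have h2 : X / 2 ≤ 3 * C * ∑ i, ∫⁻ ξ, ‖(potA V ξ : ℂ) * r i ξ‖ₑ ^ 2 := by
    have h3 : X / 2 + X / 2 ≤ 3 * C * (∑ i, ∫⁻ ξ, ‖(potA V ξ : ℂ) * r i ξ‖ₑ ^ 2) + X / 2 := by
      rwa [ENNReal.add_halves]
    exact (ENNReal.add_le_add_iff_right (by finiteness)).mp h3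
  calc X = 2 * (X / 2) := (ENNReal.mul_div_cancel (by norm_num) (by norm_num)).symm
    _ ≤ 2 * (3 * C * ∑ i, ∫⁻ ξ, ‖(potA V ξ : ℂ) * r i ξ‖ₑ ^ 2) := by gcongr
    _ = _ := by ring

end IsAdmissible

/-! ### Rescaling around the obstacles -/

theorem lintegral_comp_smul_sub {n : ℝ} (hn : 0 < n) (c : E3) {G : E3 → ℝ≥0∞} (hG : Measurable G) :
    ∫⁻ x, G (n • (x - c)) = ENNReal.ofReal ((n ^ 3)⁻¹) * ∫⁻ x, G x := by
  rw [lintegral_sub_right_eq_self (fun x => G (n • x)) c]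
  have h := Measure.map_addHaar_smul (volume : Measure E3) hn.ne'
  have h2 : ∫⁻ x, G x ∂(Measure.map (fun x : E3 => n • x) volume) = ∫⁻ x, G (n • x) :=
    lintegral_map hG (by fun_prop)
  have h3 : (fun x : E3 => n • x) = (n • · : E3 → E3) := rfl
  rw [← h2, h3, h, lintegral_smul_measure]
  simp only [finrank_euclideanSpace, Fintype.card_fin, smul_eq_mul]
  rw [abs_of_pos (by positivity)]

/-- The contribution of a single obstacle, in rescaled coordinates. -/
theorem yukawaConv_obstacle {n : ℝ} (hn : 0 < n) (κ : ℝ) (V : E3 → ℝ) (ψ : E3 → ℂ) (c x : E3) :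
    yukawaConv κ (fun y => ((n ^ 2 * V (n • (y - c)) : ℝ) : ℂ) * ψ y) x =
      yukawaConv (κ / n) (fun ξ => (V ξ : ℂ) * ψ (c + n⁻¹ • ξ)) (n • (x - c)) := by
  unfold yukawaConv
  set G : E3 → ℂ := fun y => (yukawa κ (x - y) : ℂ) * (((n ^ 2 * V (n • (y - c)) : ℝ) : ℂ) * ψ y)
  have h1 : ∫ y, G y = ∫ y, G (c + y) := (integral_add_left_eq_self G c).symm
  have h2 := Measure.integral_comp_smul (volume : Measure E3) (fun y => G (c + y)) n⁻¹
  simp only [finrank_euclideanSpace, Fintype.card_fin] at h2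
  rw [abs_of_pos (by positivity)] at h2
  have h3 : ∫ y, G (c + y) = (((n ^ 3)⁻¹ : ℝ) : ℂ) * ∫ ξ, G (c + n⁻¹ • ξ) := by
    rw [h2, Complex.real_smul, ← mul_assoc, ← Complex.ofReal_mul]
    have : (n ^ 3)⁻¹ * ((n⁻¹) ^ 3)⁻¹ = 1 := by field_simp
    rw [this]
    simp
  change ∫ y, G y = _
  rw [h1, h3, ← integral_const_mul]
  congr 1
  ext ξ
  -- The amplitude gives `n²` and the Jacobian `n⁻³`; the remaining `n⁻¹` is absorbed by the scaling
  -- of the kernel.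
  have e1 : n • (c + n⁻¹ • ξ - c) = ξ := by
    rw [add_sub_cancel_left, smul_smul, mul_inv_cancel₀ hn.ne', one_smul]
  have e2 : x - (c + n⁻¹ • ξ) = n⁻¹ • (n • (x - c) - ξ) := by
    rw [smul_sub, smul_smul, inv_mul_cancel₀ hn.ne', one_smul]
    abel
  simp only [G]
  rw [e1, e2, ← yukawa_scale κ hn]
  push_cast
  have hn' : (n : ℂ) ≠ 0 := by exact_mod_cast hn.ne'
  field_simp

theorem exists_norm_yukawaConv_coeFn_le {κ : ℝ} (hκ : 0 < κ) (h : L2) :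
    ∃ M : ℝ, 0 ≤ M ∧ ∀ x, ‖yukawaConv κ h x‖ ≤ M := by
  have hfin : (∫⁻ y, ‖yukawa κ y‖ₑ ^ 2) * (∫⁻ y, ‖h y‖ₑ ^ 2) ≠ ⊤ :=
    (ENNReal.mul_lt_top (lintegral_yukawa_sq_lt_top hκ) (lintegral_enorm_sq_lt_top (Lp.memLp h))).ne
  refine ⟨√((∫⁻ y, ‖yukawa κ y‖ₑ ^ 2) * (∫⁻ y, ‖h y‖ₑ ^ 2)).toReal, Real.sqrt_nonneg _, fun x => ?_⟩
  have h1 := ENNReal.toReal_mono hfin (enorm_yukawaConv_sq_le κ (Lp.aestronglyMeasurable h) x)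
  rw [ENNReal.toReal_pow, toReal_enorm] at h1
  exact Real.le_sqrt_of_sq_le h1

theorem continuous_yukawaConv_coeFn {κ : ℝ} (hκ : 0 < κ) (h : L2) : Continuous (yukawaConv κ h) :=
  continuous_yukawaConv hκ.le (Lp.aestronglyMeasurable h) (lintegral_enorm_sq_lt_top (Lp.memLp h))
    (integrable_yukawa_mul_coeFn hκ h)

theorem lintegral_mul_bdd_sq_lt_top {u φ : E3 → ℂ} {M : ℝ} (hu : ∫⁻ x, ‖u x‖ₑ ^ 2 < ⊤)
    (hM : ∀ x, ‖φ x‖ ≤ M) : ∫⁻ x, ‖u x * φ x‖ₑ ^ 2 < ⊤ := by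
  have h : ∀ x, ‖u x * φ x‖ₑ ^ 2 ≤ ‖u x‖ₑ ^ 2 * ENNReal.ofReal M ^ 2 := fun x => by
    rw [enorm_mul, mul_pow]
    gcongr
    rw [← ofReal_norm]
    exact ENNReal.ofReal_le_ofReal (hM x)
  refine (lintegral_mono h).trans_lt ?_
  rw [lintegral_mul_const' _ _ (by finiteness)]
  exact ENNReal.mul_lt_top hu (by finiteness)

theorem smul_sub_smul_add {n : ℝ} (hn : 0 < n) (y c ξ : E3) :
    n • y - n • c + ξ = n • (y + n⁻¹ • ξ - c) := by
  rw [smul_sub, smul_add, smul_smul, mul_inv_cancel₀ hn.ne', one_smul]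
  abel

namespace IsAdmissible

variable {V : E3 → ℝ} (hV : IsAdmissible V) {N : ℕ} (hN : 0 < N) (Y : Fin N → E3)

include hV

theorem measurable_obstaclePotential : Measurable (obstaclePotential V N Y) := by
  have := hV.measurable
  unfold obstaclePotential
  fun_prop

include hN

theorem lintegral_obstacle_lt_top (c : E3) :
    ∫⁻ x, ‖(((N : ℝ) ^ 2 * V ((N : ℝ) • (x - c)) : ℝ) : ℂ)‖ₑ ^ 2 < ⊤ := by
  have hm := hV.measurable
  have hn : (0 : ℝ) < N := by exact_mod_cast hN
  have e := lintegral_comp_smul_sub hn c (G := fun x => ‖((N : ℝ) ^ 2 * V x : ℝ)‖ₑ ^ 2) (by fun_prop)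
  simp_rw [enorm_ofReal_complex]
  rw [e]
  simp_rw [enorm_mul, mul_pow]
  rw [lintegral_const_mul' _ _ (by finiteness)]
  have := hV.lintegral_sq_lt_top
  finiteness

theorem memLp_obstaclePotential : MemLp (obstaclePotential V N Y) 2 volume := by
  have hm := hV.measurable
  unfold obstaclePotential
  refine memLp_finsetSum _ fun i _ => ?_
  refine memLp_two_of_lintegral (by fun_prop : Measurable fun x =>
    (N : ℝ) ^ 2 * V ((N : ℝ) • (x - Y i))).aestronglyMeasurable ?_
  have := hV.lintegral_obstacle_lt_top hN (Y i)
  simpa only [enorm_ofReal_complex] using this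

/-- The integral equation satisfied by the resolvent of the `N`-obstacle Hamiltonian. -/
theorem yukawaConv_eq_of_resolvent {κ : ℝ} (hκ : 0 < κ) {h f : L2}
    (heq : h + mulResolvent hκ (hV.measurable_obstaclePotential Y)
      (hV.memLp_obstaclePotential hN Y) h = f) (x : E3) :
    yukawaConv κ h x = yukawaConv κ f x - ∑ j, yukawaConv (κ / N)
      (fun ξ => (V ξ : ℂ) * yukawaConv κ h (Y j + (N : ℝ)⁻¹ • ξ)) ((N : ℝ) • (x - Y j)) := by
  have hm := hV.measurable
  have hn : (0 : ℝ) < N := by exact_mod_cast hN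
  obtain ⟨M, -, hM⟩ := exists_norm_yukawaConv_coeFn_le hκ h
  rw [← heq, yukawaConv_add_coeFn hκ]
  have e : yukawaConv κ (mulResolvent hκ (hV.measurable_obstaclePotential Y)
      (hV.memLp_obstaclePotential hN Y) h) x = ∑ j, yukawaConv κ (fun y =>
        (((N : ℝ) ^ 2 * V ((N : ℝ) • (y - Y j)) : ℝ) : ℂ) * yukawaConv κ h y) x := by
    rw [yukawaConv_congr (coeFn_mulResolvent _ _ _ h)]
    unfold yukawaConv
    rw [← integral_finsetSum]
    · congr 1
      ext y
      unfold obstaclePotential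
      push_cast
      rw [Finset.sum_mul, Finset.mul_sum]
    · intro j _
      refine integrable_yukawa_mul_of_sq hκ ?_ (lintegral_mul_bdd_sq_lt_top
        (hV.lintegral_obstacle_lt_top hN (Y j)) hM) x
      exact AEStronglyMeasurable.mul (by fun_prop : Measurable fun y =>
        (((N : ℝ) ^ 2 * V ((N : ℝ) • (y - Y j)) : ℝ) : ℂ)).aestronglyMeasurable
        (continuous_yukawaConv_coeFn hκ h).aestronglyMeasurable
  rw [e]
  simp_rw [yukawaConv_obstacle hn]
  ring

/-- With right-hand side zero the rescaled profiles solve the homogeneous system, so the a-priori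
bound makes `A χ_j`, and with it `V χ_j`, vanish. The integral equation then gives `ψ = 0`, and `h`,
being minus the potential times `ψ`, vanishes too. -/
theorem obstacle_injective {C : ℝ≥0∞} (hcoer : IsCoercive V C) {κ : ℝ} (hκ : 0 < κ)
    (hsmall : 3 * C * (ENNReal.ofReal (κ / N / (4 * Real.pi)) ^ 2 * (∫⁻ ξ, ‖potA V ξ‖ₑ ^ 2) *
      (∫⁻ ξ, ‖potB V ξ‖ₑ ^ 2) + totalInteraction V (κ / N) fun i => (N : ℝ) • Y i) ≤ 2⁻¹) (h : L2)
    (heq : h + mulResolvent hκ (hV.measurable_obstaclePotential Y)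
      (hV.memLp_obstaclePotential hN Y) h = 0) : h = 0 := by
  have hn : (0 : ℝ) < N := by exact_mod_cast hN
  obtain ⟨M, -, hM⟩ := exists_norm_yukawaConv_coeFn_le hκ h
  set ψ := yukawaConv κ h
  have hψc : Continuous ψ := continuous_yukawaConv_coeFn hκ h
  have hrep : ∀ x, ψ x = yukawaConv κ (0 : L2) x - ∑ j, yukawaConv (κ / N)
      (fun ξ => (V ξ : ℂ) * ψ (Y j + (N : ℝ)⁻¹ • ξ)) ((N : ℝ) • (x - Y j)) :=
    hV.yukawaConv_eq_of_resolvent hN Y hκ heq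
  have h0 : yukawaConv κ (0 : L2) = 0 := by
    ext x
    rw [yukawaConv_congr (Lp.coeFn_zero ℂ 2 (volume : Measure E3))]
    simp [yukawaConv]
  have hap := hV.apriori_bound hcoer (κ := κ / N) (by positivity) (fun i => (N : ℝ) • Y i)
    (e := fun i ξ => ψ (Y i + (N : ℝ)⁻¹ • ξ))
    (fun i => (by fun_prop : Continuous fun ξ => ψ (Y i + (N : ℝ)⁻¹ • ξ)).aestronglyMeasurable)
    (fun i => lintegral_mul_bdd_sq_lt_top
      (by simpa only [enorm_ofReal_complex] using hV.lintegral_potA_sq_lt_top) fun ξ => hM _) hsmall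
  have hr : ∀ i ξ, ψ (Y i + (N : ℝ)⁻¹ • ξ) + ∑ j, yukawaConv (κ / N)
      (fun y => (V y : ℂ) * ψ (Y j + (N : ℝ)⁻¹ • y)) ((N : ℝ) • Y i - (N : ℝ) • Y j + ξ) = 0 := by
    intro i ξ
    simp_rw [smul_sub_smul_add hn]
    rw [hrep (Y i + (N : ℝ)⁻¹ • ξ), h0]
    simp
  simp_rw [hr] at hap
  simp only [mul_zero, enorm_zero, ne_eq, OfNat.ofNat_ne_zero, not_false_eq_true, zero_pow,
    lintegral_zero, Finset.sum_const_zero, nonpos_iff_eq_zero, Finset.sum_eq_zero_iff,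
    Finset.mem_univ, forall_const] at hap
  have hVχ : ∀ j, (fun ξ => (V ξ : ℂ) * ψ (Y j + (N : ℝ)⁻¹ • ξ)) =ᵐ[volume] 0 := fun j => by
    have h1 := hap j
    have hm : Measurable fun ξ => ‖(potA V ξ : ℂ) * ψ (Y j + (N : ℝ)⁻¹ • ξ)‖ₑ ^ 2 := by
      have := measurable_potA hV.measurable
      have := hψc.measurable
      fun_prop
    rw [lintegral_eq_zero_iff hm] at h1
    filter_upwards [h1] with ξ hξ
    simp only [Pi.zero_apply, pow_eq_zero_iff two_ne_zero, enorm_eq_zero] at hξ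
    rw [← potA_mul_potB V ξ, Complex.ofReal_mul, mul_right_comm, hξ]
    simp
  have hψ0 : ∀ x, ψ x = 0 := fun x => by
    rw [hrep x, h0]
    have : ∀ j, yukawaConv (κ / N) (fun ξ => (V ξ : ℂ) * ψ (Y j + (N : ℝ)⁻¹ • ξ))
        ((N : ℝ) • (x - Y j)) = 0 := fun j => by
      rw [yukawaConv_congr (hVχ j)]
      simp [yukawaConv]
    simp [this]
  have hm0 : mulResolvent hκ (hV.measurable_obstaclePotential Y)
      (hV.memLp_obstaclePotential hN Y) h = 0 := by
    apply Lp.ext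
    filter_upwards [coeFn_mulResolvent hκ (hV.measurable_obstaclePotential Y)
      (hV.memLp_obstaclePotential hN Y) h, Lp.coeFn_zero ℂ 2 (volume : Measure E3)] with x a1 a2
    rw [a1, a2, Pi.zero_apply, show yukawaConv κ h x = 0 from hψ0 x, mul_zero]
  rwa [hm0, add_zero] at heq

end IsAdmissible

/-! ### Approximation of the field of an obstacle by a point source -/

/-- Young's inequality for the Yukawa kernel. -/
theorem lintegral_yukawaConv_sq_le_young (κ : ℝ) {u : E3 → ℂ} (hu : AEStronglyMeasurable u volume) :
    ∫⁻ x, ‖yukawaConv κ u x‖ₑ ^ 2 ≤ (∫⁻ y, ‖yukawa κ y‖ₑ ^ 2) * (∫⁻ y, ‖u y‖ₑ) ^ 2 := by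
  have hm : AEMeasurable (fun q : E3 × E3 => ‖u q.2‖ₑ * ‖yukawa κ (q.1 - q.2)‖ₑ ^ 2)
      (volume.prod volume) :=
    (hu.enorm.comp_quasiMeasurePreserving Measure.quasiMeasurePreserving_snd).mul
      (by fun_prop : Measurable fun q : E3 × E3 => ‖yukawa κ (q.1 - q.2)‖ₑ ^ 2).aemeasurable
  have hpt : ∀ x, ‖yukawaConv κ u x‖ₑ ^ 2 ≤
      (∫⁻ y, ‖u y‖ₑ) * ∫⁻ y, ‖u y‖ₑ * ‖yukawa κ (x - y)‖ₑ ^ 2 := fun x => by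
    refine (pow_le_pow_left' (enorm_yukawaConv_le κ u x) 2).trans ?_
    simp_rw [mul_comm (‖yukawa κ (x - _)‖ₑ)]
    exact lintegral_mul_sq_le_weighted hu.enorm (by fun_prop)
  refine (lintegral_mono hpt).trans (le_of_eq ?_)
  rw [lintegral_const_mul'' _ hm.lintegral_prod_right', lintegral_lintegral_swap hm]
  have : ∀ y, ∫⁻ x, ‖u y‖ₑ * ‖yukawa κ (x - y)‖ₑ ^ 2 = ‖u y‖ₑ * ∫⁻ x, ‖yukawa κ x‖ₑ ^ 2 := fun y => by
    rw [lintegral_const_mul' _ _ enorm_ne_top,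
      lintegral_sub_right_eq_self (fun x => ‖yukawa κ x‖ₑ ^ 2) y]
  simp_rw [this]
  rw [lintegral_mul_const'' _ hu.enorm]
  ring

theorem lintegral_yukawa_div_sq {κ n : ℝ} (hκ : 0 < κ) (hn : 0 < n) :
    ∫⁻ y, ‖yukawa (κ / n) y‖ₑ ^ 2 = ENNReal.ofReal n * ∫⁻ y, ‖yukawa κ y‖ₑ ^ 2 := by
  rw [lintegral_yukawa_sq hκ, lintegral_yukawa_sq (div_pos hκ hn), ← ENNReal.ofReal_mul hn.le]
  congr 1
  field_simp

/-- The squared error made when the kernel is evaluated at the centre of the obstacle. -/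
noncomputable def shiftError (κ n : ℝ) (v : E3 → ℂ) (z ξ : E3) : ℝ≥0∞ :=
  ∫⁻ ξ', ‖v ξ'‖ₑ * ‖yukawa κ (z + n⁻¹ • (ξ - ξ')) - yukawa κ z‖ₑ ^ 2

/-- The field of the extended charge `v` is compared with that of its total charge placed at the
centre. Cauchy–Schwarz is used with weight `|v|`, so that only one power of `v` remains inside the
error. -/
theorem enorm_yukawaConv_sub_point_sq_le {κ n : ℝ} (hκ : 0 ≤ κ) (hn : 0 < n) {v : E3 → ℂ}
    (h1 : Integrable v) (h2 : ∫⁻ y, ‖v y‖ₑ ^ 2 < ⊤) (z ξ : E3) :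
    ‖yukawaConv (κ / n) v (n • z + ξ) - (n⁻¹ : ℝ) * ((∫ y, v y) * yukawa κ z)‖ₑ ^ 2 ≤
      ENNReal.ofReal n⁻¹ ^ 2 * ((∫⁻ y, ‖v y‖ₑ) * shiftError κ n v z ξ) := by
  have hk : ∀ y, yukawa (κ / n) (n • z + ξ - y) = n⁻¹ * yukawa κ (z + n⁻¹ • (ξ - y)) := fun y => by
    rw [← yukawa_scale κ hn]
    congr 2
    rw [add_sub_assoc, smul_add, smul_smul, inv_mul_cancel₀ hn.ne', one_smul]
  have e : yukawaConv (κ / n) v (n • z + ξ) - (n⁻¹ : ℝ) * ((∫ y, v y) * yukawa κ z) =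
      (n⁻¹ : ℝ) * ∫ y, ((yukawa κ (z + n⁻¹ • (ξ - y)) - yukawa κ z : ℝ) : ℂ) * v y := by
    have hi := integrable_yukawa_mul (div_nonneg hκ hn.le) h1 h2 (n • z + ξ)
    have e1 : (n⁻¹ : ℝ) * ((∫ y, v y) * yukawa κ z) = ∫ y, ((n⁻¹ : ℝ) * yukawa κ z : ℂ) * v y := by
      rw [integral_const_mul]
      ring
    rw [e1, yukawaConv, ← integral_sub hi (h1.const_mul _), ← integral_const_mul]
    congr 1
    ext y
    rw [hk]
    push_cast
    ring
  rw [e, enorm_mul, mul_pow, enorm_ofReal_complex, Real.enorm_eq_ofReal (by positivity)]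
  gcongr
  refine (pow_le_pow_left' (enorm_integral_le_lintegral_enorm _) 2).trans ?_
  simp_rw [enorm_mul, enorm_ofReal_complex, mul_comm (‖yukawa κ _ - _‖ₑ)]
  exact lintegral_mul_sq_le_weighted h1.1.enorm (by fun_prop)

theorem measurable_shiftError (κ n : ℝ) {v : E3 → ℂ} (hv : Measurable v) :
    Measurable fun q : E3 × E3 => shiftError κ n v q.1 q.2 := by
  unfold shiftError
  exact Measurable.lintegral_prod_right' (f := fun q : (E3 × E3) × E3 => ‖v q.2‖ₑ *
    ‖yukawa κ (q.1.1 + n⁻¹ • (q.1.2 - q.2)) - yukawa κ q.1.1‖ₑ ^ 2) (by fun_prop)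

theorem measurable_shiftError_right (κ n : ℝ) {v : E3 → ℂ} (hv : Measurable v) (z : E3) :
    Measurable (shiftError κ n v z) := by
  unfold shiftError
  exact Measurable.lintegral_prod_right' (f := fun q : E3 × E3 => ‖v q.2‖ₑ *
    ‖yukawa κ (z + n⁻¹ • (q.1 - q.2)) - yukawa κ z‖ₑ ^ 2) (by fun_prop)

/-- Near the singularity the error is not small pointwise, but its integral over the displacement
`z` is, by the `L²` modulus of the kernel. The estimate `‖ξ - y‖ ≤ (1 + ‖ξ‖)(1 + ‖y‖)` leads to
first moments. -/
theorem lintegral_shiftError_le {κ n : ℝ} (hκ : 0 ≤ κ) (hn : 0 < n) {v : E3 → ℂ}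
    (hv : Measurable v) (ξ : E3) :
    ∫⁻ z, shiftError κ n v z ξ ≤ ENNReal.ofReal sphereArea * ENNReal.ofReal n⁻¹ *
      (ENNReal.ofReal (1 + ‖ξ‖) * ∫⁻ y, ENNReal.ofReal (1 + ‖y‖) * ‖v y‖ₑ) := by
  unfold shiftError
  rw [lintegral_lintegral_swap]
  swap
  · exact (by fun_prop : Measurable fun q : E3 × E3 => ‖v q.2‖ₑ *
      ‖yukawa κ (q.1 + n⁻¹ • (ξ - q.2)) - yukawa κ q.1‖ₑ ^ 2).aemeasurable
  rw [← lintegral_const_mul' _ _ ENNReal.ofReal_ne_top,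
    ← lintegral_const_mul' _ _ (by finiteness)]
  refine lintegral_mono fun y => ?_
  rw [lintegral_const_mul' _ _ enorm_ne_top]
  calc ‖v y‖ₑ * ∫⁻ z, ‖yukawa κ (z + n⁻¹ • (ξ - y)) - yukawa κ z‖ₑ ^ 2
      ≤ ‖v y‖ₑ * ENNReal.ofReal (sphereArea * ‖n⁻¹ • (ξ - y)‖) := by
        gcongr
        exact lintegral_yukawa_translate_sq_le hκ _
    _ ≤ ‖v y‖ₑ * ENNReal.ofReal (sphereArea * n⁻¹ * ((1 + ‖ξ‖) * (1 + ‖y‖))) := by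
        gcongr ‖v y‖ₑ * ENNReal.ofReal ?_
        rw [norm_smul, Real.norm_of_nonneg (by positivity), mul_assoc]
        have h := norm_sub_le ξ y
        have hs := sphereArea_nonneg
        gcongr
        nlinarith [norm_nonneg ξ, norm_nonneg y, mul_nonneg (norm_nonneg ξ) (norm_nonneg y)]
    _ = _ := by
        have hs := sphereArea_nonneg
        rw [ENNReal.ofReal_mul (by positivity), ENNReal.ofReal_mul hs,
          ENNReal.ofReal_mul (by positivity)]
        ring

/-! ### Error terms -/

section errors

variable {N : ℕ} (κ : ℝ) (G Ψ : E3 → ℂ) (Y : Fin N → E3)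

/-- The fluctuation of the field at the obstacle `i` generated by the other obstacles. -/
noncomputable def localFluctuation (i : Fin N) : ℝ≥0∞ :=
  ‖G (Y i) - ((N : ℝ)⁻¹ : ℝ) * ∑ j ∈ Finset.univ.erase i, Ψ (Y j) * yukawa κ (Y i - Y j)‖ₑ ^ 2

/-- The fluctuation in `L²(ℝ³)` of the field generated by all obstacles. -/
noncomputable def globalFluctuation : ℝ≥0∞ :=
  ∫⁻ x, ‖G x - ((N : ℝ)⁻¹ : ℝ) * ∑ j, Ψ (Y j) * yukawa κ (x - Y j)‖ₑ ^ 2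

/-- The error made by replacing an obstacle by a point source, seen by another obstacle. -/
noncomputable def pairShiftError (V : E3 → ℝ) (κ n : ℝ) (v : E3 → ℂ) (z : E3) : ℝ≥0∞ :=
  ∫⁻ ξ, ‖potA V ξ‖ₑ ^ 2 * shiftError κ n v z ξ

end errors

/-- The data of the limiting problem: the limiting solution `Ψ`, the mean field `G` and the charge
density `v` of a single obstacle. -/
structure LimitData (V : E3 → ℝ) (κ : ℝ) (f : L2) (φ v : E3 → ℂ) (Ψ G : E3 → ℂ) (M : ℝ) : Prop where
  continuous_profile : Continuous φ
  bounded_profile : ∃ K : ℝ, ∀ x, ‖φ x‖ ≤ K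
  charge : ∀ x, v x = (V x : ℂ) * φ x
  profile : ∀ x, φ x = 1 - yukawaConv 0 v x
  integrable_charge : Integrable v
  sq_charge : ∫⁻ x, ‖v x‖ₑ ^ 2 < ⊤
  measurable_charge : Measurable v
  continuous_limit : Continuous Ψ
  measurable_meanField : Measurable G
  bounded_limit : ∀ x, ‖Ψ x‖ ≤ M
  limit : ∀ x, yukawaConv κ f x = Ψ x + (∫ y, v y) * G x

theorem enorm_le_ofReal {z : ℂ} {M : ℝ} (h : ‖z‖ ≤ M) : ‖z‖ₑ ≤ ENNReal.ofReal M := by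
  rw [← ofReal_norm]; exact ENNReal.ofReal_le_ofReal h

theorem natCast_mul_ofReal_inv {N : ℕ} (hN : 0 < N) :
    (N : ℝ≥0∞) * ENNReal.ofReal (N : ℝ)⁻¹ = 1 := by
  have hn : (0 : ℝ) < N := by exact_mod_cast hN
  rw [ENNReal.ofReal_inv_of_pos hn, ENNReal.ofReal_natCast]
  exact ENNReal.mul_inv_cancel (by exact_mod_cast hN.ne') (ENNReal.natCast_ne_top N)

theorem lintegral_four_terms {ι : Type*} (s : Finset ι) (a b c d : ℝ≥0∞) {p q : E3 → ℝ≥0∞}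
    {t : ι → E3 → ℝ≥0∞} (hp : Measurable p) (hq : Measurable q) (ht : ∀ j, Measurable (t j)) :
    ∫⁻ ξ, 4 * (a * p ξ + b * q ξ + c * q ξ + d * ∑ j ∈ s, t j ξ) =
      4 * (a * (∫⁻ ξ, p ξ) + b * (∫⁻ ξ, q ξ) + c * (∫⁻ ξ, q ξ) + d * ∑ j ∈ s, ∫⁻ ξ, t j ξ) := by
  rw [lintegral_const_mul' _ _ (by finiteness), lintegral_add_right _ (by fun_prop),
    lintegral_add_right _ (by fun_prop), lintegral_add_right _ (by fun_prop),
    lintegral_const_mul _ (by fun_prop), lintegral_const_mul _ (by fun_prop),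
    lintegral_const_mul _ (by fun_prop), lintegral_const_mul _ (by fun_prop),
    lintegral_finsetSum _ fun j _ => ht j]

namespace LimitData

variable {V : E3 → ℝ} {κ : ℝ} {f : L2} {φ v Ψ G : E3 → ℂ} {M : ℝ}
  (D : LimitData V κ f φ v Ψ G M) (hκ : 0 < κ) {N : ℕ} (hN : 0 < N) (Y : Fin N → E3)

include D hκ hN

omit hκ hN in
-- The ansatz fails in four ways: the free field varies across an obstacle, the field at an obstacle
-- fluctuates around its mean, the self-interaction uses `κ / N` in place of `0`, and the other
-- obstacles are not points. Leading terms cancel because the profile solves the Lippmann–Schwinger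
-- equation and the limit solves the mean-field equation.
theorem residual_eq (i : Fin N) (ξ : E3) :
    yukawaConv κ f (Y i + (N : ℝ)⁻¹ • ξ) - Ψ (Y i) * φ ξ -
      ∑ j, Ψ (Y j) * yukawaConv (κ / N) v ((N : ℝ) • Y i - (N : ℝ) • Y j + ξ) =
    (yukawaConv κ f (Y i + (N : ℝ)⁻¹ • ξ) - yukawaConv κ f (Y i)) +
    (∫ y, v y) * (G (Y i) - ((N : ℝ)⁻¹ : ℝ) * ∑ j ∈ Finset.univ.erase i,
      Ψ (Y j) * yukawa κ (Y i - Y j)) +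
    Ψ (Y i) * (yukawaConv 0 v ξ - yukawaConv (κ / N) v ξ) +
    -∑ j ∈ Finset.univ.erase i, Ψ (Y j) * (yukawaConv (κ / N) v ((N : ℝ) • (Y i - Y j) + ξ) -
      ((N : ℝ)⁻¹ : ℝ) * ((∫ y, v y) * yukawa κ (Y i - Y j))) := by
  rw [← Finset.add_sum_erase Finset.univ _ (Finset.mem_univ i), sub_self, zero_add, D.limit (Y i),
    D.profile ξ]
  simp_rw [← smul_sub, mul_sub]
  rw [Finset.sum_sub_distrib, Finset.mul_sum, Finset.mul_sum]
  have : ∀ j, Ψ (Y j) * ((((N : ℝ)⁻¹ : ℝ) : ℂ) * ((∫ y, v y) * yukawa κ (Y i - Y j))) =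
      (∫ y, v y) * ((((N : ℝ)⁻¹ : ℝ) : ℂ) * (Ψ (Y j) * yukawa κ (Y i - Y j))) := fun j => by ring
  simp_rw [this]
  ring

theorem enorm_residual_sq_le (i : Fin N) (ξ : E3) :
    ‖(potA V ξ : ℂ) * (yukawaConv κ f (Y i + (N : ℝ)⁻¹ • ξ) - Ψ (Y i) * φ ξ -
    ∑ j, Ψ (Y j) * yukawaConv (κ / N) v ((N : ℝ) • Y i - (N : ℝ) • Y j + ξ))‖ₑ ^ 2 ≤
    4 * (ENNReal.ofReal sphereArea * ENNReal.ofReal (N : ℝ)⁻¹ * (∫⁻ y, ‖f y‖ₑ ^ 2) *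
      (ENNReal.ofReal (1 + ‖ξ‖) * ‖potA V ξ‖ₑ ^ 2) +
    ‖∫ y, v y‖ₑ ^ 2 * localFluctuation κ G Ψ Y i * ‖potA V ξ‖ₑ ^ 2 +
    ENNReal.ofReal M ^ 2 * (ENNReal.ofReal (κ / N / (4 * Real.pi)) * ∫⁻ y, ‖v y‖ₑ) ^ 2 *
      ‖potA V ξ‖ₑ ^ 2 +
    ENNReal.ofReal (N : ℝ)⁻¹ * ENNReal.ofReal M ^ 2 * (∫⁻ y, ‖v y‖ₑ) *
      ∑ j ∈ Finset.univ.erase i, ‖potA V ξ‖ₑ ^ 2 * shiftError κ N v (Y i - Y j) ξ) := by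
  have hn : (0 : ℝ) < N := by exact_mod_cast hN
  have hΨ : ∀ x, ‖Ψ x‖ₑ ≤ ENNReal.ofReal M := fun x => enorm_le_ofReal (D.bounded_limit x)
  rw [D.residual_eq Y i ξ, enorm_mul, enorm_ofReal_complex, mul_pow]
  refine (mul_le_mul_right (enorm_add_four_sq_le _ _ _ _) _).trans ?_
  have hdist : ∀ k a b c d : ℝ≥0∞,
      k * (4 * (a + b + c + d)) = 4 * (k * a + k * b + k * c + k * d) := fun k a b c d => by ring
  rw [hdist]
  gcongr 4 * (?_ + ?_ + ?_ + ?_)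
  · have h1 := enorm_yukawaConv_translate_sq_le hκ.le (Lp.aestronglyMeasurable f)
      (integrable_yukawa_mul_coeFn hκ f) (Y i) ((N : ℝ)⁻¹ • ξ)
    have h2 : ENNReal.ofReal (sphereArea * ‖(N : ℝ)⁻¹ • ξ‖) ≤
        ENNReal.ofReal sphereArea * ENNReal.ofReal (N : ℝ)⁻¹ * ENNReal.ofReal (1 + ‖ξ‖) := by
      rw [← ENNReal.ofReal_mul sphereArea_nonneg, ← ENNReal.ofReal_mul
        (mul_nonneg sphereArea_nonneg (by positivity)), norm_smul,
        Real.norm_of_nonneg (by positivity), mul_assoc]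
      have := sphereArea_nonneg
      gcongr
      linarith
    calc _ ≤ ‖potA V ξ‖ₑ ^ 2 * (ENNReal.ofReal sphereArea * ENNReal.ofReal (N : ℝ)⁻¹ *
          ENNReal.ofReal (1 + ‖ξ‖) * ∫⁻ y, ‖f y‖ₑ ^ 2) := by
          gcongr
          exact h1.trans (by gcongr)
      _ = _ := by ring
  · rw [enorm_mul, mul_pow, localFluctuation]
    exact le_of_eq (by ring)
  · rw [enorm_mul, mul_comm]
    gcongr
    rw [mul_pow]
    gcongr
    · exact hΨ _
    · exact enorm_yukawaConv_zero_sub_le (by positivity) D.integrable_charge D.sq_charge ξ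
  · rw [enorm_neg, ← Finset.mul_sum, mul_left_comm]
    gcongr
    refine (pow_le_pow_left' (enorm_sum_le _ _) 2).trans ((sq_sum_le _ _).trans ?_)
    have hterm : ∀ j ∈ Finset.univ.erase i, ‖Ψ (Y j) * (yukawaConv (κ / N) v
        ((N : ℝ) • (Y i - Y j) + ξ) - ((N : ℝ)⁻¹ : ℝ) * ((∫ y, v y) * yukawa κ (Y i - Y j)))‖ₑ ^ 2 ≤
        ENNReal.ofReal M ^ 2 * (ENNReal.ofReal (N : ℝ)⁻¹ ^ 2 * ((∫⁻ y, ‖v y‖ₑ) *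
          shiftError κ N v (Y i - Y j) ξ)) := fun j _ => by
      rw [enorm_mul, mul_pow]
      gcongr
      · exact hΨ _
      · exact enorm_yukawaConv_sub_point_sq_le hκ.le hn D.integrable_charge D.sq_charge _ _
    -- Squaring a sum of at most `N` terms costs a factor `N`, which cancels one of the two powers
    -- of `1/N` in each term.
    have hcard : ((Finset.univ.erase i).card : ℝ≥0∞) ≤ N := by
      exact_mod_cast (Finset.card_le_univ _).trans (by simp)
    calc _ ≤ (N : ℝ≥0∞) * ∑ j ∈ Finset.univ.erase i, ENNReal.ofReal M ^ 2 *
          (ENNReal.ofReal (N : ℝ)⁻¹ ^ 2 * ((∫⁻ y, ‖v y‖ₑ) * shiftError κ N v (Y i - Y j) ξ)) :=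
          mul_le_mul' hcard (Finset.sum_le_sum hterm)
      _ = ((N : ℝ≥0∞) * ENNReal.ofReal (N : ℝ)⁻¹) * (ENNReal.ofReal (N : ℝ)⁻¹ *
          ENNReal.ofReal M ^ 2 * (∫⁻ y, ‖v y‖ₑ) *
            ∑ j ∈ Finset.univ.erase i, shiftError κ N v (Y i - Y j) ξ) := by
          simp_rw [← Finset.mul_sum]
          ring
      _ = _ := by rw [natCast_mul_ofReal_inv hN, one_mul]

theorem lintegral_residual_le (hV : IsAdmissible V) (i : Fin N) :
    ∫⁻ ξ, ‖(potA V ξ : ℂ) * (yukawaConv κ f (Y i + (N : ℝ)⁻¹ • ξ) - Ψ (Y i) * φ ξ -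
      ∑ j, Ψ (Y j) * yukawaConv (κ / N) v ((N : ℝ) • Y i - (N : ℝ) • Y j + ξ))‖ₑ ^ 2 ≤
    4 * (ENNReal.ofReal sphereArea * ENNReal.ofReal (N : ℝ)⁻¹ * (∫⁻ y, ‖f y‖ₑ ^ 2) *
        (∫⁻ ξ, ENNReal.ofReal (1 + ‖ξ‖) * ‖potA V ξ‖ₑ ^ 2) +
      ‖∫ y, v y‖ₑ ^ 2 * localFluctuation κ G Ψ Y i * (∫⁻ ξ, ‖potA V ξ‖ₑ ^ 2) +
      ENNReal.ofReal M ^ 2 * (ENNReal.ofReal (κ / N / (4 * Real.pi)) * ∫⁻ y, ‖v y‖ₑ) ^ 2 *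
        (∫⁻ ξ, ‖potA V ξ‖ₑ ^ 2) +
      ENNReal.ofReal (N : ℝ)⁻¹ * ENNReal.ofReal M ^ 2 * (∫⁻ y, ‖v y‖ₑ) *
        ∑ j ∈ Finset.univ.erase i, pairShiftError V κ N v (Y i - Y j)) := by
  have hAm := measurable_potA hV.measurable
  have hsm : ∀ j, Measurable fun ξ => ‖potA V ξ‖ₑ ^ 2 * shiftError κ N v (Y i - Y j) ξ := fun j =>
    (hAm.enorm.pow_const 2).mul (measurable_shiftError_right κ N D.measurable_charge _)
  refine (lintegral_mono (D.enorm_residual_sq_le hκ hN Y i)).trans (le_of_eq ?_)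
  unfold pairShiftError
  exact lintegral_four_terms _ _ _ _ _ (p := fun ξ => ENNReal.ofReal (1 + ‖ξ‖) * ‖potA V ξ‖ₑ ^ 2)
    (q := fun ξ => ‖potA V ξ‖ₑ ^ 2) (by fun_prop) (by fun_prop) hsm

end LimitData

/-! ### Comparison of the `N`-obstacle solution with the limiting solution -/

/-- The random error controlling the distance to the limiting solution. -/
noncomputable def totalError (V : E3 → ℝ) (κ : ℝ) (v G Ψ : E3 → ℂ) {N : ℕ} (Y : Fin N → E3) :
    ℝ≥0∞ :=
  ENNReal.ofReal (N : ℝ)⁻¹ * (∑ i, localFluctuation κ G Ψ Y i) +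
    ENNReal.ofReal (N : ℝ)⁻¹ ^ 2 *
      (∑ i, ∑ j ∈ Finset.univ.erase i, pairShiftError V κ N v (Y i - Y j)) +
    globalFluctuation κ G Ψ Y

theorem ofReal_inv_le_one {N : ℕ} (hN : 0 < N) : ENNReal.ofReal (N : ℝ)⁻¹ ≤ 1 := by
  rw [ENNReal.ofReal_le_one]
  exact inv_le_one_of_one_le₀ (by exact_mod_cast hN)

theorem lintegral_add_three {p q r : E3 → ℝ≥0∞} (hp : Measurable p) (hq : Measurable q) :
    ∫⁻ x, p x + q x + r x = (∫⁻ x, p x) + (∫⁻ x, q x) + ∫⁻ x, r x := by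
  rw [lintegral_add_left (by fun_prop), lintegral_add_left hp]

namespace IsAdmissible

variable {V : E3 → ℝ} (hV : IsAdmissible V) {κ : ℝ} (hκ : 0 < κ) {N : ℕ} (hN : 0 < N)
  (Y : Fin N → E3)

include hV hκ hN

/-- Powers of `N`: Cauchy–Schwarz over the obstacles costs `N`, the change of variables gives `N⁻³`,
and `‖G_{κ/N}‖₂² = N ‖G_κ‖₂²`. The remaining `N⁻¹` averages the individual energies. -/
theorem lintegral_sum_yukawaConv_sq_le {e : Fin N → E3 → ℂ}
    (he : ∀ i, AEStronglyMeasurable (e i) volume) :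
    ∫⁻ x, ‖∑ j, yukawaConv (κ / N) (fun ξ => (V ξ : ℂ) * e j ξ) ((N : ℝ) • (x - Y j))‖ₑ ^ 2 ≤
      ENNReal.ofReal (N : ℝ)⁻¹ * ((∫⁻ y, ‖yukawa κ y‖ₑ ^ 2) * (∫⁻ y, ‖potB V y‖ₑ ^ 2)) *
        ∑ j, ∫⁻ ξ, ‖(potA V ξ : ℂ) * e j ξ‖ₑ ^ 2 := by
  have hn : (0 : ℝ) < N := by exact_mod_cast hN
  have hum : ∀ j, AEStronglyMeasurable (fun ξ => (V ξ : ℂ) * e j ξ) volume := fun j =>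
    (Complex.measurable_ofReal.comp hV.measurable).aestronglyMeasurable.mul (he j)
  have hcm : ∀ j, Measurable (yukawaConv (κ / N) (fun ξ => (V ξ : ℂ) * e j ξ)) := fun j =>
    (stronglyMeasurable_yukawaConv _ (hum j)).measurable
  have hL1 : ∀ j, (∫⁻ ξ, ‖(V ξ : ℂ) * e j ξ‖ₑ) ^ 2 ≤
      (∫⁻ y, ‖potB V y‖ₑ ^ 2) * ∫⁻ ξ, ‖(potA V ξ : ℂ) * e j ξ‖ₑ ^ 2 := fun j => by
    have h := hV.sq_lintegral_potB_mul_le (hV.memLp_potA.1.mul (he j))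
    refine le_trans (le_of_eq ?_) h
    congr 2
    ext ξ
    rw [Pi.mul_apply, ← mul_assoc, ← Complex.ofReal_mul, mul_comm (potB V ξ), potA_mul_potB]
  have hone : ∀ j, ∫⁻ x, ‖yukawaConv (κ / N) (fun ξ => (V ξ : ℂ) * e j ξ)
      ((N : ℝ) • (x - Y j))‖ₑ ^ 2 ≤ ENNReal.ofReal (((N : ℝ) ^ 3)⁻¹) * (ENNReal.ofReal N *
        (∫⁻ y, ‖yukawa κ y‖ₑ ^ 2) * ((∫⁻ y, ‖potB V y‖ₑ ^ 2) *
          ∫⁻ ξ, ‖(potA V ξ : ℂ) * e j ξ‖ₑ ^ 2)) := fun j => by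
    rw [lintegral_comp_smul_sub hn (Y j)
      (G := fun w => ‖yukawaConv (κ / N) (fun ξ => (V ξ : ℂ) * e j ξ) w‖ₑ ^ 2)
      ((hcm j).enorm.pow_const 2)]
    gcongr
    refine (lintegral_yukawaConv_sq_le_young (κ / N) (hum j)).trans ?_
    rw [lintegral_yukawa_div_sq hκ hn]
    gcongr
    exact hL1 j
  have hpt : ∀ x, ‖∑ j, yukawaConv (κ / N) (fun ξ => (V ξ : ℂ) * e j ξ)
      ((N : ℝ) • (x - Y j))‖ₑ ^ 2 ≤ (N : ℝ≥0∞) * ∑ j, ‖yukawaConv (κ / N)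
        (fun ξ => (V ξ : ℂ) * e j ξ) ((N : ℝ) • (x - Y j))‖ₑ ^ 2 := fun x => by
    refine (pow_le_pow_left' (enorm_sum_le _ _) 2).trans ((sq_sum_le _ _).trans ?_)
    simp
  refine (lintegral_mono hpt).trans ?_
  have hcm' : ∀ j ∈ Finset.univ, Measurable fun x => ‖yukawaConv (κ / N)
      (fun ξ => (V ξ : ℂ) * e j ξ) ((N : ℝ) • (x - Y j))‖ₑ ^ 2 := fun j _ =>
    ((hcm j).comp (by fun_prop : Measurable fun x : E3 => (N : ℝ) • (x - Y j))).enorm.pow_const 2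
  rw [lintegral_const_mul' _ _ (ENNReal.natCast_ne_top N), lintegral_finsetSum _ hcm']
  refine (mul_le_mul_right (Finset.sum_le_sum fun j _ => hone j) _).trans (le_of_eq ?_)
  have hscal : (N : ℝ≥0∞) * (ENNReal.ofReal (((N : ℝ) ^ 3)⁻¹) * ENNReal.ofReal N) =
      ENNReal.ofReal (N : ℝ)⁻¹ := by
    rw [← ENNReal.ofReal_natCast, ← ENNReal.ofReal_mul (by positivity),
      ← ENNReal.ofReal_mul (by positivity)]
    congr 1
    field_simp
  simp_rw [← Finset.mul_sum]
  rw [← hscal]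
  ring

end IsAdmissible

namespace LimitData

variable {V : E3 → ℝ} {κ : ℝ} {f : L2} {φ v Ψ G : E3 → ℂ} {M : ℝ}
  (D : LimitData V κ f φ v Ψ G M) (hκ : 0 < κ)

include D hκ

/-- Cauchy–Schwarz costs `N`, each squared error carries `N⁻²`, there are `N` of them, and
integrating the shift error gains `N⁻¹`. The summand `+ 0` is the choice `ξ = 0` in the point-source
estimate. -/
theorem lintegral_sum_shift_sq_le {N : ℕ} (hN : 0 < N) (Y : Fin N → E3) :
    ∫⁻ x, ‖∑ j, Ψ (Y j) * (yukawaConv (κ / N) v ((N : ℝ) • (x - Y j) + 0) -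
      ((N : ℝ)⁻¹ : ℝ) * ((∫ y, v y) * yukawa κ (x - Y j)))‖ₑ ^ 2 ≤
    ENNReal.ofReal (N : ℝ)⁻¹ * (ENNReal.ofReal M ^ 2 * (∫⁻ y, ‖v y‖ₑ) * ENNReal.ofReal sphereArea *
      ∫⁻ y, ENNReal.ofReal (1 + ‖y‖) * ‖v y‖ₑ) := by
  have hn : (0 : ℝ) < N := by exact_mod_cast hN
  have hvfin : ∫⁻ y, ‖v y‖ₑ ≠ ⊤ := D.integrable_charge.2.ne
  have hΨ : ∀ x, ‖Ψ x‖ₑ ≤ ENNReal.ofReal M := fun x => enorm_le_ofReal (D.bounded_limit x)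
  have hsm : ∀ c : E3, Measurable fun x => shiftError κ N v (x - c) 0 := fun c => by
    unfold shiftError
    have := D.measurable_charge
    exact Measurable.lintegral_prod_right' (f := fun q : E3 × E3 => ‖v q.2‖ₑ *
      ‖yukawa κ (q.1 - c + (N : ℝ)⁻¹ • (0 - q.2)) - yukawa κ (q.1 - c)‖ₑ ^ 2) (by fun_prop)
  have hpt : ∀ x, ‖∑ j, Ψ (Y j) * (yukawaConv (κ / N) v ((N : ℝ) • (x - Y j) + 0) -
      ((N : ℝ)⁻¹ : ℝ) * ((∫ y, v y) * yukawa κ (x - Y j)))‖ₑ ^ 2 ≤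
      (ENNReal.ofReal (N : ℝ)⁻¹ * (ENNReal.ofReal M ^ 2 * ∫⁻ y, ‖v y‖ₑ)) *
        ∑ j, shiftError κ N v (x - Y j) 0 := fun x => by
    refine (pow_le_pow_left' (enorm_sum_le _ _) 2).trans ((sq_sum_le _ _).trans ?_)
    have hterm : ∀ j ∈ Finset.univ, ‖Ψ (Y j) * (yukawaConv (κ / N) v
        ((N : ℝ) • (x - Y j) + 0) - ((N : ℝ)⁻¹ : ℝ) * ((∫ y, v y) * yukawa κ (x - Y j)))‖ₑ ^ 2 ≤
        ENNReal.ofReal M ^ 2 * (ENNReal.ofReal (N : ℝ)⁻¹ ^ 2 * ((∫⁻ y, ‖v y‖ₑ) *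
          shiftError κ N v (x - Y j) 0)) := fun j _ => by
      rw [enorm_mul, mul_pow]
      gcongr
      · exact hΨ _
      · exact enorm_yukawaConv_sub_point_sq_le hκ.le hn D.integrable_charge D.sq_charge _ _
    calc _ ≤ (N : ℝ≥0∞) * ∑ j, ENNReal.ofReal M ^ 2 * (ENNReal.ofReal (N : ℝ)⁻¹ ^ 2 *
          ((∫⁻ y, ‖v y‖ₑ) * shiftError κ N v (x - Y j) 0)) := by
          refine mul_le_mul' ?_ (Finset.sum_le_sum hterm)
          simp
      _ = ((N : ℝ≥0∞) * ENNReal.ofReal (N : ℝ)⁻¹) * ((ENNReal.ofReal (N : ℝ)⁻¹ *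
          (ENNReal.ofReal M ^ 2 * ∫⁻ y, ‖v y‖ₑ)) * ∑ j, shiftError κ N v (x - Y j) 0) := by
          simp_rw [← Finset.mul_sum]
          ring
      _ = _ := by rw [natCast_mul_ofReal_inv hN, one_mul]
  refine (lintegral_mono hpt).trans ?_
  rw [lintegral_const_mul' _ _ (by finiteness), lintegral_finsetSum _ fun j _ => hsm (Y j)]
  have hone : ∀ j, ∫⁻ x, shiftError κ N v (x - Y j) 0 ≤ ENNReal.ofReal sphereArea *
      ENNReal.ofReal (N : ℝ)⁻¹ * ∫⁻ y, ENNReal.ofReal (1 + ‖y‖) * ‖v y‖ₑ := fun j => by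
    rw [lintegral_sub_right_eq_self (fun x => shiftError κ N v x 0) (Y j)]
    refine (lintegral_shiftError_le hκ.le hn D.measurable_charge 0).trans (le_of_eq ?_)
    simp
  refine (mul_le_mul_right (Finset.sum_le_sum fun j _ => hone j) _).trans (le_of_eq ?_)
  rw [Finset.sum_const, Finset.card_univ, Fintype.card_fin, nsmul_eq_mul]
  calc _ = ((N : ℝ≥0∞) * ENNReal.ofReal (N : ℝ)⁻¹) * (ENNReal.ofReal (N : ℝ)⁻¹ *
        (ENNReal.ofReal M ^ 2 * (∫⁻ y, ‖v y‖ₑ) * ENNReal.ofReal sphereArea *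
      ∫⁻ y, ENNReal.ofReal (1 + ‖y‖) * ‖v y‖ₑ)) := by ring
    _ = _ := by rw [natCast_mul_ofReal_inv hN, one_mul]

/-- The a-priori bound is applied to the deviations `e i = χ_i - Ψ(Y i) φ`, whose residual is that
of the ansatz. The difference of the two solutions then consists of the field of the deviations, the
point-source error, and the fluctuation of the total field. -/
theorem lintegral_sub_sq_le (hV : IsAdmissible V) {C : ℝ≥0∞} (hcoer : IsCoercive V C)
    {N : ℕ} (hN : 0 < N) (Y : Fin N → E3)
    (hsmall : 3 * C * (ENNReal.ofReal (κ / N / (4 * Real.pi)) ^ 2 * (∫⁻ ξ, ‖potA V ξ‖ₑ ^ 2) *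
      (∫⁻ ξ, ‖potB V ξ‖ₑ ^ 2) + totalInteraction V (κ / N) fun i => (N : ℝ) • Y i) ≤ 2⁻¹) {h : L2}
    (heq : h + mulResolvent hκ (hV.measurable_obstaclePotential Y)
      (hV.memLp_obstaclePotential hN Y) h = f) :
    ∫⁻ x, ‖yukawaConv κ h x - Ψ x‖ₑ ^ 2 ≤ 3 *
      (ENNReal.ofReal (N : ℝ)⁻¹ * ((∫⁻ y, ‖yukawa κ y‖ₑ ^ 2) * (∫⁻ y, ‖potB V y‖ₑ ^ 2)) *
        (6 * C * ∑ i, ∫⁻ ξ, ‖(potA V ξ : ℂ) * (yukawaConv κ f (Y i + (N : ℝ)⁻¹ • ξ) -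
          Ψ (Y i) * φ ξ - ∑ j, Ψ (Y j) *
            yukawaConv (κ / N) v ((N : ℝ) • Y i - (N : ℝ) • Y j + ξ))‖ₑ ^ 2) +
      ENNReal.ofReal (N : ℝ)⁻¹ * (ENNReal.ofReal M ^ 2 * (∫⁻ y, ‖v y‖ₑ) *
        ENNReal.ofReal sphereArea * ∫⁻ y, ENNReal.ofReal (1 + ‖y‖) * ‖v y‖ₑ) +
      ‖∫ y, v y‖ₑ ^ 2 * globalFluctuation κ G Ψ Y) := by
  have hn : (0 : ℝ) < N := by exact_mod_cast hN
  obtain ⟨K, -, hK⟩ := exists_norm_yukawaConv_coeFn_le hκ h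
  obtain ⟨K', hK'⟩ := D.bounded_profile
  set ψ := yukawaConv κ h
  have hψc : Continuous ψ := continuous_yukawaConv_coeFn hκ h
  have hφc := D.continuous_profile
  have hrep : ∀ x, ψ x = yukawaConv κ f x - ∑ j, yukawaConv (κ / N)
      (fun ξ => (V ξ : ℂ) * ψ (Y j + (N : ℝ)⁻¹ • ξ)) ((N : ℝ) • (x - Y j)) :=
    hV.yukawaConv_eq_of_resolvent hN Y hκ heq
  set e : Fin N → E3 → ℂ := fun i ξ => ψ (Y i + (N : ℝ)⁻¹ • ξ) - Ψ (Y i) * φ ξ with he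
  have hec : ∀ i, Continuous (e i) := fun i => by simp only [he]; fun_prop
  have heb : ∀ i ξ, ‖e i ξ‖ ≤ K + M * K' := fun i ξ => by
    refine (norm_sub_le _ _).trans (add_le_add (hK _) ?_)
    rw [norm_mul]
    exact mul_le_mul (D.bounded_limit _) (hK' _) (norm_nonneg _)
      ((norm_nonneg _).trans (D.bounded_limit 0))
  have hVχ : ∀ j, Integrable (fun ξ => (V ξ : ℂ) * ψ (Y j + (N : ℝ)⁻¹ • ξ)) := fun j =>
    hV.integrable_mul_of_bounded (by fun_prop) fun ξ => hK _
  have hVχ2 : ∀ j, ∫⁻ ξ, ‖(V ξ : ℂ) * ψ (Y j + (N : ℝ)⁻¹ • ξ)‖ₑ ^ 2 < ⊤ := fun j =>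
    hV.lintegral_mul_sq_lt_top_of_bounded fun ξ => hK _
  have hlin : ∀ j x, yukawaConv (κ / N) (fun ξ => (V ξ : ℂ) * e j ξ) x =
      yukawaConv (κ / N) (fun ξ => (V ξ : ℂ) * ψ (Y j + (N : ℝ)⁻¹ • ξ)) x -
        Ψ (Y j) * yukawaConv (κ / N) v x := fun j x => by
    have i1 := integrable_yukawa_mul (κ := κ / N) (by positivity) (hVχ j) (hVχ2 j) x
    have i2 := integrable_yukawa_mul (κ := κ / N) (by positivity) D.integrable_charge D.sq_charge x
    unfold yukawaConv
    rw [← integral_const_mul, ← integral_sub i1 (i2.const_mul _)]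
    congr 1
    ext y
    rw [D.charge]
    simp only [he]
    ring
  have hap := hV.apriori_bound hcoer (κ := κ / N) (by positivity) (fun i => (N : ℝ) • Y i)
    (e := e) (fun i => (hec i).aestronglyMeasurable)
    (fun i => lintegral_mul_bdd_sq_lt_top
      (by simpa only [enorm_ofReal_complex] using hV.lintegral_potA_sq_lt_top) (heb i)) hsmall
  have hr : ∀ i ξ, e i ξ + ∑ j, yukawaConv (κ / N)
      (fun y => (V y : ℂ) * e j y) ((N : ℝ) • Y i - (N : ℝ) • Y j + ξ) =
      yukawaConv κ f (Y i + (N : ℝ)⁻¹ • ξ) - Ψ (Y i) * φ ξ -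
      ∑ j, Ψ (Y j) * yukawaConv (κ / N) v ((N : ℝ) • Y i - (N : ℝ) • Y j + ξ) := by
    intro i ξ
    simp_rw [hlin]
    rw [Finset.sum_sub_distrib]
    have h1 := hrep (Y i + (N : ℝ)⁻¹ • ξ)
    simp_rw [← smul_sub_smul_add hn] at h1
    simp only [he]
    rw [h1]
    ring
  simp_rw [hr] at hap
  -- Subtract the limiting equation `G_κ * f = Ψ + (∫ v) G`, then add and subtract the point-source
  -- field.
  have hdiff : ∀ x, ψ x - Ψ x =
      -∑ j, yukawaConv (κ / N) (fun ξ => (V ξ : ℂ) * e j ξ) ((N : ℝ) • (x - Y j)) +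
      -∑ j, Ψ (Y j) * (yukawaConv (κ / N) v ((N : ℝ) • (x - Y j) + 0) -
        ((N : ℝ)⁻¹ : ℝ) * ((∫ y, v y) * yukawa κ (x - Y j))) +
      (∫ y, v y) * (G x - ((N : ℝ)⁻¹ : ℝ) * ∑ j, Ψ (Y j) * yukawa κ (x - Y j)) := by
    intro x
    rw [hrep x, D.limit x]
    simp_rw [hlin, add_zero, mul_sub]
    rw [Finset.sum_sub_distrib, Finset.sum_sub_distrib, Finset.mul_sum, Finset.mul_sum]
    have : ∀ j, Ψ (Y j) * ((((N : ℝ)⁻¹ : ℝ) : ℂ) * ((∫ y, v y) * yukawa κ (x - Y j))) =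
        (∫ y, v y) * ((((N : ℝ)⁻¹ : ℝ) : ℂ) * (Ψ (Y j) * yukawa κ (x - Y j))) := fun j => by ring
    simp_rw [this]
    ring
  have hVe : ∀ j, AEStronglyMeasurable (fun ξ => (V ξ : ℂ) * e j ξ) volume := fun j =>
    (Complex.measurable_ofReal.comp hV.measurable).aestronglyMeasurable.mul
      (hec j).aestronglyMeasurable
  have m1 : Measurable fun x => ‖-∑ j, yukawaConv (κ / N) (fun ξ => (V ξ : ℂ) * e j ξ)
      ((N : ℝ) • (x - Y j))‖ₑ ^ 2 := by
    refine (Measurable.neg (Finset.measurable_fun_sum _ fun j _ => ?_)).enorm.pow_const 2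
    exact (stronglyMeasurable_yukawaConv _ (hVe j)).measurable.comp (by fun_prop)
  have m2 : Measurable fun x => ‖-∑ j, Ψ (Y j) * (yukawaConv (κ / N) v ((N : ℝ) • (x - Y j) + 0) -
      ((N : ℝ)⁻¹ : ℝ) * ((∫ y, v y) * yukawa κ (x - Y j)))‖ₑ ^ 2 := by
    refine (Measurable.neg (Finset.measurable_fun_sum _ fun j _ => ?_)).enorm.pow_const 2
    refine Measurable.const_mul (Measurable.sub ?_ (by fun_prop)) _
    exact (stronglyMeasurable_yukawaConv _ D.integrable_charge.1).measurable.comp (by fun_prop)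
  simp_rw [hdiff]
  refine (lintegral_mono fun x => enorm_add_three_sq_le _ _ _).trans ?_
  rw [lintegral_const_mul' _ _ (by finiteness), lintegral_add_three m1 m2]
  gcongr 3 * (?_ + ?_ + ?_)
  · simp_rw [enorm_neg]
    refine (hV.lintegral_sum_yukawaConv_sq_le hκ hN Y fun j => (hec j).aestronglyMeasurable).trans ?_
    gcongr
  · simp_rw [enorm_neg]
    exact D.lintegral_sum_shift_sq_le hκ hN Y
  · simp_rw [enorm_mul, mul_pow]
    rw [lintegral_const_mul' _ _ (by finiteness)]
    exact le_rfl

omit hκ in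
theorem lintegral_charge_moment_lt_top (hV : IsAdmissible V) :
    ∫⁻ y, ENNReal.ofReal (1 + ‖y‖) * ‖v y‖ₑ < ⊤ := by
  obtain ⟨K, hK⟩ := D.bounded_profile
  have h1 : ∀ y, ENNReal.ofReal (1 + ‖y‖) * ‖v y‖ₑ ≤
      ENNReal.ofReal (1 + ‖y‖) * ‖V y‖ₑ * ENNReal.ofReal K := fun y => by
    rw [D.charge, enorm_mul, enorm_ofReal_complex, mul_assoc]
    gcongr
    exact enorm_le_ofReal (hK y)
  refine (lintegral_mono h1).trans_lt ?_
  rw [lintegral_mul_const' _ _ ENNReal.ofReal_ne_top]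
  exact ENNReal.mul_lt_top hV.lintegral_one_add_norm_lt_top ENNReal.ofReal_lt_top

/-- The constant depends on `κ`, `f` and the limiting data but not on `N` or the configuration.
Configuration-independent residual terms are `O(1/N)` for each obstacle; summed over `N` obstacles
they are compensated by the outer factor `1/N`, leaving `O(1/N)`. -/
theorem exists_lintegral_sub_sq_le (hV : IsAdmissible V) {C : ℝ≥0∞} (hC : C ≠ ⊤)
    (hcoer : IsCoercive V C) :
    ∃ C' : ℝ≥0∞, C' ≠ ⊤ ∧ ∀ {N : ℕ} (hN : 0 < N) (Y : Fin N → E3),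
      3 * C * (ENNReal.ofReal (κ / N / (4 * Real.pi)) ^ 2 * (∫⁻ ξ, ‖potA V ξ‖ₑ ^ 2) *
        (∫⁻ ξ, ‖potB V ξ‖ₑ ^ 2) + totalInteraction V (κ / N) fun i => (N : ℝ) • Y i) ≤ 2⁻¹ →
      ∀ h : L2, h + mulResolvent hκ (hV.measurable_obstaclePotential Y)
        (hV.memLp_obstaclePotential hN Y) h = f →
      ∫⁻ x, ‖yukawaConv κ h x - Ψ x‖ₑ ^ 2 ≤
        C' * (ENNReal.ofReal (N : ℝ)⁻¹ + totalError V κ v G Ψ Y) := by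
  have f1 : ∫⁻ y, ‖yukawa κ y‖ₑ ^ 2 ≠ ⊤ := (lintegral_yukawa_sq_lt_top hκ).ne
  have f2 : ∫⁻ y, ‖potB V y‖ₑ ^ 2 ≠ ⊤ := hV.lintegral_potB_sq_lt_top.ne
  have f3 : ∫⁻ y, ‖potA V y‖ₑ ^ 2 ≠ ⊤ := hV.lintegral_potA_sq_lt_top.ne
  have f4 : ∫⁻ ξ, ENNReal.ofReal (1 + ‖ξ‖) * ‖potA V ξ‖ₑ ^ 2 ≠ ⊤ := hV.lintegral_potA_lt_top.ne
  have f5 : ∫⁻ y, ‖v y‖ₑ ≠ ⊤ := D.integrable_charge.2.ne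
  have f6 : ∫⁻ y, ENNReal.ofReal (1 + ‖y‖) * ‖v y‖ₑ ≠ ⊤ := (D.lintegral_charge_moment_lt_top hV).ne
  have f7 : ∫⁻ y, ‖f y‖ₑ ^ 2 ≠ ⊤ := (lintegral_enorm_sq_lt_top (Lp.memLp f)).ne
  have f8 : ‖∫ y, v y‖ₑ ^ 2 ≠ ⊤ := by finiteness
  set Ky := ∫⁻ y, ‖yukawa κ y‖ₑ ^ 2
  set KB := ∫⁻ y, ‖potB V y‖ₑ ^ 2
  set KA := ∫⁻ y, ‖potA V y‖ₑ ^ 2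
  set MA := ∫⁻ ξ, ENNReal.ofReal (1 + ‖ξ‖) * ‖potA V ξ‖ₑ ^ 2
  set v1 := ∫⁻ y, ‖v y‖ₑ
  set Mv := ∫⁻ y, ENNReal.ofReal (1 + ‖y‖) * ‖v y‖ₑ
  set f2' := ∫⁻ y, ‖f y‖ₑ ^ 2
  set a2 := ‖∫ y, v y‖ₑ ^ 2
  set sA := ENNReal.ofReal sphereArea
  set m2 := ENNReal.ofReal M ^ 2
  have f9 : sA ≠ ⊤ := ENNReal.ofReal_ne_top
  have f10 : m2 ≠ ⊤ := by finiteness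
  set q := ENNReal.ofReal (κ / (4 * Real.pi))
  have f11 : q ≠ ⊤ := ENNReal.ofReal_ne_top
  refine ⟨3 * (Ky * KB * (6 * C * (4 * (sA * f2' * MA + a2 * KA + m2 * (q * v1) ^ 2 * KA +
    m2 * v1))) + m2 * v1 * sA * Mv + a2), by finiteness, fun {N} hN Y hsmall h heq => ?_⟩
  refine (D.lintegral_sub_sq_le hκ hV hcoer hN Y hsmall heq).trans ?_
  set ε := ENNReal.ofReal (N : ℝ)⁻¹
  set E1 := ∑ i, localFluctuation κ G Ψ Y i
  set E2 := ∑ i, ∑ j ∈ Finset.univ.erase i, pairShiftError V κ N v (Y i - Y j)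
  have hres := Finset.sum_le_sum fun (i : Fin N) (_ : i ∈ Finset.univ) =>
    D.lintegral_residual_le hκ hN Y hV i
  have hq : ENNReal.ofReal (κ / N / (4 * Real.pi)) = q * ε := by
    rw [← ENNReal.ofReal_mul (by positivity)]
    congr 1
    field_simp
  have hNε : (N : ℝ≥0∞) * ε = 1 := natCast_mul_ofReal_inv hN
  have hε : ε ≤ 1 := ofReal_inv_le_one hN
  have hT : totalError V κ v G Ψ Y = ε * E1 + ε ^ 2 * E2 + globalFluctuation κ G Ψ Y := rfl
  set T := ε + totalError V κ v G Ψ Y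
  have t1 : ε ≤ T := le_self_add
  have t2 : ε * E1 ≤ T := by
    refine le_trans ?_ le_add_self
    rw [hT, add_assoc]
    exact le_self_add
  have t3 : ε ^ 2 * E2 ≤ T := by
    refine le_trans ?_ le_add_self
    rw [hT, add_right_comm]
    exact le_add_self
  have t4 : globalFluctuation κ G Ψ Y ≤ T := by
    refine le_trans ?_ le_add_self
    rw [hT]
    exact le_add_self
  have hsum : ε * ∑ i, ∫⁻ ξ, ‖(potA V ξ : ℂ) * (yukawaConv κ f (Y i + (N : ℝ)⁻¹ • ξ) -
      Ψ (Y i) * φ ξ - ∑ j, Ψ (Y j) *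
        yukawaConv (κ / N) v ((N : ℝ) • Y i - (N : ℝ) • Y j + ξ))‖ₑ ^ 2 ≤
      (4 * (sA * f2' * MA + a2 * KA + m2 * (q * v1) ^ 2 * KA + m2 * v1)) * T := by
    refine (mul_le_mul_right hres _).trans ?_
    rw [← Finset.mul_sum, Finset.sum_add_distrib, Finset.sum_add_distrib, Finset.sum_add_distrib,
      Finset.sum_const, Finset.sum_const, Finset.card_univ, Fintype.card_fin, nsmul_eq_mul,
      nsmul_eq_mul, ← Finset.sum_mul, ← Finset.mul_sum, ← Finset.mul_sum, hq]
    calc _ = 4 * (sA * f2' * MA * (((N : ℝ≥0∞) * ε) * ε) + a2 * KA * (ε * E1) +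
          m2 * (q * v1) ^ 2 * KA * (((N : ℝ≥0∞) * ε) * (ε * ε)) + m2 * v1 * (ε ^ 2 * E2)) := by
          ring
      _ ≤ 4 * (sA * f2' * MA * T + a2 * KA * T + m2 * (q * v1) ^ 2 * KA * T + m2 * v1 * T) := by
          rw [hNε, one_mul, one_mul]
          have hεε : ε * ε ≤ T := (mul_le_of_le_one_left' hε).trans t1
          gcongr
      _ = _ := by ring
  calc _ = 3 * (Ky * KB * (6 * C * (ε * ∑ i, ∫⁻ ξ, ‖(potA V ξ : ℂ) *
        (yukawaConv κ f (Y i + (N : ℝ)⁻¹ • ξ) - Ψ (Y i) * φ ξ - ∑ j, Ψ (Y j) *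
        yukawaConv (κ / N) v ((N : ℝ) • Y i - (N : ℝ) • Y j + ξ))‖ₑ ^ 2)) +
        m2 * v1 * sA * Mv * ε + a2 * globalFluctuation κ G Ψ Y) := by ring
    _ ≤ 3 * (Ky * KB * (6 * C * ((4 * (sA * f2' * MA + a2 * KA + m2 * (q * v1) ^ 2 * KA +
        m2 * v1)) * T)) + m2 * v1 * sA * Mv * T + a2 * T) := by gcongr
    _ = _ := by ring

end LimitData

/-! ### The law of large numbers in mean square -/

section lln

variable {α : Type*} [MeasurableSpace α] (μ : Measure α) [IsProbabilityMeasure μ]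

/-- Variances of independent coordinates add, and each is at most the second moment. -/
theorem lintegral_sum_sub_sq_le_real {X : α → ℝ} (hX : MemLp X 2 μ) (n : ℕ) :
    ∫⁻ Y, ‖∑ j : Fin n, (X (Y j) - ∫ y, X y ∂μ)‖ₑ ^ 2 ∂(Measure.pi fun _ => μ) ≤
      n * ∫⁻ y, ‖X y‖ₑ ^ 2 ∂μ := by
  set P : Measure (Fin n → α) := Measure.pi fun _ => μ
  have hj : ∀ j : Fin n, MemLp (fun Y : Fin n → α => X (Y j)) 2 P := fun j =>
    hX.comp_measurePreserving (measurePreserving_eval (fun _ => μ) j)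
  have hint : ∀ j : Fin n, ∫ Y, X (Y j) ∂P = ∫ y, X y ∂μ := fun j =>
    integral_comp_eval (μ := fun _ => μ) (i := j) hX.1
  have hmean : ∫ Y, (∑ j : Fin n, fun Y : Fin n → α => X (Y j)) Y ∂P = ∑ j : Fin n, ∫ y, X y ∂μ := by
    simp_rw [Finset.sum_apply]
    rw [integral_finsetSum _ fun j _ => (hj j).integrable one_le_two]
    simp_rw [hint]
  have hS : MemLp (∑ j : Fin n, fun Y : Fin n → α => X (Y j)) 2 P :=
    memLp_finsetSum' _ fun j _ => hj j
  have hvar := ProbabilityTheory.variance_sum_pi (μ := fun _ : Fin n => μ) (X := fun _ => X)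
    (fun _ => hX)
  have he : ∫⁻ Y, ‖∑ j : Fin n, (X (Y j) - ∫ y, X y ∂μ)‖ₑ ^ 2 ∂P =
      ProbabilityTheory.evariance (∑ j : Fin n, fun Y : Fin n → α => X (Y j)) P := by
    unfold ProbabilityTheory.evariance
    rw [hmean]
    congr 1
    ext Y
    rw [Finset.sum_apply, Finset.sum_sub_distrib]
  have hsq : ENNReal.ofReal (∫ y, X y ^ 2 ∂μ) = ∫⁻ y, ‖X y‖ₑ ^ 2 ∂μ := by
    rw [ofReal_integral_eq_lintegral_ofReal hX.integrable_sq
      (Eventually.of_forall fun y => sq_nonneg _)]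
    simp_rw [enorm_sq_eq_ofReal]
  rw [he, ← ProbabilityTheory.ofReal_variance hS, hvar, Finset.sum_const, Finset.card_univ,
    Fintype.card_fin, nsmul_eq_mul, ENNReal.ofReal_mul (by positivity), ENNReal.ofReal_natCast,
    ← hsq]
  gcongr
  exact ProbabilityTheory.variance_le_expectation_sq hX.1

theorem enorm_sq_eq_re_add_im (z : ℂ) : ‖z‖ₑ ^ 2 = ‖z.re‖ₑ ^ 2 + ‖z.im‖ₑ ^ 2 := by
  rw [enorm_sq_eq_ofReal, enorm_sq_eq_ofReal, ← ENNReal.ofReal_add (sq_nonneg _) (sq_nonneg _),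
    ← ofReal_norm, ← ENNReal.ofReal_pow (norm_nonneg _), Complex.sq_norm, Complex.normSq_apply]
  congr 1
  ring

theorem lintegral_sum_sub_sq_le {k : α → ℂ} (hk : Measurable k) (n : ℕ) :
    ∫⁻ Y, ‖∑ j : Fin n, (k (Y j) - ∫ y, k y ∂μ)‖ₑ ^ 2 ∂(Measure.pi fun _ => μ) ≤
      n * ∫⁻ y, ‖k y‖ₑ ^ 2 ∂μ := by
  rcases Nat.eq_zero_or_pos n with rfl | hn
  · simp
  -- With an infinite second moment and `n > 0` the right-hand side is infinite.
  by_cases htop : ∫⁻ y, ‖k y‖ₑ ^ 2 ∂μ = ⊤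
  · rw [htop, ENNReal.mul_top (by exact_mod_cast hn.ne')]
    exact le_top
  have hkL : MemLp k 2 μ := by
    refine ⟨hk.aestronglyMeasurable, ?_⟩
    rw [eLpNorm_lt_top_iff_lintegral_rpow_enorm_lt_top (by norm_num) (by norm_num)]
    simpa using lt_top_iff_ne_top.mpr htop
  have hki := hkL.integrable one_le_two
  have hre := integral_re hki
  have him := integral_im hki
  have e : ∀ Y : Fin n → α, ‖∑ j : Fin n, (k (Y j) - ∫ y, k y ∂μ)‖ₑ ^ 2 =
      ‖∑ j : Fin n, ((k (Y j)).re - ∫ y, (k y).re ∂μ)‖ₑ ^ 2 +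
        ‖∑ j : Fin n, ((k (Y j)).im - ∫ y, (k y).im ∂μ)‖ₑ ^ 2 := fun Y => by
    rw [enorm_sq_eq_re_add_im, Complex.re_sum, Complex.im_sum]
    simp_rw [Complex.sub_re, Complex.sub_im]
    congr 5
    · ext j
      exact congrArg _ hre.symm
    · ext j
      exact congrArg _ him.symm
  have m1 : Measurable fun Y : Fin n → α =>
      ‖∑ j : Fin n, ((k (Y j)).re - ∫ y, (k y).re ∂μ)‖ₑ ^ 2 := by fun_prop
  simp_rw [e]
  rw [lintegral_add_left m1]
  refine (add_le_add (lintegral_sum_sub_sq_le_real μ hkL.re n)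
    (lintegral_sum_sub_sq_le_real μ hkL.im n)).trans (le_of_eq ?_)
  rw [← mul_add, ← lintegral_add_left (by fun_prop)]
  congr 2
  ext y
  exact (enorm_sq_eq_re_add_im (k y)).symm

/-- Disintegration of the product measure along one coordinate. -/
theorem lintegral_pi_succAbove {n : ℕ} (i : Fin (n + 1)) {F : α × (Fin n → α) → ℝ≥0∞}
    (hF : Measurable F) :
    ∫⁻ Y, F (Y i, fun j => Y (i.succAbove j)) ∂(Measure.pi fun _ : Fin (n + 1) => μ) =
      ∫⁻ y, ∫⁻ Z, F (y, Z) ∂(Measure.pi fun _ : Fin n => μ) ∂μ := by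
  have h := (measurePreserving_piFinSuccAbove (fun _ : Fin (n + 1) => μ) i).lintegral_comp hF
  rw [lintegral_prod _ hF.aemeasurable] at h
  exact h

theorem sum_erase_eq_sum_succAbove {β : Type*} [AddCommMonoid β] {n : ℕ} (i : Fin (n + 1))
    (g : Fin (n + 1) → β) :
    ∑ j ∈ Finset.univ.erase i, g j = ∑ j : Fin n, g (i.succAbove j) := by
  have h : Finset.univ.erase i = Finset.univ.map i.succAboveEmb := by
    ext j
    simp [Fin.exists_succAbove_eq_iff]
  rw [h, Finset.sum_map]
  rfl

/-- Given `Y i`, the other `n` points are still independent with law `μ`, so the variance bound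
holds on each slice. -/
theorem lintegral_sum_erase_sub_sq_le {k : α → α → ℂ} (hk : Measurable (Function.uncurry k))
    {n : ℕ} (i : Fin (n + 1)) :
    ∫⁻ Y, ‖∑ j ∈ Finset.univ.erase i, (k (Y i) (Y j) - ∫ y, k (Y i) y ∂μ)‖ₑ ^ 2
      ∂(Measure.pi fun _ : Fin (n + 1) => μ) ≤ n * ∫⁻ y, ∫⁻ y', ‖k y y'‖ₑ ^ 2 ∂μ ∂μ := by
  simp_rw [sum_erase_eq_sum_succAbove]
  have hmean : Measurable fun y => ∫ y', k y y' ∂μ :=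
    (hk.stronglyMeasurable.integral_prod_right (ν := μ)).measurable
  have hkj : ∀ j : Fin n, Measurable fun q : α × (Fin n → α) => k q.1 (q.2 j) := fun j =>
    hk.comp (measurable_fst.prodMk ((measurable_pi_apply j).comp measurable_snd))
  have hF : Measurable fun q : α × (Fin n → α) =>
      ‖∑ j : Fin n, (k q.1 (q.2 j) - ∫ y, k q.1 y ∂μ)‖ₑ ^ 2 := by
    refine (Finset.measurable_fun_sum _ fun j _ => ?_).enorm.pow_const 2
    exact (hkj j).sub (hmean.comp measurable_fst)
  have h := lintegral_pi_succAbove μ i hF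
  simp only at h
  rw [h, ← lintegral_const_mul' _ _ (ENNReal.natCast_ne_top n)]
  exact lintegral_mono fun y => lintegral_sum_sub_sq_le μ (hk.comp measurable_prodMk_left) n

theorem lintegral_pi_pair {N : ℕ} {i j : Fin N} (hij : j ≠ i) {F : α → α → ℝ≥0∞}
    (hF : Measurable (Function.uncurry F)) :
    ∫⁻ Y, F (Y i) (Y j) ∂(Measure.pi fun _ : Fin N => μ) = ∫⁻ y, ∫⁻ y', F y y' ∂μ ∂μ := by
  obtain ⟨n, rfl⟩ : ∃ n, N = n + 1 := Nat.exists_eq_succ_of_ne_zero (fun h => by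
    subst h; exact i.elim0)
  obtain ⟨j', rfl⟩ := Fin.exists_succAbove_eq hij
  have hm : Measurable fun q : α × (Fin n → α) => F q.1 (q.2 j') :=
    hF.comp (measurable_fst.prodMk ((measurable_pi_apply j').comp measurable_snd))
  have h := lintegral_pi_succAbove μ i hm
  simp only at h
  rw [h]
  congr 1
  ext y
  exact (measurePreserving_eval (fun _ : Fin n => μ) j').lintegral_comp
    (hF.comp measurable_prodMk_left)

theorem lintegral_enorm_le_of_sq_le {P : Measure α} [IsProbabilityMeasure P] {X : α → ℝ≥0∞}
    (hX : AEMeasurable X P) {b : ℝ≥0∞} (h : ∫⁻ y, X y ^ 2 ∂P ≤ b) :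
    ∫⁻ y, X y ∂P ≤ b ^ (1 / 2 : ℝ) := by
  apply le_rpow_half_of_sq_le
  have := lintegral_mul_sq_le (μ := P) (f := fun _ => 1) aemeasurable_const hX
  simp only [one_mul, one_pow, lintegral_const, measure_univ, mul_one] at this
  exact this.trans h

end lln

/-! ### Densities -/

/-- The law on `ℝ³` with density `W`. -/
noncomputable def densityLaw (W : E3 → ℝ) : Measure E3 :=
  (volume : Measure E3).withDensity fun x => ENNReal.ofReal (W x)

theorem lintegral_densityLaw {W : E3 → ℝ} (hW : Measurable W) (g : E3 → ℝ≥0∞) :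
    ∫⁻ y, g y ∂densityLaw W = ∫⁻ y, ENNReal.ofReal (W y) * g y := by
  unfold densityLaw
  rw [lintegral_withDensity_eq_lintegral_mul_non_measurable _ (by fun_prop)
    (Eventually.of_forall fun x => ENNReal.ofReal_lt_top)]
  rfl

theorem integral_densityLaw {W : E3 → ℝ} (hW : Measurable W) (hW0 : ∀ x, 0 ≤ W x) (g : E3 → ℂ) :
    ∫ y, g y ∂densityLaw W = ∫ y, (W y : ℂ) * g y := by
  unfold densityLaw
  have h : (fun x => ENNReal.ofReal (W x)) = fun x => ((W x).toNNReal : ℝ≥0∞) := rfl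
  rw [h, integral_withDensity_eq_integral_smul (by fun_prop)]
  congr 1
  ext y
  rw [NNReal.smul_def, Complex.real_smul, Real.coe_toNNReal _ (hW0 y)]

/-- The law of the difference of two independent points has as density the autocorrelation of `W`,
which by Cauchy–Schwarz is at most `‖W‖₂²`. This is where square integrability of the density is
used. -/
theorem lintegral_densityLaw_sub_le {W : E3 → ℝ} (hW : Measurable W) {k : E3 → ℝ≥0∞}
    (hk : Measurable k) :
    ∫⁻ y, ∫⁻ y', k (y - y') ∂densityLaw W ∂densityLaw W ≤
      (∫⁻ y, ENNReal.ofReal (W y) ^ 2) * ∫⁻ z, k z := by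
  set w : E3 → ℝ≥0∞ := fun y => ENNReal.ofReal (W y)
  have hw : Measurable w := by fun_prop
  have h1 : ∀ y, ∫⁻ y', k (y - y') ∂densityLaw W = ∫⁻ z, w (y - z) * k z := fun y => by
    rw [lintegral_densityLaw hW, ← lintegral_sub_left_eq_self (fun z => w (y - z) * k z) y]
    simp only [sub_sub_cancel]
    rfl
  simp_rw [h1]
  rw [lintegral_densityLaw hW]
  have h2 : ∀ y, ENNReal.ofReal (W y) * ∫⁻ z, w (y - z) * k z = ∫⁻ z, w y * (w (y - z) * k z) :=
    fun y => (lintegral_const_mul' _ _ ENNReal.ofReal_ne_top).symm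
  simp_rw [h2]
  rw [lintegral_lintegral_swap (by fun_prop)]
  have h3 : ∀ z, ∫⁻ y, w y * (w (y - z) * k z) ≤ (∫⁻ y, w y ^ 2) * k z := fun z => by
    simp_rw [← mul_assoc]
    rw [lintegral_mul_const _ (by fun_prop)]
    refine mul_le_mul' ?_ le_rfl
    have h4 := lintegral_mul_sq_le (μ := volume) hw.aemeasurable
      (by fun_prop : Measurable fun y => w (y - z)).aemeasurable
    rw [lintegral_sub_right_eq_self (fun y => w y ^ 2) z, ← sq] at h4
    exact (ENNReal.pow_le_pow_left_iff two_ne_zero).mp h4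
  refine (lintegral_mono h3).trans (le_of_eq ?_)
  rw [lintegral_const_mul _ hk]

/-! ### Expected size of the errors -/

/-- Probability densities on `ℝ³` which are square integrable. -/
structure IsDensity (W : E3 → ℝ) : Prop where
  measurable : Measurable W
  nonneg : ∀ x, 0 ≤ W x
  lintegral_eq_one : ∫⁻ x, ENNReal.ofReal (W x) = 1
  sq : ∫⁻ x, ENNReal.ofReal (W x) ^ 2 < ⊤

theorem IsDensity.isProbabilityMeasure {W : E3 → ℝ} (hW : IsDensity W) :
    IsProbabilityMeasure (densityLaw W) := by
  constructor
  rw [densityLaw, withDensity_apply _ MeasurableSet.univ, setLIntegral_univ]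
  exact hW.lintegral_eq_one

theorem enorm_sub_sq_le (a b : ℂ) : ‖a - b‖ₑ ^ 2 ≤ 2 * (‖a‖ₑ ^ 2 + ‖b‖ₑ ^ 2) :=
  (pow_le_pow_left' (enorm_sub_le (a := a) (b := b)) 2).trans (add_sq_le_two _ _)

theorem enorm_natCast_inv (N : ℕ) : ‖(((N : ℝ)⁻¹ : ℝ) : ℂ)‖ₑ = ENNReal.ofReal (N : ℝ)⁻¹ := by
  rw [enorm_ofReal_complex, Real.enorm_eq_ofReal (by positivity)]

theorem natCast_inv_mul_cancel {N : ℕ} (hN : 0 < N) : (((N : ℝ)⁻¹ : ℝ) : ℂ) * (N : ℂ) = 1 := by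
  have : (N : ℂ) ≠ 0 := by exact_mod_cast hN.ne'
  push_cast
  exact inv_mul_cancel₀ this

section fluctuation

variable {W : E3 → ℝ} (hW : IsDensity W) {κ : ℝ} {Ψ : E3 → ℂ} (hΨ : Continuous Ψ)
  {M : ℝ} (hM : ∀ x, ‖Ψ x‖ ≤ M)

include hW

theorem IsDensity.integral_mul_yukawa (x : E3) :
    ∫ y, Ψ y * yukawa κ (x - y) ∂densityLaw W = yukawaConv κ (fun y => (W y : ℂ) * Ψ y) x := by
  rw [integral_densityLaw hW.measurable hW.nonneg, yukawaConv]
  congr 1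
  ext y
  ring

include hΨ hM

theorem IsDensity.enorm_meanField_sq_le (x : E3) :
    ‖yukawaConv κ (fun y => (W y : ℂ) * Ψ y) x‖ₑ ^ 2 ≤
      ENNReal.ofReal M ^ 2 * ((∫⁻ y, ENNReal.ofReal (W y) ^ 2) * ∫⁻ y, ‖yukawa κ y‖ₑ ^ 2) := by
  have hm : Measurable fun y => (W y : ℂ) * Ψ y :=
    (Complex.measurable_ofReal.comp hW.measurable).mul hΨ.measurable
  refine (enorm_yukawaConv_sq_le κ hm.aestronglyMeasurable x).trans ?_
  have h : ∀ y, ‖(W y : ℂ) * Ψ y‖ₑ ^ 2 ≤ ENNReal.ofReal M ^ 2 * ENNReal.ofReal (W y) ^ 2 := fun y => by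
    rw [enorm_mul, enorm_ofReal_complex, Real.enorm_eq_ofReal (hW.nonneg y), mul_pow, mul_comm]
    gcongr
    exact enorm_le_ofReal (hM y)
  refine (mul_le_mul_right (lintegral_mono h) _).trans (le_of_eq ?_)
  rw [lintegral_const_mul' _ _ (by finiteness)]
  ring

/-- Conditionally on `Y i` the sum is one of independent terms with mean `G (Y i)`. Their second
moment is finite on average because `G_κ²` is integrable and `W ∈ L²`. -/
theorem IsDensity.lintegral_localFluctuation_le {N : ℕ} (i : Fin N) :
    ∫⁻ Y, localFluctuation κ (yukawaConv κ fun y => (W y : ℂ) * Ψ y) Ψ Y i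
        ∂(Measure.pi fun _ : Fin N => densityLaw W) ≤
      2 * ENNReal.ofReal M ^ 2 * ((∫⁻ y, ENNReal.ofReal (W y) ^ 2) * ∫⁻ y, ‖yukawa κ y‖ₑ ^ 2) *
        ENNReal.ofReal (N : ℝ)⁻¹ := by
  have := hW.isProbabilityMeasure
  obtain ⟨n, rfl⟩ : ∃ n, N = n + 1 := Nat.exists_eq_succ_of_ne_zero (fun h => by
    subst h; exact i.elim0)
  set G := yukawaConv κ fun y => (W y : ℂ) * Ψ y
  set w2 := ∫⁻ y, ENNReal.ofReal (W y) ^ 2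
  set Ky := ∫⁻ y, ‖yukawa κ y‖ₑ ^ 2
  set m2 := ENNReal.ofReal M ^ 2
  set ε := ENNReal.ofReal ((n + 1 : ℕ) : ℝ)⁻¹
  have hNε : ((n + 1 : ℕ) : ℝ≥0∞) * ε = 1 := natCast_mul_ofReal_inv n.succ_pos
  have hk : Measurable (Function.uncurry fun y y' : E3 => Ψ y' * (yukawa κ (y - y') : ℂ)) := by
    have := hΨ.measurable
    exact (by fun_prop : Measurable fun q : E3 × E3 => Ψ q.2 * (yukawa κ (q.1 - q.2) : ℂ))
  have hpt : ∀ Y : Fin (n + 1) → E3, localFluctuation κ G Ψ Y i ≤ ε ^ 2 * (2 * (m2 * (w2 * Ky) +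
      ‖∑ j ∈ Finset.univ.erase i, (Ψ (Y j) * (yukawa κ (Y i - Y j) : ℂ) -
        ∫ y, Ψ y * (yukawa κ (Y i - y) : ℂ) ∂densityLaw W)‖ₑ ^ 2)) := fun Y => by
    -- There are `n` summands but the normalization is `n + 1`; the mismatch leaves one extra copy
    -- of `G (Y i)`.
    have e : G (Y i) - ((((n + 1 : ℕ) : ℝ)⁻¹ : ℝ) : ℂ) *
        ∑ j ∈ Finset.univ.erase i, Ψ (Y j) * yukawa κ (Y i - Y j) =
        ((((n + 1 : ℕ) : ℝ)⁻¹ : ℝ) : ℂ) * (G (Y i) - ∑ j ∈ Finset.univ.erase i,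
        (Ψ (Y j) * (yukawa κ (Y i - Y j) : ℂ) - ∫ y, Ψ y * (yukawa κ (Y i - y) : ℂ) ∂densityLaw W)) := by
      rw [hW.integral_mul_yukawa, Finset.sum_sub_distrib, Finset.sum_const,
        Finset.card_erase_of_mem (Finset.mem_univ i), Finset.card_univ, Fintype.card_fin,
        Nat.add_sub_cancel, nsmul_eq_mul]
      have h1 := natCast_inv_mul_cancel n.succ_pos
      have h2 : ((n + 1 : ℕ) : ℂ) = n + 1 := by push_cast; rfl
      rw [Nat.succ_eq_add_one] at h1
      rw [h2] at h1
      linear_combination (-G (Y i)) * h1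
    rw [localFluctuation, e, enorm_mul, mul_pow, enorm_natCast_inv]
    refine mul_le_mul_right ((enorm_sub_sq_le _ _).trans ?_) _
    gcongr
    exact hW.enorm_meanField_sq_le hΨ hM (Y i)
  refine (lintegral_mono hpt).trans ?_
  rw [lintegral_const_mul' _ _ (by finiteness), lintegral_const_mul' _ _ (by finiteness),
    lintegral_add_left measurable_const, lintegral_const, measure_univ, mul_one]
  have h1 := lintegral_sum_erase_sub_sq_le (densityLaw W) hk i
  have h2 : ∫⁻ y, ∫⁻ y', ‖Ψ y' * (yukawa κ (y - y') : ℂ)‖ₑ ^ 2 ∂densityLaw W ∂densityLaw W ≤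
      m2 * (w2 * Ky) := by
    have h3 : ∀ y y', ‖Ψ y' * (yukawa κ (y - y') : ℂ)‖ₑ ^ 2 ≤ m2 * ‖yukawa κ (y - y')‖ₑ ^ 2 :=
      fun y y' => by
        rw [enorm_mul, mul_pow, enorm_ofReal_complex]
        gcongr
        exact pow_le_pow_left' (enorm_le_ofReal (hM y')) 2
    refine (lintegral_mono fun y => lintegral_mono (h3 y)).trans ?_
    simp_rw [lintegral_const_mul' m2 _ (by finiteness)]
    gcongr
    exact lintegral_densityLaw_sub_le hW.measurable (k := fun z => ‖yukawa κ z‖ₑ ^ 2) (by fun_prop)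
  calc _ ≤ ε ^ 2 * (2 * (m2 * (w2 * Ky) + n * (m2 * (w2 * Ky)))) := by
        gcongr
        exact h1.trans (by gcongr)
    _ = 2 * m2 * (w2 * Ky) * ε * (((n + 1 : ℕ) : ℝ≥0∞) * ε) := by
        push_cast
        ring
    _ = _ := by rw [hNε, mul_one]

/-- The variance bound is applied at each `x`. Integrating `G_κ(x - y)²` over `x` before `y` removes
any dependence on the density beyond its total mass. -/
theorem IsDensity.lintegral_globalFluctuation_le {N : ℕ} (hN : 0 < N) :
    ∫⁻ Y, globalFluctuation κ (yukawaConv κ fun y => (W y : ℂ) * Ψ y) Ψ Y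
        ∂(Measure.pi fun _ : Fin N => densityLaw W) ≤
      ENNReal.ofReal M ^ 2 * (∫⁻ y, ‖yukawa κ y‖ₑ ^ 2) * ENNReal.ofReal (N : ℝ)⁻¹ := by
  have := hW.isProbabilityMeasure
  set G := yukawaConv κ fun y => (W y : ℂ) * Ψ y with hG
  set Ky := ∫⁻ y, ‖yukawa κ y‖ₑ ^ 2
  set m2 := ENNReal.ofReal M ^ 2
  set ε := ENNReal.ofReal (N : ℝ)⁻¹ with hε
  have hNε : (N : ℝ≥0∞) * ε = 1 := natCast_mul_ofReal_inv hN
  have hΨm := hΨ.measurable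
  have hGm : Measurable G := (stronglyMeasurable_yukawaConv κ
    ((Complex.measurable_ofReal.comp hW.measurable).mul hΨm).aestronglyMeasurable).measurable
  unfold globalFluctuation
  rw [lintegral_lintegral_swap]
  swap
  · exact (by fun_prop : Measurable fun q : (Fin N → E3) × E3 => ‖G q.2 - ((N : ℝ)⁻¹ : ℝ) *
      ∑ j, Ψ (q.1 j) * yukawa κ (q.2 - q.1 j)‖ₑ ^ 2).aemeasurable
  have hx : ∀ x, ∫⁻ Y, ‖G x - ((N : ℝ)⁻¹ : ℝ) * ∑ j, Ψ (Y j) * yukawa κ (x - Y j)‖ₑ ^ 2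
      ∂(Measure.pi fun _ : Fin N => densityLaw W) ≤
      ε * (m2 * ∫⁻ y, ‖yukawa κ (x - y)‖ₑ ^ 2 ∂densityLaw W) := fun x => by
    have e : ∀ Y : Fin N → E3, ‖G x - ((N : ℝ)⁻¹ : ℝ) * ∑ j, Ψ (Y j) * yukawa κ (x - Y j)‖ₑ ^ 2 =
        ε ^ 2 * ‖∑ j, (Ψ (Y j) * (yukawa κ (x - Y j) : ℂ) -
          ∫ y, Ψ y * (yukawa κ (x - y) : ℂ) ∂densityLaw W)‖ₑ ^ 2 := fun Y => by
      rw [hW.integral_mul_yukawa, Finset.sum_sub_distrib, Finset.sum_const, Finset.card_univ,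
        Fintype.card_fin, nsmul_eq_mul, hε, ← enorm_natCast_inv, ← mul_pow, ← enorm_mul,
        ← enorm_neg]
      congr 2
      linear_combination (G x) * natCast_inv_mul_cancel hN
    simp_rw [e]
    rw [lintegral_const_mul' _ _ (by finiteness)]
    refine (mul_le_mul_right (lintegral_sum_sub_sq_le (densityLaw W)
      (k := fun y => Ψ y * (yukawa κ (x - y) : ℂ)) (by fun_prop) N) _).trans ?_
    calc _ = ε * ((N : ℝ≥0∞) * ε) * ∫⁻ y, ‖Ψ y * (yukawa κ (x - y) : ℂ)‖ₑ ^ 2 ∂densityLaw W := by ring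
      _ ≤ ε * 1 * ∫⁻ y, m2 * ‖yukawa κ (x - y)‖ₑ ^ 2 ∂densityLaw W := by
          rw [hNε]
          refine mul_le_mul_right (lintegral_mono fun y => ?_) _
          rw [enorm_mul, mul_pow, enorm_ofReal_complex]
          gcongr
          exact pow_le_pow_left' (enorm_le_ofReal (hM y)) 2
      _ = _ := by rw [lintegral_const_mul' _ _ (by finiteness), mul_one]
  refine (lintegral_mono hx).trans (le_of_eq ?_)
  rw [lintegral_const_mul' _ _ (by finiteness), lintegral_const_mul' _ _ (by finiteness),
    lintegral_lintegral_swap]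
  swap
  · exact (by fun_prop : Measurable fun q : E3 × E3 => ‖yukawa κ (q.1 - q.2)‖ₑ ^ 2).aemeasurable
  have : ∀ y, ∫⁻ x, ‖yukawa κ (x - y)‖ₑ ^ 2 = Ky := fun y =>
    lintegral_sub_right_eq_self (fun x => ‖yukawa κ x‖ₑ ^ 2) y
  simp_rw [this]
  rw [lintegral_const, measure_univ, mul_one]
  ring

end fluctuation

theorem measurable_pairShiftError {V : E3 → ℝ} (hV : Measurable V) (κ n : ℝ) {v : E3 → ℂ}
    (hv : Measurable v) : Measurable (pairShiftError V κ n v) := by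
  unfold pairShiftError
  have h1 := (measurable_potA hV)
  have h2 := measurable_shiftError κ n hv
  exact Measurable.lintegral_prod_right' (f := fun q : E3 × E3 => ‖potA V q.2‖ₑ ^ 2 *
    shiftError κ n v q.1 q.2) (((h1.comp measurable_snd).enorm.pow_const 2).mul h2)

theorem lintegral_pairShiftError_le {V : E3 → ℝ} (hV : Measurable V) {κ n : ℝ} (hκ : 0 ≤ κ)
    (hn : 0 < n) {v : E3 → ℂ} (hv : Measurable v) :
    ∫⁻ z, pairShiftError V κ n v z ≤ ENNReal.ofReal sphereArea *
      ((∫⁻ ξ, ENNReal.ofReal (1 + ‖ξ‖) * ‖potA V ξ‖ₑ ^ 2) *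
        ∫⁻ y, ENNReal.ofReal (1 + ‖y‖) * ‖v y‖ₑ) * ENNReal.ofReal n⁻¹ := by
  unfold pairShiftError
  have h1 := (measurable_potA hV)
  have h2 := measurable_shiftError κ n hv
  rw [lintegral_lintegral_swap (((h1.comp measurable_snd).enorm.pow_const 2).mul h2).aemeasurable]
  have h3 : ∀ ξ, ∫⁻ z, ‖potA V ξ‖ₑ ^ 2 * shiftError κ n v z ξ ≤
      (ENNReal.ofReal sphereArea * ENNReal.ofReal n⁻¹ *
        ∫⁻ y, ENNReal.ofReal (1 + ‖y‖) * ‖v y‖ₑ) *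
          (ENNReal.ofReal (1 + ‖ξ‖) * ‖potA V ξ‖ₑ ^ 2) := fun ξ => by
    rw [lintegral_const_mul' _ _ (by finiteness)]
    refine (mul_le_mul_right (lintegral_shiftError_le hκ hn hv ξ) _).trans (le_of_eq ?_)
    ring
  refine (lintegral_mono h3).trans (le_of_eq ?_)
  rw [lintegral_const_mul _ (by fun_prop)]
  ring

/-- At most `N²` ordered pairs, each with the same expectation, against the factor `N⁻²`. -/
theorem IsDensity.lintegral_sum_erase_le {W : E3 → ℝ} (hW : IsDensity W) {k : E3 → ℝ≥0∞}
    (hk : Measurable k) {N : ℕ} (hN : 0 < N) :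
    ∫⁻ Y, ENNReal.ofReal (N : ℝ)⁻¹ ^ 2 * ∑ i, ∑ j ∈ Finset.univ.erase i, k (Y i - Y j)
      ∂(Measure.pi fun _ : Fin N => densityLaw W) ≤
      (∫⁻ y, ENNReal.ofReal (W y) ^ 2) * ∫⁻ z, k z := by
  have := hW.isProbabilityMeasure
  have hkm : ∀ i j : Fin N, Measurable fun Y : Fin N → E3 => k (Y i - Y j) := fun i j =>
    hk.comp (by fun_prop)
  rw [lintegral_const_mul' _ _ (by finiteness), lintegral_finsetSum _ fun i _ =>
    Finset.measurable_fun_sum _ fun j _ => hkm i j]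
  have h1 : ∀ i : Fin N, ∫⁻ Y, ∑ j ∈ Finset.univ.erase i, k (Y i - Y j)
      ∂(Measure.pi fun _ : Fin N => densityLaw W) ≤
      N * ((∫⁻ y, ENNReal.ofReal (W y) ^ 2) * ∫⁻ z, k z) := fun i => by
    rw [lintegral_finsetSum _ fun j _ => hkm i j]
    refine (Finset.sum_le_card_nsmul _ _ ((∫⁻ y, ENNReal.ofReal (W y) ^ 2) * ∫⁻ z, k z)
      fun j hj => ?_).trans ?_
    · rw [lintegral_pi_pair (densityLaw W) (Finset.ne_of_mem_erase hj) (F := fun y y' => k (y - y'))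
        (hk.comp (by fun_prop : Measurable fun q : E3 × E3 => q.1 - q.2))]
      exact lintegral_densityLaw_sub_le hW.measurable hk
    · rw [nsmul_eq_mul]
      gcongr
      exact (Finset.card_le_univ _).trans_eq (Fintype.card_fin N)
  refine (mul_le_mul_right (Finset.sum_le_sum fun i _ => h1 i) _).trans (le_of_eq ?_)
  rw [Finset.sum_const, Finset.card_univ, Fintype.card_fin, nsmul_eq_mul]
  calc _ = ((N : ℝ≥0∞) * ENNReal.ofReal (N : ℝ)⁻¹) ^ 2 *
        ((∫⁻ y, ENNReal.ofReal (W y) ^ 2) * ∫⁻ z, k z) := by ring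
    _ = _ := by rw [natCast_mul_ofReal_inv hN, one_pow, one_mul]

namespace LimitData

variable {V : E3 → ℝ} {κ : ℝ} {f : L2} {φ v Ψ : E3 → ℂ} {M : ℝ} {W : E3 → ℝ}
  (D : LimitData V κ f φ v Ψ (yukawaConv κ fun y => (W y : ℂ) * Ψ y) M)

include D

theorem measurable_totalError (hV : IsAdmissible V) (N : ℕ) :
    Measurable fun Y : Fin N → E3 =>
      totalError V κ v (yukawaConv κ fun y => (W y : ℂ) * Ψ y) Ψ Y := by
  have hG := D.measurable_meanField
  have hΨ := D.continuous_limit.measurable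
  set G := yukawaConv κ fun y => (W y : ℂ) * Ψ y
  have hS := measurable_pairShiftError hV.measurable κ N D.measurable_charge
  unfold totalError
  refine Measurable.add (Measurable.add ?_ ?_) ?_
  · unfold localFluctuation
    fun_prop
  · refine Measurable.const_mul (Finset.measurable_fun_sum _ fun i _ =>
      Finset.measurable_fun_sum _ fun j _ => hS.comp (by fun_prop)) _
  · unfold globalFluctuation
    exact Measurable.lintegral_prod_right' (f := fun q : (Fin N → E3) × E3 =>
      ‖G q.2 - ((N : ℝ)⁻¹ : ℝ) * ∑ j, Ψ (q.1 j) * yukawa κ (q.2 - q.1 j)‖ₑ ^ 2) (by fun_prop)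

theorem exists_lintegral_totalError_le (hV : IsAdmissible V) (hκ : 0 < κ) (hW : IsDensity W) :
    ∃ C : ℝ≥0∞, C ≠ ⊤ ∧ ∀ {N : ℕ}, 0 < N →
      ∫⁻ Y, totalError V κ v (yukawaConv κ fun y => (W y : ℂ) * Ψ y) Ψ Y
        ∂(Measure.pi fun _ : Fin N => densityLaw W) ≤ C * ENNReal.ofReal (N : ℝ)⁻¹ := by
  have f1 : ∫⁻ y, ‖yukawa κ y‖ₑ ^ 2 ≠ ⊤ := (lintegral_yukawa_sq_lt_top hκ).ne
  have f2 := hW.sq.ne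
  have f4 : ∫⁻ ξ, ENNReal.ofReal (1 + ‖ξ‖) * ‖potA V ξ‖ₑ ^ 2 ≠ ⊤ := hV.lintegral_potA_lt_top.ne
  have f6 : ∫⁻ y, ENNReal.ofReal (1 + ‖y‖) * ‖v y‖ₑ ≠ ⊤ := (D.lintegral_charge_moment_lt_top hV).ne
  have hG := D.measurable_meanField
  have hΨ := D.continuous_limit.measurable
  refine ⟨2 * ENNReal.ofReal M ^ 2 * ((∫⁻ y, ENNReal.ofReal (W y) ^ 2) * ∫⁻ y, ‖yukawa κ y‖ₑ ^ 2) +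
    (∫⁻ y, ENNReal.ofReal (W y) ^ 2) * (ENNReal.ofReal sphereArea *
      ((∫⁻ ξ, ENNReal.ofReal (1 + ‖ξ‖) * ‖potA V ξ‖ₑ ^ 2) *
        ∫⁻ y, ENNReal.ofReal (1 + ‖y‖) * ‖v y‖ₑ)) +
    ENNReal.ofReal M ^ 2 * ∫⁻ y, ‖yukawa κ y‖ₑ ^ 2, by finiteness, fun {N} hN => ?_⟩
  have hn : (0 : ℝ) < N := by exact_mod_cast hN
  have hS := measurable_pairShiftError hV.measurable κ N D.measurable_charge
  have hL : ∀ i, Measurable fun Y : Fin N → E3 =>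
      localFluctuation κ (yukawaConv κ fun y => (W y : ℂ) * Ψ y) Ψ Y i := fun i => by
    unfold localFluctuation
    fun_prop
  have m1 : Measurable fun Y : Fin N → E3 => ENNReal.ofReal (N : ℝ)⁻¹ *
      ∑ i, localFluctuation κ (yukawaConv κ fun y => (W y : ℂ) * Ψ y) Ψ Y i := by fun_prop
  have m2 : Measurable fun Y : Fin N → E3 => ENNReal.ofReal (N : ℝ)⁻¹ ^ 2 *
      (∑ i, ∑ j ∈ Finset.univ.erase i, pairShiftError V κ N v (Y i - Y j)) :=
    Measurable.const_mul (Finset.measurable_fun_sum _ fun i _ =>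
      Finset.measurable_fun_sum _ fun j _ => hS.comp (by fun_prop)) _
  unfold totalError
  have m12 : Measurable fun Y : Fin N → E3 => ENNReal.ofReal (N : ℝ)⁻¹ *
      (∑ i, localFluctuation κ (yukawaConv κ fun y => (W y : ℂ) * Ψ y) Ψ Y i) +
      ENNReal.ofReal (N : ℝ)⁻¹ ^ 2 *
      (∑ i, ∑ j ∈ Finset.univ.erase i, pairShiftError V κ N v (Y i - Y j)) := m1.add m2
  rw [lintegral_add_left m12, lintegral_add_left m1, add_mul, add_mul]
  refine add_le_add (add_le_add ?_ ?_) (hW.lintegral_globalFluctuation_le D.continuous_limit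
    D.bounded_limit hN)
  · rw [lintegral_const_mul' _ _ (by finiteness), lintegral_finsetSum _ fun i _ => hL i]
    refine (mul_le_mul_right (Finset.sum_le_sum fun i _ =>
      hW.lintegral_localFluctuation_le D.continuous_limit D.bounded_limit i) _).trans (le_of_eq ?_)
    rw [Finset.sum_const, Finset.card_univ, Fintype.card_fin, nsmul_eq_mul, ← mul_assoc,
      mul_comm _ (N : ℝ≥0∞), natCast_mul_ofReal_inv hN, one_mul]
  · refine (hW.lintegral_sum_erase_le hS hN).trans ?_
    rw [mul_assoc _ _ (ENNReal.ofReal (N : ℝ)⁻¹)]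
    gcongr
    exact lintegral_pairShiftError_le hV.measurable hκ.le hn D.measurable_charge

end LimitData

/-! ### The interaction of the obstacles is small with high probability -/

theorem ofReal_inv_mul_rpow {N : ℕ} (hN : 0 < N) (K : ℝ≥0∞) :
    ENNReal.ofReal (N : ℝ)⁻¹ * (N * K ^ 2) ^ (1 / 2 : ℝ) =
      (ENNReal.ofReal (N : ℝ)⁻¹ * K ^ 2) ^ (1 / 2 : ℝ) := by
  set ε := ENNReal.ofReal (N : ℝ)⁻¹
  have h : ε = (ε ^ 2) ^ (1 / 2 : ℝ) := by
    rw [← ENNReal.rpow_natCast, ← ENNReal.rpow_mul]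
    norm_num
  calc ε * (N * K ^ 2) ^ (1 / 2 : ℝ) = (ε ^ 2) ^ (1 / 2 : ℝ) * (N * K ^ 2) ^ (1 / 2 : ℝ) := by rw [← h]
    _ = (ε * ((N * ε) * K ^ 2)) ^ (1 / 2 : ℝ) := by
        rw [← ENNReal.mul_rpow_of_nonneg _ _ (by norm_num)]
        congr 1
        ring
    _ = _ := by rw [natCast_mul_ofReal_inv hN, one_mul]

/-- Taking `m i` as the conditional mean given the first point and `θ` as the full mean separates
the double sum into a part centred given one point, a centred sum of independent terms, and the
mean. Both random parts are within reach of the variance bound. -/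
theorem sum_sum_erase_decomp {n : ℕ} (b : Fin (n + 1) → Fin (n + 1) → ℂ) (m : Fin (n + 1) → ℂ)
    (θ : ℂ) :
    ∑ i, ∑ j ∈ Finset.univ.erase i, b i j =
      (∑ i, ∑ j ∈ Finset.univ.erase i, (b i j - m i)) + n * ∑ i, (m i - θ) +
        n * ((n + 1 : ℕ) * θ) := by
  have h : ∀ i : Fin (n + 1), (Finset.univ.erase i).card = n := fun i => by
    rw [Finset.card_erase_of_mem (Finset.mem_univ i), Finset.card_univ, Fintype.card_fin,
      Nat.add_sub_cancel]
  have h' : ∀ i, ∑ j ∈ Finset.univ.erase i, (b i j - m i) =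
      (∑ j ∈ Finset.univ.erase i, b i j) - n * m i := fun i => by
    rw [Finset.sum_sub_distrib, Finset.sum_const, h, nsmul_eq_mul]
  simp_rw [h']
  rw [Finset.sum_sub_distrib, Finset.sum_sub_distrib, Finset.sum_const, Finset.card_univ,
    Fintype.card_fin, nsmul_eq_mul, ← Finset.mul_sum]
  ring

theorem enorm_sum_sum_toReal {ι : Type*} (s : Finset ι) (t : ι → Finset ι) {k : ι → ι → ℝ≥0∞}
    (hk : ∀ i j, k i j ≠ ⊤) :
    ‖∑ i ∈ s, ∑ j ∈ t i, ((k i j).toReal : ℂ)‖ₑ = ∑ i ∈ s, ∑ j ∈ t i, k i j := by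
  simp_rw [← Complex.ofReal_sum]
  rw [enorm_ofReal_complex, Real.enorm_eq_ofReal (by positivity),
    ENNReal.ofReal_sum_of_nonneg fun i _ => by positivity]
  refine Finset.sum_congr rfl fun i _ => ?_
  rw [ENNReal.ofReal_sum_of_nonneg fun j _ => by positivity]
  exact Finset.sum_congr rfl fun j _ => ENNReal.ofReal_toReal (hk i j)

theorem enorm_toReal_complex {a : ℝ≥0∞} (ha : a ≠ ⊤) : ‖((a.toReal : ℝ) : ℂ)‖ₑ = a := by
  rw [enorm_ofReal_complex, Real.enorm_eq_ofReal ENNReal.toReal_nonneg, ENNReal.ofReal_toReal ha]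

namespace IsDensity

variable {W : E3 → ℝ} (hW : IsDensity W)

include hW

/-- The excess of the two-point sum of a bounded function over its mean. -/
theorem lintegral_sum_erase_min_sub_le {k : E3 → ℝ≥0∞} (hk : Measurable k) {K : ℝ≥0∞} (hK : K ≠ ⊤)
    {N : ℕ} (hN : 0 < N) :
    ∫⁻ Y, (ENNReal.ofReal (N : ℝ)⁻¹ ^ 2 * ∑ i, ∑ j ∈ Finset.univ.erase i, min (k (Y i - Y j)) K) -
        (∫⁻ y, ENNReal.ofReal (W y) ^ 2) * (∫⁻ z, k z)
      ∂(Measure.pi fun _ : Fin N => densityLaw W) ≤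
      2 * (ENNReal.ofReal (N : ℝ)⁻¹ * K ^ 2) ^ (1 / 2 : ℝ) := by
  have := hW.isProbabilityMeasure
  obtain ⟨n, rfl⟩ : ∃ n, N = n + 1 := Nat.exists_eq_succ_of_ne_zero hN.ne'
  set μ := densityLaw W
  set ε := ENNReal.ofReal ((n + 1 : ℕ) : ℝ)⁻¹ with hε
  have hNε : ((n + 1 : ℕ) : ℝ≥0∞) * ε = 1 := natCast_mul_ofReal_inv hN
  have hfin : ∀ y y', min (k (y - y')) K ≠ ⊤ := fun y y' => ne_top_of_le_ne_top hK (min_le_right _ _)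
  set b : E3 → E3 → ℂ := fun y y' => ((min (k (y - y')) K).toReal : ℂ) with hbdef
  have hbn : ∀ y y', ‖b y y'‖ₑ = min (k (y - y')) K := fun y y' => enorm_toReal_complex (hfin y y')
  have hb : Measurable (Function.uncurry b) := by
    have h1 : Measurable fun q : E3 × E3 => min (k (q.1 - q.2)) K :=
      (hk.comp (by fun_prop)).min measurable_const
    exact Complex.measurable_ofReal.comp h1.ennreal_toReal
  set m : E3 → ℂ := fun y => ∫ y', b y y' ∂μ with hm
  have hmm : Measurable m := (hb.stronglyMeasurable.integral_prod_right (ν := μ)).measurable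
  have hmK : ∀ y, ‖m y‖ₑ ≤ K := fun y => by
    refine (enorm_integral_le_lintegral_enorm _).trans ?_
    refine (lintegral_mono fun y' => (hbn y y').le.trans (min_le_right _ _)).trans ?_
    rw [lintegral_const, measure_univ, mul_one]
  set θ : ℂ := ∫ y, m y ∂μ with hθ
  have hθM : ‖θ‖ₑ ≤ (∫⁻ y, ENNReal.ofReal (W y) ^ 2) * ∫⁻ z, k z := by
    refine (enorm_integral_le_lintegral_enorm _).trans
      (le_trans (lintegral_mono fun y => ?_) (lintegral_densityLaw_sub_le hW.measurable hk))
    exact (enorm_integral_le_lintegral_enorm _).trans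
      (lintegral_mono fun y' => (hbn y y').le.trans (min_le_left _ _))
  set F : Fin (n + 1) → (Fin (n + 1) → E3) → ℝ≥0∞ := fun i Y =>
    ‖∑ j ∈ Finset.univ.erase i, (b (Y i) (Y j) - m (Y i))‖ₑ with hF
  set H : (Fin (n + 1) → E3) → ℝ≥0∞ := fun Y => ‖∑ i, (m (Y i) - θ)‖ₑ with hH
  have hFm : ∀ i, Measurable (F i) := fun i =>
    (Finset.measurable_fun_sum _ fun j _ => (hb.comp (by fun_prop :
      Measurable fun Y : Fin (n + 1) → E3 => (Y i, Y j))).sub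
        (hmm.comp (measurable_pi_apply i))).enorm
  have hHm : Measurable H := (Finset.measurable_fun_sum _ fun i _ =>
    (hmm.comp (measurable_pi_apply i)).sub measurable_const).enorm
  have hεn : ε * n ≤ 1 := by
    rw [← hNε, mul_comm]
    gcongr
    exact n.le_succ
  -- The deterministic part `n (n + 1) θ / (n + 1)²` is at most the subtracted mean-field value, so
  -- only the two centred parts survive.
  have hpt : ∀ Y : Fin (n + 1) → E3,
      (ε ^ 2 * ∑ i, ∑ j ∈ Finset.univ.erase i, min (k (Y i - Y j)) K) -
        (∫⁻ y, ENNReal.ofReal (W y) ^ 2) * ∫⁻ z, k z ≤ ε ^ 2 * ∑ i, F i Y + ε * H Y := fun Y => by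
    rw [tsub_le_iff_right, ← enorm_sum_sum_toReal _ _ fun i j => hfin (Y i) (Y j)]
    have e := sum_sum_erase_decomp (fun i j => b (Y i) (Y j)) (fun i => m (Y i)) θ
    change ε ^ 2 * ‖∑ i, ∑ j ∈ Finset.univ.erase i, b (Y i) (Y j)‖ₑ ≤ _
    rw [e]
    have h1 : ‖(∑ i, ∑ j ∈ Finset.univ.erase i, (b (Y i) (Y j) - m (Y i))) +
        n * ∑ i, (m (Y i) - θ) + n * ((n + 1 : ℕ) * θ)‖ₑ ≤
        (∑ i, F i Y) + n * H Y + n * ((n + 1 : ℕ) * ‖θ‖ₑ) := by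
      have hc : ∀ l : ℕ, ‖(l : ℂ)‖ₑ = l := fun l => by
        rw [← ofReal_norm, Complex.norm_natCast, ENNReal.ofReal_natCast]
      refine (enorm_add_le _ _).trans (add_le_add ((enorm_add_le _ _).trans (add_le_add
        (enorm_sum_le _ _) ?_)) ?_)
      · rw [enorm_mul, hc]
      · rw [enorm_mul, enorm_mul, hc, hc]
    calc _ ≤ ε ^ 2 * ((∑ i, F i Y) + n * H Y + n * ((n + 1 : ℕ) * ‖θ‖ₑ)) := by gcongr
      _ = ε ^ 2 * (∑ i, F i Y) + (ε * n) * (ε * H Y) +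
          (ε * n) * ((((n + 1 : ℕ) : ℝ≥0∞) * ε) * ‖θ‖ₑ) := by ring
      _ ≤ ε ^ 2 * (∑ i, F i Y) + 1 * (ε * H Y) +
          1 * (1 * ((∫⁻ y, ENNReal.ofReal (W y) ^ 2) * ∫⁻ z, k z)) := by
          rw [hNε]
          gcongr
      _ = _ := by rw [one_mul, one_mul, one_mul]
  refine (lintegral_mono hpt).trans ?_
  have hE1 : ∀ i, ∫⁻ Y, F i Y ∂(Measure.pi fun _ : Fin (n + 1) => μ) ≤
      ((n + 1 : ℕ) * K ^ 2) ^ (1 / 2 : ℝ) := fun i => by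
    refine lintegral_enorm_le_of_sq_le (hFm i).aemeasurable
      ((lintegral_sum_erase_sub_sq_le μ hb i).trans ?_)
    gcongr
    · exact n.le_succ
    · refine (lintegral_mono fun y => lintegral_mono fun y' => pow_le_pow_left'
        ((hbn y y').le.trans (min_le_right _ _)) 2).trans ?_
      simp
  have hE2 : ∫⁻ Y, H Y ∂(Measure.pi fun _ : Fin (n + 1) => μ) ≤
      ((n + 1 : ℕ) * K ^ 2) ^ (1 / 2 : ℝ) := by
    refine lintegral_enorm_le_of_sq_le hHm.aemeasurable
      ((lintegral_sum_sub_sq_le μ hmm (n + 1)).trans ?_)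
    gcongr
    refine (lintegral_mono fun y => pow_le_pow_left' (hmK y) 2).trans ?_
    simp
  rw [lintegral_add_right _ (hHm.const_mul _), lintegral_const_mul' _ _ (by finiteness),
    lintegral_const_mul' _ _ (by finiteness), lintegral_finsetSum _ fun i _ => hFm i]
  calc _ ≤ ε ^ 2 * (∑ _i : Fin (n + 1), ((n + 1 : ℕ) * K ^ 2) ^ (1 / 2 : ℝ)) +
        ε * ((n + 1 : ℕ) * K ^ 2) ^ (1 / 2 : ℝ) := by
        gcongr with i
        exact hE1 i
    _ = (((n + 1 : ℕ) : ℝ≥0∞) * ε) * (ε * ((n + 1 : ℕ) * K ^ 2) ^ (1 / 2 : ℝ)) +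
        ε * ((n + 1 : ℕ) * K ^ 2) ^ (1 / 2 : ℝ) := by
        rw [Finset.sum_const, Finset.card_univ, Fintype.card_fin, nsmul_eq_mul]
        ring
    _ = _ := by
        rw [hNε, one_mul, hε, ofReal_inv_mul_rpow hN]
        ring

/-- For `k = G_κ²` the square behaves like `‖x‖⁻⁴` at the origin and is not integrable, so a direct
variance estimate is unavailable. Instead `k` is cut at level `K`: the excess is controlled in mean,
the truncation by its variance. -/
theorem lintegral_sum_erase_sub_le {k : E3 → ℝ≥0∞} (hk : Measurable k) {K : ℝ≥0∞} (hK : K ≠ ⊤)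
    {N : ℕ} (hN : 0 < N) :
    ∫⁻ Y, (ENNReal.ofReal (N : ℝ)⁻¹ ^ 2 * ∑ i, ∑ j ∈ Finset.univ.erase i, k (Y i - Y j)) -
        (∫⁻ y, ENNReal.ofReal (W y) ^ 2) * (∫⁻ z, k z)
      ∂(Measure.pi fun _ : Fin N => densityLaw W) ≤
      (∫⁻ y, ENNReal.ofReal (W y) ^ 2) * (∫⁻ z, k z - K) +
        2 * (ENNReal.ofReal (N : ℝ)⁻¹ * K ^ 2) ^ (1 / 2 : ℝ) := by
  have hpt : ∀ Y : Fin N → E3,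
      (ENNReal.ofReal (N : ℝ)⁻¹ ^ 2 * ∑ i, ∑ j ∈ Finset.univ.erase i, k (Y i - Y j)) -
        (∫⁻ y, ENNReal.ofReal (W y) ^ 2) * ∫⁻ z, k z ≤
      (ENNReal.ofReal (N : ℝ)⁻¹ ^ 2 * ∑ i, ∑ j ∈ Finset.univ.erase i, (k (Y i - Y j) - K)) +
      ((ENNReal.ofReal (N : ℝ)⁻¹ ^ 2 * ∑ i, ∑ j ∈ Finset.univ.erase i, min (k (Y i - Y j)) K) -
        (∫⁻ y, ENNReal.ofReal (W y) ^ 2) * ∫⁻ z, k z) := fun Y => by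
    have h : ∀ a : ℝ≥0∞, a = (a - K) + min a K := fun a => (tsub_add_min).symm
    calc _ = (ENNReal.ofReal (N : ℝ)⁻¹ ^ 2 * ∑ i, ∑ j ∈ Finset.univ.erase i, (k (Y i - Y j) - K)) +
        (ENNReal.ofReal (N : ℝ)⁻¹ ^ 2 * ∑ i, ∑ j ∈ Finset.univ.erase i, min (k (Y i - Y j)) K) -
        (∫⁻ y, ENNReal.ofReal (W y) ^ 2) * ∫⁻ z, k z := by
          rw [← mul_add, ← Finset.sum_add_distrib]
          simp_rw [← Finset.sum_add_distrib, ← h]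
      _ ≤ _ := add_tsub_le_assoc
  have hkm : Measurable fun z => k z - K := hk.sub measurable_const
  refine (lintegral_mono hpt).trans ?_
  rw [lintegral_add_left]
  swap
  · exact Measurable.const_mul (Finset.measurable_fun_sum _ fun i _ =>
      Finset.measurable_fun_sum _ fun j _ => hkm.comp (by fun_prop)) _
  exact add_le_add (hW.lintegral_sum_erase_le hkm hN) (hW.lintegral_sum_erase_min_sub_le hk hK hN)

end IsDensity

theorem tendsto_lintegral_sub_natCast {k : E3 → ℝ≥0∞} (hk : Measurable k) (hfin : ∀ z, k z ≠ ⊤)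
    (hint : ∫⁻ z, k z ≠ ⊤) : Tendsto (fun K : ℕ => ∫⁻ z, k z - K) atTop (𝓝 0) := by
  have h := tendsto_lintegral_of_dominated_convergence (μ := (volume : Measure E3))
    (F := fun (K : ℕ) z => k z - K) (f := fun _ => 0) k (fun K => hk.sub measurable_const)
    (fun K => Eventually.of_forall fun z => tsub_le_self) hint
    (Eventually.of_forall fun z => ?_)
  · simpa using h
  · obtain ⟨n, hn⟩ := ENNReal.exists_nat_gt (hfin z)
    refine tendsto_const_nhds.congr' ?_
    filter_upwards [eventually_ge_atTop n] with K hK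
    exact (tsub_eq_zero_of_le (hn.le.trans (by exact_mod_cast hK))).symm

/-- Scaling extracts `N⁻²` and leaves an average, over microscopic displacements, of pair sums of
translates of `G_κ²`. The expectation bounds are translation invariant and hence uniform in these
displacements. -/
theorem totalInteraction_scaled {V : E3 → ℝ} (hV : IsAdmissible V) {κ : ℝ} {N : ℕ} (hN : 0 < N)
    (Y : Fin N → E3) :
    totalInteraction V (κ / N) (fun i => (N : ℝ) • Y i) =
      ∫⁻ ξ, ∫⁻ ξ', ‖potA V ξ‖ₑ ^ 2 * ‖potB V ξ'‖ₑ ^ 2 * (ENNReal.ofReal (N : ℝ)⁻¹ ^ 2 *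
        ∑ i, ∑ j ∈ Finset.univ.erase i,
          ‖yukawa κ (Y i - Y j + (N : ℝ)⁻¹ • (ξ - ξ'))‖ₑ ^ 2) := by
  have hn : (0 : ℝ) < N := by exact_mod_cast hN
  have hA := measurable_potA hV.measurable
  have hB := measurable_potB hV.measurable
  have hk : ∀ z w : E3, ‖yukawa (κ / N) ((N : ℝ) • z + w)‖ₑ ^ 2 =
      ENNReal.ofReal (N : ℝ)⁻¹ ^ 2 * ‖yukawa κ (z + (N : ℝ)⁻¹ • w)‖ₑ ^ 2 := fun z w => by
    have : yukawa (κ / N) ((N : ℝ) • z + w) = (N : ℝ)⁻¹ * yukawa κ (z + (N : ℝ)⁻¹ • w) := by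
      rw [← yukawa_scale κ hn]
      congr 2
      rw [smul_add, smul_smul, inv_mul_cancel₀ hn.ne', one_smul]
    rw [this, enorm_mul, mul_pow, Real.enorm_eq_ofReal (inv_nonneg.mpr hn.le)]
  have hm : ∀ i j : Fin N, Measurable fun q : E3 × E3 => ‖potA V q.1‖ₑ ^ 2 * ‖potB V q.2‖ₑ ^ 2 *
      (ENNReal.ofReal (N : ℝ)⁻¹ ^ 2 * ‖yukawa κ (Y i - Y j + (N : ℝ)⁻¹ • (q.1 - q.2))‖ₑ ^ 2) :=
    fun i j => by fun_prop
  have e : ∀ i j : Fin N, pairInteraction V (κ / N) ((N : ℝ) • Y i - (N : ℝ) • Y j) =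
      ∫⁻ ξ, ∫⁻ ξ', ‖potA V ξ‖ₑ ^ 2 * ‖potB V ξ'‖ₑ ^ 2 * (ENNReal.ofReal (N : ℝ)⁻¹ ^ 2 *
        ‖yukawa κ (Y i - Y j + (N : ℝ)⁻¹ • (ξ - ξ'))‖ₑ ^ 2) := fun i j => by
    unfold pairInteraction
    refine lintegral_congr fun ξ => lintegral_congr fun ξ' => ?_
    rw [← smul_sub, add_sub_assoc, hk]
    ring
  unfold totalInteraction
  simp_rw [e, Finset.mul_sum]
  have hm' : ∀ i j : Fin N, Measurable fun ξ => ∫⁻ ξ', ‖potA V ξ‖ₑ ^ 2 * ‖potB V ξ'‖ₑ ^ 2 *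
      (ENNReal.ofReal (N : ℝ)⁻¹ ^ 2 * ‖yukawa κ (Y i - Y j + (N : ℝ)⁻¹ • (ξ - ξ'))‖ₑ ^ 2) :=
    fun i j => (hm i j).lintegral_prod_right'
  have hm'' : ∀ (i j : Fin N) (ξ : E3), Measurable fun ξ' => ‖potA V ξ‖ₑ ^ 2 * ‖potB V ξ'‖ₑ ^ 2 *
      (ENNReal.ofReal (N : ℝ)⁻¹ ^ 2 * ‖yukawa κ (Y i - Y j + (N : ℝ)⁻¹ • (ξ - ξ'))‖ₑ ^ 2) :=
    fun i j ξ => by fun_prop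
  have s1 : ∀ ξ, ∫⁻ ξ', ∑ i, ∑ j ∈ Finset.univ.erase i, ‖potA V ξ‖ₑ ^ 2 * ‖potB V ξ'‖ₑ ^ 2 *
      (ENNReal.ofReal (N : ℝ)⁻¹ ^ 2 * ‖yukawa κ (Y i - Y j + (N : ℝ)⁻¹ • (ξ - ξ'))‖ₑ ^ 2) =
      ∑ i, ∑ j ∈ Finset.univ.erase i, ∫⁻ ξ', ‖potA V ξ‖ₑ ^ 2 * ‖potB V ξ'‖ₑ ^ 2 *
      (ENNReal.ofReal (N : ℝ)⁻¹ ^ 2 * ‖yukawa κ (Y i - Y j + (N : ℝ)⁻¹ • (ξ - ξ'))‖ₑ ^ 2) :=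
    fun ξ => by
      rw [lintegral_finsetSum _ fun i _ => Finset.measurable_fun_sum _ fun j _ => hm'' i j ξ]
      exact Finset.sum_congr rfl fun i _ => lintegral_finsetSum _ fun j _ => hm'' i j ξ
  simp_rw [s1]
  rw [lintegral_finsetSum _ fun i _ => Finset.measurable_fun_sum _ fun j _ => hm' i j]
  exact Finset.sum_congr rfl fun i _ => (lintegral_finsetSum _ fun j _ => hm' i j).symm

/-- With high probability the interaction does not exceed its mean field value by much. -/
theorem tendsto_measure_totalInteraction {V W : E3 → ℝ} (hV : IsAdmissible V) (hW : IsDensity W)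
    {κ : ℝ} (hκ : 0 < κ) {δ : ℝ≥0∞} (hδ : δ ≠ 0) (hδt : δ ≠ ⊤) :
    Tendsto (fun N : ℕ => Measure.pi (fun _ : Fin N => densityLaw W)
      {Y | (∫⁻ ξ, ‖potA V ξ‖ₑ ^ 2) * (∫⁻ ξ, ‖potB V ξ‖ₑ ^ 2) *
        ((∫⁻ y, ENNReal.ofReal (W y) ^ 2) * ∫⁻ y, ‖yukawa κ y‖ₑ ^ 2) + δ ≤
        totalInteraction V (κ / N) fun i => (N : ℝ) • Y i}) atTop (𝓝 0) := by
  have := hW.isProbabilityMeasure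
  have hA := measurable_potA hV.measurable
  have hB := measurable_potB hV.measurable
  have fA : ∫⁻ ξ, ‖potA V ξ‖ₑ ^ 2 ≠ ⊤ := hV.lintegral_potA_sq_lt_top.ne
  have fB : ∫⁻ ξ, ‖potB V ξ‖ₑ ^ 2 ≠ ⊤ := hV.lintegral_potB_sq_lt_top.ne
  have fw := hW.sq.ne
  have fy : ∫⁻ y, ‖yukawa κ y‖ₑ ^ 2 ≠ ⊤ := (lintegral_yukawa_sq_lt_top hκ).ne
  set KA := ∫⁻ ξ, ‖potA V ξ‖ₑ ^ 2 with hKA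
  set KB := ∫⁻ ξ, ‖potB V ξ‖ₑ ^ 2 with hKB
  set w2 := ∫⁻ y, ENNReal.ofReal (W y) ^ 2
  set Ky := ∫⁻ y, ‖yukawa κ y‖ₑ ^ 2 with hKy
  have main : ∀ {N : ℕ}, 0 < N → ∀ K : ℕ, Measure.pi (fun _ : Fin N => densityLaw W)
      {Y | KA * KB * (w2 * Ky) + δ ≤ totalInteraction V (κ / N) fun i => (N : ℝ) • Y i} ≤
      (KA * KB * (w2 * (∫⁻ z, ‖yukawa κ z‖ₑ ^ 2 - K) +
        2 * (ENNReal.ofReal (N : ℝ)⁻¹ * (K : ℝ≥0∞) ^ 2) ^ (1 / 2 : ℝ))) / δ := by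
    intro N hN K
    set T : (Fin N → E3) → E3 → E3 → ℝ≥0∞ := fun Y ξ ξ' => ENNReal.ofReal (N : ℝ)⁻¹ ^ 2 *
        ∑ i, ∑ j ∈ Finset.univ.erase i,
          ‖yukawa κ (Y i - Y j + (N : ℝ)⁻¹ • (ξ - ξ'))‖ₑ ^ 2 with hT
    -- Only the positive excess over the mean-field value matters; its expectation tends to zero,
    -- and Markov's inequality finishes.
    set R : (Fin N → E3) → ℝ≥0∞ := fun Y =>
      ∫⁻ ξ, ∫⁻ ξ', ‖potA V ξ‖ₑ ^ 2 * ‖potB V ξ'‖ₑ ^ 2 * (T Y ξ ξ' - w2 * Ky) with hR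
    have hTm : Measurable fun q : ((Fin N → E3) × E3) × E3 => ‖potA V q.1.2‖ₑ ^ 2 *
        ‖potB V q.2‖ₑ ^ 2 * (T q.1.1 q.1.2 q.2 - w2 * Ky) := by
      have : Measurable fun q : ((Fin N → E3) × E3) × E3 => T q.1.1 q.1.2 q.2 := by
        simp only [hT]
        fun_prop
      fun_prop
    have hTm1 : Measurable fun q : (Fin N → E3) × E3 => ∫⁻ ξ', ‖potA V q.2‖ₑ ^ 2 *
        ‖potB V ξ'‖ₑ ^ 2 * (T q.1 q.2 ξ' - w2 * Ky) := hTm.lintegral_prod_right'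
    have hRm : Measurable R := hTm1.lintegral_prod_right'
    have hSR : ∀ Y : Fin N → E3, totalInteraction V (κ / N) (fun i => (N : ℝ) • Y i) ≤
        KA * KB * (w2 * Ky) + R Y := fun Y => by
      rw [totalInteraction_scaled hV hN]
      have e : KA * KB * (w2 * Ky) =
          ∫⁻ ξ, ∫⁻ ξ', ‖potA V ξ‖ₑ ^ 2 * ‖potB V ξ'‖ₑ ^ 2 * (w2 * Ky) := by
        have e1 : ∀ ξ, ∫⁻ ξ', ‖potA V ξ‖ₑ ^ 2 * ‖potB V ξ'‖ₑ ^ 2 * (w2 * Ky) =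
            ‖potA V ξ‖ₑ ^ 2 * (KB * (w2 * Ky)) := fun ξ => by
          simp_rw [mul_assoc (‖potA V ξ‖ₑ ^ 2)]
          rw [lintegral_const_mul' _ _ (by finiteness), lintegral_mul_const' _ _ (by finiteness)]
        simp_rw [e1]
        rw [lintegral_mul_const' _ _ (by finiteness), mul_assoc]
      rw [e, hR, ← lintegral_add_left]
      swap
      · exact Measurable.lintegral_prod_right' (f := fun q : E3 × E3 => ‖potA V q.1‖ₑ ^ 2 *
          ‖potB V q.2‖ₑ ^ 2 * (w2 * Ky)) (by fun_prop)
      refine lintegral_mono fun ξ => ?_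
      rw [← lintegral_add_left (by fun_prop)]
      refine lintegral_mono fun ξ' => ?_
      rw [← mul_add]
      exact mul_le_mul_right le_add_tsub _
    have hER : ∫⁻ Y, R Y ∂(Measure.pi fun _ : Fin N => densityLaw W) ≤
        KA * KB * (w2 * (∫⁻ z, ‖yukawa κ z‖ₑ ^ 2 - K) +
          2 * (ENNReal.ofReal (N : ℝ)⁻¹ * (K : ℝ≥0∞) ^ 2) ^ (1 / 2 : ℝ)) := by
      set Q := w2 * (∫⁻ z, ‖yukawa κ z‖ₑ ^ 2 - K) +
          2 * (ENNReal.ofReal (N : ℝ)⁻¹ * (K : ℝ≥0∞) ^ 2) ^ (1 / 2 : ℝ) with hQ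
      have hz : ∀ ξ ξ', ∫⁻ Y, T Y ξ ξ' - w2 * Ky ∂(Measure.pi fun _ : Fin N => densityLaw W) ≤ Q :=
        fun ξ ξ' => by
          have h := hW.lintegral_sum_erase_sub_le
            (k := fun z => ‖yukawa κ (z + (N : ℝ)⁻¹ • (ξ - ξ'))‖ₑ ^ 2) (by fun_prop)
            (ENNReal.natCast_ne_top K) hN
          rw [lintegral_add_right_eq_self (fun z => ‖yukawa κ z‖ₑ ^ 2),
            lintegral_add_right_eq_self (fun z => ‖yukawa κ z‖ₑ ^ 2 - K)] at h
          exact h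
      rw [hR, lintegral_lintegral_swap hTm1.aemeasurable]
      have hξ : ∀ ξ, ∫⁻ Y, (∫⁻ ξ', ‖potA V ξ‖ₑ ^ 2 * ‖potB V ξ'‖ₑ ^ 2 * (T Y ξ ξ' - w2 * Ky))
          ∂(Measure.pi fun _ : Fin N => densityLaw W) ≤ ‖potA V ξ‖ₑ ^ 2 * (KB * Q) := fun ξ => by
        rw [lintegral_lintegral_swap]
        swap
        · have : Measurable fun q : (Fin N → E3) × E3 => T q.1 ξ q.2 := by
            simp only [hT]
            fun_prop
          exact (by fun_prop : Measurable fun q : (Fin N → E3) × E3 => ‖potA V ξ‖ₑ ^ 2 *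
            ‖potB V q.2‖ₑ ^ 2 * (T q.1 ξ q.2 - w2 * Ky)).aemeasurable
        have : ∀ ξ', ∫⁻ Y, ‖potA V ξ‖ₑ ^ 2 * ‖potB V ξ'‖ₑ ^ 2 * (T Y ξ ξ' - w2 * Ky)
            ∂(Measure.pi fun _ : Fin N => densityLaw W) ≤
            ‖potA V ξ‖ₑ ^ 2 * ‖potB V ξ'‖ₑ ^ 2 * Q := fun ξ' => by
          rw [lintegral_const_mul' _ _ (by finiteness)]
          exact mul_le_mul_right (hz ξ ξ') _
        refine (lintegral_mono this).trans (le_of_eq ?_)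
        simp_rw [mul_assoc (‖potA V ξ‖ₑ ^ 2)]
        rw [lintegral_const_mul' _ _ (by finiteness), lintegral_mul_const _ (by fun_prop)]
      refine (lintegral_mono hξ).trans (le_of_eq ?_)
      rw [lintegral_mul_const _ (by fun_prop), mul_assoc]
    have hsub : {Y | KA * KB * (w2 * Ky) + δ ≤
        totalInteraction V (κ / N) fun i => (N : ℝ) • Y i} ⊆ {Y | δ ≤ R Y} := fun Y hY =>
      (ENNReal.add_le_add_iff_left (by finiteness)).mp (le_trans hY (hSR Y))
    refine (measure_mono hsub).trans ?_
    refine (meas_ge_le_lintegral_div hRm.aemeasurable hδ hδt).trans ?_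
    gcongr
  have hlim := tendsto_lintegral_sub_natCast (k := fun z => ‖yukawa κ z‖ₑ ^ 2) (by fun_prop)
    (fun z => by finiteness) fy
  have hlim1 : Tendsto (fun K : ℕ => KA * KB * (w2 * ∫⁻ z, ‖yukawa κ z‖ₑ ^ 2 - K) / δ) atTop (𝓝 0) := by
    have := ENNReal.Tendsto.div_const (ENNReal.Tendsto.const_mul (a := KA * KB)
      (ENNReal.Tendsto.const_mul (a := w2) hlim (Or.inr fw)) (Or.inr (by finiteness))) (b := δ)
      (Or.inr hδ)
    simpa using this
  have hlim2 : ∀ K : ℕ, Tendsto (fun N : ℕ => KA * KB *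
      (2 * (ENNReal.ofReal (N : ℝ)⁻¹ * (K : ℝ≥0∞) ^ 2) ^ (1 / 2 : ℝ)) / δ) atTop (𝓝 0) := fun K => by
    have h0 : Tendsto (fun N : ℕ => ENNReal.ofReal (N : ℝ)⁻¹) atTop (𝓝 0) := by
      rw [← ENNReal.ofReal_zero]
      exact ENNReal.tendsto_ofReal tendsto_inv_atTop_nhds_zero_nat
    have h1 := ENNReal.Tendsto.mul_const (b := (K : ℝ≥0∞) ^ 2) h0 (Or.inr (by finiteness))
    have h2 := ((ENNReal.continuous_rpow_const (y := 1 / 2)).tendsto _).comp h1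
    have := ENNReal.Tendsto.div_const (ENNReal.Tendsto.const_mul (a := KA * KB)
      (ENNReal.Tendsto.const_mul (a := 2) h2 (Or.inr (by finiteness))) (Or.inr (by finiteness)))
      (b := δ) (Or.inr hδ)
    simpa using this
  rw [ENNReal.tendsto_atTop_zero]
  intro η hη
  have hη2 : 0 < η / 2 := ENNReal.half_pos hη.ne'
  -- The truncation level is fixed first, to make the discarded mass small; only then is `N` taken
  -- large, depending on that level.
  obtain ⟨K, hK⟩ := (ENNReal.tendsto_atTop_zero.mp hlim1) (η / 2) hη2
  obtain ⟨N₀, hN₀⟩ := (ENNReal.tendsto_atTop_zero.mp (hlim2 K)) (η / 2) hη2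
  refine ⟨max N₀ 1, fun N hN => (main (lt_of_lt_of_le one_pos (le_of_max_le_right hN)) K).trans ?_⟩
  rw [mul_add, ENNReal.add_div, ← ENNReal.add_halves η]
  exact add_le_add (hK K le_rfl) (hN₀ N (le_of_max_le_left hN))

/-! ### The limiting operator -/

/-- The hypothesis says that the Hilbert–Schmidt norm of `U R` is less than one, so `-1` cannot be
an eigenvalue. -/
theorem mulResolvent_injective_of_small {U : E3 → ℝ} {κ : ℝ} (hκ : 0 < κ) (hU : Measurable U)
    (hU2 : MemLp U 2 volume) (hsmall : (∫⁻ x, ‖U x‖ₑ ^ 2) * (∫⁻ y, ‖yukawa κ y‖ₑ ^ 2) < 1) (h : L2)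
    (heq : h + mulResolvent hκ hU hU2 h = 0) : h = 0 := by
  have hh : h = -mulResolvent hκ hU hU2 h := eq_neg_of_add_eq_zero_left heq
  have hfin : ‖h‖ₑ ^ 2 ≠ ⊤ := by finiteness
  have h1 : ‖h‖ₑ ^ 2 ≤ (∫⁻ x, ‖U x‖ₑ ^ 2) * (∫⁻ y, ‖yukawa κ y‖ₑ ^ 2) * ‖h‖ₑ ^ 2 := by
    have h2 : ‖h‖ₑ ^ 2 = ‖mulResolvent hκ hU hU2 h‖ₑ ^ 2 := by
      conv_lhs => rw [hh, enorm_neg]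
    conv_lhs => rw [h2]
    rw [enorm_sq_eq_lintegral, enorm_sq_eq_lintegral]
    have h3 : ∫⁻ x, ‖mulResolvent hκ hU hU2 h x‖ₑ ^ 2 ≤
        ∫⁻ x, ‖U x‖ₑ ^ 2 * ((∫⁻ y, ‖yukawa κ y‖ₑ ^ 2) * ∫⁻ x, ‖h x‖ₑ ^ 2) := by
      refine lintegral_mono_ae ?_
      filter_upwards [coeFn_mulResolvent hκ hU hU2 h] with x hx
      rw [hx, enorm_mul, mul_pow, enorm_ofReal_complex]
      exact mul_le_mul_right (enorm_yukawaConv_sq_le κ (Lp.aestronglyMeasurable h) x) _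
    refine h3.trans (le_of_eq ?_)
    rw [lintegral_mul_const _ (by fun_prop), mul_assoc]
  by_contra hne
  have hpos : ‖h‖ₑ ^ 2 ≠ 0 := pow_ne_zero 2 (enorm_ne_zero.mpr hne)
  have h4 := ENNReal.mul_lt_mul_left hpos hfin hsmall
  rw [one_mul] at h4
  exact absurd h1 (not_le.mpr h4)

theorem exists_mul_lintegral_yukawa_sq_lt {c d : ℝ≥0∞} (hc : c ≠ ⊤) (hd : 0 < d) :
    ∃ κ₀ : ℝ, 0 < κ₀ ∧ ∀ κ, κ₀ < κ → c * (∫⁻ y, ‖yukawa κ y‖ₑ ^ 2) < d := by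
  have h1 : Tendsto (fun κ : ℝ => sphereArea / (32 * Real.pi ^ 2 * κ)) atTop (𝓝 0) :=
    tendsto_const_nhds.div_atTop (tendsto_id.const_mul_atTop (by positivity))
  have h2 : Tendsto (fun κ : ℝ => c * ENNReal.ofReal (sphereArea / (32 * Real.pi ^ 2 * κ))) atTop
      (𝓝 0) := by
    simpa using ENNReal.Tendsto.const_mul (ENNReal.tendsto_ofReal h1) (Or.inr hc)
  obtain ⟨κ₀, hκ₀⟩ := (h2.eventually_lt_const hd).exists_forall_of_atTop
  refine ⟨max κ₀ 1, by positivity, fun κ hκ => ?_⟩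
  rw [lintegral_yukawa_sq (lt_of_lt_of_le one_pos (le_of_max_le_right hκ.le))]
  exact hκ₀ κ (le_of_max_le_left hκ.le)

section limitData

variable {V W φ₀ : E3 → ℝ}

theorem IsDensity.lintegral_enorm_sq (hW : IsDensity W) :
    ∫⁻ x, ‖W x‖ₑ ^ 2 = ∫⁻ x, ENNReal.ofReal (W x) ^ 2 :=
  lintegral_congr fun x => by rw [Real.enorm_eq_ofReal (hW.nonneg x)]

theorem IsDensity.memLp_const_mul (hW : IsDensity W) (c : ℝ) :
    MemLp (fun x => c * W x) 2 volume :=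
  (memLp_two_of_lintegral hW.measurable.aestronglyMeasurable
    (hW.lintegral_enorm_sq ▸ hW.sq)).const_mul c

/-- The charge of one obstacle is `c = ∫ V φ₀`, the coupling constant of the limiting potential, so
the equation for `h`, convolved with `G_κ`, is the mean-field equation. -/
theorem IsScatteringSolution.limitData (hφ : IsScatteringSolution V φ₀) (hV : IsAdmissible V)
    (hW : IsDensity W) {κ : ℝ} (hκ : 0 < κ) {c : ℝ} (hc : c = ∫ x, V x * φ₀ x) {h f : L2}
    (heq : h + mulResolvent hκ (hW.measurable.const_mul c) (hW.memLp_const_mul c) h = f) :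
    ∃ M : ℝ, LimitData V κ f (fun x => (φ₀ x : ℂ)) (fun x => (V x : ℂ) * φ₀ x) (yukawaConv κ h)
      (yukawaConv κ fun y => (W y : ℂ) * yukawaConv κ h y) M := by
  obtain ⟨M, -, hM⟩ := exists_norm_yukawaConv_coeFn_le hκ h
  obtain ⟨K, hK⟩ := hφ.exists_bound
  have hcφ : Continuous fun x => (φ₀ x : ℂ) := Complex.continuous_ofReal.comp hφ.continuous
  have hΨ := continuous_yukawaConv_coeFn hκ h
  refine ⟨M, hcφ, ⟨K, hK⟩, fun x => rfl, hV.scatteringSolution_eq hφ,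
    hV.integrable_mul_of_bounded hcφ hK, hV.lintegral_mul_sq_lt_top_of_bounded hK,
    (Complex.measurable_ofReal.comp hV.measurable).mul hcφ.measurable, hΨ, ?_, hM, fun x => ?_⟩
  · exact (stronglyMeasurable_yukawaConv κ ((Complex.measurable_ofReal.comp hW.measurable).mul
      hΨ.measurable).aestronglyMeasurable).measurable
  · have e1 : ∫ y, (V y : ℂ) * φ₀ y = (c : ℂ) := by
      rw [hc, ← integral_complex_ofReal]
      push_cast
      rfl
    rw [e1, ← heq, yukawaConv_add_coeFn hκ, yukawaConv_congr (coeFn_mulResolvent hκ _ _ h)]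
    congr 1
    rw [yukawaConv, yukawaConv, ← integral_const_mul]
    congr 1
    ext y
    push_cast
    ring

end limitData

/-! ### Convergence of resolvents -/

section convergence

variable {V W : E3 → ℝ} (hV : IsAdmissible V) {κ : ℝ} {C : ℝ≥0∞}

include hV

theorem IsAdmissible.eventually_small (hC : C ≠ ⊤) :
    ∀ᶠ N : ℕ in atTop, 3 * C * (ENNReal.ofReal (κ / N / (4 * Real.pi)) ^ 2 *
      (∫⁻ ξ, ‖potA V ξ‖ₑ ^ 2) * (∫⁻ ξ, ‖potB V ξ‖ₑ ^ 2)) ≤ 6⁻¹ := by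
  have fA : ∫⁻ ξ, ‖potA V ξ‖ₑ ^ 2 ≠ ⊤ := hV.lintegral_potA_sq_lt_top.ne
  have fB : ∫⁻ ξ, ‖potB V ξ‖ₑ ^ 2 ≠ ⊤ := hV.lintegral_potB_sq_lt_top.ne
  have h0 : Tendsto (fun N : ℕ => ENNReal.ofReal (κ / N / (4 * Real.pi))) atTop (𝓝 0) := by
    rw [← ENNReal.ofReal_zero]
    have := (tendsto_const_div_atTop_nhds_zero_nat κ).div_const (4 * Real.pi)
    rw [zero_div] at this
    exact ENNReal.tendsto_ofReal this
  have h1 := ENNReal.Tendsto.pow (n := 2) h0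
  have h2 := ENNReal.Tendsto.const_mul (a := 3 * C) (ENNReal.Tendsto.mul_const
    (ENNReal.Tendsto.mul_const h1 (Or.inr fA)) (Or.inr fB)) (Or.inr (by finiteness))
  have h3 : 3 * C * ((0 : ℝ≥0∞) ^ 2 * (∫⁻ ξ, ‖potA V ξ‖ₑ ^ 2) * (∫⁻ ξ, ‖potB V ξ‖ₑ ^ 2)) = 0 := by simp
  rw [h3] at h2
  exact (h2.eventually_lt_const (by simp : (0 : ℝ≥0∞) < 6⁻¹)).mono fun N hN => hN.le

/-- The smallness condition on the obstacles holds with high probability. -/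
theorem IsAdmissible.tendsto_measure_not_small (hW : IsDensity W) (hκ : 0 < κ) (hC : C ≠ ⊤)
    (hmean : 3 * C * ((∫⁻ ξ, ‖potA V ξ‖ₑ ^ 2) * (∫⁻ ξ, ‖potB V ξ‖ₑ ^ 2) *
      (∫⁻ y, ENNReal.ofReal (W y) ^ 2)) * (∫⁻ y, ‖yukawa κ y‖ₑ ^ 2) < 6⁻¹) :
    Tendsto (fun N : ℕ => Measure.pi (fun _ : Fin N => densityLaw W)
      {Y | ¬ 3 * C * (ENNReal.ofReal (κ / N / (4 * Real.pi)) ^ 2 * (∫⁻ ξ, ‖potA V ξ‖ₑ ^ 2) *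
        (∫⁻ ξ, ‖potB V ξ‖ₑ ^ 2) + totalInteraction V (κ / N) fun i => (N : ℝ) • Y i) ≤ 2⁻¹})
      atTop (𝓝 0) := by
  -- The budget `1/2` is divided into three sixths: the self-interaction error, the mean-field
  -- interaction, and the excess `δ`, for which `3 C δ ≤ 1/6`. Using `C + 1` keeps `δ` finite when
  -- `C = 0`.
  set δ : ℝ≥0∞ := (18 * (C + 1))⁻¹ with hδ
  have hδ0 : δ ≠ 0 := ENNReal.inv_ne_zero.mpr (by finiteness)
  have hδt : δ ≠ ⊤ := ENNReal.inv_ne_top.mpr (by simp)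
  have hCδ : 3 * C * δ ≤ 6⁻¹ := by
    have e : (6 : ℝ≥0∞)⁻¹ = 3 * (C + 1) * δ := by
      have hC1 : C + 1 ≠ 0 := by simp
      have hC2 : C + 1 ≠ ⊤ := by finiteness
      rw [hδ, ENNReal.mul_inv (Or.inl (by norm_num)) (Or.inl (by norm_num))]
      calc (6 : ℝ≥0∞)⁻¹ = 3 * 18⁻¹ := by
            rw [show (18 : ℝ≥0∞) = 3 * 6 by norm_num,
              ENNReal.mul_inv (Or.inl (by norm_num)) (Or.inl (by norm_num)), ← mul_assoc,
              ENNReal.mul_inv_cancel (by norm_num) (by norm_num), one_mul]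
        _ = 3 * 18⁻¹ * ((C + 1) * (C + 1)⁻¹) := by rw [ENNReal.mul_inv_cancel hC1 hC2, mul_one]
        _ = _ := by ring
    rw [e]
    gcongr
    exact le_self_add
  refine tendsto_of_tendsto_of_tendsto_of_le_of_le' tendsto_const_nhds
    (tendsto_measure_totalInteraction hV hW hκ hδ0 hδt) (Eventually.of_forall fun _ => zero_le) ?_
  filter_upwards [hV.eventually_small (κ := κ) hC] with N hN
  refine measure_mono fun Y hY => ?_
  by_contra hlt
  simp only [Set.mem_ofPred_eq, not_le] at hY hlt
  refine absurd hY (not_lt.mpr ?_)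
  set KA := ∫⁻ ξ, ‖potA V ξ‖ₑ ^ 2
  set KB := ∫⁻ ξ, ‖potB V ξ‖ₑ ^ 2
  set w2 := ∫⁻ y, ENNReal.ofReal (W y) ^ 2
  set Ky := ∫⁻ y, ‖yukawa κ y‖ₑ ^ 2
  rw [mul_add]
  calc _ ≤ 6⁻¹ + 3 * C * (KA * KB * (w2 * Ky) + δ) := by gcongr
    _ = 6⁻¹ + (3 * C * (KA * KB * w2) * Ky + 3 * C * δ) := by ring
    _ ≤ 6⁻¹ + (6⁻¹ + 6⁻¹) := by gcongr
    _ = 3 * 6⁻¹ := by ring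
    _ = 2⁻¹ := by
        rw [show (6 : ℝ≥0∞) = 3 * 2 by norm_num,
          ENNReal.mul_inv (Or.inl (by norm_num)) (Or.inl (by norm_num)), ← mul_assoc,
          ENNReal.mul_inv_cancel (by norm_num) (by norm_num), one_mul]

end convergence

/-- The quotient is of order `N^(2β - 1)`: Markov's bound for a squared error of mean `1/N` at
threshold `N^(-2β)`. -/
theorem tendsto_rate (D : ℝ≥0∞) (hD : D ≠ ⊤) {ε β : ℝ} (hε : 0 < ε) (hβ : β < 1 / 2) :
    Tendsto (fun N : ℕ => D * ENNReal.ofReal (N : ℝ)⁻¹ /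
      ENNReal.ofReal ((ε * (N : ℝ) ^ (-β)) ^ 2)) atTop (𝓝 0) := by
  have h1 : Tendsto (fun N : ℕ => (ε ^ 2)⁻¹ * (N : ℝ) ^ (-(1 - 2 * β))) atTop (𝓝 0) := by
    have := ((tendsto_rpow_neg_atTop (y := 1 - 2 * β) (by linarith)).comp
      tendsto_natCast_atTop_atTop).const_mul (ε ^ 2)⁻¹
    simpa using this
  have h2 := ENNReal.Tendsto.const_mul (a := D) (ENNReal.tendsto_ofReal h1) (Or.inr hD)
  rw [ENNReal.ofReal_zero, mul_zero] at h2
  refine h2.congr' ?_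
  filter_upwards [eventually_gt_atTop 0] with N hN
  have hn : (0 : ℝ) < N := by exact_mod_cast hN
  rw [mul_div_assoc, ← ENNReal.ofReal_div_of_pos (by positivity)]
  congr 2
  rw [mul_pow, ← Real.rpow_natCast ((N : ℝ) ^ (-β)), ← Real.rpow_mul hn.le, neg_sub,
    Real.rpow_sub hn, Real.rpow_one, show -β * ((2 : ℕ) : ℝ) = -(2 * β) by push_cast; ring,
    Real.rpow_neg hn.le]
  field_simp

theorem enorm_freeResolvent_sub_sq {κ : ℝ} (hκ : 0 < κ) (h h' : L2) :
    ‖freeResolvent hκ h - freeResolvent hκ h'‖ₑ ^ 2 =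
      ∫⁻ x, ‖yukawaConv κ h x - yukawaConv κ h' x‖ₑ ^ 2 := by
  rw [enorm_sq_eq_lintegral]
  refine lintegral_congr_ae ?_
  filter_upwards [Lp.coeFn_sub (freeResolvent hκ h) (freeResolvent hκ h'),
    coeFn_freeResolvent hκ h, coeFn_freeResolvent hκ h'] with x h1 h2 h3
  rw [h1, Pi.sub_apply, h2, h3]

/-- The convergence theorem for measurable potentials and densities. -/
theorem IsAdmissible.exists_forall_tendsto {V W : E3 → ℝ} (hV : IsAdmissible V)
    (heig : ¬ ZeroIsEigenvalue V) (hres : ¬ ZeroIsResonance V) (hW : IsDensity W) {a : ℝ}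
    (ha : IsScatteringLength V a) :
    ∃ l₀ : ℝ, 0 < l₀ ∧ ∀ l : ℝ, l₀ < l →
      -(l : ℂ) ∈ resolventSet (limitHamiltonian a W) ∧
      Tendsto (fun N : ℕ => obstacleLaw W N
          {Y | -(l : ℂ) ∉ resolventSet (hamiltonian V N Y)}) atTop (𝓝 0) ∧
      ∀ (f : L2) (ε : ℝ) (β : ℝ), 0 < ε → β < 1 / 2 →
        Tendsto (fun N : ℕ => obstacleLaw W N
            {Y | ε < (N : ℝ) ^ β * ‖resolvent (hamiltonian V N Y) (-(l : ℂ)) f -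
              resolvent (limitHamiltonian a W) (-(l : ℂ)) f‖}) atTop (𝓝 0) := by
  obtain ⟨φ₀, hφ, -, ha⟩ := ha
  obtain ⟨C, hC, hcoer⟩ := hV.exists_lintegral_sq_le heig hres
  have hcoer : IsCoercive V C := hcoer
  have := hW.isProbabilityMeasure
  have fA : ∫⁻ ξ, ‖potA V ξ‖ₑ ^ 2 ≠ ⊤ := hV.lintegral_potA_sq_lt_top.ne
  have fB : ∫⁻ ξ, ‖potB V ξ‖ₑ ^ 2 ≠ ⊤ := hV.lintegral_potB_sq_lt_top.ne
  have fw := hW.sq.ne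
  have hU2 := hW.memLp_const_mul (4 * Real.pi * a)
  have hU := hW.measurable.const_mul (4 * Real.pi * a)
  -- The first threshold makes the limiting operator invertible, the second makes the mean-field
  -- interaction of the obstacles small; neither depends on `f`.
  obtain ⟨κ₁, hκ₁, h₁⟩ := exists_mul_lintegral_yukawa_sq_lt (d := 1)
    (lintegral_enorm_sq_lt_top hU2).ne one_pos
  obtain ⟨κ₂, hκ₂, h₂⟩ := exists_mul_lintegral_yukawa_sq_lt (d := 6⁻¹)
    (c := 3 * C * ((∫⁻ ξ, ‖potA V ξ‖ₑ ^ 2) * (∫⁻ ξ, ‖potB V ξ‖ₑ ^ 2) *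
      (∫⁻ y, ENNReal.ofReal (W y) ^ 2))) (by finiteness) (by simp)
  refine ⟨(max κ₁ κ₂) ^ 2, by positivity, fun l hl => ?_⟩
  obtain ⟨κ, hκm, rfl⟩ : ∃ κ : ℝ, max κ₁ κ₂ < κ ∧ κ ^ 2 = l := by
    have hl0 : 0 ≤ l := (sq_nonneg _).trans hl.le
    exact ⟨√l, Real.lt_sqrt_of_sq_lt hl, Real.sq_sqrt hl0⟩
  have hκ : 0 < κ := hκ₁.trans ((le_max_left _ _).trans_lt hκm)
  have hs1 := h₁ κ ((le_max_left _ _).trans_lt hκm)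
  have hs2 := h₂ κ ((le_max_right _ _).trans_lt hκm)
  obtain ⟨hmem, hlim⟩ := schrodinger_resolvent hκ hU hU2
    (mulResolvent_injective_of_small hκ hU hU2 hs1)
  have hbad := hV.tendsto_measure_not_small hW hκ hC hs2
  refine ⟨hmem, ?_, fun f ε β hε hβ => ?_⟩
  · refine tendsto_of_tendsto_of_tendsto_of_le_of_le' tendsto_const_nhds hbad
      (Eventually.of_forall fun _ => zero_le) ?_
    filter_upwards [eventually_gt_atTop 0] with N hN
    refine measure_mono fun Y hY hsmall => hY ?_
    exact (schrodinger_resolvent hκ (hV.measurable_obstaclePotential Y)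
      (hV.memLp_obstaclePotential hN Y) (hV.obstacle_injective hN Y hcoer hκ hsmall)).1
  · obtain ⟨h, hRh, heq⟩ := hlim f
    obtain ⟨M, D⟩ := hφ.limitData hV hW hκ (c := 4 * Real.pi * a)
      (by rw [ha]; field_simp) heq
    obtain ⟨C₁, hC₁, hdiff⟩ := D.exists_lintegral_sub_sq_le hκ hV hC hcoer
    obtain ⟨C₂, hC₂, hmean⟩ := D.exists_lintegral_totalError_le hV hκ hW
    -- The failure event is covered by the configurations violating the smallness condition and
    -- those where the error bound exceeds the threshold.
    have hsum := hbad.add (tendsto_rate (C₁ * (1 + C₂)) (by finiteness) hε hβ)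
    rw [add_zero] at hsum
    refine tendsto_of_tendsto_of_tendsto_of_le_of_le' tendsto_const_nhds hsum
      (Eventually.of_forall fun _ => zero_le) ?_
    filter_upwards [eventually_gt_atTop 0] with N hN
    have hn : (0 : ℝ) < N := by exact_mod_cast hN
    set E : (Fin N → E3) → ℝ≥0∞ := fun Y => C₁ * (ENNReal.ofReal (N : ℝ)⁻¹ +
      totalError V κ (fun x => (V x : ℂ) * φ₀ x)
        (yukawaConv κ fun y => (W y : ℂ) * yukawaConv κ h y) (yukawaConv κ h) Y) with hE
    have hEm : Measurable E := ((D.measurable_totalError hV N).const_add _).const_mul _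
    have hEint : ∫⁻ Y, E Y ∂(Measure.pi fun _ : Fin N => densityLaw W) ≤
        C₁ * (1 + C₂) * ENNReal.ofReal (N : ℝ)⁻¹ := by
      rw [hE, lintegral_const_mul' _ _ hC₁, lintegral_add_left measurable_const, lintegral_const,
        measure_univ, mul_one]
      calc _ ≤ C₁ * (ENNReal.ofReal (N : ℝ)⁻¹ + C₂ * ENNReal.ofReal (N : ℝ)⁻¹) := by
            gcongr
            exact hmean hN
        _ = _ := by ring
    have ht : 0 < (ε * (N : ℝ) ^ (-β)) ^ 2 := by positivity
    have hmarkov : Measure.pi (fun _ : Fin N => densityLaw W)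
        {Y | ENNReal.ofReal ((ε * (N : ℝ) ^ (-β)) ^ 2) ≤ E Y} ≤
        C₁ * (1 + C₂) * ENNReal.ofReal (N : ℝ)⁻¹ / ENNReal.ofReal ((ε * (N : ℝ) ^ (-β)) ^ 2) :=
      (meas_ge_le_lintegral_div hEm.aemeasurable (ENNReal.ofReal_pos.mpr ht).ne'
        ENNReal.ofReal_ne_top).trans (ENNReal.div_le_div_right hEint _)
    refine le_trans ?_ (add_le_add le_rfl hmarkov)
    refine le_trans (measure_mono fun Y hY => ?_) (measure_union_le _ _)
    by_cases hsmall : 3 * C * (ENNReal.ofReal (κ / N / (4 * Real.pi)) ^ 2 *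
        (∫⁻ ξ, ‖potA V ξ‖ₑ ^ 2) * (∫⁻ ξ, ‖potB V ξ‖ₑ ^ 2) +
          totalInteraction V (κ / N) fun i => (N : ℝ) • Y i) ≤ 2⁻¹
    swap
    · exact Or.inl hsmall
    right
    obtain ⟨hN', hRN, heqN⟩ := (schrodinger_resolvent hκ (hV.measurable_obstaclePotential Y)
      (hV.memLp_obstaclePotential hN Y) (hV.obstacle_injective hN Y hcoer hκ hsmall)).2 f
    -- On a good configuration the resolvent difference is a difference of free resolvents, whose
    -- squared norm is bounded by the error variable.
    refine le_trans ?_ (hdiff hN Y hsmall hN' heqN)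
    rw [← enorm_freeResolvent_sub_sq hκ, ← hRN, ← hRh, ENNReal.ofReal_pow (by positivity)]
    refine pow_le_pow_left' ?_ 2
    rw [← ofReal_norm]
    refine ENNReal.ofReal_le_ofReal ?_
    have hY : ε < (N : ℝ) ^ β * ‖resolvent (schrodinger (obstaclePotential V N Y))
      (-((κ ^ 2 : ℝ) : ℂ)) f - resolvent (schrodinger fun x => 4 * Real.pi * a * W x)
        (-((κ ^ 2 : ℝ) : ℂ)) f‖ := hY
    rw [Real.rpow_neg hn.le, ← div_eq_mul_inv, div_le_iff₀' (by positivity)]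
    exact hY.le

/-! ### Dependence on the potential and the density almost everywhere -/

theorem mulOp_congr {U U' : E3 → ℝ} (h : U =ᵐ[volume] U') : mulOp U = mulOp U' := by
  have h' : ∀ ψ : L2, (fun x => (U x : ℂ) * ψ x) =ᵐ[volume] fun x => (U' x : ℂ) * ψ x := fun ψ => by
    filter_upwards [h] with x hx
    rw [hx]
  refine LinearPMap.ext ?_ fun ψ hf hg => MemLp.toLp_congr hf hg (h' ψ)
  ext ψ
  exact memLp_congr_ae (h' ψ)

theorem schrodinger_congr {U U' : E3 → ℝ} (h : U =ᵐ[volume] U') : schrodinger U = schrodinger U' := by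
  rw [schrodinger, mulOp_congr h, schrodinger]

theorem IsZeroEnergySolution.congr {V V' : E3 → ℝ} (h : V =ᵐ[volume] V') {ψ : E3 → ℂ}
    (hψ : IsZeroEnergySolution V ψ) : IsZeroEnergySolution V' ψ where
  locallyIntegrable := hψ.locallyIntegrable
  locallyIntegrable_mul := by
    refine hψ.locallyIntegrable_mul.congr ?_
    filter_upwards [h] with x hx
    rw [hx]
  weak φ h1 h2 := by
    rw [← hψ.weak φ h1 h2]
    refine integral_congr_ae ?_
    filter_upwards [h] with x hx
    rw [hx]

theorem ZeroIsEigenvalue.congr {V V' : E3 → ℝ} (h : V =ᵐ[volume] V') (hV : ZeroIsEigenvalue V) :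
    ZeroIsEigenvalue V' := by
  unfold ZeroIsEigenvalue
  rw [← schrodinger_congr h]
  exact hV

theorem ZeroIsResonance.congr {V V' : E3 → ℝ} (h : V =ᵐ[volume] V') (hV : ZeroIsResonance V) :
    ZeroIsResonance V' := by
  obtain ⟨ψ, hψ, h1, h2⟩ := hV
  exact ⟨ψ, hψ.congr h, h1, h2⟩

theorem IsScatteringLength.congr {V V' : E3 → ℝ} (h : V =ᵐ[volume] V') {a : ℝ}
    (ha : IsScatteringLength V a) : IsScatteringLength V' a := by
  obtain ⟨φ₀, hφ, hi, rfl⟩ := ha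
  have e : (fun x => V x * φ₀ x) =ᵐ[volume] fun x => V' x * φ₀ x := by
    filter_upwards [h] with x hx
    rw [hx]
  exact ⟨φ₀, ⟨hφ.continuous, hφ.solution.congr h, hφ.tendsto_one⟩, hi.congr e, by
    rw [integral_congr_ae e]⟩

/-- Dilations by `N ≠ 0` and translations preserve null sets. For `N = 0` there is no index `i` and
nothing to check. -/
theorem obstaclePotential_congr {V V' : E3 → ℝ} (h : V =ᵐ[volume] V') (N : ℕ) (Y : Fin N → E3) :
    obstaclePotential V N Y =ᵐ[volume] obstaclePotential V' N Y := by
  have hi : ∀ i : Fin N, ∀ᵐ x, V ((N : ℝ) • (x - Y i)) = V' ((N : ℝ) • (x - Y i)) := fun i => by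
    have hN : (N : ℝ) ≠ 0 := by exact_mod_cast (Fin.pos i).ne'
    have h1 : ∀ᵐ x : E3, V ((N : ℝ) • x) = V' ((N : ℝ) • x) := by
      rw [ae_iff]
      have := Measure.addHaar_preimage_smul (volume : Measure E3) hN {x | ¬ V x = V' x}
      rw [ae_iff.mp h, mul_zero] at this
      exact this
    exact (measurePreserving_sub_right volume (Y i)).quasiMeasurePreserving.ae h1
  filter_upwards [ae_all_iff.mpr hi] with x hx
  unfold obstaclePotential
  simp_rw [hx]

theorem obstacleLaw_congr {W W' : E3 → ℝ} (h : W =ᵐ[volume] W') (N : ℕ) :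
    obstacleLaw W N = obstacleLaw W' N := by
  unfold obstacleLaw
  rw [withDensity_congr_ae (h.mono fun x hx => by rw [hx])]

/-- For finite `p` one has `t² ≤ t + t^p`, by comparing `t` with `1`; for `p = ∞` one factor is
bounded by the essential supremum. -/
theorem lintegral_sq_lt_top_of_memLp {W : E3 → ℝ} (h1 : Integrable W) {p : ℝ≥0∞} (hp : 2 < p)
    (hWp : MemLp W p volume) : ∫⁻ x, ‖W x‖ₑ ^ 2 < ⊤ := by
  rcases eq_or_ne p ⊤ with rfl | hpt
  · have hb : ∀ᵐ x, ‖W x‖ₑ ≤ eLpNorm W ⊤ volume := by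
      rw [eLpNorm_exponent_top]
      exact ae_le_eLpNormEssSup
    have h : ∫⁻ x, ‖W x‖ₑ ^ 2 ≤ ∫⁻ x, eLpNorm W ⊤ volume * ‖W x‖ₑ := by
      refine lintegral_mono_ae ?_
      filter_upwards [hb] with x hx
      rw [sq]
      gcongr
    refine h.trans_lt ?_
    rw [lintegral_const_mul' _ _ hWp.2.ne]
    exact ENNReal.mul_lt_top hWp.2 h1.2
  · have hp0 : p ≠ 0 := (lt_of_le_of_lt zero_le hp).ne'
    have h2 := (eLpNorm_lt_top_iff_lintegral_rpow_enorm_lt_top hp0 hpt).mp hWp.2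
    have hr : (2 : ℝ) ≤ p.toReal := by
      have := ENNReal.toReal_mono hpt hp.le
      simpa using this
    have h : ∀ x, ‖W x‖ₑ ^ 2 ≤ ‖W x‖ₑ + ‖W x‖ₑ ^ p.toReal := fun x => by
      rcases le_total ‖W x‖ₑ 1 with hx | hx
      · refine le_trans ?_ le_self_add
        rw [sq]
        exact mul_le_of_le_one_left' hx
      · refine le_trans ?_ le_add_self
        rw [← ENNReal.rpow_natCast]
        exact ENNReal.rpow_le_rpow_of_exponent_le hx (by simpa using hr)
    refine (lintegral_mono h).trans_lt ?_
    rw [lintegral_add_left' h1.1.enorm]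
    exact ENNReal.add_lt_top.mpr ⟨h1.2, h2⟩

/-- The truncation at zero changes `W` only on a null set and makes it nonnegative at every point,
as the everywhere-defined structure requires. -/
theorem exists_isDensity {W : E3 → ℝ} (hW0 : ∀ᵐ x, 0 ≤ W x) (hW : ∫ x, W x = 1)
    (hW1 : Integrable W) {p : ℝ≥0∞} (hp : 2 < p) (hWp : MemLp W p volume) :
    ∃ W' : E3 → ℝ, W =ᵐ[volume] W' ∧ IsDensity W' := by
  have hae : W =ᵐ[volume] fun x => max (hW1.1.mk W x) 0 := by
    filter_upwards [hW1.1.ae_eq_mk, hW0] with x h1 h2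
    rw [← h1, max_eq_left h2]
  refine ⟨_, hae, hW1.1.stronglyMeasurable_mk.measurable.max measurable_const,
    fun x => le_max_right _ _, ?_, ?_⟩
  · rw [← ofReal_integral_eq_lintegral_ofReal (hW1.congr hae)
      (Eventually.of_forall fun x => le_max_right _ _), ← integral_congr_ae hae, hW,
      ENNReal.ofReal_one]
  · refine lt_of_eq_of_lt (lintegral_congr_ae ?_) (lintegral_sq_lt_top_of_memLp hW1 hp hWp)
    filter_upwards [hae] with x hx
    rw [hx, Real.enorm_eq_ofReal (le_max_right _ _)]

theorem exists_isAdmissible {V : E3 → ℝ} (hV1 : Integrable (fun x => (1 + ‖x‖ ^ 4) * V x) volume)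
    (hV3 : MemLp V 3 volume) : ∃ V' : E3 → ℝ, V =ᵐ[volume] V' ∧ IsAdmissible V' := by
  have hae := hV3.1.ae_eq_mk
  refine ⟨hV3.1.mk V, hae, hV3.1.stronglyMeasurable_mk.measurable, hV1.congr ?_, hV3.ae_eq hae⟩
  filter_upwards [hae] with x hx
  rw [← hx]

end LorentzGas

/-! ### The main theorem: reduction to measurable representatives -/

theorem theorem1
    (V : LorentzGas.E3 → ℝ)
    (hV1 : Integrable (fun x => (1 + ‖x‖ ^ 4) * V x) volume)
    (hV3 : MemLp V 3 volume)
    (hV_eig : ¬ LorentzGas.ZeroIsEigenvalue V)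
    (hV_res : ¬ LorentzGas.ZeroIsResonance V)
    (W : LorentzGas.E3 → ℝ) (hW_nonneg : ∀ᵐ x, 0 ≤ W x) (hW_prob : ∫ x, W x = 1)
    (hW1 : Integrable W volume) (p : ℝ≥0∞) (hp : 3 < p) (hWp : MemLp W p volume) :
    (∃! a : ℝ, LorentzGas.IsScatteringLength V a) ∧
    ∀ a : ℝ, LorentzGas.IsScatteringLength V a →
      ∃ l₀ : ℝ, 0 < l₀ ∧ ∀ l : ℝ, l₀ < l →
        -(l : ℂ) ∈ LorentzGas.resolventSet (LorentzGas.limitHamiltonian a W) ∧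
        Tendsto (fun N : ℕ => LorentzGas.obstacleLaw W N
            {Y | -(l : ℂ) ∉ LorentzGas.resolventSet (LorentzGas.hamiltonian V N Y)})
          atTop (𝓝 0) ∧
        ∀ (f : LorentzGas.L2) (ε : ℝ) (β : ℝ), 0 < ε → β < 1 / 2 →
          Tendsto (fun N : ℕ => LorentzGas.obstacleLaw W N
              {Y | ε < (N : ℝ) ^ β *
                ‖LorentzGas.resolvent (LorentzGas.hamiltonian V N Y) (-(l : ℂ)) f -
                  LorentzGas.resolvent (LorentzGas.limitHamiltonian a W) (-(l : ℂ)) f‖})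
            atTop (𝓝 0) := by
  obtain ⟨V', hVV', hV'⟩ := LorentzGas.exists_isAdmissible hV1 hV3
  obtain ⟨W', hWW', hW'⟩ := LorentzGas.exists_isDensity hW_nonneg hW_prob hW1
    ((by norm_num : (2 : ℝ≥0∞) < 3).trans hp) hWp
  have heig : ¬ LorentzGas.ZeroIsEigenvalue V' := fun h => hV_eig (h.congr hVV'.symm)
  have hres : ¬ LorentzGas.ZeroIsResonance V' := fun h => hV_res (h.congr hVV'.symm)
  -- Operators, resolvent sets and laws depend only on the almost-everywhere classes of `V` and `W`,
  -- so the statement for the chosen representatives is literally the statement for the given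
  -- functions.
  have hham : ∀ (N : ℕ) (Y : Fin N → LorentzGas.E3),
      LorentzGas.hamiltonian V N Y = LorentzGas.hamiltonian V' N Y := fun N Y =>
    LorentzGas.schrodinger_congr (LorentzGas.obstaclePotential_congr hVV' N Y)
  have hlim : ∀ a, LorentzGas.limitHamiltonian a W = LorentzGas.limitHamiltonian a W' := fun a =>
    LorentzGas.schrodinger_congr (hWW'.mono fun x hx => by simp only [hx])
  simp_rw [hham, hlim, LorentzGas.obstacleLaw_congr hWW']
  refine ⟨?_, fun a ha => hV'.exists_forall_tendsto heig hres hW' (ha.congr hVV')⟩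
  obtain ⟨a, ha, huniq⟩ := hV'.existsUnique_scatteringLength heig hres
  exact ⟨a, ha.congr hVV'.symm, fun b hb => huniq b (hb.congr hVV')⟩
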